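/- Let $\Gamma$ be the Ginzburg dg algebra (over $\mathbb C$) of the $A_2$ quiver: the path algebra of the graded quiver with vertices $0,1$, arrows $a:0\to1$ of degree $0$, $a^*:1\to0$ of degree $-1$ and loops $t_0,t_1$ at $0,1$ of degree $-2$, with differential $d t_0=a a^*$, $d t_1=-a^* a$, $da=da^*=0$. Let $\mathcal D$ be the derived category of right dg $\Gamma$-modules with finite-dimensional total cohomology, and let $\mathcal A^0\subset\mathcal D$ be the standard heart, consisting of the objects whose cohomology is concentrated in degree $0$. Let $S$ and $T$ be the simple modules at the vertices $0$ and $1$, so that $\operatorname{Ext}^1(S,T)\cong\mathbb C$. Hearts are identified with strictly full subcategories of $\mathcal D$. For a simple object $U$ of $\mathcal A^0$ write $\langle U\rangle=\{U^{\oplus n}:n\in\mathbb N_0\}$. * The left tilt $L_U(\mathcal A^0)$ consists of the objects $Y$ which lie in a distinguished triangle $F\to Y\to V[-1]\to F[1]$ with $V\in\langle U\rangle$ and $F\in\mathcal A^0$, $\operatorname{Hom}(U,F)=0$. * The right tilt $R_U(\mathcal A^0)$ consists of the objects $Y$ which lie in a distinguished triangle $F[1]\to Y\to V\to F[2]$ with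 $F\in\langle U\rangle$ and $V\in\mathcal A^0$, $\operatorname{Hom}(V,U)=0$. A nontrivial extension of $B$ by $A$ is an object $C$ in a distinguished triangle $A\to C\to B\xrightarrow{h}A[1]$ with $h\neq0$. Write $\mathcal H=(A,B)_C$ if $\mathcal H\subset\mathcal D$ is the heart of a bounded t-structure (in particular an abelian category), $A$ and $B$ are non-isomorphic simple objects of $\mathcal H$, every simple object of $\mathcal H$ is isomorphic to $A$ or to $B$, the objects of $\mathcal H$ are exactly those obtained from $A$, $B$ and $0$ by finitely many extensions, and $C$ is, up to isomorphism, the unique nontrivial extension of $B$ by $A$. For $U\in\{S,T\}$, a spherical twist along $U$ is a $\mathbb C$-linear exact autoequivalence $\Phi_U$ of $\mathcal D$ with a natural transformation $\mathrm{id}\to\Phi_U$ such that for every $Y$ the morphism $Y\to\Phi_U(Y)$ fits into a distinguished triangle $$U\otimes\operatorname{Hom}^\bullet(U,Y)\xrightarrow{\ \mathrm{ev}\ }Y\to\Phi_U(Y)\to .$$ **Proposition.** There are a nontrivial extension $E$ of $S$ by $T$ and a nontrivial extension $X$ of $T[-1]$ by $S$, both unique up to isomorphism, and spherical twists $\Phi_S,\Phi_T$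 along $S$ and $T$ exist. The standard heart is $\mathcal A^0=(T,S)_E$, and its four simple tilts are $$R_S(\mathcal A^0)=(S[1],T)_{X[1]},\qquad L_T(\mathcal A^0)=(S,T[-1])_{X},$$ $$R_T(\mathcal A^0)=(E,T[1])_{S},\qquad L_S(\mathcal A^0)=(S[-1],E)_{T}.$$ Moreover, for all spherical twists $\Phi_S,\Phi_T$ along $S$ and $T$, with functors composed from right to left, $$R_S(\mathcal A^0)=(\Phi_T\Phi_S\Phi_T)[3]\,(\mathcal A^0),\qquad L_T(\mathcal A^0)=\big((\Phi_T\Phi_S\Phi_T)[3]\big)^{-1}(\mathcal A^0),$$ $$R_T(\mathcal A^0)=(\Phi_S\Phi_T)[2]\,(\mathcal A^0),\qquad L_S(\mathcal A^0)=\big((\Phi_S\Phi_T)[2]\big)^{-1}(\mathcal A^0).$$ -/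

import Mathlib

open CategoryTheory Limits Pretriangulated

noncomputable section


/-- A differential graded `ℂ`-algebra (cohomological grading, differential of degree `1`). -/
structure DGAlgebra where
  carrier : Type
  [ring : Ring carrier]
  [algebra : Algebra ℂ carrier]
  gr : ℤ → Submodule ℂ carrier
  isInternal : DirectSum.IsInternal gr
  one_mem : (1 : carrier) ∈ gr 0
  mul_mem : ∀ {m n : ℤ} {x y : carrier}, x ∈ gr m → y ∈ gr n → x * y ∈ gr (m + n)
  d : carrier →ₗ[ℂ] carrier
  d_mem : ∀ {n : ℤ} {x : carrier}, x ∈ gr n → d x ∈ gr (n + 1)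
  d_d : ∀ x : carrier, d (d x) = 0
  leibniz : ∀ {n : ℤ} {x : carrier} (y : carrier), x ∈ gr n →
    d (x * y) = d x * y + (-1 : ℂ) ^ n • (x * d y)

attribute [instance] DGAlgebra.ring DGAlgebra.algebra

/-- A right differential graded module over `A`. -/
structure DGModule (A : DGAlgebra) where
  carrier : Type
  [addCommGroup : AddCommGroup carrier]
  [module : Module ℂ carrier]
  [rightModule : Module A.carrierᵐᵒᵖ carrier]
  [isScalarTower : IsScalarTower ℂ A.carrierᵐᵒᵖ carrier]
  gr : ℤ → Submodule ℂ carrier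
  isInternal : DirectSum.IsInternal gr
  smul_mem : ∀ {m n : ℤ} {x : carrier} {a : A.carrier}, x ∈ gr m → a ∈ A.gr n →
    MulOpposite.op a • x ∈ gr (m + n)
  d : carrier →ₗ[ℂ] carrier
  d_mem : ∀ {n : ℤ} {x : carrier}, x ∈ gr n → d x ∈ gr (n + 1)
  d_d : ∀ x : carrier, d (d x) = 0
  leibniz : ∀ {n : ℤ} {x : carrier} (a : A.carrier), x ∈ gr n →
    d (MulOpposite.op a • x) = MulOpposite.op a • d x + (-1 : ℂ) ^ n • MulOpposite.op (A.d a) • x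

namespace DGModule

attribute [instance] addCommGroup module rightModule isScalarTower

variable {A : DGAlgebra}

instance (M : DGModule A) : SMulCommClass ℂ A.carrierᵐᵒᵖ M.carrier :=
  IsScalarTower.to_smulCommClass

instance (M : DGModule A) : SMulCommClass A.carrierᵐᵒᵖ ℂ M.carrier :=
  IsScalarTower.to_smulCommClass'

/-- Morphisms of dg modules: `A`-linear maps of degree `0` commuting with the differentials. -/
def homs (M N : DGModule A) : Submodule ℂ (M.carrier →ₗ[A.carrierᵐᵒᵖ] N.carrier) where
  carrier := {f | (∀ n, ∀ x ∈ M.gr n, f x ∈ N.gr n) ∧ ∀ x, f (M.d x) = N.d (f x)}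
  add_mem' {f g} hf hg := ⟨fun n x hx => add_mem (hf.1 n x hx) (hg.1 n x hx), fun x => by
    simp [hf.2, hg.2]⟩
  zero_mem' := ⟨fun n x _ => zero_mem _, fun x => by simp⟩
  smul_mem' c f hf := ⟨fun n x hx => Submodule.smul_mem _ _ (hf.1 n x hx), fun x => by
    simp [hf.2]⟩

instance : Category (DGModule A) where
  Hom M N := homs M N
  id M := ⟨LinearMap.id, fun _ _ hx => hx, fun _ => rfl⟩
  comp f g := ⟨g.1.comp f.1, fun n x hx => g.2.1 n _ (f.2.1 n x hx), fun x => by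
    simp [f.2.2, g.2.2]⟩

instance (M N : DGModule A) : AddCommGroup (M ⟶ N) := inferInstanceAs (AddCommGroup (homs M N))

instance (M N : DGModule A) : Module ℂ (M ⟶ N) := inferInstanceAs (Module ℂ (homs M N))

/-- The linear map underlying a morphism of dg modules. -/
def lin {M N : DGModule A} : (M ⟶ N) →ₗ[ℂ] (M.carrier →ₗ[A.carrierᵐᵒᵖ] N.carrier) :=
  (homs M N).subtype

lemma hom_ext {M N : DGModule A} {f g : M ⟶ N} (h : ∀ x, lin f x = lin g x) : f = g :=
  Subtype.ext (LinearMap.ext h)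

lemma lin_mem {M N : DGModule A} (f : M ⟶ N) {n : ℤ} {x : M.carrier} (hx : x ∈ M.gr n) :
    lin f x ∈ N.gr n := f.2.1 n x hx

lemma lin_d {M N : DGModule A} (f : M ⟶ N) (x : M.carrier) : lin f (M.d x) = N.d (lin f x) :=
  f.2.2 x

/-- Constructor for morphisms. -/
def mkHom {M N : DGModule A} (f : M.carrier →ₗ[A.carrierᵐᵒᵖ] N.carrier)
    (h₁ : ∀ n, ∀ x ∈ M.gr n, f x ∈ N.gr n) (h₂ : ∀ x, f (M.d x) = N.d (f x)) : M ⟶ N :=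
  ⟨f, h₁, h₂⟩

@[simp] lemma lin_mkHom {M N : DGModule A} (f : M.carrier →ₗ[A.carrierᵐᵒᵖ] N.carrier)
    (h₁ : ∀ n, ∀ x ∈ M.gr n, f x ∈ N.gr n) (h₂ : ∀ x, f (M.d x) = N.d (f x)) :
    lin (mkHom f h₁ h₂) = f := rfl

@[simp] lemma lin_id (M : DGModule A) : lin (𝟙 M) = LinearMap.id := rfl

@[simp] lemma lin_comp {M N P : DGModule A} (f : M ⟶ N) (g : N ⟶ P) :
    lin (f ≫ g) = (lin g).comp (lin f) := rfl

instance : Preadditive (DGModule A) where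
  add_comp _ _ _ f f' g := hom_ext fun x => by simp
  comp_add _ _ _ f g g' := hom_ext fun x => by simp

instance : Linear ℂ (DGModule A) where
  smul_comp _ _ _ r f g := hom_ext fun x => by
    simp [LinearMap.map_smul_of_tower]
  comp_smul _ _ _ f r g := hom_ext fun x => by simp

lemma sign_mul_self (k : ℤ) : (-1 : ℂ) ^ k * (-1 : ℂ) ^ k = 1 := by
  rw [← mul_zpow]; norm_num

lemma sign_smul_smul {V : Type} [AddCommGroup V] [Module ℂ V] (k : ℤ) (x : V) :
    (-1 : ℂ) ^ k • (-1 : ℂ) ^ k • x = x := by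
  rw [smul_smul, sign_mul_self, one_smul]

lemma sign_add (k l : ℤ) : (-1 : ℂ) ^ (k + l) = (-1 : ℂ) ^ k * (-1 : ℂ) ^ l :=
  zpow_add₀ (by norm_num) k l

lemma sign_succ (k : ℤ) : (-1 : ℂ) ^ (k + 1) = -(-1 : ℂ) ^ k := by
  rw [sign_add, zpow_one, mul_neg_one]

/-- The shift: `(M⟦k⟧)ⁿ = Mⁿ⁺ᵏ`, with differential `(-1)ᵏ d` and the same right action. -/
def shift (M : DGModule A) (k : ℤ) : DGModule A where
  carrier := M.carrier
  gr n := M.gr (n + k)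
  isInternal := by
    have h := (DirectSum.isInternal_submodule_iff_iSupIndep_and_iSup_eq_top _).1 M.isInternal
    refine (DirectSum.isInternal_submodule_iff_iSupIndep_and_iSup_eq_top _).2
      ⟨h.1.comp (add_left_injective k), ?_⟩
    rw [← h.2]
    exact (Equiv.addRight k).iSup_comp (g := M.gr)
  smul_mem {m n x a} hx ha := by
    have := M.smul_mem hx ha
    rwa [add_right_comm] at this
  d := (-1 : ℂ) ^ k • M.d
  d_mem {n x} hx := by
    have := M.d_mem hx
    rw [add_right_comm] at this
    exact Submodule.smul_mem _ _ this
  d_d x := by simp [M.d_d]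
  leibniz {n x} a hx := by
    simp only [LinearMap.smul_apply, M.leibniz a hx, smul_add, smul_comm ((-1 : ℂ) ^ k)
      (MulOpposite.op a)]
    rw [sign_add, smul_smul, mul_left_comm, sign_mul_self, mul_one]

/-- The shift of a morphism: the same underlying map. -/
def shiftMap {M N : DGModule A} (f : M ⟶ N) (k : ℤ) : M.shift k ⟶ N.shift k :=
  ⟨f.1, fun _ _ hx => f.2.1 _ _ hx,
    fun x => (f.1.map_smul_of_tower _ _).trans (congrArg _ (f.2.2 x))⟩

/-- The shift as a functor. -/
def shiftF (k : ℤ) : DGModule A ⥤ DGModule A where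
  obj M := M.shift k
  map f := shiftMap f k
  map_id _ := rfl
  map_comp _ _ := rfl

lemma eqToHom_shift {k l : ℤ} (h : k = l) (M : DGModule A) (e : M.shift k = M.shift l)
    (x : (M.shift k).carrier) : lin (eqToHom e) x = (show M.carrier from x) := by
  subst h; rfl

/-- The identity map as an isomorphism between dg modules with the same underlying data. -/
def shiftIso (M : DGModule A) (j k l : ℤ) (h : j + k = l) :
    M.shift l ≅ (M.shift j).shift k where
  hom := mkHom (M := M.shift l) (N := (M.shift j).shift k) LinearMap.id
    (fun n x hx => by
      have hx' : x ∈ M.gr (n + l) := hx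
      rw [← h, add_comm j, ← add_assoc] at hx'
      exact hx')
    (fun x => by
      change (-1 : ℂ) ^ l • M.d x = (-1 : ℂ) ^ k • ((-1 : ℂ) ^ j • M.d x)
      rw [smul_smul, ← sign_add, add_comm k, h])
  inv := mkHom (M := (M.shift j).shift k) (N := M.shift l) LinearMap.id
    (fun n x hx => by
      have hx' : x ∈ M.gr (n + k + j) := hx
      rw [add_assoc, add_comm k, h] at hx'
      exact hx')
    (fun x => by
      change (-1 : ℂ) ^ k • ((-1 : ℂ) ^ j • M.d x) = (-1 : ℂ) ^ l • M.d x
      rw [smul_smul, ← sign_add, add_comm k, h])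

/-- The identity map as an isomorphism `M⟦0⟧ ≅ M`. -/
def shiftZeroIso (M : DGModule A) : M.shift 0 ≅ M where
  hom := mkHom (M := M.shift 0) (N := M) LinearMap.id
    (fun n x hx => by
      have hx' : x ∈ M.gr (n + 0) := hx
      rwa [add_zero] at hx')
    (fun x => by
      change (-1 : ℂ) ^ (0 : ℤ) • M.d x = M.d x
      simp)
  inv := mkHom (M := M) (N := M.shift 0) LinearMap.id
    (fun n x hx => by
      change x ∈ M.gr (n + 0)
      rwa [add_zero])
    (fun x => by
      change M.d x = (-1 : ℂ) ^ (0 : ℤ) • M.d x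
      simp)

/-- The data defining the shift by `ℤ` on dg modules. -/
def shiftCore : ShiftMkCore (DGModule A) ℤ where
  F := shiftF
  zero := NatIso.ofComponents shiftZeroIso (fun _ => hom_ext fun _ => rfl)
  add j k := NatIso.ofComponents (fun M => shiftIso M j k _ rfl) (fun _ => hom_ext fun _ => rfl)
  assoc_hom_app j k l M := hom_ext fun x =>
    (eqToHom_shift (add_assoc j k l) M (by rw [add_assoc]) x).symm
  zero_add_hom_app n M := hom_ext fun x =>
    (eqToHom_shift (zero_add n) M (by rw [zero_add]) x).symm
  add_zero_hom_app n M := hom_ext fun x =>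
    (eqToHom_shift (add_zero n) M (by rw [add_zero]) x).symm

instance : HasShift (DGModule A) ℤ := hasShiftMk _ _ shiftCore

lemma lin_shift_map {M N : DGModule A} (f : M ⟶ N) (k : ℤ) (x : M.carrier) :
    lin (f⟦k⟧') (show (M.shift k).carrier from x) = (show (N.shift k).carrier from lin f x) := rfl

instance (k : ℤ) : (shiftFunctor (DGModule A) k).Additive where
  map_add {_ _ _ _} := rfl

instance (k : ℤ) : (shiftFunctor (DGModule A) k).Linear ℂ where
  map_smul _ _ := rfl

/-- `f` is the identity map on underlying sets. -/
def IsId {M N : DGModule A} (f : M ⟶ N) (h : M.carrier = N.carrier) : Prop :=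
  ∀ x : M.carrier, lin f x = cast h x

lemma shiftF_carrier (M : DGModule A) (k : ℤ) : (M⟦k⟧).carrier = M.carrier := rfl

lemma isId_add (M : DGModule A) (j k i : ℤ) (h : j + k = i) :
    IsId ((shiftFunctorAdd' (DGModule A) j k i h).hom.app M) rfl := by
  subst h
  rw [shiftFunctorAdd'_eq_shiftFunctorAdd]
  intro x
  rfl

lemma isId_add_inv (M : DGModule A) (j k i : ℤ) (h : j + k = i) :
    IsId ((shiftFunctorAdd' (DGModule A) j k i h).inv.app M) rfl := by
  subst h
  rw [shiftFunctorAdd'_eq_shiftFunctorAdd]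
  intro x
  rfl

lemma isId_comm (M : DGModule A) (j k : ℤ) :
    IsId ((shiftFunctorComm (DGModule A) j k).hom.app M) rfl := by
  rw [shiftFunctorComm_eq _ _ _ _ rfl]
  intro x
  exact (congrArg _ (isId_add_inv M j k _ rfl x)).trans (isId_add M k j _ (add_comm k j) x)

/-- Homotopy of morphisms of dg modules: `f - g = d h + h d` with `h` an `A`-linear map of
degree `-1`. -/
def htpy (A : DGAlgebra) : HomRel (DGModule A) := fun M N f g =>
  ∃ h : M.carrier →ₗ[A.carrierᵐᵒᵖ] N.carrier, (∀ n, ∀ x ∈ M.gr (n + 1), h x ∈ N.gr n) ∧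
    ∀ x, lin f x - lin g x = N.d (h x) + h (M.d x)

lemma htpy_add {M N : DGModule A} (f₁ f₂ g₁ g₂ : M ⟶ N) (hf : htpy A f₁ f₂) (hg : htpy A g₁ g₂) :
    htpy A (f₁ + g₁) (f₂ + g₂) := by
  obtain ⟨h, h₁, h₂⟩ := hf
  obtain ⟨k, k₁, k₂⟩ := hg
  refine ⟨h + k, fun n x hx => add_mem (h₁ n x hx) (k₁ n x hx), fun x => ?_⟩
  simp only [map_add, LinearMap.add_apply, add_sub_add_comm, h₂, k₂]
  abel

lemma htpy_smul (c : ℂ) {M N : DGModule A} (f g : M ⟶ N) (hf : htpy A f g) :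
    htpy A (c • f) (c • g) := by
  obtain ⟨h, h₁, h₂⟩ := hf
  refine ⟨c • h, fun n x hx => Submodule.smul_mem _ _ (h₁ n x hx), fun x => ?_⟩
  simp only [map_smul, LinearMap.smul_apply, ← smul_sub, h₂, smul_add]

lemma htpy_comp {M N P : DGModule A} {f f' : M ⟶ N} {g g' : N ⟶ P} (hf : htpy A f f')
    (hg : htpy A g g') : htpy A (f ≫ g) (f' ≫ g') := by
  obtain ⟨h, h₁, h₂⟩ := hf
  obtain ⟨k, k₁, k₂⟩ := hg
  refine ⟨(lin g).comp h + k.comp (lin f'), fun n x hx =>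
    add_mem (lin_mem g (h₁ n x hx)) (k₁ n _ (lin_mem f' hx)), fun x => ?_⟩
  have e₁ := congrArg (lin g) (h₂ x)
  have e₂ := k₂ (lin f' x)
  simp only [map_sub, map_add, lin_d] at e₁
  simp only [lin_comp, LinearMap.comp_apply, LinearMap.add_apply, map_add, lin_d]
  rw [← sub_add_sub_cancel _ (lin g (lin f' x)), e₁, e₂]
  abel

lemma htpy_refl {M N : DGModule A} (f : M ⟶ N) : htpy A f f :=
  ⟨0, fun _ _ _ => zero_mem _, fun x => by simp⟩

instance : Congruence (htpy A) where
  equivalence :=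
    { refl := htpy_refl
      symm := by
        rintro f g ⟨h, h₁, h₂⟩
        refine ⟨-h, fun n x hx => neg_mem (h₁ n x hx), fun x => ?_⟩
        rw [← neg_sub, h₂]
        simp [add_comm]
      trans := by
        rintro f g e ⟨h, h₁, h₂⟩ ⟨k, k₁, k₂⟩
        refine ⟨h + k, fun n x hx => add_mem (h₁ n x hx) (k₁ n x hx), fun x => ?_⟩
        rw [← sub_add_sub_cancel _ (lin g x), h₂, k₂]
        simp only [LinearMap.add_apply, map_add]
        abel }
  comp_left f _ _ hg := htpy_comp (htpy_refl f) hg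
  comp_right g hf := htpy_comp hf (htpy_refl g)

instance : (htpy A).IsCompatibleWithShift ℤ where
  condition k M N f g := by
    rintro ⟨h, h₁, h₂⟩
    refine ⟨(-1 : ℂ) ^ k • (show (M⟦k⟧).carrier →ₗ[A.carrierᵐᵒᵖ] (N⟦k⟧).carrier from h), ?_, ?_⟩
    · intro n x hx
      refine Submodule.smul_mem _ _ (h₁ (n + k) x ?_)
      rw [add_right_comm]
      exact hx
    · intro x
      refine (h₂ x).trans ?_
      change _ = (-1 : ℂ) ^ k • N.d ((-1 : ℂ) ^ k • h x) +
        (-1 : ℂ) ^ k • h ((-1 : ℂ) ^ k • M.d x)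
      rw [map_smul, sign_smul_smul, LinearMap.map_smul_of_tower, sign_smul_smul]

end DGModule

/-- The homotopy category of right dg modules over `A`. -/
abbrev HoCat (A : DGAlgebra) := Quotient (DGModule.htpy A)

namespace HoCat

open DGModule

variable {A : DGAlgebra}

/-- The functor from dg modules to the homotopy category. -/
abbrev q (A : DGAlgebra) : DGModule A ⥤ HoCat A := Quotient.functor _

instance : Preadditive (HoCat A) := Quotient.preadditive _ fun _ _ => htpy_add

instance : (q A).Additive := Quotient.functor_additive _ fun _ _ => htpy_add

instance : Linear ℂ (HoCat A) := Quotient.linear ℂ _ fun c _ _ => htpy_smul c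

instance : (q A).Linear ℂ := Quotient.linear_functor ℂ _ fun c _ _ => htpy_smul c

lemma q_eq {M N : DGModule A} {f g : M ⟶ N} (h : htpy A f g) : (q A).map f = (q A).map g :=
  CategoryTheory.Quotient.sound _ h

lemma htpy_of_eq {M N : DGModule A} {f g : M ⟶ N} (h : (q A).map f = (q A).map g) : htpy A f g :=
  (Quotient.functor_map_eq_iff _ _ _).1 h

instance (n : ℤ) : (shiftFunctor (HoCat A) n).Additive := by
  have : ((q A) ⋙ shiftFunctor (HoCat A) n).Additive :=
    Functor.additive_of_iso ((q A).commShiftIso n)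
  exact Functor.additive_of_full_essSurj_comp (q A) _

instance (n : ℤ) : (shiftFunctor (HoCat A) n).Linear ℂ where
  map_smul {X Y} f c := by
    obtain ⟨X⟩ := X
    obtain ⟨Y⟩ := Y
    obtain ⟨f, rfl⟩ := (q A).map_surjective f
    have : (q A ⋙ shiftFunctor (HoCat A) n).Linear ℂ :=
      Functor.linear_of_iso _ ((q A).commShiftIso n)
    exact Functor.Linear.map_smul (F := q A ⋙ shiftFunctor (HoCat A) n) f c

end HoCat

namespace DGModule

variable {A : DGAlgebra}

/-- The zero dg module. -/
def zero (A : DGAlgebra) : DGModule A where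
  carrier := PUnit
  gr _ := ⊥
  isInternal := (DirectSum.isInternal_submodule_iff_iSupIndep_and_iSup_eq_top _).2
    ⟨fun _ => disjoint_bot_left, Subsingleton.elim _ _⟩
  smul_mem _ _ := Subsingleton.elim _ _
  d := 0
  d_mem _ := Subsingleton.elim _ _
  d_d _ := rfl
  leibniz _ _ := rfl

instance : HasZeroObject (DGModule A) where
  zero := ⟨zero A, (IsZero.iff_id_eq_zero _).2 (hom_ext fun _ => rfl)⟩

instance : HasZeroObject (HoCat A) := (HoCat.q A).hasZeroObject_of_additive

lemma isInternal_prod {V W : Type} [AddCommGroup V] [Module ℂ V] [AddCommGroup W] [Module ℂ W]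
    {p : ℤ → Submodule ℂ V} {q : ℤ → Submodule ℂ W} (hp : DirectSum.IsInternal p)
    (hq : DirectSum.IsInternal q) : DirectSum.IsInternal fun n => (p n).prod (q n) := by
  rw [DirectSum.isInternal_submodule_iff_iSupIndep_and_iSup_eq_top] at hp hq ⊢
  constructor
  · intro i
    have hle : (⨆ j, ⨆ (_ : j ≠ i), (p j).prod (q j)) ≤
        (⨆ j, ⨆ (_ : j ≠ i), p j).prod (⨆ j, ⨆ (_ : j ≠ i), q j) :=
      iSup₂_le fun j hj => Submodule.prod_mono (le_iSup₂_of_le j hj le_rfl)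
        (le_iSup₂_of_le j hj le_rfl)
    refine Disjoint.mono_right hle ?_
    rw [disjoint_iff, Submodule.prod_inf_prod, disjoint_iff.1 (hp.1 i), disjoint_iff.1 (hq.1 i),
      Submodule.prod_bot]
  · rw [eq_top_iff]
    rintro ⟨x, y⟩ -
    have hx : ((x, 0) : V × W) ∈ ⨆ n, (p n).prod (q n) := by
      have h : x ∈ ⨆ n, p n := hp.2 ▸ Submodule.mem_top
      have hle : (⨆ n, p n) ≤ (⨆ n, (p n).prod (q n)).comap (LinearMap.inl ℂ V W) :=
        iSup_le fun n v hv => Submodule.mem_iSup_of_mem n ⟨hv, zero_mem _⟩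
      exact hle h
    have hy : ((0, y) : V × W) ∈ ⨆ n, (p n).prod (q n) := by
      have h : y ∈ ⨆ n, q n := hq.2 ▸ Submodule.mem_top
      have hle : (⨆ n, q n) ≤ (⨆ n, (p n).prod (q n)).comap (LinearMap.inr ℂ V W) :=
        iSup_le fun n v hv => Submodule.mem_iSup_of_mem n ⟨zero_mem _, hv⟩
      exact hle h
    simpa using add_mem hx hy

/-- The mapping cone of `f : M ⟶ N`: the right module `M × N` with `(Cone f)ⁿ = Mⁿ⁺¹ × Nⁿ` and
`d (x, y) = (-d x, f x + d y)`. -/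
def cone {M N : DGModule A} (f : M ⟶ N) : DGModule A where
  carrier := M.carrier × N.carrier
  gr n := (M.gr (n + 1)).prod (N.gr n)
  isInternal := isInternal_prod (M.shift 1).isInternal N.isInternal
  smul_mem {m n x a} hx ha := ⟨(M.shift 1).smul_mem hx.1 ha, N.smul_mem hx.2 ha⟩
  d := (-(M.d ∘ₗ LinearMap.fst _ _ _)).prod
    ((lin f).restrictScalars ℂ ∘ₗ LinearMap.fst _ _ _ + N.d ∘ₗ LinearMap.snd _ _ _)
  d_mem {n x} hx := by
    have h₁ : -M.d x.1 ∈ M.gr (n + 1 + 1) := neg_mem (M.d_mem hx.1)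
    have h₂ : lin f x.1 + N.d x.2 ∈ N.gr (n + 1) := add_mem (lin_mem f hx.1) (N.d_mem hx.2)
    exact ⟨h₁, h₂⟩
  d_d x := by
    ext <;> simp [M.d_d, N.d_d, lin_d]
  leibniz {n x} a hx := by
    have h₁ := M.leibniz a hx.1
    have h₂ := N.leibniz a hx.2
    ext
    · simp [h₁, sign_succ, add_comm]
    · simp [h₂, add_assoc, add_left_comm]

lemma cone_d {M N : DGModule A} (f : M ⟶ N) (x : M.carrier) (y : N.carrier) :
    (cone f).d (x, y) = (-M.d x, lin f x + N.d y) := rfl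

/-- The inclusion `N ⟶ Cone f`. -/
def inr {M N : DGModule A} (f : M ⟶ N) : N ⟶ cone f :=
  mkHom (N := cone f) (LinearMap.inr A.carrierᵐᵒᵖ M.carrier N.carrier)
    (fun _ _ hx => ⟨zero_mem _, hx⟩)
    (fun x => by
      change ((0, N.d x) : M.carrier × N.carrier) = (-M.d 0, lin f 0 + N.d x)
      simp)

/-- The projection `Cone f ⟶ M⟦1⟧`. -/
def fst {M N : DGModule A} (f : M ⟶ N) : cone f ⟶ M⟦(1 : ℤ)⟧ :=
  mkHom (M := cone f) (N := M.shift 1) (LinearMap.fst A.carrierᵐᵒᵖ M.carrier N.carrier)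
    (fun _ _ hx => hx.1)
    (fun x => by
      change -M.d x.1 = (-1 : ℂ) ^ (1 : ℤ) • M.d x.1
      simp)

/-- The triangle `M ⟶ N ⟶ Cone f ⟶ M⟦1⟧`. -/
def triangle {M N : DGModule A} (f : M ⟶ N) : Triangle (DGModule A) :=
  Triangle.mk f (inr f) (fst f)

/-- The morphism of cones induced by a square commuting up to a homotopy `h`. -/
def coneMap {M₁ N₁ M₂ N₂ : DGModule A} (f₁ : M₁ ⟶ N₁) (f₂ : M₂ ⟶ N₂) (a : M₁ ⟶ M₂) (b : N₁ ⟶ N₂)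
    (h : M₁.carrier →ₗ[A.carrierᵐᵒᵖ] N₂.carrier) (h₁ : ∀ n, ∀ x ∈ M₁.gr (n + 1), h x ∈ N₂.gr n)
    (h₂ : ∀ x, lin (f₁ ≫ b) x - lin (a ≫ f₂) x = N₂.d (h x) + h (M₁.d x)) :
    cone f₁ ⟶ cone f₂ :=
  mkHom (M := cone f₁) (N := cone f₂)
    (((lin a).comp (LinearMap.fst A.carrierᵐᵒᵖ M₁.carrier N₁.carrier)).prod
      (h.comp (LinearMap.fst A.carrierᵐᵒᵖ M₁.carrier N₁.carrier) +
        (lin b).comp (LinearMap.snd A.carrierᵐᵒᵖ M₁.carrier N₁.carrier)))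
    (fun n x hx => by
      have e₁ : lin a x.1 ∈ M₂.gr (n + 1) := lin_mem a hx.1
      have e₂ : h x.1 + lin b x.2 ∈ N₂.gr n := add_mem (h₁ _ _ hx.1) (lin_mem b hx.2)
      exact ⟨e₁, e₂⟩)
    (fun x => by
      obtain ⟨x, y⟩ := x
      change ((lin a (-M₁.d x), h (-M₁.d x) + lin b (lin f₁ x + N₁.d y)) :
        M₂.carrier × N₂.carrier) =
        (-M₂.d (lin a x), lin f₂ (lin a x) + N₂.d (h x + lin b y))
      have e := h₂ x
      simp only [lin_comp, LinearMap.comp_apply] at e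
      rw [sub_eq_iff_eq_add] at e
      simp only [map_neg, map_add, lin_d, e]
      congr 1
      abel)

/-- The homotopy equivalence `M⟦1⟧ ⟶ Cone (inr f)`. -/
def rotHom {M N : DGModule A} (f : M ⟶ N) : M⟦(1 : ℤ)⟧ ⟶ cone (inr f) :=
  mkHom (M := M.shift 1) (N := cone (inr f))
    ((-(lin f)).prod (LinearMap.inl A.carrierᵐᵒᵖ M.carrier N.carrier))
    (fun _ _ hx => ⟨neg_mem (lin_mem f hx), hx, zero_mem _⟩)
    (fun x => by
      change ((-lin f ((-1 : ℂ) ^ (1 : ℤ) • M.d x), ((-1 : ℂ) ^ (1 : ℤ) • M.d x, 0)) :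
        N.carrier × (M.carrier × N.carrier)) =
        (-N.d (-lin f x), (0, -lin f x) + (-M.d x, lin f x + N.d 0))
      simp
      exact lin_d f x)

/-- The homotopy inverse of `rotHom`. -/
def rotInv {M N : DGModule A} (f : M ⟶ N) : cone (inr f) ⟶ M⟦(1 : ℤ)⟧ :=
  mkHom (M := cone (inr f)) (N := M.shift 1)
    ((LinearMap.fst A.carrierᵐᵒᵖ M.carrier N.carrier).comp
      (LinearMap.snd A.carrierᵐᵒᵖ N.carrier (M.carrier × N.carrier)))
    (fun _ _ hx => hx.2.1)
    (fun x => by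
      obtain ⟨z, x, y⟩ := x
      change 0 + -M.d x = (-1 : ℂ) ^ (1 : ℤ) • M.d x
      simp)

lemma rotHom_rotInv {M N : DGModule A} (f : M ⟶ N) : rotHom f ≫ rotInv f = 𝟙 _ :=
  hom_ext fun _ => rfl

lemma rotInv_rotHom {M N : DGModule A} (f : M ⟶ N) : htpy A (rotInv f ≫ rotHom f) (𝟙 _) := by
  refine ⟨(-((LinearMap.snd A.carrierᵐᵒᵖ M.carrier N.carrier).comp
      (LinearMap.snd A.carrierᵐᵒᵖ N.carrier (M.carrier × N.carrier)))).prod 0,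
    fun n x hx => ⟨neg_mem hx.2.2, zero_mem (M.gr (n + 1)), zero_mem (N.gr n)⟩, ?_⟩
  rintro ⟨z, x, y⟩
  change ((-lin f x, (x, 0)) : N.carrier × (M.carrier × N.carrier)) - (z, (x, y)) =
    (-N.d (-y), (0, -y) + (-M.d 0, lin f 0 + N.d 0)) + (-(z + (lin f x + N.d y)), 0)
  simp
  abel

lemma rot_comm₂ {M N : DGModule A} (f : M ⟶ N) : htpy A (fst f ≫ rotHom f) (inr (inr f)) := by
  refine ⟨-((LinearMap.inl A.carrierᵐᵒᵖ N.carrier (M.carrier × N.carrier)).comp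
      (LinearMap.snd A.carrierᵐᵒᵖ M.carrier N.carrier)),
    fun n x hx => neg_mem ⟨hx.2, zero_mem (M.gr (n + 1)), zero_mem (N.gr n)⟩, ?_⟩
  rintro ⟨x, y⟩
  change ((-lin f x, (x, 0)) : N.carrier × (M.carrier × N.carrier)) - (0, (x, y)) =
    (-N.d (-y), (0, -y) + (-M.d (-0), lin f (-0) + N.d (-0))) + -(lin f x + N.d y, 0)
  simp

lemma rot_comm₃ {M N : DGModule A} (f : M ⟶ N) : rotHom f ≫ fst (inr f) = -f⟦(1 : ℤ)⟧' :=
  hom_ext fun _ => rfl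

/-- The isomorphism `(Cone f)⟦n⟧ ≅ Cone (f⟦n⟧)`. -/
def coneShiftIso {M N : DGModule A} (f : M ⟶ N) (n : ℤ) : (cone f)⟦n⟧ ≅ cone (f⟦n⟧') where
  hom := mkHom (M := (cone f).shift n) (N := cone (f⟦n⟧'))
    (((-1 : ℂ) ^ n • LinearMap.fst A.carrierᵐᵒᵖ M.carrier N.carrier).prod
      (LinearMap.snd A.carrierᵐᵒᵖ M.carrier N.carrier))
    (fun k x hx => by
      have e : x.1 ∈ M.gr (k + n + 1) := hx.1
      rw [add_right_comm] at e
      exact ⟨Submodule.smul_mem _ _ e, hx.2⟩)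
    (fun x => by
      have key : ∀ (x : M.carrier) (y : N.carrier),
          (((-1 : ℂ) ^ n • (-1 : ℂ) ^ n • -M.d x, (-1 : ℂ) ^ n • (lin f x + N.d y)) :
          M.carrier × N.carrier) = (-((-1 : ℂ) ^ n • M.d ((-1 : ℂ) ^ n • x)),
          lin f ((-1 : ℂ) ^ n • x) + (-1 : ℂ) ^ n • N.d y) := fun x y => by
        simp [sign_smul_smul, LinearMap.map_smul_of_tower]
      exact key x.1 x.2)
  inv := mkHom (N := (cone f).shift n) (M := cone (f⟦n⟧'))
    (((-1 : ℂ) ^ n • LinearMap.fst A.carrierᵐᵒᵖ M.carrier N.carrier).prod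
      (LinearMap.snd A.carrierᵐᵒᵖ M.carrier N.carrier))
    (fun k x hx => by
      have e : x.1 ∈ M.gr (k + 1 + n) := hx.1
      rw [add_right_comm] at e
      exact ⟨Submodule.smul_mem _ _ e, hx.2⟩)
    (fun x => by
      have key : ∀ (x : M.carrier) (y : N.carrier),
          (((-1 : ℂ) ^ n • -((-1 : ℂ) ^ n • M.d x), lin f x + (-1 : ℂ) ^ n • N.d y) :
          M.carrier × N.carrier) =
          (-1 : ℂ) ^ n • (-M.d ((-1 : ℂ) ^ n • x), lin f ((-1 : ℂ) ^ n • x) + N.d y) :=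
        fun x y => by simp [sign_smul_smul, LinearMap.map_smul_of_tower]
      exact key x.1 x.2)
  hom_inv_id := hom_ext fun x => Prod.ext (sign_smul_smul n _) rfl
  inv_hom_id := hom_ext fun x => Prod.ext (sign_smul_smul n _) rfl

lemma lin_units_smul {M N : DGModule A} (n : ℤ) (f : M ⟶ N) (x : M.carrier) :
    lin (n.negOnePow • f) x = (-1 : ℂ) ^ n • lin f x := by
  obtain h | h := Int.even_or_odd n
  · simp [Int.negOnePow_even n h, h.neg_one_zpow]
  · simp [Int.negOnePow_odd n h, h.neg_one_zpow]

/-- The isomorphism `(triangle f)⟦n⟧ ≅ triangle (f⟦n⟧)`. -/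
def triangleShiftIso {M N : DGModule A} (f : M ⟶ N) (n : ℤ) :
    (Triangle.shiftFunctor _ n).obj (triangle f) ≅ triangle (f⟦n⟧') :=
  Triangle.isoMk _ _ (Iso.refl _) (n.negOnePow • Iso.refl _) (coneShiftIso f n)
    (by
      change (n.negOnePow • f⟦n⟧') ≫ (n.negOnePow • 𝟙 _) = 𝟙 _ ≫ f⟦n⟧'
      simp [smul_smul])
    (by
      change (n.negOnePow • (inr f)⟦n⟧') ≫ (coneShiftIso f n).hom =
        (n.negOnePow • 𝟙 _) ≫ inr (f⟦n⟧')
      rw [Linear.units_smul_comp, Linear.units_smul_comp, Category.id_comp]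
      exact congrArg _ (hom_ext fun x => Prod.ext
        (smul_zero (A := M.carrier) ((-1 : ℂ) ^ n)) rfl))
    (by
      change (n.negOnePow • (fst f)⟦n⟧' ≫ (shiftFunctorComm (DGModule A) 1 n).hom.app M) ≫
        (𝟙 _)⟦(1 : ℤ)⟧' = (coneShiftIso f n).hom ≫ fst (f⟦n⟧')
      rw [CategoryTheory.Functor.map_id]
      refine hom_ext fun x => (lin_units_smul n _ x).trans ?_
      exact congrArg (fun y : M.carrier => (-1 : ℂ) ^ n • y) (isId_comm M 1 n x.1))

end DGModule

namespace HoCat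

open DGModule

variable {A : DGAlgebra}

/-- The standard triangle of a morphism of dg modules, in the homotopy category. -/
abbrev triangleh {M N : DGModule A} (f : M ⟶ N) : Triangle (HoCat A) :=
  (q A).mapTriangle.obj (triangle f)

/-- The distinguished triangles: those isomorphic to some `M ⟶ N ⟶ Cone f ⟶ M⟦1⟧`. -/
def distTriangles (A : DGAlgebra) : Set (Triangle (HoCat A)) :=
  {T | ∃ (M N : DGModule A) (f : M ⟶ N), Nonempty (T ≅ triangleh f)}

lemma isomorphic_dist (T₁ : Triangle (HoCat A)) (hT₁ : T₁ ∈ distTriangles A)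
    (T₂ : Triangle (HoCat A)) (e : T₂ ≅ T₁) : T₂ ∈ distTriangles A := by
  obtain ⟨M, N, f, ⟨e'⟩⟩ := hT₁
  exact ⟨M, N, f, ⟨e ≪≫ e'⟩⟩

lemma isZero_cone_id (M : DGModule A) : IsZero ((q A).obj (cone (𝟙 M))) := by
  rw [IsZero.iff_id_eq_zero, ← (q A).map_id, ← (q A).map_zero]
  refine q_eq ⟨(LinearMap.inl A.carrierᵐᵒᵖ M.carrier M.carrier).comp
    (LinearMap.snd A.carrierᵐᵒᵖ M.carrier M.carrier), fun n x hx => ⟨hx.2, zero_mem _⟩, ?_⟩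
  rintro ⟨x, y⟩
  have key : ∀ x y : M.carrier, ((x, y) : M.carrier × M.carrier) - 0 =
      (-M.d y, y + M.d 0) + (x + M.d y, 0) := fun x y => by simp
  exact key x y

lemma contractible_dist (X : HoCat A) : contractibleTriangle X ∈ distTriangles A := by
  obtain ⟨M⟩ := X
  have h := isZero_cone_id M
  refine ⟨M, M, 𝟙 M, ⟨Triangle.isoMk _ _ (Iso.refl _) (Iso.refl _) ((isZero_zero _).iso h)
    ?_ (h.eq_of_tgt _ _) ((isZero_zero _).eq_of_src _ _)⟩⟩
  exact (Category.id_comp _).trans ((q A).map_id M).symm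

lemma cocone_dist {X Y : HoCat A} (f : X ⟶ Y) :
    ∃ (Z : HoCat A) (g : Y ⟶ Z) (h : Z ⟶ X⟦(1 : ℤ)⟧), Triangle.mk f g h ∈ distTriangles A := by
  obtain ⟨X⟩ := X
  obtain ⟨Y⟩ := Y
  obtain ⟨f, rfl⟩ := (q A).map_surjective f
  exact ⟨_, _, _, ⟨_, _, f, ⟨Iso.refl _⟩⟩⟩

/-- `rotHom` as an isomorphism in the homotopy category. -/
def rotIso {M N : DGModule A} (f : M ⟶ N) : (q A).obj (M⟦(1 : ℤ)⟧) ≅ (q A).obj (cone (inr f)) where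
  hom := (q A).map (rotHom f)
  inv := (q A).map (rotInv f)
  hom_inv_id := by rw [← Functor.map_comp, rotHom_rotInv, CategoryTheory.Functor.map_id]
  inv_hom_id := by rw [← Functor.map_comp, q_eq (rotInv_rotHom f), CategoryTheory.Functor.map_id]

/-- The rotation of a standard triangle is a standard triangle. -/
def rotTriangleIso {M N : DGModule A} (f : M ⟶ N) : (triangleh f).rotate ≅ triangleh (inr f) :=
  Triangle.isoMk _ _ (Iso.refl _) (Iso.refl _)
    (((q A).commShiftIso (1 : ℤ)).symm.app M ≪≫ rotIso f)
    ((Category.comp_id _).trans (Category.id_comp _).symm)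
    (by
      change ((q A).map (fst f) ≫ ((q A).commShiftIso (1 : ℤ)).hom.app M) ≫
        (((q A).commShiftIso (1 : ℤ)).inv.app M ≫ (q A).map (rotHom f)) =
        𝟙 _ ≫ (q A).map (inr (inr f))
      rw [Category.assoc, Iso.hom_inv_id_app_assoc, ← Functor.map_comp, q_eq (rot_comm₂ f),
        Category.id_comp])
    (by
      change (-((q A).map f)⟦(1 : ℤ)⟧') ≫ (𝟙 _)⟦(1 : ℤ)⟧' =
        (((q A).commShiftIso (1 : ℤ)).inv.app M ≫ (q A).map (rotHom f)) ≫
          (q A).map (fst (inr f)) ≫ ((q A).commShiftIso (1 : ℤ)).hom.app N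
      rw [CategoryTheory.Functor.map_id, Category.comp_id, Category.assoc,
        ← Functor.map_comp_assoc, rot_comm₃, Functor.map_neg, Preadditive.neg_comp,
        Preadditive.comp_neg]
      congr 1
      rw [Functor.commShiftIso_hom_naturality, Iso.inv_hom_id_app_assoc])

lemma rotate_dist' (T : Triangle (HoCat A)) (hT : T ∈ distTriangles A) :
    T.rotate ∈ distTriangles A := by
  obtain ⟨M, N, f, ⟨e⟩⟩ := hT
  exact ⟨_, _, _, ⟨(rotate _).mapIso e ≪≫ rotTriangleIso f⟩⟩

lemma shift_dist (T : Triangle (HoCat A)) (hT : T ∈ distTriangles A) (n : ℤ) :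
    (Triangle.shiftFunctor _ n).obj T ∈ distTriangles A := by
  obtain ⟨M, N, f, ⟨e⟩⟩ := hT
  exact ⟨_, _, _, ⟨(Triangle.shiftFunctor _ n).mapIso e ≪≫
    ((q A).mapTriangle.commShiftIso n).symm.app _ ≪≫
    (q A).mapTriangle.mapIso (triangleShiftIso f n)⟩⟩

lemma invRotate_dist' (T : Triangle (HoCat A)) (hT : T ∈ distTriangles A) :
    T.invRotate ∈ distTriangles A :=
  isomorphic_dist _ (shift_dist _ (rotate_dist' _ (rotate_dist' _ hT)) _) _
    ((invRotateIsoRotateRotateShiftFunctorNegOne _).app T)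

lemma rotate_dist (T : Triangle (HoCat A)) : T ∈ distTriangles A ↔ T.rotate ∈ distTriangles A :=
  ⟨rotate_dist' T, fun hT => isomorphic_dist _ (invRotate_dist' T.rotate hT) _
    ((triangleRotation _).unitIso.app T)⟩

lemma complete_std {M₁ N₁ M₂ N₂ : DGModule A} (f₁ : M₁ ⟶ N₁) (f₂ : M₂ ⟶ N₂)
    (a : (q A).obj M₁ ⟶ (q A).obj M₂) (b : (q A).obj N₁ ⟶ (q A).obj N₂)
    (fac : (q A).map f₁ ≫ b = a ≫ (q A).map f₂) :
    ∃ φ : triangleh f₁ ⟶ triangleh f₂, φ.hom₁ = a ∧ φ.hom₂ = b := by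
  obtain ⟨a, rfl⟩ := (q A).map_surjective a
  obtain ⟨b, rfl⟩ := (q A).map_surjective b
  rw [← Functor.map_comp, ← Functor.map_comp] at fac
  obtain ⟨h, h₁, h₂⟩ := htpy_of_eq fac
  let c := coneMap f₁ f₂ a b h h₁ h₂
  have d₁ : inr f₁ ≫ c = b ≫ inr f₂ := hom_ext fun x => Prod.ext (map_zero (lin a))
    ((congrArg (· + lin b x) (map_zero h)).trans (zero_add _))
  have d₂ : c ≫ fst f₂ = fst f₁ ≫ a⟦(1 : ℤ)⟧' := hom_ext fun _ => rfl
  refine ⟨Triangle.homMk _ _ ((q A).map a) ((q A).map b) ((q A).map c) ?_ ?_ ?_, rfl, rfl⟩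
  · change (q A).map f₁ ≫ (q A).map b = (q A).map a ≫ (q A).map f₂
    rw [← Functor.map_comp, ← Functor.map_comp, fac]
  · change (q A).map (inr f₁) ≫ (q A).map c = (q A).map b ≫ (q A).map (inr f₂)
    rw [← Functor.map_comp, ← Functor.map_comp, d₁]
  · change ((q A).map (fst f₁) ≫ ((q A).commShiftIso (1 : ℤ)).hom.app M₁) ≫
      ((q A).map a)⟦(1 : ℤ)⟧' = (q A).map c ≫
        ((q A).map (fst f₂) ≫ ((q A).commShiftIso (1 : ℤ)).hom.app M₂)
    rw [← Functor.map_comp_assoc, d₂, Category.assoc, Functor.map_comp, Category.assoc,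
      Functor.commShiftIso_hom_naturality]

lemma complete_of_iso {T₁ T₂ S₁ S₂ : Triangle (HoCat A)} (e₁ : T₁ ≅ S₁) (e₂ : T₂ ≅ S₂)
    (H : ∀ (a : S₁.obj₁ ⟶ S₂.obj₁) (b : S₁.obj₂ ⟶ S₂.obj₂), S₁.mor₁ ≫ b = a ≫ S₂.mor₁ →
      ∃ φ : S₁ ⟶ S₂, φ.hom₁ = a ∧ φ.hom₂ = b)
    (a : T₁.obj₁ ⟶ T₂.obj₁) (b : T₁.obj₂ ⟶ T₂.obj₂) (fac : T₁.mor₁ ≫ b = a ≫ T₂.mor₁) :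
    ∃ c : T₁.obj₃ ⟶ T₂.obj₃, T₁.mor₂ ≫ c = b ≫ T₂.mor₂ ∧
      T₁.mor₃ ≫ a⟦(1 : ℤ)⟧' = c ≫ T₂.mor₃ := by
  obtain ⟨φ, h₁, h₂⟩ := H (e₁.inv.hom₁ ≫ a ≫ e₂.hom.hom₁) (e₁.inv.hom₂ ≫ b ≫ e₂.hom.hom₂) (by
    rw [← Category.assoc, e₁.inv.comm₁, Category.assoc, reassoc_of% fac, e₂.hom.comm₁]
    simp)
  let γ := e₁.hom ≫ φ ≫ e₂.inv
  have hγ₁ : γ.hom₁ = a := by simp [γ, h₁]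
  have hγ₂ : γ.hom₂ = b := by simp [γ, h₂]
  exact ⟨γ.hom₃, hγ₂ ▸ γ.comm₂, hγ₁ ▸ γ.comm₃⟩

lemma complete_dist (T₁ T₂ : Triangle (HoCat A)) (hT₁ : T₁ ∈ distTriangles A)
    (hT₂ : T₂ ∈ distTriangles A) (a : T₁.obj₁ ⟶ T₂.obj₁) (b : T₁.obj₂ ⟶ T₂.obj₂)
    (fac : T₁.mor₁ ≫ b = a ≫ T₂.mor₁) :
    ∃ c : T₁.obj₃ ⟶ T₂.obj₃, T₁.mor₂ ≫ c = b ≫ T₂.mor₂ ∧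
      T₁.mor₃ ≫ a⟦(1 : ℤ)⟧' = c ≫ T₂.mor₃ := by
  obtain ⟨_, _, f₁, ⟨e₁⟩⟩ := hT₁
  obtain ⟨_, _, f₂, ⟨e₂⟩⟩ := hT₂
  exact complete_of_iso e₁ e₂ (complete_std f₁ f₂) a b fac

instance : Pretriangulated (HoCat A) where
  distinguishedTriangles := distTriangles A
  isomorphic_distinguished := isomorphic_dist
  contractible_distinguished := contractible_dist
  distinguished_cocone_triangle := cocone_dist
  rotate_distinguished_triangle := rotate_dist
  complete_distinguished_triangle_morphism := complete_dist

end HoCat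


namespace DGModule

variable {A : DGAlgebra}

/-- The morphism `Cone f ⟶ Cone (f ≫ g)`. -/
def octA {M N P : DGModule A} (f : M ⟶ N) (g : N ⟶ P) : cone f ⟶ cone (f ≫ g) :=
  coneMap f (f ≫ g) (𝟙 M) g 0 (fun _ _ _ => zero_mem _) (fun x => by simp)

/-- The morphism `Cone (f ≫ g) ⟶ Cone g`. -/
def octB {M N P : DGModule A} (f : M ⟶ N) (g : N ⟶ P) : cone (f ≫ g) ⟶ cone g :=
  coneMap (f ≫ g) g f (𝟙 P) 0 (fun _ _ _ => zero_mem _) (fun x => by simp)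

/-- The homotopy equivalence `Cone g ⟶ Cone (octA f g)`. -/
def octHom {M N P : DGModule A} (f : M ⟶ N) (g : N ⟶ P) : cone g ⟶ cone (octA f g) :=
  mkHom (M := cone g) (N := cone (octA f g))
    ((LinearMap.prodMap (LinearMap.inr A.carrierᵐᵒᵖ M.carrier N.carrier)
      (LinearMap.inr A.carrierᵐᵒᵖ M.carrier P.carrier)))
    (fun n x hx => ⟨⟨zero_mem (M.gr (n + 1 + 1)), hx.1⟩, ⟨zero_mem (M.gr (n + 1)), hx.2⟩⟩)
    (fun x => by
      obtain ⟨x, y⟩ := x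
      have key : ∀ (x : N.carrier) (y : P.carrier),
          (((0, -N.d x), (0, lin g x + P.d y)) :
            (M.carrier × N.carrier) × (M.carrier × P.carrier)) =
          (-(-M.d 0, lin f 0 + N.d x), ((0 : M.carrier), (0 : P.carrier) + lin g x) +
            (-M.d 0, lin g (lin f 0) + P.d y)) := fun x y => by simp
      exact key x y)

/-- The homotopy inverse of `octHom`. -/
def octInv {M N P : DGModule A} (f : M ⟶ N) (g : N ⟶ P) : cone (octA f g) ⟶ cone g :=
  mkHom (M := cone (octA f g)) (N := cone g)
    (((LinearMap.snd A.carrierᵐᵒᵖ M.carrier N.carrier).comp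
        (LinearMap.fst A.carrierᵐᵒᵖ (M.carrier × N.carrier) (M.carrier × P.carrier)) +
      (lin f).comp ((LinearMap.fst A.carrierᵐᵒᵖ M.carrier P.carrier).comp
        (LinearMap.snd A.carrierᵐᵒᵖ (M.carrier × N.carrier) (M.carrier × P.carrier)))).prod
      ((LinearMap.snd A.carrierᵐᵒᵖ M.carrier P.carrier).comp
        (LinearMap.snd A.carrierᵐᵒᵖ (M.carrier × N.carrier) (M.carrier × P.carrier))))
    (fun n x hx => by
      have e₁ : x.1.2 ∈ N.gr (n + 1) := hx.1.2
      have e₂ : lin f x.2.1 ∈ N.gr (n + 1) := lin_mem f hx.2.1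
      exact ⟨add_mem e₁ e₂, hx.2.2⟩)
    (fun x => by
      obtain ⟨⟨m, n⟩, ⟨m', p⟩⟩ := x
      have key : ∀ (m m' : M.carrier) (n : N.carrier) (p : P.carrier),
          ((-(lin f m + N.d n) + lin f (m + -M.d m'),
            0 + lin g n + (lin g (lin f m') + P.d p)) : N.carrier × P.carrier) =
          (-N.d (n + lin f m'), lin g (n + lin f m') + P.d p) := fun m m' n p => by
        simp only [map_add, map_neg, lin_d]
        refine Prod.ext ?_ ?_
        · simp [add_comm]
        · simp [add_assoc]
      exact key m m' n p)

lemma octHom_octInv {M N P : DGModule A} (f : M ⟶ N) (g : N ⟶ P) :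
    octHom f g ≫ octInv f g = 𝟙 _ :=
  hom_ext fun x => by
    obtain ⟨x, y⟩ := x
    have key : ∀ (x : N.carrier) (y : P.carrier),
      ((x + lin f 0, y) : N.carrier × P.carrier) = (x, y) := fun x y => by simp
    exact key x y

lemma octInv_octHom {M N P : DGModule A} (f : M ⟶ N) (g : N ⟶ P) :
    htpy A (octInv f g ≫ octHom f g) (𝟙 _) := by
  refine ⟨((-((LinearMap.inl A.carrierᵐᵒᵖ M.carrier N.carrier).comp
    ((LinearMap.fst A.carrierᵐᵒᵖ M.carrier P.carrier).comp
      (LinearMap.snd A.carrierᵐᵒᵖ (M.carrier × N.carrier) (M.carrier × P.carrier)))))).prod 0,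
    fun n x hx => ?_, ?_⟩
  · have e : -x.2.1 ∈ M.gr (n + 1 + 1) := (M.gr (n + 1 + 1)).neg_mem hx.2.1
    have key : ∀ y : M.carrier, -y ∈ M.gr (n + 1 + 1) →
      (-((y, 0) : M.carrier × N.carrier)) ∈ (M.gr (n + 1 + 1)).prod (N.gr (n + 1)) :=
      fun y hy => ⟨hy, by simp⟩
    exact ⟨key _ e, zero_mem (M.gr (n + 1)), zero_mem (P.gr n)⟩
  · rintro ⟨⟨m, n⟩, ⟨m', p⟩⟩
    have key : ∀ (m m' : M.carrier) (n : N.carrier) (p : P.carrier),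
        (((0, n + lin f m'), (0, p)) : (M.carrier × N.carrier) × (M.carrier × P.carrier)) -
          ((m, n), (m', p)) =
        (-(-M.d (-m'), lin f (-m') + N.d (-0)), ((-m', 0 + lin g (-0)) :
            M.carrier × P.carrier) + (-M.d 0, lin g (lin f 0) + P.d 0)) +
          (-((m + -M.d m', 0) : M.carrier × N.carrier), 0) := fun m m' n p => by simp
    exact key m m' n p

lemma oct_comm₂ {M N P : DGModule A} (f : M ⟶ N) (g : N ⟶ P) :
    inr (octA f g) ≫ octInv f g = octB f g :=
  hom_ext fun x => by
    obtain ⟨x, y⟩ := x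
    have key : ∀ (x : M.carrier) (y : P.carrier),
      ((0 + lin f x, y) : N.carrier × P.carrier) = (lin f x, 0 + y) := fun x y => by simp
    exact key x y

lemma oct_comm₃ {M N P : DGModule A} (f : M ⟶ N) (g : N ⟶ P) :
    octHom f g ≫ fst (octA f g) = fst g ≫ (inr f)⟦(1 : ℤ)⟧' :=
  hom_ext fun _ => rfl

end DGModule

namespace HoCat

open DGModule

variable {A : DGAlgebra}

/-- `octHom` as an isomorphism in the homotopy category. -/
def octIso {M N P : DGModule A} (f : M ⟶ N) (g : N ⟶ P) :
    (q A).obj (cone g) ≅ (q A).obj (cone (octA f g)) where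
  hom := (q A).map (octHom f g)
  inv := (q A).map (octInv f g)
  hom_inv_id := by rw [← Functor.map_comp, octHom_octInv, CategoryTheory.Functor.map_id]
  inv_hom_id := by rw [← Functor.map_comp, q_eq (octInv_octHom f g), CategoryTheory.Functor.map_id]

lemma triangleh_dist {M N : DGModule A} (f : M ⟶ N) : triangleh f ∈ distTriang (HoCat A) :=
  ⟨_, _, f, ⟨Iso.refl _⟩⟩

lemma oct_mem {M N P : DGModule A} (f : M ⟶ N) (g : N ⟶ P) :
    Triangle.mk ((q A).map (octA f g)) ((q A).map (octB f g))
      ((triangleh g).mor₃ ≫ ((q A).map (inr f))⟦(1 : ℤ)⟧') ∈ distTriang (HoCat A) := by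
  refine ⟨_, _, octA f g, ⟨Triangle.isoMk _ _ (Iso.refl _) (Iso.refl _) (octIso f g) ?_ ?_ ?_⟩⟩
  · exact (Category.comp_id _).trans (Category.id_comp _).symm
  · change (q A).map (octB f g) ≫ (octIso f g).hom = 𝟙 _ ≫ (q A).map (inr (octA f g))
    rw [Category.id_comp, ← Iso.eq_comp_inv]
    change _ = (q A).map _ ≫ (q A).map (octInv f g)
    rw [← Functor.map_comp, oct_comm₂]
  · change (((q A).map (fst g) ≫ ((q A).commShiftIso (1 : ℤ)).hom.app N) ≫
      ((q A).map (inr f))⟦(1 : ℤ)⟧') ≫ (𝟙 _)⟦(1 : ℤ)⟧' = (q A).map (octHom f g) ≫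
        (q A).map (fst (octA f g)) ≫ ((q A).commShiftIso (1 : ℤ)).hom.app (cone f)
    rw [CategoryTheory.Functor.map_id, Category.comp_id, Category.assoc,
      ← Functor.map_comp_assoc (q A) (octHom f g), oct_comm₃, Functor.map_comp, Category.assoc,
      Functor.commShiftIso_hom_naturality]

instance : IsTriangulated (HoCat A) := IsTriangulated.mk' (by
  rintro ⟨M⟩ ⟨N⟩ ⟨P⟩ u v
  obtain ⟨f, rfl⟩ := (q A).map_surjective u
  obtain ⟨g, rfl⟩ := (q A).map_surjective v
  refine ⟨_, _, _, _, _, _, _, _, Iso.refl _, Iso.refl _, Iso.refl _,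
    (Category.comp_id _).trans (Category.id_comp _).symm,
    (Category.comp_id _).trans (Category.id_comp _).symm,
    _, _, triangleh_dist f, _, _, triangleh_dist g, (q A).map (inr (f ≫ g)),
    (q A).map (fst (f ≫ g)) ≫ ((q A).commShiftIso (1 : ℤ)).hom.app M, ?_, ⟨?_⟩⟩
  · have := triangleh_dist (f ≫ g)
    have e : (q A).map f ≫ (q A).map g = (q A).map (f ≫ g) := ((q A).map_comp f g).symm
    rw [e]
    exact this
  · refine Triangulated.Octahedron.mk ((q A).map (octA f g)) ((q A).map (octB f g))
      ?_ ?_ ?_ ?_ (oct_mem f g)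
    · change (q A).map (inr f) ≫ (q A).map (octA f g) = (q A).map g ≫ (q A).map (inr (f ≫ g))
      rw [← Functor.map_comp, ← Functor.map_comp]
      congr 1
      refine hom_ext fun x => ?_
      have key : ∀ x : N.carrier, ((0, 0 + lin g x) : M.carrier × P.carrier) = (0, lin g x) :=
        fun x => by simp
      exact key x
    · change (q A).map (octA f g) ≫ (q A).map (fst (f ≫ g)) ≫ _ = (q A).map (fst f) ≫ _
      rw [← Functor.map_comp_assoc]
      rfl
    · change (q A).map (inr (f ≫ g)) ≫ (q A).map (octB f g) = (q A).map (inr g)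
      rw [← Functor.map_comp]
      congr 1
      refine hom_ext fun x => ?_
      have key : ∀ x : P.carrier, ((lin f 0, 0 + x) : N.carrier × P.carrier) = (0, x) :=
        fun x => by simp
      exact key x
    · change ((q A).map (fst (f ≫ g)) ≫ ((q A).commShiftIso (1 : ℤ)).hom.app M) ≫
        ((q A).map f)⟦(1 : ℤ)⟧' = (q A).map (octB f g) ≫ (q A).map (fst g) ≫
          ((q A).commShiftIso (1 : ℤ)).hom.app N
      rw [← Functor.map_comp_assoc, Category.assoc, ← Functor.commShiftIso_hom_naturality,
        ← Functor.map_comp_assoc]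
      rfl)

end HoCat

namespace DGModule

variable {A : DGAlgebra}

/-- The total cohomology `ker d / im d` of a dg module, as an (ungraded) vector space. -/
abbrev Coh (M : DGModule A) : Type :=
  LinearMap.ker M.d ⧸ (LinearMap.range M.d).submoduleOf (LinearMap.ker M.d)

/-- The map induced by a morphism of dg modules on the kernels of the differentials. -/
def kerMap {M N : DGModule A} (f : M ⟶ N) : LinearMap.ker M.d →ₗ[ℂ] LinearMap.ker N.d :=
  ((lin f).restrictScalars ℂ).restrict fun x hx => by
    change N.d (lin f x) = 0
    rw [← lin_d, LinearMap.mem_ker.1 hx, map_zero]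

/-- The map induced by a morphism of dg modules on total cohomology. -/
def cohMap {M N : DGModule A} (f : M ⟶ N) : Coh M →ₗ[ℂ] Coh N :=
  Submodule.mapQ _ _ (kerMap f) (by
    rintro ⟨_, hx⟩ ⟨y, rfl⟩
    exact ⟨lin f y, (lin_d f y).symm⟩)

/-- Total cohomology as a functor on dg modules. -/
def coh (A : DGAlgebra) : DGModule A ⥤ ModuleCat ℂ where
  obj M := ModuleCat.of ℂ (Coh M)
  map f := ModuleCat.ofHom (cohMap f)
  map_id M := by
    ext x
    rfl
  map_comp f g := by
    ext x
    rfl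

lemma coh_htpy {M N : DGModule A} (f g : M ⟶ N) (h : htpy A f g) :
    (coh A).map f = (coh A).map g := by
  obtain ⟨h, -, h₂⟩ := h
  ext x
  obtain ⟨⟨x, hx⟩, rfl⟩ := Submodule.Quotient.mk_surjective _ x
  refine (Submodule.Quotient.eq _).2 ⟨h x, ?_⟩
  have := h₂ x
  rw [LinearMap.mem_ker.1 hx, map_zero, add_zero] at this
  exact this.symm

end DGModule

namespace HoCat

open DGModule

/-- Total cohomology as a functor on the homotopy category. -/
def coh (A : DGAlgebra) : HoCat A ⥤ ModuleCat ℂ :=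
  CategoryTheory.Quotient.lift _ (DGModule.coh A) fun _ _ => coh_htpy

variable (A : DGAlgebra)

instance : (coh A).PreservesZeroMorphisms where
  map_zero X Y := by
    obtain ⟨X⟩ := X
    obtain ⟨Y⟩ := Y
    change (DGModule.coh A).map (0 : X ⟶ Y) = 0
    ext x
    obtain ⟨x, rfl⟩ := Submodule.Quotient.mk_surjective _ x
    rfl

instance : (coh A).IsHomological := Functor.IsHomological.mk' _ fun T hT => by
  obtain ⟨M, N, f, ⟨e⟩⟩ := hT
  refine ⟨_, e, ?_⟩
  rw [ShortComplex.moduleCat_exact_iff]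
  intro y hy
  obtain ⟨⟨y, hy'⟩, rfl⟩ := Submodule.Quotient.mk_surjective _ y
  obtain ⟨⟨m, n⟩, hmn⟩ := (Submodule.Quotient.mk_eq_zero _).1 hy
  have h₁ : -M.d m = 0 := congrArg Prod.fst hmn
  have h₂ : lin f m + N.d n = y := congrArg Prod.snd hmn
  refine ⟨Submodule.Quotient.mk ⟨m, neg_eq_zero.1 h₁⟩, ?_⟩
  refine (Submodule.Quotient.eq _).2 ⟨-n, ?_⟩
  have key : ∀ y : N.carrier, lin f m + N.d n = y → N.d (-n) = lin f m - y := by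
    rintro _ rfl
    simp
  exact key y h₂

/-- The class of quasi-isomorphisms in the homotopy category: the morphisms whose cone is
acyclic, i.e. has vanishing cohomology. -/
abbrev qis : MorphismProperty (HoCat A) := (coh A).homologicalKernel.trW

end HoCat

/-- The derived category of right dg modules over `A`: the localization of the homotopy category
at the quasi-isomorphisms. -/
abbrev DerCat (A : DGAlgebra) := (HoCat.qis A).Localization

namespace DerCat

variable (A : DGAlgebra)

/-- The localization functor from dg modules to the derived category. -/
abbrev Q : DGModule A ⥤ DerCat A := HoCat.q A ⋙ (HoCat.qis A).Q


lemma coh_inverts : (HoCat.qis A).IsInvertedBy (HoCat.coh A) := by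
  intro X Y f hf
  let _ := Functor.ShiftSequence.tautological (HoCat.coh A) ℤ
  have := (Functor.mem_homologicalKernel_trW_iff (HoCat.coh A) f).1 hf 0
  exact (NatIso.isIso_map_iff ((HoCat.coh A).isoShiftZero ℤ) f).1 this

/-- Total cohomology as a functor on the derived category. -/
def coh : DerCat A ⥤ ModuleCat ℂ :=
  Localization.lift (HoCat.coh A) (coh_inverts A) (HoCat.qis A).Q

instance : (coh A).IsHomological :=
  have := Localization.essSurj_mapArrow (HoCat.qis A).Q (HoCat.qis A)
  Functor.isHomological_of_localization (HoCat.qis A).Q _ _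
    (Localization.fac (HoCat.coh A) (coh_inverts A) (HoCat.qis A).Q)

/-- The objects with finite-dimensional total cohomology. (The cohomology of `X⟦n⟧` is that of `X`
up to a regrading.) -/
def fd : ObjectProperty (DerCat A) := fun X => ∀ n : ℤ, Module.Finite ℂ ((coh A).obj (X⟦n⟧))

lemma finite_of_iso {V W : ModuleCat ℂ} (e : V ≅ W) [Module.Finite ℂ V] : Module.Finite ℂ W :=
  Module.Finite.equiv e.toLinearEquiv

lemma finite_of_exact (S : ShortComplex (ModuleCat ℂ)) (hS : S.Exact)
    (h₁ : Module.Finite ℂ S.X₁) (h₃ : Module.Finite ℂ S.X₃) : Module.Finite ℂ S.X₂ := by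
  rw [ShortComplex.moduleCat_exact_iff_range_eq_ker] at hS
  have e₁ : (LinearMap.ker S.g.hom).FG := by
    rw [← hS, LinearMap.range_eq_map]
    exact Module.Finite.fg_top.map _
  exact ⟨Submodule.fg_of_fg_map_of_fg_inf_ker S.g.hom (IsNoetherian.noetherian _)
    (by rwa [top_inf_eq])⟩

instance : (fd A).IsClosedUnderIsomorphisms where
  of_iso e hX n :=
    have : Module.Finite ℂ ((shiftFunctor (DerCat A) n ⋙ coh A).obj _) := hX n
    finite_of_iso ((shiftFunctor (DerCat A) n ⋙ coh A).mapIso e)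

instance : (fd A).IsTriangulated where
  exists_zero := ⟨_, isZero_zero (DerCat A), fun n => by
    have h := (shiftFunctor (DerCat A) n ⋙ coh A).map_isZero (isZero_zero (DerCat A))
    have := ModuleCat.subsingleton_of_isZero h
    exact Module.Finite.of_finite (R := ℂ)
      (M := (shiftFunctor (DerCat A) n ⋙ coh A).obj _)⟩
  toIsStableUnderShift := ⟨fun a => ⟨fun X hX b => by
    have : Module.Finite ℂ ((coh A).obj (X⟦a + b⟧)) := hX (a + b)
    exact finite_of_iso ((coh A).mapIso ((shiftFunctorAdd (DerCat A) a b).app X))⟩⟩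
  toIsTriangulatedClosed₂ := ObjectProperty.IsTriangulatedClosed₂.mk' fun T hT h₁ h₃ n => by
    exact finite_of_exact _ ((coh A).map_distinguished_exact _
      (Triangle.shift_distinguished T hT n)) (h₁ n) (h₃ n)

end DerCat

/-- The full subcategory of the derived category on the objects with finite-dimensional total
cohomology. -/
abbrev Dfd (A : DGAlgebra) := (DerCat.fd A).FullSubcategory

instance (A : DGAlgebra) (n : ℤ) : (shiftFunctor (Dfd A) n).Linear ℂ where
  map_smul {X Y} f c := by
    have h : (shiftFunctor (Dfd A) n ⋙ (DerCat.fd A).ι).Linear ℂ :=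
      Functor.linear_of_iso ℂ ((DerCat.fd A).ι.commShiftIso n).symm
    exact (DerCat.fd A).ι.map_injective
      (Functor.Linear.map_smul (F := shiftFunctor (Dfd A) n ⋙ (DerCat.fd A).ι) f c)


namespace Ginzburg

/-- The generators of the Ginzburg dg algebra of the quiver `a : 0 ⟶ 1` of type `A₂`: the
idempotents `e 0, e 1` of the two vertices, the arrow `a : 0 ⟶ 1`, the opposite arrow
`b = a* : 1 ⟶ 0` and the loops `t i : i ⟶ i`. -/
inductive Gen
  | e (i : Fin 2)
  | a
  | b
  | t (i : Fin 2)

namespace Gen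

/-- The source of a generator. -/
def src : Gen → Fin 2
  | e i => i
  | a => 0
  | b => 1
  | t i => i

/-- The target of a generator. -/
def tgt : Gen → Fin 2
  | e i => i
  | a => 1
  | b => 0
  | t i => i

/-- The degree of a generator. -/
def deg : Gen → ℤ
  | e _ => 0
  | a => 0
  | b => -1
  | t _ => -2

end Gen

open Gen

/-- The relations of the path algebra (paths are composed from left to right). The orthogonality of
the two idempotents is a consequence. -/
inductive Rel : FreeAlgebra ℂ Gen → FreeAlgebra ℂ Gen → Prop
  | one : Rel (FreeAlgebra.ι ℂ (e 0) + FreeAlgebra.ι ℂ (e 1)) 1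
  | src (x : Gen) : Rel (FreeAlgebra.ι ℂ (e x.src) * FreeAlgebra.ι ℂ x) (FreeAlgebra.ι ℂ x)
  | tgt (x : Gen) : Rel (FreeAlgebra.ι ℂ x * FreeAlgebra.ι ℂ (e x.tgt)) (FreeAlgebra.ι ℂ x)

/-- The path algebra of the graded quiver with arrows `a, b, t 0, t 1`. -/
def Alg : Type := RingQuot Rel

instance : Ring Alg := inferInstanceAs (Ring (RingQuot Rel))

instance : Algebra ℂ Alg := inferInstanceAs (Algebra ℂ (RingQuot Rel))

/-- The quotient map. -/
def mk : FreeAlgebra ℂ Gen →ₐ[ℂ] Alg := RingQuot.mkAlgHom ℂ Rel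

lemma mk_surjective : Function.Surjective mk := RingQuot.mkAlgHom_surjective ℂ Rel

lemma mk_rel {x y : FreeAlgebra ℂ Gen} (h : Rel x y) : mk x = mk y := RingQuot.mkAlgHom_rel ℂ h

/-- The class of a generator. -/
def g (x : Gen) : Alg := mk (FreeAlgebra.ι ℂ x)

lemma g_one : g (e 0) + g (e 1) = 1 := by
  simpa [g] using mk_rel Rel.one

lemma g_src (x : Gen) : g (e x.src) * g x = g x := by
  simpa [g] using mk_rel (Rel.src x)

lemma g_tgt (x : Gen) : g x * g (e x.tgt) = g x := by
  simpa [g] using mk_rel (Rel.tgt x)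

/-- The universal property of the path algebra. -/
def lift {B : Type} [Semiring B] [Algebra ℂ B] (φ : Gen → B) (h₁ : φ (e 0) + φ (e 1) = 1)
    (h₂ : ∀ x, φ (e x.src) * φ x = φ x) (h₃ : ∀ x, φ x * φ (e x.tgt) = φ x) : Alg →ₐ[ℂ] B :=
  RingQuot.liftAlgHom ℂ ⟨FreeAlgebra.lift ℂ φ, by
    rintro _ _ (_ | x | x)
    · simpa using h₁
    · simpa using h₂ x
    · simpa using h₃ x⟩

@[simp] lemma lift_g {B : Type} [Semiring B] [Algebra ℂ B] (φ : Gen → B) (h₁ : φ (e 0) + φ (e 1) = 1)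
    (h₂ : ∀ x, φ (e x.src) * φ x = φ x) (h₃ : ∀ x, φ x * φ (e x.tgt) = φ x) (x : Gen) :
    lift φ h₁ h₂ h₃ (g x) = φ x :=
  (RingQuot.liftAlgHom_mkAlgHom_apply ..).trans (FreeAlgebra.lift_ι_apply _ _)

lemma alg_induction {P : Alg → Prop} (h₀ : ∀ c, P (algebraMap ℂ Alg c)) (h₁ : ∀ x, P (g x))
    (h₂ : ∀ x y, P x → P y → P (x * y)) (h₃ : ∀ x y, P x → P y → P (x + y)) (x : Alg) : P x := by
  obtain ⟨x, rfl⟩ := mk_surjective x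
  induction x using FreeAlgebra.induction with
  | grade0 c => simpa using h₀ c
  | grade1 x => exact h₁ x
  | mul x y hx hy => simpa using h₂ _ _ hx hy
  | add x y hx hy => simpa using h₃ _ _ hx hy

/-- The product of a list of generators. -/
def word (l : List Gen) : Alg := (l.map g).prod

/-- The total degree of a list of generators. -/
def wdeg (l : List Gen) : ℤ := (l.map deg).sum

/-- The grading: the degree `n` part is spanned by the products of generators of total
degree `n`. -/
def gr (n : ℤ) : Submodule ℂ Alg := Submodule.span ℂ {x | ∃ l, wdeg l = n ∧ word l = x}

lemma word_mem (l : List Gen) : word l ∈ gr (wdeg l) := Submodule.subset_span ⟨l, rfl, rfl⟩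

lemma g_mem (x : Gen) : g x ∈ gr x.deg := Submodule.subset_span ⟨[x], by simp [wdeg], by simp [word]⟩

lemma gr_induction {n : ℤ} {P : Alg → Prop} (h₀ : ∀ l, wdeg l = n → P (word l)) (h₁ : P 0)
    (h₂ : ∀ x y, P x → P y → P (x + y)) (h₃ : ∀ (c : ℂ) x, P x → P (c • x)) {x : Alg}
    (hx : x ∈ gr n) : P x := by
  induction hx using Submodule.span_induction with
  | mem x hx => obtain ⟨l, hl, rfl⟩ := hx; exact h₀ l hl
  | zero => exact h₁
  | add x y _ _ hx hy => exact h₂ x y hx hy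
  | smul c x _ hx => exact h₃ c x hx

instance : SetLike.GradedMonoid gr where
  one_mem := Submodule.subset_span ⟨[], rfl, rfl⟩
  mul_mem m n x y hx hy := by
    refine gr_induction (P := fun x => x * y ∈ gr (m + n)) (fun l hl => ?_) (by simp)
      (fun _ _ h h' => by simpa [add_mul] using add_mem h h')
      (fun c _ h => by simpa using Submodule.smul_mem _ c h) hx
    refine gr_induction (P := fun y => word l * y ∈ gr (m + n)) (fun k hk => ?_) (by simp)
      (fun _ _ h h' => by simpa [mul_add] using add_mem h h')
      (fun c _ h => by simpa using Submodule.smul_mem _ c h) hy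
    exact Submodule.subset_span ⟨l ++ k, by simp [wdeg, ← hl, ← hk], by simp [word]⟩

lemma of_eq {m n : ℤ} (h : m = n) {x y : Alg} (hx : x ∈ gr m) (hy : y ∈ gr n) (hxy : x = y) :
    DirectSum.of (fun n => gr n) m ⟨x, hx⟩ = DirectSum.of (fun n => gr n) n ⟨y, hy⟩ := by
  subst h hxy
  rfl

/-- The algebra morphism which decomposes an element into its homogeneous components. -/
def decompose : Alg →ₐ[ℂ] DirectSum ℤ fun n => gr n :=
  lift (fun x => DirectSum.of (fun n => gr n) x.deg ⟨g x, g_mem x⟩)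
    (by
      rw [DirectSum.one_def]
      exact ((DirectSum.of (fun n => gr n) 0).map_add ⟨g (e 0), g_mem (e 0)⟩
        ⟨g (e 1), g_mem (e 1)⟩).symm.trans (of_eq rfl _ _ g_one))
    (fun x => by
      rw [DirectSum.of_mul_of]
      exact of_eq (zero_add _) _ _ (g_src x))
    (fun x => by
      rw [DirectSum.of_mul_of]
      exact of_eq (add_zero _) _ _ (g_tgt x))

lemma decompose_word (l : List Gen) :
    decompose (word l) = DirectSum.of (fun n => gr n) (wdeg l) ⟨word l, word_mem l⟩ := by
  induction l with
  | nil =>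
    change decompose 1 = _
    rw [map_one, DirectSum.one_def]
    exact of_eq rfl _ _ rfl
  | cons x l ih =>
    have h : word (x :: l) = g x * word l := by simp [word]
    refine (congrArg decompose h).trans ?_
    rw [map_mul, ih, decompose, lift_g, DirectSum.of_mul_of]
    exact of_eq (by simp [wdeg]) _ _ h.symm

lemma decompose_of_mem {n : ℤ} {x : Alg} (hx : x ∈ gr n) :
    decompose x = DirectSum.lof ℂ ℤ (fun n => gr n) n ⟨x, hx⟩ := by
  have := gr_induction (n := n) (P := fun x => ∃ hx : x ∈ gr n,
    decompose x = DirectSum.lof ℂ ℤ (fun n => gr n) n ⟨x, hx⟩) ?_ ⟨zero_mem _, ?_⟩ ?_ ?_ hx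
  · exact this.2
  · rintro l rfl
    exact ⟨word_mem l, decompose_word l⟩
  · rw [map_zero]
    exact (map_zero _).symm
  · rintro x y ⟨hx, h⟩ ⟨hy, h'⟩
    refine ⟨add_mem hx hy, ?_⟩
    rw [map_add, h, h', ← map_add]
    rfl
  · rintro c x ⟨hx, h⟩
    refine ⟨Submodule.smul_mem _ c hx, ?_⟩
    rw [map_smul, h, ← map_smul]
    rfl

instance : GradedAlgebra gr := GradedAlgebra.ofAlgHom gr decompose
  (by
    refine AlgHom.ext fun x => ?_
    refine alg_induction (P := fun x => (DirectSum.coeAlgHom gr).comp decompose x = x)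
      (fun c => by simp) (fun x => ?_) (fun x y hx hy => by rw [map_mul, hx, hy])
      (fun x y hx hy => by rw [map_add, hx, hy]) x
    simp [decompose])
  (fun n x => decompose_of_mem x.2)

/-- The differential on generators: `d (t 0) = a b` and `d (t 1) = - b a`, the other generators
being closed. -/
def dGen : Gen → Alg
  | e _ => 0
  | a => 0
  | b => 0
  | t i => if i = 0 then g a * g b else -(g b * g a)

lemma dGen_mem (x : Gen) : dGen x ∈ gr (x.deg + 1) := by
  match x with
  | e _ => exact zero_mem _
  | a => exact zero_mem _
  | b => exact zero_mem _
  | t i =>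
    have h₁ := SetLike.mul_mem_graded (g_mem a) (g_mem b)
    have h₂ := SetLike.mul_mem_graded (g_mem b) (g_mem a)
    change (if i = 0 then g a * g b else -(g b * g a)) ∈ gr (-1)
    split_ifs
    · exact h₁
    · exact neg_mem h₂

lemma dGen_src (x : Gen) : g (e x.src) * dGen x = dGen x := by
  match x with
  | e _ => exact mul_zero _
  | a => exact mul_zero _
  | b => exact mul_zero _
  | t i =>
    have h₁ : g (e 0) * g a = g a := g_src a
    have h₂ : g (e 1) * g b = g b := g_src b
    fin_cases i
    · simp [dGen, Gen.src, ← mul_assoc, h₁]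
    · change g (e 1) * -(g b * g a) = -(g b * g a)
      rw [mul_neg, ← mul_assoc, h₂]

lemma dGen_tgt (x : Gen) : dGen x * g (e x.tgt) = dGen x := by
  match x with
  | e _ => exact zero_mul _
  | a => exact zero_mul _
  | b => exact zero_mul _
  | t i =>
    have h₁ : g b * g (e 0) = g b := g_tgt b
    have h₂ : g a * g (e 1) = g a := g_tgt a
    fin_cases i
    · simp [dGen, Gen.tgt, mul_assoc, h₁]
    · change -(g b * g a) * g (e 1) = -(g b * g a)
      rw [neg_mul, mul_assoc, h₂]

/-- The algebra morphism `x ↦ ((-1)^|x| x, d x; 0, x)`, which encodes the differential. -/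
def mat : Alg →ₐ[ℂ] Matrix (Fin 2) (Fin 2) Alg :=
  lift (fun x => !![(-1 : ℂ) ^ x.deg • g x, dGen x; 0, g x])
    (by
      simp [Gen.deg, dGen, g_one, Matrix.one_fin_two])
    (fun x => by
      have h : (e x.src).deg = 0 := rfl
      have h' : dGen (e x.src) = 0 := rfl
      rw [h, h']
      simp [g_src, dGen_src])
    (fun x => by
      have h : (e x.tgt).deg = 0 := rfl
      have h' : dGen (e x.tgt) = 0 := rfl
      rw [h, h']
      simp [g_tgt, dGen_tgt])

/-- The differential of the Ginzburg dg algebra: the derivation of degree `1` extending `dGen`. -/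
def d : Alg →ₗ[ℂ] Alg where
  toFun x := mat x 0 1
  map_add' x y := by simp
  map_smul' c x := by simp

lemma mat_lower (x : Alg) : mat x 1 0 = 0 ∧ mat x 1 1 = x := by
  refine alg_induction (P := fun x => mat x 1 0 = 0 ∧ mat x 1 1 = x) (fun c => ?_) (fun x => ?_)
    (fun x y hx hy => ?_) (fun x y hx hy => ?_) x
  · simp [AlgHom.commutes, Matrix.algebraMap_matrix_apply]
  · simp [mat]
  · simp [Matrix.mul_apply, Fin.sum_univ_two, hx.1, hx.2, hy.1, hy.2]
  · simp [hx.1, hx.2, hy.1, hy.2]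

lemma mat_mul_upper (x y : Alg) : mat (x * y) 0 0 = mat x 0 0 * mat y 0 0 := by
  simp [Matrix.mul_apply, Fin.sum_univ_two, (mat_lower y).1]

lemma d_mul (x y : Alg) : d (x * y) = mat x 0 0 * d y + d x * y := by
  change mat (x * y) 0 1 = mat x 0 0 * mat y 0 1 + mat x 0 1 * y
  simp [Matrix.mul_apply, Fin.sum_univ_two, (mat_lower y).2]

lemma mat_upper {n : ℤ} {x : Alg} (hx : x ∈ gr n) : mat x 0 0 = (-1 : ℂ) ^ n • x := by
  refine gr_induction (P := fun x => mat x 0 0 = (-1 : ℂ) ^ n • x) ?_ (by simp)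
    (fun x y h h' => by simp [h, h']) (fun c x h => by simp [h, smul_comm c]) hx
  clear hx
  rintro l rfl
  induction l with
  | nil =>
    change mat 1 0 0 = (-1 : ℂ) ^ (0 : ℤ) • 1
    simp
  | cons x l ih =>
    have h : word (x :: l) = g x * word l := by simp [word]
    have h' : wdeg (x :: l) = x.deg + wdeg l := by simp [wdeg]
    rw [h, h', mat_mul_upper, ih, DGModule.sign_add]
    simp [mat, smul_smul, mul_comm]

lemma leibniz {n : ℤ} {x : Alg} (y : Alg) (hx : x ∈ gr n) :
    d (x * y) = d x * y + (-1 : ℂ) ^ n • (x * d y) := by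
  rw [d_mul, mat_upper hx, add_comm, smul_mul_assoc]

lemma d_g (x : Gen) : d (g x) = dGen x := by
  change mat (g x) 0 1 = _
  simp [mat]

lemma d_one : d 1 = 0 := by
  change mat 1 0 1 = 0
  simp

lemma d_word (l : List Gen) : d (word l) ∈ gr (wdeg l + 1) := by
  induction l with
  | nil =>
    change d 1 ∈ _
    rw [d_one]
    exact zero_mem _
  | cons x l ih =>
    have h : word (x :: l) = g x * word l := by simp [word]
    have h' : wdeg (x :: l) = x.deg + wdeg l := by simp [wdeg]
    rw [h, h', leibniz _ (g_mem x), d_g]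
    have e₁ := SetLike.mul_mem_graded (dGen_mem x) (word_mem l)
    have e₂ := SetLike.mul_mem_graded (g_mem x) ih
    rw [add_right_comm] at e₁
    rw [← add_assoc] at e₂
    exact add_mem e₁ (Submodule.smul_mem _ _ e₂)

lemma d_mem {n : ℤ} {x : Alg} (hx : x ∈ gr n) : d x ∈ gr (n + 1) := by
  refine gr_induction (P := fun x => d x ∈ gr (n + 1)) ?_ (by simp)
    (fun x y h h' => by simpa using add_mem h h')
    (fun c x h => by simpa using Submodule.smul_mem _ c h) hx
  rintro l rfl
  exact d_word l

lemma d_dGen (x : Gen) : d (dGen x) = 0 := by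
  match x with
  | e _ => exact map_zero d
  | a => exact map_zero d
  | b => exact map_zero d
  | t i =>
    have h₁ : d (g a) = 0 := d_g a
    have h₂ : d (g b) = 0 := d_g b
    fin_cases i <;> simp [dGen, d_mul, h₁, h₂]

lemma d_d (x : Alg) : d (d x) = 0 := by
  have h : ∀ x (y : Alg), d (d (g x)) = 0 ∧ (d (d y) = 0 → d (d (g x * y)) = 0) := by
    intro x y
    have h : d (d (g x)) = 0 := by rw [d_g, d_dGen]
    refine ⟨h, fun hy => ?_⟩
    rw [leibniz _ (g_mem x), map_add, leibniz _ (d_mem (g_mem x)), map_smul,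
      leibniz _ (g_mem x), hy, h, DGModule.sign_succ]
    simp only [zero_mul, mul_zero, smul_zero, add_zero, zero_add]
    rw [← add_smul, neg_add_cancel, zero_smul]
  have key : ∀ x : Alg, ∀ y, d (d y) = 0 → d (d (x * y)) = 0 := by
    refine alg_induction (fun c y hy => ?_) (fun x y hy => (h x y).2 hy)
      (fun x₁ x₂ h₁ h₂ y hy => ?_) (fun x₁ x₂ h₁ h₂ y hy => ?_)
    · rw [← Algebra.smul_def, map_smul, map_smul, hy, smul_zero]
    · rw [mul_assoc]
      exact h₁ _ (h₂ _ hy)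
    · rw [add_mul, map_add, map_add, h₁ y hy, h₂ y hy, add_zero]
  have := key x 1 (by rw [d_one, map_zero])
  rwa [mul_one] at this

end Ginzburg

/-- The Ginzburg dg algebra of the `A₂` quiver. -/
def ginzburgA₂ : DGAlgebra where
  carrier := Ginzburg.Alg
  gr := Ginzburg.gr
  isInternal := DirectSum.Decomposition.isInternal _
  one_mem := SetLike.one_mem_graded _
  mul_mem hx hy := SetLike.mul_mem_graded hx hy
  d := Ginzburg.d
  d_mem := Ginzburg.d_mem
  d_d := Ginzburg.d_d
  leibniz := Ginzburg.leibniz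

section Triangulated

variable {C : Type*} [Category* C] [Preadditive C] [HasZeroObject C] [HasShift C ℤ]
  [∀ n : ℤ, (shiftFunctor C n).Additive] [Pretriangulated C]

/-- The objects `S^{⊕n}`, for `n : ℕ`. -/
def directSums (S : C) : ObjectProperty C := fun X =>
  ∃ (n : ℕ) (i : Fin n → (S ⟶ X)), Nonempty (IsColimit (Cofan.mk X i))

/-- The left tilt of a heart at a torsion pair `(𝒯, ℱ)`: the extensions of an object of `𝒯⟦-1⟧` by
an object of `ℱ`. -/
def leftTilt (𝒯 ℱ : ObjectProperty C) : ObjectProperty C := fun Y =>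
  ∃ (F T : C) (f : F ⟶ Y) (g : Y ⟶ T⟦(-1 : ℤ)⟧) (h : T⟦(-1 : ℤ)⟧ ⟶ F⟦(1 : ℤ)⟧),
    ℱ F ∧ 𝒯 T ∧ Triangle.mk f g h ∈ distTriang C

/-- The right tilt of a heart at a torsion pair `(𝒯, ℱ)`: the extensions of an object of `𝒯` by
an object of `ℱ⟦1⟧`. -/
def rightTilt (𝒯 ℱ : ObjectProperty C) : ObjectProperty C := fun Y =>
  ∃ (F T : C) (f : F⟦(1 : ℤ)⟧ ⟶ Y) (g : Y ⟶ T) (h : T ⟶ F⟦(1 : ℤ)⟧⟦(1 : ℤ)⟧),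
    ℱ F ∧ 𝒯 T ∧ Triangle.mk f g h ∈ distTriang C

/-- The left tilt `L_S(𝒜)` of a heart `𝒜` at a simple object `S`. -/
def leftSimpleTilt (𝒜 : ObjectProperty C) (S : C) : ObjectProperty C :=
  leftTilt (directSums S) fun X => 𝒜 X ∧ ∀ f : S ⟶ X, f = 0

/-- The right tilt `R_S(𝒜)` of a heart `𝒜` at a simple object `S`. -/
def rightSimpleTilt (𝒜 : ObjectProperty C) (S : C) : ObjectProperty C :=
  rightTilt (fun X => 𝒜 X ∧ ∀ f : X ⟶ S, f = 0) (directSums S)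

/-- `E` is a nontrivial extension of `B` by `A`: there is a distinguished triangle
`A ⟶ E ⟶ B ⟶ A⟦1⟧` whose last map is nonzero. -/
def IsNontrivialExtension (A B E : C) : Prop :=
  ∃ (f : A ⟶ E) (g : E ⟶ B) (h : B ⟶ A⟦(1 : ℤ)⟧), Triangle.mk f g h ∈ distTriang C ∧ h ≠ 0

/-- `E` is, up to isomorphism, the unique nontrivial extension of `B` by `A`. -/
def IsUniqueNontrivialExtension (A B E : C) : Prop :=
  IsNontrivialExtension A B E ∧ ∀ E', IsNontrivialExtension A B E' → Nonempty (E' ≅ E)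

/-- The objects obtained from `A` and `B` by finitely many extensions. -/
inductive ExtensionClosure (A B : C) : C → Prop
  | left : ExtensionClosure A B A
  | right : ExtensionClosure A B B
  | zero (X : C) (hX : IsZero X) : ExtensionClosure A B X
  | ext (X Y Z : C) (f : X ⟶ Y) (g : Y ⟶ Z) (h : Z ⟶ X⟦(1 : ℤ)⟧)
      (hT : Triangle.mk f g h ∈ distTriang C) (hX : ExtensionClosure A B X)
      (hZ : ExtensionClosure A B Z) : ExtensionClosure A B Y

/-- `ℋ = (A, B)_E`: `ℋ` is the heart of a bounded t-structure (in particular an abelian category),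
`A` and `B` are its two simple objects, they generate `ℋ` under extensions, and `E` is the unique
nontrivial extension of `B` by `A`. -/
structure IsGeneratedBySimples (ℋ : ObjectProperty C) (A B E : C) : Prop where
  isHeart : ∃ t : Triangulated.TStructure C, t.heart = ℋ ∧ ∀ X, t.bounded X
  left_mem : ℋ A
  right_mem : ℋ B
  simple_left : Simple (⟨A, left_mem⟩ : ℋ.FullSubcategory)
  simple_right : Simple (⟨B, right_mem⟩ : ℋ.FullSubcategory)
  not_iso : IsEmpty (A ≅ B)
  iso_of_simple : ∀ X : ℋ.FullSubcategory, Simple X → Nonempty (X.obj ≅ A) ∨ Nonempty (X.obj ≅ B)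
  generated : ∀ X, ℋ X ↔ ExtensionClosure A B X
  extension : IsUniqueNontrivialExtension A B E

variable [Linear ℂ C]

/-- `ev : W ⟶ Y` is the evaluation map `X ⊗ Hom^•(X, Y) = ⨁ᵢ X⟦i⟧ ⊗ Hom(X⟦i⟧, Y) ⟶ Y`. -/
def IsEvaluation (X Y W : C) (ev : W ⟶ Y) : Prop :=
  ∃ (J : ℤ → Type) (β : ∀ i, Module.Basis (J i) ℂ (X⟦i⟧ ⟶ Y))
    (inj : ∀ p : (Σ i, J i), X⟦p.1⟧ ⟶ W),
    Nonempty (IsColimit (Cofan.mk W inj)) ∧ ∀ p, inj p ≫ ev = β p.1 p.2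

/-- The autoequivalence `Φ` is a twist functor along `X`: it is linear and exact, and there are
distinguished triangles `X ⊗ Hom^•(X, Y) ⟶ Y ⟶ Φ Y ⟶`, where the first map is the evaluation and
the second one is natural in `Y`. -/
structure IsTwist (X : C) (Φ : C ≌ C) : Prop where
  linear : Φ.functor.Linear ℂ
  exact : ∃ _ : Φ.functor.CommShift ℤ, Φ.functor.IsTriangulated
  cone : ∃ η : 𝟭 C ⟶ Φ.functor, ∀ Y, ∃ (W : C) (ev : W ⟶ Y) (δ : Φ.functor.obj Y ⟶ W⟦(1 : ℤ)⟧),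
    IsEvaluation X Y W ev ∧ Triangle.mk ev (η.app Y) δ ∈ distTriang C

end Triangulated

namespace DerCat

variable {A : DGAlgebra}

/-- The comparison of the cohomology functors on dg modules and on the derived category. -/
def cohIso (A : DGAlgebra) : Q A ⋙ coh A ≅ DGModule.coh A :=
  Functor.associator _ _ _ ≪≫ Functor.isoWhiskerLeft (HoCat.q A)
    (Localization.fac (HoCat.coh A) (coh_inverts A) (HoCat.qis A).Q) ≪≫
    CategoryTheory.Quotient.lift.isLift _ _ _

lemma fd_of_finite (M : DGModule A) (hM : Module.Finite ℂ M.carrier) : fd A ((Q A).obj M) := by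
  intro n
  have h : Module.Finite ℂ (DGModule.Coh (M⟦n⟧)) := by
    have : Module.Finite ℂ (M⟦n⟧).carrier := hM
    infer_instance
  have h' : Module.Finite ℂ ((DGModule.coh A).obj (M⟦n⟧)) := h
  exact finite_of_iso ((cohIso A).symm.app (M⟦n⟧) ≪≫
    (coh A).mapIso (((Q A).commShiftIso n).app M))

end DerCat

namespace DGModule

/-- The grading on `ℂ` concentrated in degree `0`. -/
def degZero (n : ℤ) : Submodule ℂ ℂ := if n = 0 then ⊤ else ⊥

lemma eq_zero_of_mem_degZero {n : ℤ} (hn : n ≠ 0) {x : ℂ} (hx : x ∈ degZero n) : x = 0 := by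
  rwa [degZero, if_neg hn, Submodule.mem_bot] at hx

lemma degZero_isInternal : DirectSum.IsInternal degZero := by
  refine (DirectSum.isInternal_submodule_iff_iSupIndep_and_iSup_eq_top _).2 ⟨fun i => ?_, ?_⟩
  · by_cases hi : i = 0
    · have : (⨆ j, ⨆ (_ : j ≠ i), degZero j) = ⊥ := by
        simp only [iSup_eq_bot]
        intro j hj
        exact if_neg (hi ▸ hj)
      rw [this]
      exact disjoint_bot_right
    · rw [degZero, if_neg hi]
      exact disjoint_bot_left
  · exact top_le_iff.1 (le_iSup_of_le 0 (if_pos rfl).ge)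

/-- The right dg module `ℂ`, in degree `0`, on which `A` acts through an algebra morphism `χ : A ⟶ ℂ`
which vanishes on the elements of nonzero degree and on the boundaries. -/
def ofCharacter {A : DGAlgebra} (χ : A.carrier →ₐ[ℂ] ℂ)
    (h₁ : ∀ {n : ℤ}, n ≠ 0 → ∀ {x}, x ∈ A.gr n → χ x = 0) (h₂ : ∀ x, χ (A.d x) = 0) : DGModule A :=
  let act : Module A.carrierᵐᵒᵖ ℂ := Module.compHom ℂ
    (χ.toRingHom.fromOpposite fun _ _ => Commute.all _ _)
  { carrier := ℂ
    rightModule := act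
    isScalarTower := ⟨fun c x y => by
      change χ (c • x.unop) * y = c * (χ x.unop * y)
      rw [map_smul, smul_eq_mul, mul_assoc]⟩
    gr := degZero
    isInternal := degZero_isInternal
    smul_mem := fun {m n x y} hx hy => by
      change χ y * x ∈ degZero (m + n)
      by_cases hm : m = 0
      · by_cases hn : n = 0
        · rw [degZero, if_pos (by rw [hm, hn, add_zero])]
          trivial
        · rw [h₁ hn hy, zero_mul]
          exact zero_mem _
      · rw [eq_zero_of_mem_degZero hm hx, mul_zero]
        exact zero_mem _
    d := 0
    d_mem := fun _ => zero_mem _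
    d_d := fun _ => rfl
    leibniz := fun {n x} y _ => by
      change (0 : ℂ) = χ y * 0 + (-1 : ℂ) ^ n • (χ (A.d y) * x)
      rw [h₂]
      simp }

end DGModule

namespace Ginzburg

open Gen

/-- The character of the path algebra at the vertex `i`: it is `1` on `e i` and `0` on the other
generators. -/
def char (i : Fin 2) : Alg →ₐ[ℂ] ℂ :=
  lift (fun x => match x with
      | e j => if j = i then 1 else 0
      | _ => 0)
    (by fin_cases i <;> simp)
    (fun x => by cases x <;> simp [Gen.src]; grind)
    (fun x => by cases x <;> simp [Gen.tgt]; grind)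

lemma char_g {i : Fin 2} {x : Gen} (h : x.deg ≠ 0) : char i (g x) = 0 := by
  rw [char, lift_g]
  cases x <;> simp_all [Gen.deg]

lemma char_word {i : Fin 2} (l : List Gen) (h : wdeg l ≠ 0) : char i (word l) = 0 := by
  induction l with
  | nil => simp [wdeg] at h
  | cons x l ih =>
    have e₁ : word (x :: l) = g x * word l := by simp [word]
    have e₂ : wdeg (x :: l) = x.deg + wdeg l := by simp [wdeg]
    rw [e₁, map_mul]
    by_cases hx : x.deg = 0
    · rw [ih (by simpa [e₂, hx] using h), mul_zero]
    · rw [char_g hx, zero_mul]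

lemma char_gr {i : Fin 2} {n : ℤ} (hn : n ≠ 0) {x : Alg} (hx : x ∈ gr n) : char i x = 0 :=
  gr_induction (P := fun x => char i x = 0) (fun l hl => char_word l (hl ▸ hn)) (map_zero _)
    (fun x y h h' => by rw [map_add, h, h', add_zero])
    (fun c x h => by rw [map_smul, h, smul_zero]) hx

lemma char_dGen {i : Fin 2} (x : Gen) : char i (dGen x) = 0 := by
  have h : char i (g a) = 0 := by rw [char, lift_g]
  have h' : dGen x = 0 ∨ dGen x = g a * g b ∨ dGen x = -(g b * g a) := by
    cases x with
    | t j =>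
      by_cases hj : j = 0
      · exact Or.inr (Or.inl (if_pos hj))
      · exact Or.inr (Or.inr (if_neg hj))
    | _ => exact Or.inl rfl
  obtain h' | h' | h' := h' <;> rw [h'] <;> simp [h]

lemma char_d {i : Fin 2} (x : Alg) : char i (d x) = 0 := by
  have key : ∀ x : Alg, ∀ y, char i (d y) = 0 → char i (d (x * y)) = 0 := by
    refine alg_induction (fun c y hy => ?_) (fun x y hy => ?_)
      (fun x₁ x₂ h₁ h₂ y hy => ?_) (fun x₁ x₂ h₁ h₂ y hy => ?_)
    · rw [← Algebra.smul_def, map_smul, map_smul, hy, smul_zero]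
    · rw [leibniz _ (g_mem x), map_add, map_smul, map_mul, map_mul, hy, d_g, char_dGen]
      simp
    · rw [mul_assoc]
      exact h₁ _ (h₂ _ hy)
    · rw [add_mul, map_add, map_add, h₁ y hy, h₂ y hy, add_zero]
  have := key x 1 (by rw [d_one, map_zero])
  rwa [mul_one] at this

/-- The simple right dg module at the vertex `i`: one-dimensional and in degree `0`. -/
def simpleModule (i : Fin 2) : DGModule ginzburgA₂ :=
  DGModule.ofCharacter (A := ginzburgA₂) (char i) char_gr char_d

/-- The derived category `𝒟` of dg modules with finite-dimensional total cohomology over the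
Ginzburg dg algebra of the `A₂` quiver. -/
abbrev D := Dfd ginzburgA₂

/-- The simple module at the source of the arrow. -/
def S : D :=
  ⟨(DerCat.Q ginzburgA₂).obj (simpleModule 0),
    DerCat.fd_of_finite _ (inferInstanceAs (Module.Finite ℂ ℂ))⟩

/-- The simple module at the target of the arrow. -/
def T : D :=
  ⟨(DerCat.Q ginzburgA₂).obj (simpleModule 1),
    DerCat.fd_of_finite _ (inferInstanceAs (Module.Finite ℂ ℂ))⟩

/-- The standard heart `𝒜⁰`: the dg modules whose cohomology is concentrated in degree zero. -/
def standardHeart : ObjectProperty D := fun X =>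
  ∃ M : DGModule ginzburgA₂,
    (∀ n ≠ 0, ∀ x ∈ M.gr n, M.d x = 0 → ∃ y, M.d y = x) ∧
    Nonempty (X.obj ≅ (DerCat.Q ginzburgA₂).obj M)

end Ginzburg

end

noncomputable section

namespace DGModule

variable {A : DGAlgebra}

/-- A dg module is acyclic if every cocycle is a coboundary. -/
def Acyclic (M : DGModule A) : Prop := ∀ x, M.d x = 0 → ∃ y, M.d y = x

lemma acyclic_iff_subsingleton (M : DGModule A) : M.Acyclic ↔ Subsingleton (Coh M) := by
  rw [Submodule.Quotient.subsingleton_iff, eq_top_iff]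
  constructor
  · rintro h ⟨x, hx⟩ -
    exact h x hx
  · intro h x hx
    exact h (x := ⟨x, hx⟩) trivial

lemma acyclic_shift {M : DGModule A} (hM : M.Acyclic) (k : ℤ) : (M.shift k).Acyclic := by
  intro x hx
  have hx' : M.d x = 0 := by
    have h : (-1 : ℂ) ^ k • M.d x = 0 := hx
    rw [← sign_smul_smul k (M.d x), h, smul_zero]
  obtain ⟨y, hy⟩ := hM x hx'
  refine ⟨((-1 : ℂ) ^ k • y : M.carrier), ?_⟩
  change (-1 : ℂ) ^ k • M.d ((-1 : ℂ) ^ k • y) = x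
  rw [map_smul, sign_smul_smul, hy]

lemma isZero_coh_iff (M : DGModule A) : IsZero ((coh A).obj M) ↔ M.Acyclic := by
  rw [acyclic_iff_subsingleton]
  exact ModuleCat.isZero_iff_subsingleton

lemma homologicalKernel_iff (M : DGModule A) :
    (HoCat.coh A).homologicalKernel ((HoCat.q A).obj M) ↔ M.Acyclic := by
  have e (n : ℤ) : (HoCat.coh A).obj (((HoCat.q A).obj M)⟦n⟧) ≅ (coh A).obj (M⟦n⟧) :=
    (HoCat.coh A).mapIso (((HoCat.q A).commShiftIso n).symm.app M)
  constructor
  · intro h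
    refine (isZero_coh_iff M).1 ?_
    have h0 := (e 0).isZero_iff.1 (h 0)
    exact h0.of_iso ((coh A).mapIso (shiftZeroIso M).symm)
  · intro h n
    exact (e n).isZero_iff.2 ((isZero_coh_iff _).2 (acyclic_shift h n))

/-- A morphism of dg modules which induces an isomorphism on cohomology. -/
structure QuasiIso {M N : DGModule A} (f : M ⟶ N) : Prop where
  inj : ∀ x y, M.d x = 0 → lin f x = N.d y → ∃ z, M.d z = x
  surj : ∀ y, N.d y = 0 → ∃ x z, M.d x = 0 ∧ y = lin f x + N.d z

lemma QuasiIso.acyclic_cone {M N : DGModule A} {f : M ⟶ N} (hf : QuasiIso f) :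
    (cone f).Acyclic := by
  rintro ⟨x, y⟩ h
  have h₁ : M.d x = 0 := neg_eq_zero.1 (congrArg Prod.fst h)
  have h₂ : lin f x + N.d y = 0 := congrArg Prod.snd h
  obtain ⟨z, hz⟩ := hf.inj x (-y) h₁ (by rw [map_neg]; exact eq_neg_of_add_eq_zero_left h₂)
  obtain ⟨x', w, hx', hw⟩ := hf.surj (y + lin f z) (by rw [map_add, ← lin_d, hz, add_comm, h₂])
  refine ⟨(x' - z, w), ?_⟩
  rw [cone_d]
  refine Prod.ext ?_ ?_
  · simp [hx', hz]
  · simp only [map_sub]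
    rw [sub_add_eq_add_sub, ← hw, add_sub_cancel_right]

lemma quasiIso_of_acyclic_cone {M N : DGModule A} {f : M ⟶ N} (hf : (cone f).Acyclic) :
    QuasiIso f where
  inj x y hx hy := by
    obtain ⟨⟨a, b⟩, h⟩ := hf (x, -y) (by rw [cone_d, hx, hy]; simp; rfl)
    exact ⟨-a, by rw [map_neg]; exact congrArg Prod.fst h⟩
  surj y hy := by
    obtain ⟨⟨a, b⟩, h⟩ := hf (0, y) (by rw [cone_d, hy]; simp; rfl)
    exact ⟨a, b, neg_eq_zero.1 (congrArg Prod.fst h), (congrArg Prod.snd h).symm⟩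

lemma QuasiIso.qis {M N : DGModule A} {f : M ⟶ N} (hf : QuasiIso f) :
    HoCat.qis A ((HoCat.q A).map f) :=
  (ObjectProperty.trW_iff _ _).2 ⟨_, _, _, HoCat.triangleh_dist f,
    (homologicalKernel_iff _).2 hf.acyclic_cone⟩

lemma quasiIso_of_qis {M N : DGModule A} {f : M ⟶ N} (hf : HoCat.qis A ((HoCat.q A).map f)) :
    QuasiIso f := by
  have h := ((HoCat.coh A).homologicalKernel.trW_iff_of_distinguished _
    (HoCat.triangleh_dist f)).1 hf
  exact quasiIso_of_acyclic_cone ((homologicalKernel_iff _).1 h)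

lemma QuasiIso.isIso {M N : DGModule A} {f : M ⟶ N} (hf : QuasiIso f) :
    IsIso ((DerCat.Q A).map f) :=
  Localization.inverts (HoCat.qis A).Q (HoCat.qis A) _ hf.qis

lemma quasiIso_zero {M : DGModule A} (hM : M.Acyclic) : QuasiIso (0 : M ⟶ zero A) where
  inj x _ hx _ := hM x hx
  surj _ _ := ⟨0, 0, map_zero _, rfl⟩

lemma isZero_zero' : IsZero (zero A) := (IsZero.iff_id_eq_zero _).2 (hom_ext fun _ => rfl)

lemma isZero_of_acyclic {M : DGModule A} (hM : M.Acyclic) : IsZero ((DerCat.Q A).obj M) := by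
  have := (quasiIso_zero hM).isIso
  exact ((DerCat.Q A).map_isZero isZero_zero').of_iso (asIso ((DerCat.Q A).map (0 : M ⟶ zero A)))

section Homogeneous

variable {V W : Type*} [AddCommGroup V] [Module ℂ V] [AddCommGroup W] [Module ℂ W]

lemma induction_gr {gr : ℤ → Submodule ℂ V} (h : DirectSum.IsInternal gr) {P : V → Prop}
    (h₁ : ∀ n, ∀ x ∈ gr n, P x) (h₂ : ∀ x y, P x → P y → P (x + y)) (x : V) : P x := by
  have hx : x ∈ ⨆ n, gr n := by
    rw [((DirectSum.isInternal_submodule_iff_iSupIndep_and_iSup_eq_top _).1 h).2]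
    trivial
  exact Submodule.iSup_induction gr (motive := P) hx h₁ (h₁ 0 0 (zero_mem _)) h₂

/-- The projection to the degree `n` part, viewed in the whole space. -/
def proj {gr : ℤ → Submodule ℂ V} (h : DirectSum.IsInternal gr) (n : ℤ) : V →ₗ[ℂ] V :=
  (gr n).subtype ∘ₗ DirectSum.component ℂ ℤ (fun n => gr n) n ∘ₗ
    (LinearEquiv.ofBijective (DirectSum.coeLinearMap gr) h).symm.toLinearMap

lemma symm_of_mem {gr : ℤ → Submodule ℂ V} (h : DirectSum.IsInternal gr) {n : ℤ} {x : V}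
    (hx : x ∈ gr n) : (LinearEquiv.ofBijective (DirectSum.coeLinearMap gr) h).symm x =
      DirectSum.lof ℂ ℤ (fun n => gr n) n ⟨x, hx⟩ := by
  rw [LinearEquiv.symm_apply_eq]
  exact (DirectSum.coeLinearMap_of gr n ⟨x, hx⟩).symm

lemma proj_mem {gr : ℤ → Submodule ℂ V} (h : DirectSum.IsInternal gr) (n : ℤ) (x : V) :
    proj h n x ∈ gr n := Subtype.mem _

lemma proj_of_mem {gr : ℤ → Submodule ℂ V} (h : DirectSum.IsInternal gr) {n : ℤ} {x : V}
    (hx : x ∈ gr n) : proj h n x = x := by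
  simp only [proj, LinearMap.comp_apply, LinearEquiv.coe_coe, symm_of_mem h hx]
  rw [DirectSum.component.lof_self]
  rfl

lemma proj_of_mem_ne {gr : ℤ → Submodule ℂ V} (h : DirectSum.IsInternal gr) {m n : ℤ}
    (hmn : m ≠ n) {x : V} (hx : x ∈ gr m) : proj h n x = 0 := by
  simp only [proj, LinearMap.comp_apply, LinearEquiv.coe_coe, symm_of_mem h hx]
  rw [DirectSum.component.of, dif_neg hmn, map_zero]

/-- The operator `(-1)ⁿ` in degree `n`. -/
def parity {gr : ℤ → Submodule ℂ V} (h : DirectSum.IsInternal gr) : V →ₗ[ℂ] V :=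
  DirectSum.toModule ℂ ℤ V (fun n => (-1 : ℂ) ^ n • (gr n).subtype) ∘ₗ
    (LinearEquiv.ofBijective (DirectSum.coeLinearMap gr) h).symm.toLinearMap

lemma parity_of_mem {gr : ℤ → Submodule ℂ V} (h : DirectSum.IsInternal gr) {n : ℤ} {x : V}
    (hx : x ∈ gr n) : parity h x = (-1 : ℂ) ^ n • x := by
  simp only [parity, LinearMap.comp_apply, LinearEquiv.coe_coe, symm_of_mem h hx]
  rw [DirectSum.toModule_lof]
  rfl

/-- A linear map of degree `k` commutes with projections to homogeneous components. -/
lemma proj_map {gr : ℤ → Submodule ℂ V} (h : DirectSum.IsInternal gr)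
    {gr' : ℤ → Submodule ℂ W} (h' : DirectSum.IsInternal gr') (f : V →ₗ[ℂ] W) (k : ℤ)
    (hf : ∀ n, ∀ x ∈ gr n, f x ∈ gr' (n + k)) (n : ℤ) (x : V) :
    proj h' (n + k) (f x) = f (proj h n x) := by
  refine induction_gr h (P := fun x => proj h' (n + k) (f x) = f (proj h n x)) (fun m x hx => ?_)
    (fun x y hx hy => by rw [map_add, map_add, hx, hy, map_add, map_add]) x
  by_cases hmn : m = n
  · subst hmn
    rw [proj_of_mem h hx, proj_of_mem h' (hf _ x hx)]
  · rw [proj_of_mem_ne h hmn hx, map_zero,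
      proj_of_mem_ne h' (fun e => hmn (add_right_cancel e)) (hf _ x hx)]

lemma linearMap_ext_gr {gr : ℤ → Submodule ℂ V} (h : DirectSum.IsInternal gr) {f g : V →ₗ[ℂ] W}
    (hfg : ∀ n, ∀ x ∈ gr n, f x = g x) : f = g :=
  LinearMap.ext (induction_gr h hfg fun x y hx hy => by rw [map_add, map_add, hx, hy])

end Homogeneous

/-- To check acyclicity it suffices to consider homogeneous cocycles. -/
lemma acyclic_of_homogeneous {M : DGModule A}
    (h : ∀ n, ∀ x ∈ M.gr n, M.d x = 0 → ∃ y, M.d y = x) : M.Acyclic := by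
  classical
  intro x hx
  have hproj n : ∃ y, M.d y = proj M.isInternal n x := by
    refine h n _ (proj_mem _ _ _) ?_
    have := proj_map M.isInternal M.isInternal M.d 1 (fun n x hx => M.d_mem hx) n x
    rw [← this, hx, map_zero]
  suffices H : x ∈ LinearMap.range M.d from H
  let e := LinearEquiv.ofBijective (DirectSum.coeLinearMap M.gr) M.isInternal
  have hx' : x = DirectSum.coeLinearMap M.gr (e.symm x) := (e.apply_symm_apply x).symm
  rw [hx']
  erw [DirectSum.coeLinearMap_eq_dfinsuppSum]
  refine Submodule.sum_mem _ fun n _ => ?_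
  exact hproj n

/-- A homogeneous coboundary is the coboundary of a homogeneous element. -/
lemma exists_homogeneous {M : DGModule A} {n : ℤ} {x : M.carrier} (hx : x ∈ M.gr (n + 1))
    (h : ∃ y, M.d y = x) : ∃ y ∈ M.gr n, M.d y = x := by
  obtain ⟨y, rfl⟩ := h
  refine ⟨proj M.isInternal n y, proj_mem _ _ _, ?_⟩
  rw [← proj_map M.isInternal M.isInternal M.d 1 (fun n x hx => M.d_mem hx) n y,
    proj_of_mem M.isInternal hx]

end DGModule

end

noncomputable section

namespace DGModule

variable {A : DGAlgebra}

/-- A linear map is homogeneous of degree `k`. -/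
def HasDeg {M N : DGModule A} (k : ℤ) (h : M.carrier →ₗ[A.carrierᵐᵒᵖ] N.carrier) : Prop :=
  ∀ n, ∀ x ∈ M.gr n, h x ∈ N.gr (n + k)

/-- `h'` is the differential of the map `h` of degree `k`. -/
def IsDiff {M N : DGModule A} (k : ℤ) (h h' : M.carrier →ₗ[A.carrierᵐᵒᵖ] N.carrier) : Prop :=
  ∀ x, h' x = N.d (h x) - (-1 : ℂ) ^ k • h (M.d x)

/-- The identity map `M⟦k⟧ ⟶ M` of degree `k`. -/
def unshift (M : DGModule A) (k : ℤ) : (M.shift k).carrier →ₗ[A.carrierᵐᵒᵖ] M.carrier :=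
  LinearMap.id (M := M.carrier)

/-- The identity map `M ⟶ M⟦k⟧` of degree `-k`. -/
def toShift (M : DGModule A) (k : ℤ) : M.carrier →ₗ[A.carrierᵐᵒᵖ] (M.shift k).carrier :=
  LinearMap.id (M := M.carrier)

lemma hasDeg_unshift (M : DGModule A) (k : ℤ) : HasDeg k (M.unshift k) := fun _ _ hx => hx

lemma isDiff_unshift (M : DGModule A) (k : ℤ) : IsDiff k (M.unshift k) 0 := fun x => by
  have key : ∀ x : M.carrier, 0 = M.d x - (-1 : ℂ) ^ k • (-1 : ℂ) ^ k • M.d x := fun x => by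
    rw [sign_smul_smul, sub_self]
  exact key x

lemma hasDeg_toShift (M : DGModule A) (k : ℤ) : HasDeg (-k) (M.toShift k) := fun n x hx => by
  change x ∈ M.gr (n + -k + k)
  rwa [neg_add_cancel_right]

/-- The inclusion `M ⟶ Cone f` of degree `-1`. -/
def coneInl {M N : DGModule A} (f : M ⟶ N) : M.carrier →ₗ[A.carrierᵐᵒᵖ] (cone f).carrier :=
  LinearMap.inl A.carrierᵐᵒᵖ M.carrier N.carrier

/-- The inclusion `N ⟶ Cone f`. -/
def coneInr {M N : DGModule A} (f : M ⟶ N) : N.carrier →ₗ[A.carrierᵐᵒᵖ] (cone f).carrier :=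
  LinearMap.inr A.carrierᵐᵒᵖ M.carrier N.carrier

/-- The projection `Cone f ⟶ M` of degree `1`. -/
def coneFst {M N : DGModule A} (f : M ⟶ N) : (cone f).carrier →ₗ[A.carrierᵐᵒᵖ] M.carrier :=
  LinearMap.fst A.carrierᵐᵒᵖ M.carrier N.carrier

/-- The projection `Cone f ⟶ N`. -/
def coneSnd {M N : DGModule A} (f : M ⟶ N) : (cone f).carrier →ₗ[A.carrierᵐᵒᵖ] N.carrier :=
  LinearMap.snd A.carrierᵐᵒᵖ M.carrier N.carrier

lemma hasDeg_coneInl {M N : DGModule A} (f : M ⟶ N) : HasDeg (-1) (coneInl f) := fun n x hx => by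
  refine ⟨?_, zero_mem _⟩
  change x ∈ M.gr (n + -1 + 1)
  rwa [neg_add_cancel_right]

lemma isDiff_coneInl {M N : DGModule A} (f : M ⟶ N) :
    IsDiff (-1) (coneInl f) ((coneInr f).comp (lin f)) := fun x => by
  have key : ∀ x : M.carrier, ((0, lin f x) : M.carrier × N.carrier) =
      (-M.d x, lin f x + N.d 0) - (-1 : ℂ) ^ (-1 : ℤ) • (M.d x, 0) := fun x => by
    ext <;> simp
  exact key x

end DGModule

open DGModule

/-- A dg functor from dg modules to dg modules, given on all linear maps. -/
structure DGFunctor (A : DGAlgebra) where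
  obj : DGModule A → DGModule A
  map {M N : DGModule A} : (M.carrier →ₗ[A.carrierᵐᵒᵖ] N.carrier) →ₗ[ℂ]
    ((obj M).carrier →ₗ[A.carrierᵐᵒᵖ] (obj N).carrier)
  map_id (M : DGModule A) : map (LinearMap.id : M.carrier →ₗ[A.carrierᵐᵒᵖ] M.carrier) =
    LinearMap.id
  map_comp {M N P : DGModule A} (f : M.carrier →ₗ[A.carrierᵐᵒᵖ] N.carrier)
    (g : N.carrier →ₗ[A.carrierᵐᵒᵖ] P.carrier) : map (g.comp f) = (map g).comp (map f)
  hasDeg {M N : DGModule A} {k : ℤ} {h : M.carrier →ₗ[A.carrierᵐᵒᵖ] N.carrier} :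
    HasDeg k h → HasDeg k (map h)
  isDiff {M N : DGModule A} {k : ℤ} {h h' : M.carrier →ₗ[A.carrierᵐᵒᵖ] N.carrier} :
    HasDeg k h → IsDiff k h h' → IsDiff k (map h) (map h')

namespace DGFunctor

variable {A : DGAlgebra} (F : DGFunctor A)

lemma map_comp_apply {M N P : DGModule A} (f : M.carrier →ₗ[A.carrierᵐᵒᵖ] N.carrier)
    (g : N.carrier →ₗ[A.carrierᵐᵒᵖ] P.carrier) (x) :
    F.map g (F.map f x) = F.map (g.comp f) x := by
  rw [F.map_comp]; rfl

lemma map_id_apply {M : DGModule A} (x) :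
    F.map (LinearMap.id : M.carrier →ₗ[A.carrierᵐᵒᵖ] M.carrier) x = x := by
  rw [F.map_id]; rfl

/-- The underlying functor on dg modules. -/
def functor : DGModule A ⥤ DGModule A where
  obj := F.obj
  map {M N} f := mkHom (F.map (lin f))
    (fun n x hx => by
      have h : HasDeg 0 (lin f) := fun n x hx => by
        rw [add_zero]
        exact lin_mem f hx
      have := F.hasDeg h n x hx
      rwa [add_zero] at this)
    (fun x => by
      have h : HasDeg 0 (lin f) := fun n x hx => by
        rw [add_zero]
        exact lin_mem f hx
      have h' : IsDiff 0 (lin f) 0 := fun x => by simp [lin_d]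
      have := F.isDiff h h' x
      rw [map_zero, zpow_zero, one_smul] at this
      exact (sub_eq_zero.1 this.symm).symm)
  map_id M := hom_ext fun x => F.map_id_apply x
  map_comp f g := hom_ext fun x => (F.map_comp_apply (lin f) (lin g) x).symm

instance : F.functor.Linear ℂ where
  map_smul f c := hom_ext fun x => by
    change F.map (c • lin f) x = c • F.map (lin f) x
    rw [map_smul]; rfl

lemma map_unshift_d (M : DGModule A) (k : ℤ) (x) :
    F.map (M.unshift k) ((F.obj (M.shift k)).d x) =
      (-1 : ℂ) ^ k • (F.obj M).d (F.map (M.unshift k) x) := by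
  have := F.isDiff (hasDeg_unshift M k) (isDiff_unshift M k) x
  rw [map_zero] at this
  rw [sub_eq_zero.1 this.symm, sign_smul_smul]

/-- A dg functor commutes with the shift. -/
def shiftIso (M : DGModule A) (k : ℤ) : F.obj (M.shift k) ≅ (F.obj M).shift k where
  hom := mkHom (M := F.obj (M.shift k)) (N := (F.obj M).shift k) (F.map (M.unshift k))
    (fun n x hx => F.hasDeg (hasDeg_unshift M k) n x hx)
    (fun x => F.map_unshift_d M k x)
  inv := mkHom (M := (F.obj M).shift k) (N := F.obj (M.shift k)) (F.map (M.toShift k))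
    (fun n x hx => by
      have := F.hasDeg (hasDeg_toShift M k) _ x hx
      rwa [add_neg_cancel_right] at this)
    (fun x => by
      have h (y : (F.obj M).carrier) : F.map (M.unshift k) (F.map (M.toShift k) y) = y :=
        (F.map_comp_apply _ _ y).trans (F.map_id_apply y)
      have h' (y) : F.map (M.toShift k) (F.map (M.unshift k) y) = y :=
        (F.map_comp_apply _ _ y).trans (F.map_id_apply (M := M.shift k) y)
      have key (x : (F.obj M).carrier) : F.map (M.toShift k) ((-1 : ℂ) ^ k • (F.obj M).d x) =
          (F.obj (M.shift k)).d (F.map (M.toShift k) x) := by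
        rw [← h' ((F.obj (M.shift k)).d _), F.map_unshift_d, h]
      exact key x)
  hom_inv_id := hom_ext fun x => (F.map_comp_apply _ _ x).trans (F.map_id_apply (M := M.shift k) x)
  inv_hom_id := hom_ext fun x => (F.map_comp_apply _ _ x).trans (F.map_id_apply (M := M) x)

instance : F.functor.CommShift ℤ where
  commShiftIso k := NatIso.ofComponents (fun M => F.shiftIso M k) (fun {M N} f => hom_ext fun x => by
    refine (F.map_comp_apply (lin (f⟦k⟧')) (N.unshift k) x).trans ?_
    exact (F.map_comp_apply (M.unshift k) (lin f) x).symm)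
  commShiftIso_zero := by
    ext M
    refine hom_ext fun x => ?_
    rfl
  commShiftIso_add j k := by
    ext M
    refine hom_ext fun x => ?_
    rw [Functor.CommShift.isoAdd_hom_app]
    have h₁ (y : ((F.obj M)⟦j⟧⟦k⟧).carrier) :
      lin ((shiftFunctorAdd (DGModule A) j k).inv.app (F.obj M)) y = y := rfl
    refine Eq.trans ?_ (h₁ _).symm
    have h₂ (x : (F.obj (M.shift (j + k))).carrier) : F.map (M.unshift (j + k)) x = F.map (M.unshift j) (F.map ((M.shift j).unshift k)
        (F.map (M := M.shift (j + k)) (N := (M.shift j).shift k)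
          (lin ((shiftFunctorAdd (DGModule A) j k).hom.app M)) x)) := by
      rw [F.map_comp_apply, F.map_comp_apply]
      rfl
    exact h₂ x

/-- A dg functor commutes with cones. -/
def coneIso {M N : DGModule A} (f : M ⟶ N) : F.obj (cone f) ≅ cone (F.functor.map f) := by
  let a : cone (F.functor.map f) ⟶ F.obj (cone f) := mkHom (M := cone (F.functor.map f))
    (LinearMap.coprod (F.map (coneInl f)) (F.map (coneInr f)))
    (fun n x hx => by
      have h₁ := F.hasDeg (hasDeg_coneInl f) _ _ hx.1
      rw [add_neg_cancel_right] at h₁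
      exact add_mem h₁ (lin_mem (F.functor.map (inr f)) hx.2))
    (fun x => by
      have key (x : (F.obj M).carrier) (y : (F.obj N).carrier) :
          F.map (coneInl f) (-(F.obj M).d x) + F.map (coneInr f) (F.map (lin f) x +
          (F.obj N).d y) = (F.obj (cone f)).d (F.map (coneInl f) x + F.map (coneInr f) y) := by
        have h₁ := F.isDiff (hasDeg_coneInl f) (isDiff_coneInl f) x
        have h₃ : F.map (coneInr f) ((F.obj N).d y) = (F.obj (cone f)).d (F.map (coneInr f) y) :=
          lin_d (F.functor.map (inr f)) y
        rw [map_add, map_add, h₃, F.map_comp_apply, h₁, map_neg]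
        simp
        abel
      exact key x.1 x.2)
  have h (z) : F.map (coneInl f) (F.map (coneFst f) z) + F.map (coneInr f) (F.map (coneSnd f) z) =
      z := by
    rw [F.map_comp_apply, F.map_comp_apply, ← LinearMap.add_apply, ← map_add]
    have e : (coneInl f).comp (coneFst f) + (coneInr f).comp (coneSnd f) = LinearMap.id := by
      refine LinearMap.ext fun x => ?_
      have key : ∀ x : M.carrier × N.carrier, (x.1, (0 : N.carrier)) + ((0 : M.carrier), x.2) = x :=
        fun x => by simp
      exact key x
    rw [e, F.map_id_apply]
  have hb (x) : ((F.map (coneFst f)).prod (F.map (coneSnd f)))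
      (LinearMap.coprod (F.map (coneInl f)) (F.map (coneInr f)) x) = x := by
    obtain ⟨x, y⟩ := x
    have e₁ : (coneFst f).comp (coneInl f) = LinearMap.id := rfl
    have e₂ : (coneFst f).comp (coneInr f) = 0 := rfl
    have e₃ : (coneSnd f).comp (coneInl f) = 0 := rfl
    have e₄ : (coneSnd f).comp (coneInr f) = LinearMap.id := rfl
    refine Prod.ext ?_ ?_
    · change F.map (coneFst f) (F.map (coneInl f) x + F.map (coneInr f) y) = x
      rw [map_add, F.map_comp_apply, F.map_comp_apply, e₁, e₂, F.map_id_apply, map_zero]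
      simp
    · change F.map (coneSnd f) (F.map (coneInl f) x + F.map (coneInr f) y) = y
      rw [map_add, F.map_comp_apply, F.map_comp_apply, e₃, e₄, F.map_id_apply, map_zero]
      simp
  exact
    { hom := mkHom (N := cone (F.functor.map f)) ((F.map (coneFst f)).prod (F.map (coneSnd f)))
        (fun n x hx => by
          have hf : HasDeg 1 (coneFst f) := fun n x hx => hx.1
          have hs : HasDeg 0 (coneSnd f) := fun n x hx => by
            rw [add_zero]
            exact hx.2
          have h₂ := F.hasDeg hs n x hx
          rw [add_zero] at h₂
          exact ⟨F.hasDeg hf n x hx, h₂⟩)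
        (fun z => by
          have e := (lin_d a (((F.map (coneFst f)).prod (F.map (coneSnd f))) z))
          have e₂ : lin a (((F.map (coneFst f)).prod (F.map (coneSnd f))) z) = z := h z
          rw [e₂] at e
          rw [← e]
          exact hb _)
      inv := a
      hom_inv_id := hom_ext h
      inv_hom_id := hom_ext hb }

/-- A dg functor preserves the standard triangles. -/
def triangleIso {M N : DGModule A} (f : M ⟶ N) :
    F.functor.mapTriangle.obj (triangle f) ≅ triangle (F.functor.map f) :=
  Triangle.isoMk _ _ (Iso.refl _) (Iso.refl _) (F.coneIso f)
    ((Category.comp_id _).trans (Category.id_comp _).symm)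
    (by
      refine hom_ext fun y => Prod.ext ?_ ?_
      · have key (y : (F.obj N).carrier) : F.map (coneFst f) (F.map (coneInr f) y) = 0 := by
          have e₂ : (coneFst f).comp (coneInr f) = 0 := rfl
          rw [F.map_comp_apply, e₂, map_zero]
          rfl
        exact key y
      · have key (y : (F.obj N).carrier) : F.map (coneSnd f) (F.map (coneInr f) y) = y := by
          have e₂ : (coneSnd f).comp (coneInr f) = LinearMap.id := rfl
          rw [F.map_comp_apply, e₂, F.map_id_apply]
        exact key y)
    (by
      change (F.functor.map (fst f) ≫ (F.functor.commShiftIso (1 : ℤ)).hom.app M) ≫ (𝟙 _)⟦(1 : ℤ)⟧' =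
        (F.coneIso f).hom ≫ fst (F.functor.map f)
      rw [CategoryTheory.Functor.map_id]
      refine hom_ext fun z => ?_
      exact F.map_comp_apply (lin (fst f)) (M.unshift 1) z)

end DGFunctor

end

noncomputable section

namespace DerCat

open DGModule

variable {A : DGAlgebra}

/-- Natural transformations between functors on the derived category can be constructed on dg
modules. -/
lemma exists_natTrans {E : Type*} [Category* E] (G₁ G₂ : DerCat A ⥤ E) (τ : Q A ⋙ G₁ ⟶ Q A ⋙ G₂) :
    ∃ τ' : G₁ ⟶ G₂, ∀ M, τ'.app ((Q A).obj M) = τ.app M := by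
  have := Localization.full_whiskeringLeft (HoCat.qis A).Q (HoCat.qis A) E
  let σ : (HoCat.qis A).Q ⋙ G₁ ⟶ (HoCat.qis A).Q ⋙ G₂ := Quotient.natTransLift _ τ
  obtain ⟨τ', h⟩ := ((Functor.whiskeringLeft _ _ E).obj (HoCat.qis A).Q).map_surjective σ
  exact ⟨τ', fun M => congrArg (fun σ => σ.app ((HoCat.q A).obj M)) h⟩

lemma exists_iso_Q (X : DerCat A) : ∃ M : DGModule A, Nonempty ((Q A).obj M ≅ X) := by
  have := Localization.essSurj (HoCat.qis A).Q (HoCat.qis A)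
  have e := (HoCat.qis A).Q.objObjPreimageIso X
  generalize (HoCat.qis A).Q.objPreimage X = M at e
  obtain ⟨M⟩ := M
  exact ⟨M, ⟨e⟩⟩

lemma isIso_app_of_Q {E : Type*} [Category* E] {G₁ G₂ : DerCat A ⥤ E} (τ : G₁ ⟶ G₂)
    (h : ∀ M, IsIso (τ.app ((Q A).obj M))) : IsIso τ := by
  rw [NatTrans.isIso_iff_isIso_app]
  intro X
  obtain ⟨M, ⟨e⟩⟩ := exists_iso_Q X
  exact (NatTrans.isIso_app_iff_of_iso τ e).1 (h M)

end DerCat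

namespace DGFunctor

open DGModule

variable {A : DGAlgebra} (F G : DGFunctor A)

lemma htpy_map {M N : DGModule A} (f g : M ⟶ N) (h : htpy A f g) :
    htpy A (F.functor.map f) (F.functor.map g) := by
  obtain ⟨h, h₁, h₂⟩ := h
  have hd : HasDeg (-1) h := fun n x hx => h₁ (n + -1) x (by rwa [neg_add_cancel_right])
  have hd' : IsDiff (-1) h (lin f - lin g) := fun x => by
    rw [LinearMap.sub_apply, h₂]
    simp
  refine ⟨F.map h, fun n x hx => ?_, fun x => ?_⟩
  · have := F.hasDeg hd _ x hx
    rwa [add_neg_cancel_right] at this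
  · have := F.isDiff hd hd' x
    rw [map_sub] at this
    refine this.trans ?_
    simp
    rfl

/-- The functor induced on homotopy categories. -/
def ho : HoCat A ⥤ HoCat A :=
  CategoryTheory.Quotient.lift _ (F.functor ⋙ HoCat.q A)
    fun _ _ f g h => HoCat.q_eq (F.htpy_map f g h)

/-- `F.ho` is induced by `F`. -/
def hoIso : HoCat.q A ⋙ F.ho ≅ F.functor ⋙ HoCat.q A := CategoryTheory.Quotient.lift.isLift _ _ _

instance : F.ho.CommShift ℤ :=
  inferInstanceAs ((CategoryTheory.Quotient.lift _ (F.functor ⋙ HoCat.q A) _).CommShift ℤ)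

instance : NatTrans.CommShift F.hoIso.hom ℤ := by
  unfold hoIso
  exact Quotient.liftCommShift_compatibility ..

instance : F.ho.Linear ℂ where
  map_smul {X Y} f c := by
    obtain ⟨X⟩ := X
    obtain ⟨Y⟩ := Y
    obtain ⟨f, rfl⟩ := (HoCat.q A).map_surjective f
    change (HoCat.q A).map (F.functor.map (c • f)) = c • (HoCat.q A).map (F.functor.map f)
    rw [Functor.map_smul, Functor.map_smul]

instance : F.ho.IsTriangulated where
  map_distinguished T hT := by
    obtain ⟨M, N, f, ⟨e⟩⟩ := hT
    refine ⟨_, _, F.functor.map f, ⟨F.ho.mapTriangle.mapIso e ≪≫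
      (Functor.mapTriangleCompIso (HoCat.q A) F.ho).symm.app (triangle f) ≪≫
      (Functor.mapTriangleIso F.hoIso).app (triangle f) ≪≫
      (Functor.mapTriangleCompIso F.functor (HoCat.q A)).app (triangle f) ≪≫
      (HoCat.q A).mapTriangle.mapIso (F.triangleIso f)⟩⟩

/-- `F` preserves acyclic dg modules. -/
class PreservesAcyclic : Prop where
  acyclic : ∀ M : DGModule A, M.Acyclic → (F.obj M).Acyclic

section

variable [F.PreservesAcyclic] [G.PreservesAcyclic]

lemma quasiIso_map {M N : DGModule A} {f : M ⟶ N} (hf : QuasiIso f) :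
    QuasiIso (F.functor.map f) := by
  refine quasiIso_of_acyclic_cone fun x hx => ?_
  have h := PreservesAcyclic.acyclic (F := F) _ hf.acyclic_cone
  obtain ⟨y, hy⟩ := h (lin (F.coneIso f).inv x) (by rw [← lin_d, hx, map_zero])
  refine ⟨lin (F.coneIso f).hom y, ?_⟩
  rw [← lin_d, hy]
  exact congrArg (fun g => lin g x) (F.coneIso f).inv_hom_id

lemma inverts : (HoCat.qis A).IsInvertedBy (F.ho ⋙ (HoCat.qis A).Q) := by
  intro X Y f hf
  obtain ⟨X⟩ := X
  obtain ⟨Y⟩ := Y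
  obtain ⟨f, rfl⟩ := (HoCat.q A).map_surjective f
  exact (F.quasiIso_map (quasiIso_of_qis hf)).isIso

/-- The functor induced on derived categories. -/
def der : DerCat A ⥤ DerCat A :=
  Localization.lift (F.ho ⋙ (HoCat.qis A).Q) F.inverts (HoCat.qis A).Q

instance : Localization.Lifting (HoCat.qis A).Q (HoCat.qis A) (F.ho ⋙ (HoCat.qis A).Q) F.der :=
  inferInstanceAs (Localization.Lifting _ _ _ (Localization.lift _ _ _))

instance : F.der.CommShift ℤ :=
  Functor.commShiftOfLocalization (HoCat.qis A).Q (HoCat.qis A) ℤ (F.ho ⋙ (HoCat.qis A).Q) F.der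

instance : F.der.IsTriangulated := by
  have := Localization.essSurj_mapArrow (HoCat.qis A).Q (HoCat.qis A)
  have : NatTrans.CommShift (Localization.Lifting.iso (HoCat.qis A).Q (HoCat.qis A)
      (F.ho ⋙ (HoCat.qis A).Q) F.der).hom ℤ :=
    NatTrans.commShift_iso_hom_of_localization ..
  exact Functor.isTriangulated_of_precomp_iso (Localization.Lifting.iso (HoCat.qis A).Q
    (HoCat.qis A) (F.ho ⋙ (HoCat.qis A).Q) F.der)

instance : F.der.Linear ℂ :=
  (Localization.functor_linear_iff (R := ℂ) (HoCat.qis A).Q (HoCat.qis A) (F.ho ⋙ (HoCat.qis A).Q)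
    F.der).1 inferInstance

/-- `F.der` is induced by `F`. -/
def derIso : DerCat.Q A ⋙ F.der ≅ F.functor ⋙ DerCat.Q A :=
  Functor.isoWhiskerLeft (HoCat.q A) (Localization.Lifting.iso (HoCat.qis A).Q (HoCat.qis A)
    (F.ho ⋙ (HoCat.qis A).Q) F.der)

/-- A natural transformation between dg functors, on the derived category. -/
lemma exists_natTrans_id (η : 𝟭 (DGModule A) ⟶ F.functor) :
    ∃ η' : 𝟭 (DerCat A) ⟶ F.der, ∀ M,
      η'.app ((DerCat.Q A).obj M) = (DerCat.Q A).map (η.app M) ≫ F.derIso.inv.app M :=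
  DerCat.exists_natTrans (𝟭 _) F.der
    ((Functor.whiskerRight η (DerCat.Q A) : DerCat.Q A ⟶ F.functor ⋙ DerCat.Q A) ≫ F.derIso.inv)

/-- The composite of the functors induced by two dg functors. -/
def derCompIso : DerCat.Q A ⋙ F.der ⋙ G.der ≅ (F.functor ⋙ G.functor) ⋙ DerCat.Q A :=
  (Functor.associator _ _ _).symm ≪≫ Functor.isoWhiskerRight F.derIso G.der ≪≫
    Functor.associator _ _ _ ≪≫ Functor.isoWhiskerLeft F.functor G.derIso ≪≫
    (Functor.associator _ _ _).symm

variable {F G}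

lemma nonempty_unitIso (η : 𝟭 (DGModule A) ⟶ F.functor ⋙ G.functor)
    (h : ∀ M, QuasiIso (η.app M)) : Nonempty (𝟭 (DerCat A) ≅ F.der ⋙ G.der) := by
  obtain ⟨τ, hτ⟩ := DerCat.exists_natTrans (𝟭 _) (F.der ⋙ G.der)
    ((Functor.whiskerRight η (DerCat.Q A) : DerCat.Q A ⟶ _) ≫ (F.derCompIso G).inv)
  have : IsIso τ := DerCat.isIso_app_of_Q τ fun M => by
    have := (h M).isIso
    have e : τ.app ((DerCat.Q A).obj M) =
      (DerCat.Q A).map (η.app M) ≫ (F.derCompIso G).inv.app M := hτ M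
    rw [e]
    infer_instance
  exact ⟨asIso τ⟩

lemma nonempty_counitIso (ε : F.functor ⋙ G.functor ⟶ 𝟭 (DGModule A))
    (h : ∀ M, QuasiIso (ε.app M)) : Nonempty (F.der ⋙ G.der ≅ 𝟭 (DerCat A)) := by
  obtain ⟨τ, hτ⟩ := DerCat.exists_natTrans (F.der ⋙ G.der) (𝟭 _)
    ((F.derCompIso G).hom ≫ (Functor.whiskerRight ε (DerCat.Q A) : _ ⟶ DerCat.Q A))
  have : IsIso τ := DerCat.isIso_app_of_Q τ fun M => by
    have := (h M).isIso
    have e : τ.app ((DerCat.Q A).obj M) =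
      (F.derCompIso G).hom.app M ≫ (DerCat.Q A).map (ε.app M) := hτ M
    rw [e]
    infer_instance
  exact ⟨asIso τ⟩

variable (F)

/-- The functor induced on the objects with finite-dimensional total cohomology. -/
def fd (hF : ∀ X, DerCat.fd A X → DerCat.fd A (F.der.obj X)) : Dfd A ⥤ Dfd A :=
  (DerCat.fd A).lift ((DerCat.fd A).ι ⋙ F.der) fun X => hF _ X.property

variable (hF : ∀ X, DerCat.fd A X → DerCat.fd A (F.der.obj X))

instance : (F.fd hF).CommShift ℤ :=
  inferInstanceAs (((DerCat.fd A).lift ((DerCat.fd A).ι ⋙ F.der) _).CommShift ℤ)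

instance : (F.fd hF).IsTriangulated :=
  inferInstanceAs (((DerCat.fd A).lift ((DerCat.fd A).ι ⋙ F.der) _).IsTriangulated)

instance : (F.fd hF).Linear ℂ where
  map_smul _ _ := (DerCat.fd A).ι.map_injective (F.der.map_smul _ _)

lemma exists_equivalence {F G : DGFunctor A} [F.PreservesAcyclic] [G.PreservesAcyclic]
    (hF : ∀ X, DerCat.fd A X → DerCat.fd A (F.der.obj X))
    (hG : ∀ X, DerCat.fd A X → DerCat.fd A (G.der.obj X))
    (η : 𝟭 (DGModule A) ⟶ F.functor ⋙ G.functor) (hη : ∀ M, QuasiIso (η.app M))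
    (ε : G.functor ⋙ F.functor ⟶ 𝟭 (DGModule A)) (hε : ∀ M, QuasiIso (ε.app M)) :
    ∃ Φ : Dfd A ≌ Dfd A, Φ.functor = F.fd hF ∧ Φ.inverse = G.fd hG := by
  obtain ⟨e₁⟩ := nonempty_unitIso η hη
  obtain ⟨e₂⟩ := nonempty_counitIso ε hε
  let u : 𝟭 (Dfd A) ≅ F.fd hF ⋙ G.fd hG :=
    NatIso.ofComponents (fun X => (DerCat.fd A).isoMk (e₁.app X.obj))
      (fun f => (DerCat.fd A).ι.map_injective (e₁.hom.naturality f.hom))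
  let c : G.fd hG ⋙ F.fd hF ≅ 𝟭 (Dfd A) :=
    NatIso.ofComponents (fun X => (DerCat.fd A).isoMk (e₂.app X.obj))
      (fun f => (DerCat.fd A).ι.map_injective (e₂.hom.naturality f.hom))
  exact ⟨CategoryTheory.Equivalence.mk (F.fd hF) (G.fd hG) u c, rfl, rfl⟩

end

end DGFunctor

end

noncomputable section

section HomZero

variable {C : Type*} [Category* C] [Preadditive C]

/-- There are no nonzero morphisms from `X` to `Y`. -/
def HomZero (X Y : C) : Prop := ∀ f : X ⟶ Y, f = 0

lemma HomZero.of_iso {X X' Y Y' : C} (h : HomZero X Y) (e : X ≅ X') (e' : Y ≅ Y') :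
    HomZero X' Y' := fun f => by
  have := h (e.hom ≫ f ≫ e'.inv)
  rw [← cancel_epi e.hom, ← cancel_mono e'.inv, Category.assoc, this]
  simp

lemma homZero_iff_of_iso {X X' Y Y' : C} (e : X ≅ X') (e' : Y ≅ Y') :
    HomZero X Y ↔ HomZero X' Y' := ⟨fun h => h.of_iso e e', fun h => h.of_iso e.symm e'.symm⟩

variable [HasShift C ℤ] [∀ n : ℤ, (shiftFunctor C n).Additive]

lemma homZero_shift_iff (X Y : C) (n : ℤ) : HomZero (X⟦n⟧) (Y⟦n⟧) ↔ HomZero X Y := by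
  constructor
  · intro h f
    exact (shiftFunctor C n).map_injective ((h _).trans (Functor.map_zero _ _ _).symm)
  · intro h f
    obtain ⟨f, rfl⟩ := (shiftFunctor C n).map_surjective f
    rw [h f, Functor.map_zero]

lemma homZero_shift_iff' (X Y : C) {a b c d : ℤ} (h : a + d = c + b) :
    HomZero (X⟦a⟧) (Y⟦b⟧) ↔ HomZero (X⟦c⟧) (Y⟦d⟧) := by
  rw [← homZero_shift_iff (X⟦a⟧) (Y⟦b⟧) (c - a)]
  exact homZero_iff_of_iso ((shiftFunctorAdd' C a (c - a) c (by lia)).symm.app X)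
    ((shiftFunctorAdd' C b (c - a) d (by lia)).symm.app Y)

lemma homZero_shift_right_iff (X Y : C) {a b : ℤ} (h : a + b = 0) :
    HomZero (X⟦a⟧) Y ↔ HomZero X (Y⟦b⟧) :=
  (homZero_iff_of_iso (Iso.refl _) ((shiftFunctorZero C ℤ).symm.app Y)).trans
    ((homZero_shift_iff' X Y (by lia : a + b = 0 + 0)).trans
      (homZero_iff_of_iso ((shiftFunctorZero C ℤ).app X) (Iso.refl _)))

variable [HasZeroObject C] [Pretriangulated C]

lemma HomZero.middle_right {X : C} {T : Triangle C} (hT : T ∈ distTriang C)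
    (h₁ : HomZero X T.obj₁) (h₃ : HomZero X T.obj₃) : HomZero X T.obj₂ := fun f => by
  obtain ⟨g, rfl⟩ := Triangle.coyoneda_exact₂ T hT f (h₃ _)
  rw [h₁ g, zero_comp]

lemma HomZero.middle_left {X : C} {T : Triangle C} (hT : T ∈ distTriang C)
    (h₁ : HomZero T.obj₁ X) (h₃ : HomZero T.obj₃ X) : HomZero T.obj₂ X := fun f => by
  obtain ⟨g, rfl⟩ := Triangle.yoneda_exact₂ T hT f (h₁ _)
  rw [h₃ g, comp_zero]

end HomZero

namespace DGModule

variable {A : DGAlgebra}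

/-- A dg module is K-projective if all morphisms to acyclic dg modules are null-homotopic. -/
def KProjective (P : DGModule A) : Prop := ∀ N : DGModule A, N.Acyclic → ∀ f : P ⟶ N, htpy A f 0

lemma KProjective.leftOrthogonal {P : DGModule A} (hP : P.KProjective) :
    (HoCat.coh A).homologicalKernel.leftOrthogonal ((HoCat.q A).obj P) := by
  rintro ⟨N⟩ f hN
  obtain ⟨f, rfl⟩ := (HoCat.q A).map_surjective f
  rw [HoCat.q_eq (hP N ((homologicalKernel_iff N).1 hN) f), Functor.map_zero]

lemma KProjective.exists_map {P : DGModule A} (hP : P.KProjective) {M : DGModule A}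
    (g : (DerCat.Q A).obj P ⟶ (DerCat.Q A).obj M) : ∃ f : P ⟶ M, (DerCat.Q A).map f = g := by
  obtain ⟨f, rfl⟩ := (ObjectProperty.leftOrthogonal.map_bijective_of_isTriangulated
    hP.leftOrthogonal (HoCat.qis A).Q _).2 g
  obtain ⟨f, rfl⟩ := (HoCat.q A).map_surjective f
  exact ⟨f, rfl⟩

lemma KProjective.htpy_of_eq {P : DGModule A} (hP : P.KProjective) {M : DGModule A}
    {f g : P ⟶ M} (h : (DerCat.Q A).map f = (DerCat.Q A).map g) : htpy A f g :=
  HoCat.htpy_of_eq ((ObjectProperty.leftOrthogonal.map_bijective_of_isTriangulated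
    hP.leftOrthogonal (HoCat.qis A).Q _).1 h)

lemma Q_map_eq_of_htpy {M N : DGModule A} {f g : M ⟶ N} (h : htpy A f g) :
    (DerCat.Q A).map f = (DerCat.Q A).map g := congrArg (HoCat.qis A).Q.map (HoCat.q_eq h)

/-- Morphisms in the derived category are fractions. -/
lemma exists_fraction {M N : DGModule A} (f : (DerCat.Q A).obj M ⟶ (DerCat.Q A).obj N) :
    ∃ (N' : DGModule A) (g : M ⟶ N') (s : N ⟶ N'), QuasiIso s ∧
      f ≫ (DerCat.Q A).map s = (DerCat.Q A).map g := by
  obtain ⟨φ, hφ⟩ := Localization.exists_leftFraction (HoCat.qis A).Q (HoCat.qis A) f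
  obtain @⟨⟨N'⟩, g, s, hs⟩ := φ
  obtain ⟨g, rfl⟩ := (HoCat.q A).map_surjective g
  obtain ⟨s, rfl⟩ := (HoCat.q A).map_surjective s
  refine ⟨N', g, s, quasiIso_of_qis hs, ?_⟩
  rw [hφ]
  exact MorphismProperty.LeftFraction.map_comp_map_s _ _ _

variable (A) in
/-- The free dg module of rank one. -/
def free : DGModule A where
  carrier := A.carrier
  isScalarTower := ⟨fun c x y => by
    change y * (c • x.unop) = c • (y * x.unop)
    rw [mul_smul_comm]⟩
  gr := A.gr
  isInternal := A.isInternal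
  smul_mem hx ha := A.mul_mem hx ha
  d := A.d
  d_mem := A.d_mem
  d_d := A.d_d
  leibniz a hx := A.leibniz a hx

/-- The `A`-linear map `x ↦ z x`. -/
def mulLeft {M : DGModule A} (z : M.carrier) : (free A).carrier →ₗ[A.carrierᵐᵒᵖ] M.carrier where
  toFun x := MulOpposite.op (show A.carrier from x) • z
  map_add' x y := by
    change MulOpposite.op ((show A.carrier from x) + (show A.carrier from y)) • z = _
    rw [MulOpposite.op_add, add_smul]
  map_smul' a x := mul_smul _ _ z

lemma eq_mulLeft {M : DGModule A} (f : (free A).carrier →ₗ[A.carrierᵐᵒᵖ] M.carrier)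
    (x : A.carrier) : f x = MulOpposite.op x • f (1 : A.carrier) := by
  have := f.map_smul (MulOpposite.op x) (show (free A).carrier from (1 : A.carrier))
  rw [← this]
  exact congrArg f (one_mul x).symm

/-- The morphism `A⟦k⟧ ⟶ M` given by a cocycle. -/
def ofCocycle {M : DGModule A} {k l : ℤ} (h : k + l = 0) (z : M.carrier) (hz : z ∈ M.gr l)
    (hz' : M.d z = 0) : (free A).shift k ⟶ M :=
  mkHom (M := (free A).shift k) (mulLeft z)
    (fun n x hx => by
      have := M.smul_mem hz (show (show A.carrier from x) ∈ A.gr (n + k) from hx)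
      rwa [← add_assoc, add_comm l, add_assoc, add_comm l, h, add_zero] at this)
    (fun x => by
      have key (x : A.carrier) : MulOpposite.op ((-1 : ℂ) ^ k • A.d x) • z =
          M.d (MulOpposite.op x • z) := by
        rw [M.leibniz x hz, hz', smul_zero, zero_add, MulOpposite.op_smul, smul_assoc]
        congr 1
        rw [eq_neg_of_add_eq_zero_left h, zpow_neg, ← inv_zpow, inv_neg, inv_one]
      exact key x)

lemma one_mem_shift {k l : ℤ} (h : k + l = 0) :
    (show ((free A).shift k).carrier from (1 : A.carrier)) ∈ ((free A).shift k).gr l := by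
  change (1 : A.carrier) ∈ A.gr (l + k)
  rw [add_comm, h]
  exact A.one_mem

lemma A_d_one : A.d 1 = 0 := by
  have := A.leibniz (1 : A.carrier) A.one_mem
  simpa using this

lemma d_one_shift (k : ℤ) :
    ((free A).shift k).d (show ((free A).shift k).carrier from (1 : A.carrier)) = 0 := by
  change (-1 : ℂ) ^ k • A.d 1 = 0
  rw [A_d_one, smul_zero]

/-- The value at `1` of a morphism from a shift of `A`. -/
def val {M : DGModule A} {k : ℤ} (f : (free A).shift k ⟶ M) : M.carrier :=
  lin f (show ((free A).shift k).carrier from (1 : A.carrier))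

lemma val_mem {M : DGModule A} {k l : ℤ} (h : k + l = 0) (f : (free A).shift k ⟶ M) :
    val f ∈ M.gr l := lin_mem f (one_mem_shift h)

lemma d_val {M : DGModule A} {k : ℤ} (f : (free A).shift k ⟶ M) : M.d (val f) = 0 :=
  (lin_d f _).symm.trans ((congrArg (lin f) (d_one_shift k)).trans (map_zero _))

lemma val_ofCocycle {M : DGModule A} {k l : ℤ} (h : k + l = 0) (z : M.carrier) (hz : z ∈ M.gr l)
    (hz' : M.d z = 0) : val (ofCocycle h z hz hz') = z := one_smul _ z

lemma lin_eq_val {M : DGModule A} {k : ℤ} (f : (free A).shift k ⟶ M) (x : A.carrier) :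
    lin f (show ((free A).shift k).carrier from x) = MulOpposite.op x • val f :=
  eq_mulLeft (M := M) (lin f : ((free A).shift k).carrier →ₗ[A.carrierᵐᵒᵖ] M.carrier) x

lemma hom_free_ext {M : DGModule A} {k : ℤ} {f g : (free A).shift k ⟶ M}
    (h : val f = val g) : f = g :=
  hom_ext fun x => (lin_eq_val f x).trans
    ((congrArg (fun y => MulOpposite.op (show A.carrier from x) • y) h).trans (lin_eq_val g x).symm)

/-- A map from a shifted free module is null-homotopic if and only if the corresponding cocycle
is a coboundary. -/
lemma htpy_free_iff {M : DGModule A} {k : ℤ} (f : (free A).shift k ⟶ M) :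
    htpy A f 0 ↔ ∃ y, M.d y = val f := by
  constructor
  · rintro ⟨h, -, h₂⟩
    refine ⟨h (show ((free A).shift k).carrier from (1 : A.carrier)), ?_⟩
    have := h₂ (show ((free A).shift k).carrier from (1 : A.carrier))
    rw [d_one_shift, map_zero h, add_zero, map_zero] at this
    exact this.symm.trans (sub_zero _)
  · intro hy
    have h₁ : val f ∈ M.gr (-k - 1 + 1) := by
      rw [sub_add_cancel]
      exact val_mem (add_neg_cancel k) f
    obtain ⟨y, hy, hy'⟩ := exists_homogeneous h₁ hy
    refine ⟨mulLeft y, fun n x hx => ?_, fun x => ?_⟩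
    · have := M.smul_mem hy (show (show A.carrier from x) ∈ A.gr (n + 1 + k) from hx)
      rwa [show -k - 1 + (n + 1 + k) = n by ring] at this
    · have key (x : A.carrier) : MulOpposite.op x • val f = M.d (MulOpposite.op x • y) +
          MulOpposite.op ((-1 : ℂ) ^ k • A.d x) • y := by
        rw [M.leibniz x hy, hy', MulOpposite.op_smul, smul_assoc, add_assoc, ← add_smul]
        have e : (-1 : ℂ) ^ (-k - 1) + (-1 : ℂ) ^ k = 0 := by
          have := sign_succ (-k - 1)
          rw [sub_add_cancel, zpow_neg, ← inv_zpow, inv_neg, inv_one] at this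
          rw [this]
          ring
        rw [e, zero_smul, add_zero]
      exact (sub_zero _).trans ((lin_eq_val f x).trans (key x))

lemma kProjective_free (k : ℤ) : ((free A).shift k).KProjective := fun _ hN f =>
  (htpy_free_iff f).2 (hN _ (d_val f))

lemma homZero_free_iff {M : DGModule A} {k l : ℤ} (h : k + l = 0) :
    HomZero ((DerCat.Q A).obj ((free A).shift k)) ((DerCat.Q A).obj M) ↔
      ∀ x ∈ M.gr l, M.d x = 0 → ∃ y, M.d y = x := by
  constructor
  · intro H x hx hx'
    have := (kProjective_free k).htpy_of_eq ((H ((DerCat.Q A).map (ofCocycle h x hx hx'))).trans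
      (Functor.map_zero _ _ _).symm)
    obtain ⟨y, hy⟩ := (htpy_free_iff _).1 this
    exact ⟨y, hy.trans (val_ofCocycle h x hx hx')⟩
  · intro H f
    obtain ⟨f, rfl⟩ := (kProjective_free k).exists_map f
    rw [← (DerCat.Q A).map_zero]
    refine Q_map_eq_of_htpy ((htpy_free_iff f).2 (H _ (val_mem h f) (d_val f)))

lemma homZero_free_shift_iff {M : DGModule A} {k l : ℤ} (h : k + l = 0) :
    HomZero (((DerCat.Q A).obj (free A))⟦k⟧) ((DerCat.Q A).obj M) ↔
      ∀ x ∈ M.gr l, M.d x = 0 → ∃ y, M.d y = x :=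
  (homZero_iff_of_iso (((DerCat.Q A).commShiftIso k).symm.app (free A)) (Iso.refl _)).trans
    (homZero_free_iff h)

end DGModule

end

noncomputable section

/-- A dg algebra concentrated in nonpositive degrees. -/
class DGAlgebra.Nonpos (A : DGAlgebra) : Prop where
  eq_zero : ∀ n > 0, ∀ x ∈ A.gr n, x = 0

section

variable {C : Type*} [Category* C] [Preadditive C] [HasZeroObject C] [HasShift C ℤ]
  [∀ n : ℤ, (shiftFunctor C n).Additive] [Pretriangulated C]

lemma dist_of_iso₂ {X Y Y' Z : C} {f : X ⟶ Y} {g : Y ⟶ Z} {h : Z ⟶ X⟦(1 : ℤ)⟧}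
    (H : Triangle.mk f g h ∈ distTriang C) (e : Y ≅ Y') :
    Triangle.mk (f ≫ e.hom) (e.inv ≫ g) h ∈ distTriang C :=
  isomorphic_distinguished _ H _ (Triangle.isoMk _ _ (Iso.refl _) e.symm (Iso.refl _)
    (by change (f ≫ e.hom) ≫ e.inv = 𝟙 _ ≫ f; simp) (by change (e.inv ≫ g) ≫ 𝟙 _ = e.inv ≫ g; simp)
    (by change h ≫ (𝟙 _)⟦(1 : ℤ)⟧' = 𝟙 _ ≫ h; simp))

end

namespace DGModule

section Internal

variable {V W : Type*} [AddCommGroup V] [Module ℂ V] [AddCommGroup W] [Module ℂ W]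

lemma mem_of_proj_mem {gr : ℤ → Submodule ℂ V} (h : DirectSum.IsInternal gr) (S : Submodule ℂ V)
    {x : V} (hx : ∀ n, proj h n x ∈ S) : x ∈ S := by
  classical
  let e := LinearEquiv.ofBijective (DirectSum.coeLinearMap gr) h
  have hx' : x = DirectSum.coeLinearMap gr (e.symm x) := (e.apply_symm_apply x).symm
  rw [hx']
  erw [DirectSum.coeLinearMap_eq_dfinsuppSum]
  exact Submodule.sum_mem _ fun n _ => hx n

lemma exists_bound {gr : ℤ → Submodule ℂ V} (h : DirectSum.IsInternal gr) (x : V) :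
    ∃ N : ℕ, ∀ n : ℤ, N < |n| → proj h n x = 0 := by
  refine induction_gr h (P := fun x => ∃ N : ℕ, ∀ n : ℤ, N < |n| → proj h n x = 0)
    (fun m x hx => ⟨m.natAbs, fun n hn => proj_of_mem_ne h ?_ hx⟩) ?_ x
  · rintro rfl
    simp at hn
  · rintro x y ⟨N, hN⟩ ⟨N', hN'⟩
    refine ⟨N + N', fun n hn => ?_⟩
    rw [map_add, hN n (by push_cast at hn; lia), hN' n (by push_cast at hn; lia), add_zero]

lemma isInternal_of_detect {gr : ℤ → Submodule ℂ V} (ι : V →ₗ[ℂ] W) (hι : Function.Injective ι)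
    (P : ℤ → V →ₗ[ℂ] W) (h₁ : ∀ n, ∀ x ∈ gr n, P n x = ι x)
    (h₂ : ∀ m n, m ≠ n → ∀ x ∈ gr m, P n x = 0) (h₃ : ∀ x, x ∈ ⨆ n, gr n) :
    DirectSum.IsInternal gr := by
  refine (DirectSum.isInternal_submodule_iff_iSupIndep_and_iSup_eq_top _).2 ⟨fun i => ?_,
    eq_top_iff.2 fun x _ => h₃ x⟩
  rw [Submodule.disjoint_def]
  intro x hx hx'
  have hle : (⨆ j, ⨆ (_ : j ≠ i), gr j) ≤ LinearMap.ker (P i) :=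
    iSup₂_le fun j hj x hx => h₂ j i hj x hx
  apply hι
  rw [map_zero, ← h₁ i x hx]
  exact hle hx'

end Internal

variable {A : DGAlgebra}

lemma proj_d (M : DGModule A) (n : ℤ) (x : M.carrier) :
    proj M.isInternal (n + 1) (M.d x) = M.d (proj M.isInternal n x) :=
  proj_map M.isInternal M.isInternal M.d 1 (fun _ _ hx => M.d_mem hx) n x

lemma proj_smul (M : DGModule A) {k : ℤ} {a : A.carrier} (ha : a ∈ A.gr k) (n : ℤ)
    (x : M.carrier) : proj M.isInternal (n + k) (MulOpposite.op a • x) =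
      MulOpposite.op a • proj M.isInternal n x :=
  proj_map M.isInternal M.isInternal (DistribSMul.toLinearMap ℂ M.carrier (MulOpposite.op a)) k
    (fun _ _ hx => M.smul_mem hx ha) n x

lemma proj_smul' (M : DGModule A) {k : ℤ} {a : A.carrier} (ha : a ∈ A.gr k) (n : ℤ)
    (x : M.carrier) : proj M.isInternal n (MulOpposite.op a • x) =
      MulOpposite.op a • proj M.isInternal (n - k) x := by
  rw [← proj_smul M ha, sub_add_cancel]

lemma lin_proj {M N : DGModule A} (f : M ⟶ N) (n : ℤ) (x : M.carrier) :
    proj N.isInternal n (lin f x) = lin f (proj M.isInternal n x) := by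
  have := proj_map M.isInternal N.isInternal ((lin f).restrictScalars ℂ) 0
    (fun n x hx => by rw [add_zero]; exact lin_mem f hx) n x
  rwa [add_zero] at this

/-- A dg submodule. -/
def sub (M : DGModule A) (P : Submodule A.carrierᵐᵒᵖ M.carrier) (hd : ∀ x ∈ P, M.d x ∈ P)
    (hgr : ∀ n, ∀ x ∈ P, proj M.isInternal n x ∈ P) : DGModule A where
  carrier := P
  gr n := (M.gr n).comap (P.subtype.restrictScalars ℂ)
  isInternal := isInternal_of_detect (P.subtype.restrictScalars ℂ) Subtype.val_injective
    (fun n => proj M.isInternal n ∘ₗ P.subtype.restrictScalars ℂ)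
    (fun _ _ hx => proj_of_mem M.isInternal hx)
    (fun _ _ hmn _ hx => proj_of_mem_ne M.isInternal hmn hx)
    (fun x => by
      let S := (⨆ n, (M.gr n).comap (P.subtype.restrictScalars ℂ)).map
        (P.subtype.restrictScalars ℂ)
      have h : (x : M.carrier) ∈ S := mem_of_proj_mem M.isInternal S fun n =>
        ⟨⟨_, hgr n x x.2⟩, Submodule.mem_iSup_of_mem n (proj_mem M.isInternal n x), rfl⟩
      obtain ⟨y, hy, e⟩ := h
      rwa [← Subtype.val_injective e])
  smul_mem hx ha := M.smul_mem hx ha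
  d := (M.d ∘ₗ P.subtype.restrictScalars ℂ).codRestrict (P.restrictScalars ℂ) fun x => hd x x.2
  d_mem hx := M.d_mem hx
  d_d x := Subtype.ext (M.d_d x)
  leibniz a hx := Subtype.ext (M.leibniz a hx)

section

variable (M : DGModule A) (P : Submodule A.carrierᵐᵒᵖ M.carrier) (hd : ∀ x ∈ P, M.d x ∈ P)
    (hgr : ∀ n, ∀ x ∈ P, proj M.isInternal n x ∈ P)

/-- The inclusion of a dg submodule. -/
def subι : M.sub P hd hgr ⟶ M := mkHom (M := M.sub P hd hgr) P.subtype (fun _ _ hx => hx)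
  (fun _ => rfl)

/-- Lift a morphism to a dg submodule. -/
def subLift {N : DGModule A} (f : N ⟶ M) (hf : ∀ x, lin f x ∈ P) : N ⟶ M.sub P hd hgr :=
  mkHom (N := M.sub P hd hgr) ((lin f).codRestrict P hf) (fun _ _ hx => lin_mem f hx)
    (fun x => Subtype.ext (lin_d f x))

lemma subLift_ι {N : DGModule A} (f : N ⟶ M) (hf : ∀ x, lin f x ∈ P) :
    subLift M P hd hgr f hf ≫ subι M P hd hgr = f := hom_ext fun _ => rfl

end

section Trunc

variable [A.Nonpos] (M : DGModule A) (n : ℤ)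

lemma mem_trunc_smul (x : M.carrier) (hx : ∀ m > n, proj M.isInternal m x = 0)
    (hx' : M.d (proj M.isInternal n x) = 0) (a : A.carrier) :
    (∀ m > n, proj M.isInternal m (MulOpposite.op a • x) = 0) ∧
      M.d (proj M.isInternal n (MulOpposite.op a • x)) = 0 := by
  refine induction_gr A.isInternal (P := fun a =>
    (∀ m > n, proj M.isInternal m (MulOpposite.op a • x) = 0) ∧
      M.d (proj M.isInternal n (MulOpposite.op a • x)) = 0) (fun k a ha => ?_) ?_ a
  · by_cases hk : k ≤ 0
    · refine ⟨fun m hm => ?_, ?_⟩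
      · rw [proj_smul' M ha, hx _ (by lia), smul_zero]
      · rw [proj_smul' M ha, M.leibniz a (proj_mem _ _ _)]
        obtain hk | rfl := hk.lt_or_eq
        · rw [hx _ (by lia)]
          simp
        · have := DGAlgebra.Nonpos.eq_zero (A := A) (0 + 1) (by lia) _ (A.d_mem ha)
          rw [sub_zero, hx', this]
          simp
    · rw [DGAlgebra.Nonpos.eq_zero k (by lia) a ha]
      simp
  · rintro a b ⟨h₁, h₂⟩ ⟨h₃, h₄⟩
    simp only [MulOpposite.op_add, add_smul, map_add]
    exact ⟨fun m hm => by rw [h₁ m hm, h₃ m hm, add_zero], by rw [h₂, h₄, add_zero]⟩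

/-- The submodule `M^{<n} ⊕ ker (d : Mⁿ ⟶ Mⁿ⁺¹)`. -/
def truncSubmodule : Submodule A.carrierᵐᵒᵖ M.carrier where
  carrier := {x | (∀ m > n, proj M.isInternal m x = 0) ∧ M.d (proj M.isInternal n x) = 0}
  add_mem' := by
    rintro x y ⟨h₁, h₂⟩ ⟨h₃, h₄⟩
    simp only [Set.mem_ofPred_eq, map_add]
    exact ⟨fun m hm => by rw [h₁ m hm, h₃ m hm, add_zero], by rw [h₂, h₄, add_zero]⟩
  zero_mem' := by simp
  smul_mem' a x hx := mem_trunc_smul M n x hx.1 hx.2 a.unop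

variable {M n} in
lemma mem_trunc_of_gr {m : ℤ} {x : M.carrier} (hx : x ∈ M.gr m) (h : m ≤ n)
    (h' : m = n → M.d x = 0) : x ∈ truncSubmodule M n := by
  refine ⟨fun k hk => proj_of_mem_ne _ (by lia) hx, ?_⟩
  by_cases hmn : m = n
  · subst hmn
    rw [proj_of_mem _ hx, h' rfl]
  · rw [proj_of_mem_ne _ hmn hx, map_zero]

/-- The canonical truncation `τ_{≤n} M`. -/
def trunc : DGModule A := M.sub (truncSubmodule M n)
  (fun x hx => by
    refine ⟨fun m hm => ?_, ?_⟩
    · obtain ⟨m, rfl⟩ : ∃ k, m = k + 1 := ⟨m - 1, by lia⟩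
      rw [proj_d]
      by_cases h : m = n
      · rw [h, hx.2]
      · rw [hx.1 m (by lia), map_zero]
    · have := proj_d M (n - 1) x
      rw [sub_add_cancel] at this
      rw [this, M.d_d])
  (fun m x hx => by
    by_cases hm : m ≤ n
    · refine mem_trunc_of_gr (proj_mem _ _ _) hm ?_
      rintro rfl
      exact hx.2
    · rw [hx.1 m (by lia)]
      exact zero_mem _)

/-- The inclusion of the canonical truncation. -/
def truncι : M.trunc n ⟶ M := subι _ _ _ _

lemma truncι_injective : Function.Injective (lin (M.truncι n)) := Subtype.val_injective

lemma trunc_gr_eq_zero {m : ℤ} (hm : n < m) {x : (M.trunc n).carrier}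
    (hx : x ∈ (M.trunc n).gr m) : x = 0 := by
  refine Subtype.ext ?_
  exact (proj_of_mem M.isInternal hx).symm.trans (x.2.1 m hm)

/-- The cohomology of `M` vanishes in degree `n`. -/
def CohZero : Prop := ∀ x ∈ M.gr n, M.d x = 0 → ∃ y, M.d y = x

lemma cohZero_trunc {m : ℤ} (hm : n < m) : (M.trunc n).CohZero m := fun x hx _ =>
  ⟨0, by rw [trunc_gr_eq_zero M n hm hx, map_zero]⟩

lemma cohZero_cone_trunc {m : ℤ} (hm : m ≤ n) : (cone (M.truncι n)).CohZero m := by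
  rintro ⟨x, y⟩ ⟨hx, hy⟩ h
  have h₂ : lin (M.truncι n) x + M.d y = 0 := congrArg Prod.snd h
  have hy' : y ∈ truncSubmodule M n := by
    refine mem_trunc_of_gr hy hm ?_
    rintro rfl
    have hx₀ := trunc_gr_eq_zero M m (lt_add_one m) (x := x) hx
    rwa [hx₀, map_zero, zero_add] at h₂
  let y' : (M.trunc n).carrier := ⟨y, hy'⟩
  refine ⟨(y', 0), ?_⟩
  rw [cone_d]
  refine Prod.ext ?_ ?_
  · refine truncι_injective M n ?_
    have : lin (M.truncι n) (-(M.trunc n).d y') = - M.d y := rfl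
    rw [this]
    exact (eq_neg_of_add_eq_zero_left h₂).symm
  · change y + M.d 0 = y
    rw [map_zero, add_zero]

lemma quasiIso_truncι (h : ∀ m > n, M.CohZero m) : QuasiIso (M.truncι n) := by
  refine quasiIso_of_acyclic_cone (acyclic_of_homogeneous fun m => ?_)
  by_cases hm : m ≤ n
  · exact cohZero_cone_trunc M n hm
  · rintro ⟨x, y⟩ ⟨hx, hy⟩ h₁
    obtain rfl := trunc_gr_eq_zero M n (by lia) hx
    have h₂ : lin (M.truncι n) 0 + M.d y = 0 := congrArg Prod.snd h₁
    rw [map_zero, zero_add] at h₂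
    obtain ⟨z, hz⟩ := h m (by lia) y hy h₂
    refine ⟨(0, z), ?_⟩
    rw [cone_d, hz]
    simp
    rfl

lemma acyclic_trunc (h : ∀ m ≤ n, M.CohZero m) : (M.trunc n).Acyclic := by
  refine acyclic_of_homogeneous fun m x hx hx' => ?_
  by_cases hm : m ≤ n
  · obtain ⟨k, rfl⟩ : ∃ k, m = k + 1 := ⟨m - 1, by lia⟩
    have h₁ : M.d (show truncSubmodule M n from x) = 0 := congrArg Subtype.val hx'
    obtain ⟨y, hy, hy'⟩ := exists_homogeneous (M := M) hx (h _ hm _ hx h₁)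
    exact ⟨⟨y, mem_trunc_of_gr hy (by lia) (by lia)⟩, Subtype.ext hy'⟩
  · exact cohZero_trunc M n (by lia) x hx hx'

lemma coh_trunc_injective : Function.Injective (cohMap (M.truncι n)) := by
  rw [injective_iff_map_eq_zero]
  intro x hx
  obtain ⟨⟨x, hx'⟩, rfl⟩ := Submodule.Quotient.mk_surjective _ x
  obtain ⟨y, hy⟩ := (Submodule.Quotient.mk_eq_zero _).1 hx
  refine (Submodule.Quotient.mk_eq_zero _).2 ?_
  change x ∈ LinearMap.range (M.trunc n).d
  refine mem_of_proj_mem (M.trunc n).isInternal _ fun m => ?_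
  have hp : lin (M.truncι n) (proj (M.trunc n).isInternal m x) ∈ M.gr m :=
    lin_mem _ (proj_mem _ _ _)
  by_cases hm : m ≤ n
  · obtain ⟨m, rfl⟩ : ∃ k, m = k + 1 := ⟨m - 1, by lia⟩
    have hy' : M.d (proj M.isInternal m y) =
        lin (M.truncι n) (proj (M.trunc n).isInternal (m + 1) x) := by
      rw [← proj_d, ← lin_proj]
      exact congrArg _ hy
    exact ⟨⟨_, mem_trunc_of_gr (proj_mem _ m y) (by lia) (by lia)⟩, Subtype.ext hy'⟩
  · rw [trunc_gr_eq_zero M n (by lia) (proj_mem _ m x)]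
    exact zero_mem _

variable {M n} in
/-- A morphism from a dg module in degrees `≤ n` factors through the truncation. -/
def truncLift {N : DGModule A} (f : N ⟶ M) (hN : ∀ m > n, ∀ x ∈ N.gr m, x = 0) :
    N ⟶ M.trunc n :=
  subLift _ _ _ _ f fun x => by
    refine induction_gr N.isInternal (P := fun x => lin f x ∈ truncSubmodule M n)
      (fun m x hx => ?_) (fun x y hx hy => by rw [map_add]; exact add_mem hx hy) x
    by_cases hm : m ≤ n
    · refine mem_trunc_of_gr (lin_mem f hx) hm ?_
      rintro rfl
      rw [← lin_d, hN _ (lt_add_one m) _ (N.d_mem hx), map_zero]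
    · rw [hN m (by lia) x hx, map_zero]
      exact zero_mem _

variable {M n} in
lemma truncLift_ι {N : DGModule A} (f : N ⟶ M) (hN : ∀ m > n, ∀ x ∈ N.gr m, x = 0) :
    truncLift f hN ≫ M.truncι n = f := subLift_ι _ _ _ _ _ _

end Trunc

end DGModule

namespace DerCat

open DGModule

variable {A : DGAlgebra}

/-- The cohomology of `X` vanishes in degree `n`. -/
def CohZero (X : DerCat A) (n : ℤ) : Prop := HomZero (((Q A).obj (free A))⟦-n⟧) X

lemma cohZero_Q_iff (M : DGModule A) (n : ℤ) : CohZero ((Q A).obj M) n ↔ M.CohZero n :=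
  homZero_free_shift_iff (neg_add_cancel n)

lemma CohZero.of_iso {X Y : DerCat A} {n : ℤ} (h : CohZero X n) (e : X ≅ Y) : CohZero Y n :=
  HomZero.of_iso h (Iso.refl _) e

lemma cohZero_shift_iff (X : DerCat A) (a m n : ℤ) (h : n + a = m) :
    CohZero (X⟦a⟧) n ↔ CohZero X m :=
  (homZero_shift_iff' _ X (by lia : -n + 0 = -m + a)).trans
    (homZero_iff_of_iso (Iso.refl _) ((shiftFunctorZero (DerCat A) ℤ).app X))

lemma fd_Q_iff (M : DGModule A) : fd A ((Q A).obj M) ↔ Module.Finite ℂ (Coh M) := by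
  have e (n : ℤ) : (DGModule.coh A).obj (M⟦n⟧) ≅ (coh A).obj (((Q A).obj M)⟦n⟧) :=
    (cohIso A).symm.app (M⟦n⟧) ≪≫ (coh A).mapIso (((Q A).commShiftIso n).app M)
  constructor
  · intro h
    have h₀ := h 0
    have := finite_of_iso ((e 0).symm ≪≫ (DGModule.coh A).mapIso (shiftZeroIso M))
    exact this
  · intro h n
    have h₁ : LinearMap.ker M.d ≤ LinearMap.ker (M.shift n).d := fun x hx => by
      change (-1 : ℂ) ^ n • M.d x = 0
      rw [LinearMap.mem_ker.1 hx, smul_zero]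
    have h₂ : Module.Finite ℂ (Coh (M.shift n)) := by
      refine Module.Finite.of_surjective (Submodule.mapQ ((LinearMap.range M.d).submoduleOf _)
        ((LinearMap.range (M.shift n).d).submoduleOf _) (Submodule.inclusion h₁) ?_) ?_
      · rintro ⟨_, hx⟩ ⟨y, rfl⟩
        exact ⟨((-1 : ℂ) ^ n • y : M.carrier), by
          change (-1 : ℂ) ^ n • M.d ((-1 : ℂ) ^ n • y) = M.d y
          rw [map_smul, sign_smul_smul]⟩
      · intro x
        obtain ⟨⟨x, hx⟩, rfl⟩ := Submodule.Quotient.mk_surjective _ x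
        have hx' : M.d x = 0 := by
          have h : (-1 : ℂ) ^ n • M.d x = 0 := hx
          rw [← sign_smul_smul n (M.d x), h, smul_zero]
        exact ⟨Submodule.Quotient.mk ⟨x, hx'⟩, rfl⟩
    have h₃ : Module.Finite ℂ ((DGModule.coh A).obj (M⟦n⟧)) := h₂
    exact finite_of_iso (e n)

lemma isZero_of_cohZero {X : DerCat A} (h : ∀ n, CohZero X n) : IsZero X := by
  obtain ⟨M, ⟨e⟩⟩ := exists_iso_Q X
  refine IsZero.of_iso (isZero_of_acyclic (M := M) (acyclic_of_homogeneous fun n => ?_)) e.symm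
  exact (cohZero_Q_iff M n).1 ((h n).of_iso e.symm)

lemma exists_cohZero_bound {X : DerCat A} (hX : fd A X) :
    ∃ N : ℕ, ∀ n : ℤ, N < |n| → CohZero X n := by
  obtain ⟨M, ⟨e⟩⟩ := exists_iso_Q X
  have h : Module.Finite ℂ (Coh M) := (fd_Q_iff M).1 ((fd A).prop_of_iso e.symm hX)
  suffices H : ∃ N : ℕ, ∀ z : LinearMap.ker M.d, ∀ n : ℤ, N < |n| →
      proj M.isInternal n (z : M.carrier) ∈ LinearMap.range M.d by
    obtain ⟨N, hN⟩ := H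
    refine ⟨N, fun n hn => ((cohZero_Q_iff M n).2 fun x hx hx' => ?_).of_iso e⟩
    have := hN ⟨x, hx'⟩ n hn
    rwa [proj_of_mem _ hx] at this
  obtain ⟨k, s, hs⟩ := Module.Finite.exists_fin (R := ℂ) (M := Coh M)
  choose z hz using fun i => Submodule.Quotient.mk_surjective _ (s i)
  choose N hN using fun i => exists_bound M.isInternal (z i : M.carrier)
  refine ⟨∑ i, N i, fun w n hn => ?_⟩
  have hw : (Submodule.Quotient.mk w : Coh M) ∈ Submodule.span ℂ (Set.range s) := by
    rw [hs]
    trivial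
  let φ : LinearMap.ker M.d →ₗ[ℂ] M.carrier := proj M.isInternal n ∘ₗ Submodule.subtype _
  let R : Submodule ℂ (Coh M) := ((LinearMap.range M.d).comap φ).map (Submodule.mkQ _)
  have hR : Submodule.span ℂ (Set.range s) ≤ R := by
    rw [Submodule.span_le]
    rintro _ ⟨i, rfl⟩
    refine ⟨z i, ?_, hz i⟩
    have : φ (z i) = 0 := hN i n (lt_of_le_of_lt (by
      exact_mod_cast Finset.single_le_sum (f := N) (fun _ _ => Nat.zero_le _)
        (Finset.mem_univ i)) hn)
    exact (LinearMap.range M.d).mem_comap.2 (this ▸ zero_mem _)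
  obtain ⟨w', hw', e'⟩ := hR hw
  obtain ⟨y, hy⟩ := (Submodule.Quotient.eq _).1 e'
  have h₁ : M.d y = (w' : M.carrier) - w := hy
  have h₂ : (w : M.carrier) = w' - M.d y := by rw [h₁]; abel
  rw [h₂, map_sub]
  refine sub_mem hw' ?_
  have := proj_d M (n - 1) y
  rw [sub_add_cancel] at this
  rw [this]
  exact ⟨_, rfl⟩

variable [A.Nonpos]

/-- An object with cohomology in degrees `≤ n` is represented by a dg module in degrees `≤ n`. -/
lemma exists_strict {X : DerCat A} {n : ℤ} (h : ∀ m > n, CohZero X m) :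
    ∃ M : DGModule A, Nonempty ((Q A).obj (M.trunc n) ≅ X) := by
  obtain ⟨M, ⟨e⟩⟩ := exists_iso_Q X
  have := (quasiIso_truncι M n fun m hm => (cohZero_Q_iff M m).1 ((h m hm).of_iso e.symm)).isIso
  exact ⟨M, ⟨asIso ((Q A).map (M.truncι n)) ≪≫ e⟩⟩

lemma homZero_of_cohZero {X Y : DerCat A} {n : ℤ} (hX : ∀ m > n, CohZero X m)
    (hY : ∀ m ≤ n, CohZero Y m) : HomZero X Y := by
  obtain ⟨M, ⟨e⟩⟩ := exists_strict hX
  obtain ⟨N, ⟨e'⟩⟩ := exists_iso_Q Y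
  refine HomZero.of_iso (fun f => ?_) e e'
  obtain ⟨N', g, s, hs, hf⟩ := exists_fraction f
  have := hs.isIso
  have h₀ : IsZero ((Q A).obj (N'.trunc n)) := isZero_of_acyclic (acyclic_trunc N' n fun m hm =>
    (cohZero_Q_iff N' m).1 ((hY m hm).of_iso (e'.symm ≪≫ asIso ((Q A).map s))))
  rw [← cancel_mono ((Q A).map s), hf, zero_comp,
    ← truncLift_ι g (fun m hm x hx => trunc_gr_eq_zero M n hm hx), Functor.map_comp,
    h₀.eq_of_tgt ((Q A).map _) 0, zero_comp]

lemma exists_trunc_triangle (M : DGModule A) (n : ℤ) :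
    ∃ h : (Q A).obj (cone (M.truncι n)) ⟶ ((Q A).obj (M.trunc n))⟦(1 : ℤ)⟧,
      Triangle.mk ((Q A).map (M.truncι n)) ((Q A).map (inr (M.truncι n))) h ∈
        distTriang (DerCat A) :=
  ⟨_, (HoCat.qis A).Q.map_distinguished _ (HoCat.triangleh_dist (M.truncι n))⟩

variable (A) in
/-- The standard t-structure. -/
def tStr : Triangulated.TStructure (DerCat A) where
  le n X := ∀ m > n, CohZero X m
  ge n X := ∀ m < n, CohZero X m
  le_isClosedUnderIsomorphisms n := ⟨fun e h m hm => (h m hm).of_iso e⟩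
  ge_isClosedUnderIsomorphisms n := ⟨fun e h m hm => (h m hm).of_iso e⟩
  le_shift n a n' h X hX m hm := (cohZero_shift_iff X a (m + a) m rfl).2 (hX _ (by lia))
  ge_shift n a n' h X hX m hm := (cohZero_shift_iff X a (m + a) m rfl).2 (hX _ (by lia))
  zero' X Y f hX hY := homZero_of_cohZero hX (fun m hm => hY m (by lia)) f
  le_zero_le X hX m hm := hX m (by lia)
  ge_one_le X hX m hm := hX m (by lia)
  exists_triangle_zero_one X := by
    obtain ⟨M, ⟨e⟩⟩ := exists_iso_Q X
    obtain ⟨h, H⟩ := exists_trunc_triangle M 0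
    refine ⟨_, _, fun m hm => (cohZero_Q_iff _ m).2 (cohZero_trunc M 0 hm),
      fun m hm => (cohZero_Q_iff _ m).2 (cohZero_cone_trunc M 0 (by lia)),
      _, _, h, dist_of_iso₂ H e⟩

lemma fd_trunc {M : DGModule A} (h : fd A ((Q A).obj M)) (n : ℤ) :
    fd A ((Q A).obj (M.trunc n)) := by
  rw [fd_Q_iff] at h ⊢
  exact Module.Finite.of_injective _ (coh_trunc_injective M n)

instance : (fd A).HasInducedTStructure (tStr A) where
  exists_triangle_zero_one X hX := by
    obtain ⟨M, ⟨e⟩⟩ := exists_iso_Q X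
    obtain ⟨h, H⟩ := exists_trunc_triangle M 0
    have hM := (fd A).prop_of_iso e.symm hX
    have h₁ := fd_trunc hM 0
    have h₃ : fd A ((Q A).obj (cone (M.truncι 0))) := (fd A).ext_of_isTriangulatedClosed₃ _ H h₁ hM
    refine ⟨_, _, ⟨fun m hm => (cohZero_Q_iff _ m).2 (cohZero_trunc M 0 hm)⟩,
      ⟨fun m hm => (cohZero_Q_iff _ m).2 (cohZero_cone_trunc M 0 (by lia))⟩,
      _, _, h, dist_of_iso₂ H e,
      (fd A).le_isoClosure _ h₁, (fd A).le_isoClosure _ h₃⟩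

variable (A) in
/-- The standard t-structure on the objects with finite-dimensional total cohomology. -/
def tFd : Triangulated.TStructure (Dfd A) := (fd A).tStructure (tStr A)

lemma tFd_heart_iff (X : Dfd A) : (tFd A).heart X ↔ ∀ n ≠ 0, CohZero X.obj n := by
  constructor
  · rintro ⟨h₁, h₂⟩ n hn
    obtain hn | hn := hn.lt_or_gt
    · exact h₂ n hn
    · exact h₁ n hn
  · intro h
    exact ⟨fun n hn => h n hn.ne', fun n hn => h n hn.ne⟩

lemma tFd_bounded (X : Dfd A) : (tFd A).bounded X := by
  obtain ⟨N, hN⟩ := exists_cohZero_bound X.property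
  exact ⟨⟨-N, ⟨fun m hm => hN m (by rw [abs_of_neg] <;> lia)⟩⟩,
    ⟨N, ⟨fun m hm => hN m (by rw [abs_of_pos] <;> lia)⟩⟩⟩

end DerCat

end

noncomputable section

open DGModule

namespace DGModule

lemma parity_mem {V : Type*} [AddCommGroup V] [Module ℂ V] {gr : ℤ → Submodule ℂ V}
    (h : DirectSum.IsInternal gr) {n : ℤ} {x : V} (hx : x ∈ gr n) : parity h x ∈ gr n := by
  rw [parity_of_mem h hx]
  exact Submodule.smul_mem _ _ hx

lemma parity_map {V W : Type*} [AddCommGroup V] [Module ℂ V] [AddCommGroup W] [Module ℂ W]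
    {gr : ℤ → Submodule ℂ V} (h : DirectSum.IsInternal gr)
    {gr' : ℤ → Submodule ℂ W} (h' : DirectSum.IsInternal gr') (f : V →ₗ[ℂ] W) (k : ℤ)
    (hf : ∀ n, ∀ x ∈ gr n, f x ∈ gr' (n + k)) (x : V) :
    parity h' (f x) = (-1 : ℂ) ^ k • f (parity h x) := by
  have : parity h' ∘ₗ f = (-1 : ℂ) ^ k • (f ∘ₗ parity h) := linearMap_ext_gr h fun n x hx => by
    simp only [LinearMap.comp_apply, LinearMap.smul_apply]
    rw [parity_of_mem h hx, parity_of_mem h' (hf n x hx), map_smul, smul_smul, ← sign_add,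
      add_comm]
  exact LinearMap.congr_fun this x

variable {A : DGAlgebra}

/-- The sign operator of a dg module. -/
def sig (M : DGModule A) : M.carrier →ₗ[ℂ] M.carrier := parity M.isInternal

lemma sig_of_mem {M : DGModule A} {n : ℤ} {x : M.carrier} (hx : x ∈ M.gr n) :
    M.sig x = (-1 : ℂ) ^ n • x := parity_of_mem M.isInternal hx

lemma sig_mem {M : DGModule A} {n : ℤ} {x : M.carrier} (hx : x ∈ M.gr n) : M.sig x ∈ M.gr n :=
  parity_mem M.isInternal hx

lemma sig_sig {M : DGModule A} (x : M.carrier) : M.sig (M.sig x) = x := by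
  refine induction_gr M.isInternal (P := fun x => M.sig (M.sig x) = x) (fun n x hx => ?_)
    (fun x y hx hy => by rw [map_add, map_add, hx, hy]) x
  rw [sig_of_mem (sig_mem hx), sig_of_mem hx, sign_smul_smul]

lemma sig_d {M : DGModule A} (x : M.carrier) : M.sig (M.d x) = -M.d (M.sig x) := by
  have := parity_map M.isInternal M.isInternal M.d 1 (fun _ _ hx => M.d_mem hx) x
  rw [zpow_one, neg_smul, one_smul] at this
  exact this

lemma sig_smul {M : DGModule A} {k : ℤ} {a : A.carrier} (ha : a ∈ A.gr k) (x : M.carrier) :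
    M.sig (MulOpposite.op a • x) = (-1 : ℂ) ^ k • MulOpposite.op a • M.sig x :=
  parity_map M.isInternal M.isInternal (DistribSMul.toLinearMap ℂ M.carrier (MulOpposite.op a)) k
    (fun _ _ hx => M.smul_mem hx ha) x

lemma leibniz_sig {M : DGModule A} (x : M.carrier) (a : A.carrier) :
    M.d (MulOpposite.op a • x) = MulOpposite.op a • M.d x + MulOpposite.op (A.d a) • M.sig x := by
  refine induction_gr M.isInternal (P := fun x => M.d (MulOpposite.op a • x) =
    MulOpposite.op a • M.d x + MulOpposite.op (A.d a) • M.sig x) (fun n x hx => ?_)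
    (fun x y hx hy => ?_) x
  · rw [M.leibniz a hx, sig_of_mem hx, smul_comm]
  · rw [smul_add, map_add, hx, hy, map_add, map_add, smul_add, smul_add]
    abel

lemma sig_hasDeg {M N : DGModule A} {k : ℤ} {h : M.carrier →ₗ[A.carrierᵐᵒᵖ] N.carrier}
    (hh : HasDeg k h) (x : M.carrier) : N.sig (h x) = (-1 : ℂ) ^ k • h (M.sig x) :=
  parity_map M.isInternal N.isInternal (h.restrictScalars ℂ) k hh x

lemma op_sum_smul {K : Type} [Fintype K] (f : K → A.carrier) {M : DGModule A} (x : M.carrier) :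
    MulOpposite.op (∑ k, f k) • x = ∑ k, MulOpposite.op (f k) • x := by
  refine (Finset.sum_smul (f := fun k => MulOpposite.op (f k)) (x := x)
    (s := Finset.univ)).symm ▸ ?_
  congr 1
  exact map_sum (MulOpposite.opAddEquiv (α := A.carrier)) f Finset.univ

lemma d_op_smul {M : DGModule A} (c : ℂ) (a : A.carrier) (x : M.carrier) :
    MulOpposite.op (c • a) • x = c • MulOpposite.op a • x := by
  rw [MulOpposite.op_smul, smul_assoc]

lemma op_mul_smul {M : DGModule A} (a b : A.carrier) (x : M.carrier) :
    MulOpposite.op (a * b) • x = MulOpposite.op b • MulOpposite.op a • x := by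
  rw [MulOpposite.op_mul, mul_smul]

end DGModule

/-- A dg bimodule which is finitely generated and projective as a left module, presented by the
matrices of the right action and of the differential with respect to a system of generators:
`b_k = ε_k b_k` has degree `- w k`, `b_k a = ∑ R(a)_{kl} b_l` and `d b_k = ∑ c_{kl} b_l`. -/
structure MatrixBimodule (A : DGAlgebra) where
  K : Type
  [fintype : Fintype K]
  [decidableEq : DecidableEq K]
  ε : K → A.carrier
  w : K → ℤ
  R : A.carrier →ₗ[ℂ] K → K → A.carrier
  c : K → K → A.carrier
  ε_mem k : ε k ∈ A.gr 0
  d_ε k : A.d (ε k) = 0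
  ε_ε k : ε k * ε k = ε k
  R_right a k l : R a k l * ε l = R a k l
  R_one k l : R 1 k l = if k = l then ε k else 0
  R_mul a b k l : R (a * b) k l = ∑ p, R a k p * R b p l
  R_mem {n a} (ha : a ∈ A.gr n) k l : R a k l ∈ A.gr (n + w l - w k)
  c_right k l : c k l * ε l = c k l
  c_mem k l : c k l ∈ A.gr (1 + w l - w k)
  d_c k l : A.d (c k l) = ∑ p, (-1 : ℂ) ^ (w k + w p) • (c k p * c p l)
  d_R {n a} (ha : a ∈ A.gr n) k l :
    A.d (R a k l) + ∑ p, (-1 : ℂ) ^ (n + w p - w k) • (R a k p * c p l) =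
      ∑ p, c k p * R a p l + (-1 : ℂ) ^ (w k) • R (A.d a) k l

attribute [instance] MatrixBimodule.fintype MatrixBimodule.decidableEq

namespace MatrixBimodule

variable {A : DGAlgebra} (B : MatrixBimodule A) (M : DGModule A)

/-- The vector space underlying the tensor product of `M` and a matrix bimodule. -/
def space : Submodule ℂ (B.K → M.carrier) where
  carrier := {m | ∀ k, MulOpposite.op (B.ε k) • m k = m k}
  add_mem' hx hy k := by rw [Pi.add_apply, smul_add, hx, hy]
  zero_mem' k := smul_zero _
  smul_mem' c x hx k := by rw [Pi.smul_apply, smul_comm, hx]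

variable {B M} in
@[ext] lemma space_ext {x y : B.space M} (h : ∀ k, x.1 k = y.1 k) : x = y :=
  Subtype.ext (funext h)

/-- The right action. -/
def act (a : A.carrier) : B.space M →ₗ[ℂ] B.space M where
  toFun m := ⟨fun l => ∑ k, MulOpposite.op (B.R a k l) • m.1 k, fun l => by
    rw [Finset.smul_sum]
    exact Finset.sum_congr rfl fun k _ => by rw [← op_mul_smul, B.R_right]⟩
  map_add' x y := space_ext fun l => by simp [Finset.sum_add_distrib]
  map_smul' r x := space_ext fun l => by simp [Finset.smul_sum, smul_comm r]

lemma act_apply (a : A.carrier) (m : B.space M) (l : B.K) :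
    (B.act M a m).1 l = ∑ k, MulOpposite.op (B.R a k l) • m.1 k := rfl

/-- The differential. -/
def diff : B.space M →ₗ[ℂ] B.space M where
  toFun m := ⟨fun l => M.d (m.1 l) + ∑ k, MulOpposite.op (B.c k l) • M.sig (m.1 k), fun l => by
    rw [smul_add, Finset.smul_sum]
    congr 1
    · conv_rhs => rw [← m.2 l, leibniz_sig, B.d_ε]
      simp
    · exact Finset.sum_congr rfl fun k _ => by rw [← op_mul_smul, B.c_right]⟩
  map_add' x y := space_ext fun l => by simp [Finset.sum_add_distrib, add_add_add_comm]
  map_smul' r x := space_ext fun l => by simp [Finset.smul_sum, smul_comm r]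

lemma diff_apply (m : B.space M) (l : B.K) :
    (B.diff M m).1 l = M.d (m.1 l) + ∑ k, MulOpposite.op (B.c k l) • M.sig (m.1 k) := rfl

/-- The grading. -/
def grading (n : ℤ) : Submodule ℂ (B.space M) where
  carrier := {m | ∀ k, m.1 k ∈ M.gr (n + B.w k)}
  add_mem' hx hy k := add_mem (hx k) (hy k)
  zero_mem' _ := zero_mem _
  smul_mem' _ _ hx k := Submodule.smul_mem _ _ (hx k)

lemma isInternal : DirectSum.IsInternal (B.grading M) := by
  refine isInternal_of_detect (Submodule.subtype _) Subtype.val_injective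
    (fun n => LinearMap.pi fun k => proj M.isInternal (n + B.w k) ∘ₗ LinearMap.proj (φ := fun _ => M.carrier) k ∘ₗ
      (B.space M).subtype) (fun n x hx => funext fun k => proj_of_mem _ (hx k))
    (fun m n hmn x hx => funext fun k => proj_of_mem_ne _ (by lia) (hx k)) (fun x => ?_)
  let s (k : B.K) : M.carrier →ₗ[ℂ] B.space M :=
    { toFun x := ⟨Pi.single k (MulOpposite.op (B.ε k) • x), fun l => by
        by_cases h : k = l
        · subst h
          rw [Pi.single_eq_same, ← op_mul_smul, B.ε_ε]
        · rw [Pi.single_eq_of_ne (Ne.symm h), smul_zero]⟩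
      map_add' x y := Subtype.ext (by
        change Pi.single k _ = Pi.single k _ + Pi.single k _
        rw [smul_add, Pi.single_add])
      map_smul' r x := Subtype.ext (by
        change Pi.single k _ = r • Pi.single k _
        rw [smul_comm, Pi.single_smul]) }
  have hs (k : B.K) (x : M.carrier) : s k x ∈ ⨆ n, B.grading M n := by
    refine induction_gr M.isInternal (P := fun x => s k x ∈ ⨆ n, B.grading M n)
      (fun n x hx => Submodule.mem_iSup_of_mem (n - B.w k) fun l => ?_)
      (fun x y hx hy => by rw [map_add]; exact add_mem hx hy) x
    by_cases h : k = l
    · subst h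
      change (Pi.single k (MulOpposite.op (B.ε k) • x) : B.K → M.carrier) k ∈ _
      rw [Pi.single_eq_same, sub_add_cancel]
      simpa using M.smul_mem hx (B.ε_mem k)
    · change (Pi.single k (MulOpposite.op (B.ε k) • x) : B.K → M.carrier) l ∈ _
      rw [Pi.single_eq_of_ne (Ne.symm h)]
      exact zero_mem _
  have hx : x = ∑ k, s k (x.1 k) := Subtype.ext (by
    rw [AddSubmonoidClass.coe_finsetSum]
    change x.1 = ∑ k, Pi.single k (MulOpposite.op (B.ε k) • x.1 k)
    simp only [x.2 _]
    exact (Finset.univ_sum_single x.1).symm)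
  rw [hx]
  exact Submodule.sum_mem _ fun k _ => hs k _

lemma diff_diff (m : B.space M) : B.diff M (B.diff M m) = 0 := by
  refine space_ext fun l => ?_
  rw [diff_apply, diff_apply, map_add, M.d_d, zero_add, map_sum]
  change _ = (0 : M.carrier)
  have h₁ k : M.d (MulOpposite.op (B.c k l) • M.sig (m.1 k)) =
      - MulOpposite.op (B.c k l) • M.sig (M.d (m.1 k)) +
        ∑ p, (-1 : ℂ) ^ (B.w k + B.w p) •
          MulOpposite.op (B.c p l) • MulOpposite.op (B.c k p) • m.1 k := by
    rw [leibniz_sig, sig_sig, B.d_c, op_sum_smul, sig_d, neg_smul_neg]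
    congr 1
    exact Finset.sum_congr rfl fun p _ => by rw [d_op_smul, op_mul_smul]
  have h₂ k : MulOpposite.op (B.c k l) • M.sig ((B.diff M m).1 k) =
      MulOpposite.op (B.c k l) • M.sig (M.d (m.1 k)) -
        ∑ p, (-1 : ℂ) ^ (B.w p + B.w k) •
          MulOpposite.op (B.c k l) • MulOpposite.op (B.c p k) • m.1 p := by
    rw [diff_apply, map_add, smul_add, map_sum, Finset.smul_sum, sub_eq_add_neg,
      ← Finset.sum_neg_distrib]
    congr 1
    refine Finset.sum_congr rfl fun p _ => ?_
    rw [sig_smul (B.c_mem p k), sig_sig, smul_comm, ← neg_smul]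
    congr 1
    rw [show 1 + B.w k - B.w p = (B.w p + B.w k) + 1 - 2 * B.w p by ring,
      zpow_sub₀ (by norm_num), sign_succ, zpow_mul]
    simp
  simp only [h₁, h₂, neg_smul]
  rw [Finset.sum_add_distrib, Finset.sum_sub_distrib, Finset.sum_neg_distrib,
    Finset.sum_comm (f := fun k p => (-1 : ℂ) ^ (B.w k + B.w p) •
          MulOpposite.op (B.c p l) • MulOpposite.op (B.c k p) • m.1 k)]
  abel

lemma leibniz {n : ℤ} {m : B.space M} (a : A.carrier) (hm : m ∈ B.grading M n) :
    B.diff M (B.act M a m) = B.act M a (B.diff M m) +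
      (-1 : ℂ) ^ n • B.act M (A.d a) m := by
  refine induction_gr A.isInternal (P := fun a => B.diff M (B.act M a m) =
    B.act M a (B.diff M m) + (-1 : ℂ) ^ n • B.act M (A.d a) m) (fun j a ha => ?_)
    (fun a b h₁ h₂ => ?_) a
  · refine space_ext fun l => ?_
    have e : (B.act M a (B.diff M m) + (-1 : ℂ) ^ n • B.act M (A.d a) m).1 l =
      (B.act M a (B.diff M m)).1 l + (-1 : ℂ) ^ n • (B.act M (A.d a) m).1 l := rfl
    rw [e, diff_apply, act_apply, act_apply, act_apply]
    have h₁ k : M.d (MulOpposite.op (B.R a k l) • m.1 k) = MulOpposite.op (B.R a k l) • M.d (m.1 k)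
        + MulOpposite.op (A.d (B.R a k l)) • M.sig (m.1 k) := leibniz_sig _ _
    have h₂ p : MulOpposite.op (B.c p l) • M.sig ((B.act M a m).1 p) =
        ∑ k, MulOpposite.op ((-1 : ℂ) ^ (j + B.w p - B.w k) • (B.R a k p * B.c p l)) •
          M.sig (m.1 k) := by
      rw [act_apply, map_sum, Finset.smul_sum]
      refine Finset.sum_congr rfl fun k _ => ?_
      rw [sig_smul (B.R_mem ha k p), d_op_smul, op_mul_smul, smul_comm]
    have h₃ k : MulOpposite.op (B.R a k l) • (B.diff M m).1 k = MulOpposite.op (B.R a k l) •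
        M.d (m.1 k) + ∑ p, MulOpposite.op (B.c p k * B.R a k l) • M.sig (m.1 p) := by
      rw [diff_apply, smul_add, Finset.smul_sum]
      simp only [op_mul_smul]
    have h₄ k : (-1 : ℂ) ^ n • MulOpposite.op (B.R (A.d a) k l) • m.1 k =
        MulOpposite.op ((-1 : ℂ) ^ (B.w k) • B.R (A.d a) k l) • M.sig (m.1 k) := by
      rw [sig_of_mem (hm k), d_op_smul, smul_comm _ ((-1 : ℂ) ^ (n + B.w k)), smul_smul,
        sign_add, mul_comm ((-1 : ℂ) ^ n), ← mul_assoc, sign_mul_self, one_mul]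
    rw [map_sum, Finset.smul_sum]
    simp only [h₁, h₂, h₃, h₄]
    rw [Finset.sum_add_distrib, Finset.sum_add_distrib, add_assoc, add_assoc]
    congr 1
    rw [Finset.sum_comm, Finset.sum_comm (f := fun k p => MulOpposite.op (B.c p k * B.R a k l) •
      M.sig (m.1 p)), ← Finset.sum_add_distrib, ← Finset.sum_add_distrib]
    refine Finset.sum_congr rfl fun k _ => ?_
    rw [← op_sum_smul, ← op_sum_smul, ← add_smul, ← add_smul, ← MulOpposite.op_add, ← MulOpposite.op_add,
      B.d_R ha k l]
  · have e (x y : A.carrier) (m : B.space M) : B.act M (x + y) m = B.act M x m + B.act M y m :=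
      space_ext fun l => by
        change ∑ k, MulOpposite.op (B.R (x + y) k l) • m.1 k =
          ∑ k, MulOpposite.op (B.R x k l) • m.1 k + ∑ k, MulOpposite.op (B.R y k l) • m.1 k
        rw [← Finset.sum_add_distrib]
        exact Finset.sum_congr rfl fun k _ => by
          rw [map_add, Pi.add_apply, Pi.add_apply, MulOpposite.op_add, add_smul]
    rw [e, map_add, h₁, h₂, e, map_add, e, smul_add]
    abel

/-- The right module structure. -/
@[reducible]
def rightModule : Module A.carrierᵐᵒᵖ (B.space M) where
  smul a m := B.act M a.unop m
  one_smul m := space_ext fun l => by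
    change ∑ k, MulOpposite.op (B.R 1 k l) • m.1 k = m.1 l
    rw [Finset.sum_eq_single l]
    · rw [B.R_one, if_pos rfl, m.2]
    · intro k _ hk
      rw [B.R_one, if_neg hk, MulOpposite.op_zero, zero_smul]
    · simp
  mul_smul a b m := space_ext fun l => by
    change ∑ k, MulOpposite.op (B.R (b.unop * a.unop) k l) • m.1 k =
      ∑ p, MulOpposite.op (B.R a.unop p l) • ∑ k, MulOpposite.op (B.R b.unop k p) • m.1 k
    simp only [B.R_mul, op_sum_smul, op_mul_smul, Finset.smul_sum]
    exact Finset.sum_comm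
  smul_zero a := map_zero (B.act M a.unop)
  smul_add a := map_add (B.act M a.unop)
  add_smul a b m := space_ext fun l => by
    change ∑ k, MulOpposite.op (B.R (a.unop + b.unop) k l) • m.1 k =
      ∑ k, MulOpposite.op (B.R a.unop k l) • m.1 k + ∑ k, MulOpposite.op (B.R b.unop k l) • m.1 k
    rw [← Finset.sum_add_distrib]
    exact Finset.sum_congr rfl fun k _ => by
      rw [map_add, Pi.add_apply, Pi.add_apply, MulOpposite.op_add, add_smul]
  zero_smul m := space_ext fun l => by
    change ∑ k, MulOpposite.op (B.R 0 k l) • m.1 k = 0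
    simp

/-- The dg module `M ⊗ B`. -/
def obj : DGModule A :=
  let inst := B.rightModule M
  { carrier := B.space M
    rightModule := inst
    isScalarTower := ⟨fun r a m => space_ext fun l => by
      change ∑ k, MulOpposite.op (B.R (r • a.unop) k l) • m.1 k =
        r • ∑ k, MulOpposite.op (B.R a.unop k l) • m.1 k
      rw [Finset.smul_sum, map_smul]
      exact Finset.sum_congr rfl fun k _ => d_op_smul _ _ _⟩
    gr := B.grading M
    isInternal := B.isInternal M
    smul_mem := fun {p n m a} hm ha l => by
      refine Submodule.sum_mem (M.gr (p + n + B.w l)) fun k _ => ?_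
      have := M.smul_mem (hm k) (B.R_mem ha k l)
      rwa [show p + B.w k + (n + B.w l - B.w k) = p + n + B.w l by ring] at this
    d := B.diff M
    d_mem := fun {n m} hm l => by
      refine add_mem ?_ (Submodule.sum_mem (M.gr (n + 1 + B.w l)) fun k _ => ?_)
      · have := M.d_mem (hm l)
        rwa [add_right_comm] at this
      · have := M.smul_mem (sig_mem (hm k)) (B.c_mem k l)
        rwa [show n + B.w k + (1 + B.w l - B.w k) = n + 1 + B.w l by ring] at this
    d_d := B.diff_diff M
    leibniz := fun a hm => B.leibniz M a hm }

variable {M} in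
/-- Functoriality in all linear maps. -/
def mapLin {N : DGModule A} (h : M.carrier →ₗ[A.carrierᵐᵒᵖ] N.carrier) :
    (B.obj M).carrier →ₗ[A.carrierᵐᵒᵖ] (B.obj N).carrier where
  toFun m := ⟨fun k => h (m.1 k), fun k => by rw [← map_smul, m.2]⟩
  map_add' x y := space_ext fun k => map_add h _ _
  map_smul' a m := space_ext fun l => by
    change h (∑ k, _) = ∑ k, _
    rw [map_sum]
    exact Finset.sum_congr rfl fun k _ => map_smul h _ _

/-- The dg functor `- ⊗ B`. -/
def tensor : DGFunctor A where
  obj := B.obj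
  map {M N} :=
    { toFun h := B.mapLin h
      map_add' _ _ := rfl
      map_smul' _ _ := rfl }
  map_id _ := rfl
  map_comp _ _ := rfl
  hasDeg {M N k h} hh n m hm l := by
    have := hh _ _ (hm l)
    rwa [add_right_comm] at this
  isDiff {M N k h h'} hh hd m := space_ext fun l => by
    have e : (show B.space N from
        (B.obj N).d (B.mapLin h m) - (-1 : ℂ) ^ k • B.mapLin h ((B.obj M).d m)).1 l =
      (N.d (h (m.1 l)) + ∑ p, MulOpposite.op (B.c p l) • N.sig (h (m.1 p))) -
        (-1 : ℂ) ^ k • h (M.d (m.1 l) + ∑ p, MulOpposite.op (B.c p l) • M.sig (m.1 p)) := rfl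
    refine Eq.trans ?_ e.symm
    have e₁ p : MulOpposite.op (B.c p l) • N.sig (h (m.1 p)) =
        (-1 : ℂ) ^ k • h (MulOpposite.op (B.c p l) • M.sig (m.1 p)) := by
      rw [sig_hasDeg hh, smul_comm, map_smul]
    simp only [e₁]
    rw [← Finset.smul_sum, ← map_sum, map_add, smul_add, add_sub_add_right_eq_sub]
    exact hd (m.1 l)

end MatrixBimodule

end

noncomputable section

namespace Ginzburg

open Gen DGModule

instance : DecidableEq Gen := Classical.decEq _

instance : DGAlgebra.Nonpos ginzburgA₂ where
  eq_zero n hn x hx := by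
    refine gr_induction (P := fun x => x = 0) (fun l hl => ?_) rfl
      (fun x y hx hy => by rw [hx, hy, add_zero]) (fun c x hx => by rw [hx, smul_zero]) hx
    have : wdeg l ≤ 0 := by
      clear hl
      induction l with
      | nil => simp [wdeg]
      | cons x l ih =>
        have h : wdeg (x :: l) = x.deg + wdeg l := by simp [wdeg]
        have h' : x.deg ≤ 0 := by cases x <;> simp [Gen.deg]
        lia
    lia

/-- The other vertex. -/
def opp (i : Fin 2) : Fin 2 := i + 1

/-- The arrow with source `i`. -/
def out (i : Fin 2) : Gen := if i = 0 then a else b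

/-- The arrow with target `i`. -/
def inn (i : Fin 2) : Gen := if i = 0 then b else a

/-- The sign of the vertex `i`. -/
def sg (i : Fin 2) : ℂ := if i = 0 then 1 else -1

lemma sg_sg (i : Fin 2) (V : Type*) [AddCommGroup V] [Module ℂ V] (x : V) :
    sg i • sg i • x = x := by
  fin_cases i <;> simp [sg]

variable (i : Fin 2)

lemma src_out : (out i).src = i := by fin_cases i <;> rfl
lemma tgt_out : (out i).tgt = opp i := by fin_cases i <;> rfl
lemma src_inn : (inn i).src = opp i := by fin_cases i <;> rfl
lemma tgt_inn : (inn i).tgt = i := by fin_cases i <;> rfl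
lemma opp_ne : opp i ≠ i := by fin_cases i <;> decide

lemma sign_out : (-1 : ℂ) ^ (out i).deg = sg i := by fin_cases i <;> simp [out, sg, Gen.deg]

lemma deg_out_inn : (out i).deg + (inn i).deg = -1 := by
  fin_cases i <;> simp [out, inn, Gen.deg]

lemma e_add_opp : g (e i) + g (e (opp i)) = 1 := by
  fin_cases i
  · exact g_one
  · exact (add_comm _ _).trans g_one

lemma e_e : g (e i) * g (e i) = g (e i) := g_src (e i)

lemma e_opp : g (e i) * g (e (opp i)) = 0 := by
  have h := congrArg (g (e i) * ·) (e_add_opp i)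
  simp only [mul_add, e_e, mul_one] at h
  exact add_eq_left.1 h

lemma opp_e : g (e (opp i)) * g (e i) = 0 := by
  have h := congrArg (· * g (e i)) (e_add_opp i)
  simp only [add_mul, e_e, one_mul] at h
  exact add_eq_left.1 h

lemma d_t : d (g (t i)) = sg i • (g (out i) * g (inn i)) := by
  rw [d_g]
  fin_cases i <;> simp [dGen, sg, out, inn]

lemma d_e : d (g (e i)) = 0 := d_g _

lemma d_out : d (g (out i)) = 0 := by
  rw [d_g]; fin_cases i <;> rfl

lemma d_inn : d (g (inn i)) = 0 := by
  rw [d_g]; fin_cases i <;> rfl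

lemma char_e (k : Fin 2) : char i (g (e k)) = if k = i then 1 else 0 := by
  rw [char, lift_g]

lemma char_eq_zero {x : Gen} (hx : ∀ k, x ≠ e k) : char i (g x) = 0 := by
  rw [char, lift_g]
  cases x <;> simp_all

lemma char_self : char i (g (e i)) = 1 := by rw [char_e, if_pos rfl]

lemma char_opp : char i (g (e (opp i))) = 0 := by rw [char_e, if_neg (opp_ne i)]

/-- The arrows at which derivations are considered. -/
def IsArrow (x : Gen) : Prop := ∀ k, x ≠ e k

lemma isArrow_out : IsArrow (out i) := fun k => by fin_cases i <;> simp [out]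
lemma isArrow_inn : IsArrow (inn i) := fun k => by fin_cases i <;> simp [inn]
lemma isArrow_t : IsArrow (t i) := fun k => by simp

section RightDer

variable {γ : Gen} (hγ : IsArrow γ)

/-- The algebra morphism encoding `rightDer`. -/
def rightMat : Alg →ₐ[ℂ] Matrix (Fin 2) (Fin 2) Alg :=
  lift (fun x => !![algebraMap ℂ Alg (char γ.src (g x)), if x = γ then g (e γ.tgt) else 0; 0, g x])
    (by
      rw [if_neg (hγ 0).symm, if_neg (hγ 1).symm]
      ext i j
      fin_cases i <;> fin_cases j <;> simp [g_one, ← map_add])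
    (fun x => by
      rw [if_neg (hγ _).symm]
      by_cases hx : x = γ
      · subst hx
        simp [char_self, g_src, char_eq_zero _ hγ]
      · simp only [hx, if_false, Matrix.mul_fin_two, ← map_mul, g_src]
        simp)
    (fun x => by
      rw [if_neg (hγ _).symm]
      by_cases hx : x = γ
      · subst hx
        simp [g_tgt, char_eq_zero _ hγ, e_e]
      · simp only [hx, if_false, Matrix.mul_fin_two, ← map_mul, g_tgt]
        simp)

/-- The map which extracts the paths starting with `γ`. -/
def rightDer : Alg →ₗ[ℂ] Alg where
  toFun x := rightMat hγ x 0 1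
  map_add' x y := by simp
  map_smul' c x := by simp

lemma rightMat_eq (x : Alg) : rightMat hγ x 1 0 = 0 ∧ rightMat hγ x 1 1 = x ∧
    rightMat hγ x 0 0 = algebraMap ℂ Alg (char γ.src x) := by
  refine alg_induction (P := fun x => rightMat hγ x 1 0 = 0 ∧ rightMat hγ x 1 1 = x ∧
    rightMat hγ x 0 0 = algebraMap ℂ Alg (char γ.src x)) (fun c => ?_) (fun x => ?_)
    (fun x y hx hy => ?_) (fun x y hx hy => ?_) x
  · simp [AlgHom.commutes, Matrix.algebraMap_matrix_apply]
  · simp [rightMat]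
  · simp only [map_mul, Matrix.mul_apply, Fin.sum_univ_two, hx.1, hx.2.1, hx.2.2, hy.1, hy.2.1,
      hy.2.2]
    simp
  · simp [hx.1, hx.2, hy.1, hy.2]

lemma rightDer_mul (x y : Alg) :
    rightDer hγ (x * y) = rightDer hγ x * y + char γ.src x • rightDer hγ y := by
  change rightMat hγ (x * y) 0 1 = rightMat hγ x 0 1 * y + char γ.src x • rightMat hγ y 0 1
  rw [map_mul, Matrix.mul_apply, Fin.sum_univ_two, (rightMat_eq hγ x).2.2, (rightMat_eq hγ y).2.1,
    Algebra.smul_def, add_comm]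

lemma rightDer_g (x : Gen) : rightDer hγ (g x) = if x = γ then g (e γ.tgt) else 0 := by
  change rightMat hγ (g x) 0 1 = _
  simp [rightMat]

lemma rightDer_self : rightDer hγ (g γ) = g (e γ.tgt) := by rw [rightDer_g, if_pos rfl]

lemma rightDer_ne {x : Gen} (hx : x ≠ γ) : rightDer hγ (g x) = 0 := by rw [rightDer_g, if_neg hx]

lemma rightDer_one : rightDer hγ 1 = 0 := by
  change rightMat hγ 1 0 1 = 0
  simp

lemma rightDer_mem {n : ℤ} {x : Alg} (hx : x ∈ gr n) : rightDer hγ x ∈ gr (n - γ.deg) := by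
  refine gr_induction (P := fun x => rightDer hγ x ∈ gr (n - γ.deg)) ?_ (by simp)
    (fun x y h h' => by simpa using add_mem h h')
    (fun c x h => by simpa using Submodule.smul_mem _ c h) hx
  clear hx
  rintro l rfl
  induction l with
  | nil =>
    change rightDer hγ 1 ∈ _
    rw [rightDer_one]
    exact zero_mem _
  | cons x l ih =>
    have h : word (x :: l) = g x * word l := by simp [word]
    have h' : wdeg (x :: l) = x.deg + wdeg l := by simp [wdeg]
    rw [h, h', rightDer_mul]
    refine add_mem ?_ ?_
    · rw [rightDer_g]
      split_ifs with hx
      · subst hx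
        rw [add_sub_cancel_left, ← zero_add (wdeg l)]
        exact SetLike.mul_mem_graded (g_mem (e x.tgt)) (word_mem l)
      · rw [zero_mul]
        exact zero_mem _
    · by_cases hx : x.deg = 0
      · rw [hx, zero_add]
        exact Submodule.smul_mem _ _ (ih)
      · rw [char_g hx, zero_smul]
        exact zero_mem _

lemma e_rightDer (x : Alg) : g (e γ.tgt) * rightDer hγ x = rightDer hγ x := by
  refine alg_induction (P := fun x => g (e γ.tgt) * rightDer hγ x = rightDer hγ x)
    (fun c => ?_) (fun x => ?_) (fun x y hx hy => ?_) (fun x y hx hy => ?_) x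
  · rw [Algebra.algebraMap_eq_smul_one, map_smul, rightDer_one, smul_zero, mul_zero]
  · rw [rightDer_g]
    split_ifs <;> simp [e_e]
  · rw [rightDer_mul, mul_add, ← mul_assoc, hx, mul_smul_comm, hy]
  · rw [map_add, mul_add, hx, hy]

/-- The algebra morphism encoding `leftDer`. -/
def leftMat : Alg →ₐ[ℂ] Matrix (Fin 2) (Fin 2) Alg :=
  lift (fun x => !![g x, if x = γ then g (e γ.src) else 0; 0, algebraMap ℂ Alg (char γ.tgt (g x))])
    (by
      rw [if_neg (hγ 0).symm, if_neg (hγ 1).symm]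
      ext i j
      fin_cases i <;> fin_cases j <;> simp [g_one, ← map_add])
    (fun x => by
      rw [if_neg (hγ _).symm]
      by_cases hx : x = γ
      · subst hx
        simp only [if_true, Matrix.mul_fin_two, g_src, char_eq_zero _ hγ, e_e]
        simp
      · simp only [hx, if_false, Matrix.mul_fin_two, ← map_mul, g_src]
        simp)
    (fun x => by
      rw [if_neg (hγ _).symm]
      by_cases hx : x = γ
      · subst hx
        simp only [if_true, Matrix.mul_fin_two, g_tgt, char_self, char_eq_zero _ hγ, map_zero,
          map_one, mul_zero, zero_mul, add_zero, mul_one, zero_add]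
      · simp only [hx, if_false, Matrix.mul_fin_two, ← map_mul, g_tgt]
        simp)

/-- The map which extracts the paths ending with `γ`. -/
def leftDer : Alg →ₗ[ℂ] Alg where
  toFun x := leftMat hγ x 0 1
  map_add' x y := by simp
  map_smul' c x := by simp

lemma leftMat_eq (x : Alg) : leftMat hγ x 1 0 = 0 ∧ leftMat hγ x 0 0 = x ∧
    leftMat hγ x 1 1 = algebraMap ℂ Alg (char γ.tgt x) := by
  refine alg_induction (P := fun x => leftMat hγ x 1 0 = 0 ∧ leftMat hγ x 0 0 = x ∧
    leftMat hγ x 1 1 = algebraMap ℂ Alg (char γ.tgt x)) (fun c => ?_) (fun x => ?_)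
    (fun x y hx hy => ?_) (fun x y hx hy => ?_) x
  · simp [AlgHom.commutes, Matrix.algebraMap_matrix_apply]
  · simp [leftMat]
  · simp only [map_mul, Matrix.mul_apply, Fin.sum_univ_two, hx.1, hx.2.1, hx.2.2, hy.1, hy.2.1,
      hy.2.2]
    simp
  · simp [hx.1, hx.2, hy.1, hy.2]

lemma leftDer_mul (x y : Alg) :
    leftDer hγ (x * y) = x * leftDer hγ y + char γ.tgt y • leftDer hγ x := by
  change leftMat hγ (x * y) 0 1 = x * leftMat hγ y 0 1 + char γ.tgt y • leftMat hγ x 0 1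
  rw [map_mul, Matrix.mul_apply, Fin.sum_univ_two, (leftMat_eq hγ x).2.1, (leftMat_eq hγ y).2.2,
    Algebra.smul_def, Algebra.commutes]

lemma leftDer_g (x : Gen) : leftDer hγ (g x) = if x = γ then g (e γ.src) else 0 := by
  change leftMat hγ (g x) 0 1 = _
  simp [leftMat]

lemma leftDer_self : leftDer hγ (g γ) = g (e γ.src) := by rw [leftDer_g, if_pos rfl]

lemma leftDer_ne {x : Gen} (hx : x ≠ γ) : leftDer hγ (g x) = 0 := by rw [leftDer_g, if_neg hx]

lemma leftDer_one : leftDer hγ 1 = 0 := by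
  change leftMat hγ 1 0 1 = 0
  simp

lemma leftDer_mem {n : ℤ} {x : Alg} (hx : x ∈ gr n) : leftDer hγ x ∈ gr (n - γ.deg) := by
  refine gr_induction (P := fun x => leftDer hγ x ∈ gr (n - γ.deg)) ?_ (by simp)
    (fun x y h h' => by simpa using add_mem h h')
    (fun c x h => by simpa using Submodule.smul_mem _ c h) hx
  clear hx
  rintro l rfl
  induction l with
  | nil =>
    change leftDer hγ 1 ∈ _
    rw [leftDer_one]
    exact zero_mem _
  | cons x l ih =>
    have h : word (x :: l) = g x * word l := by simp [word]
    have h' : wdeg (x :: l) = x.deg + wdeg l := by simp [wdeg]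
    rw [h, h', leftDer_mul]
    refine add_mem ?_ ?_
    · rw [add_sub_assoc]
      exact SetLike.mul_mem_graded (g_mem x) (ih)
    · rw [leftDer_g]
      split_ifs with hx
      · subst hx
        rw [add_sub_cancel_left]
        by_cases hl : wdeg l = 0
        · rw [hl]
          exact Submodule.smul_mem _ _ (g_mem (e x.src))
        · rw [char_word l hl, zero_smul]
          exact zero_mem _
      · rw [smul_zero]
        exact zero_mem _

lemma leftDer_e (x : Alg) : leftDer hγ x * g (e γ.src) = leftDer hγ x := by
  refine alg_induction (P := fun x => leftDer hγ x * g (e γ.src) = leftDer hγ x)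
    (fun c => ?_) (fun x => ?_) (fun x y hx hy => ?_) (fun x y hx hy => ?_) x
  · rw [Algebra.algebraMap_eq_smul_one, map_smul, leftDer_one, smul_zero, zero_mul]
  · rw [leftDer_g]
    split_ifs <;> simp [e_e]
  · rw [leftDer_mul, add_mul, mul_assoc, hy, smul_mul_assoc, hx]
  · rw [map_add, add_mul, hx, hy]

end RightDer

/-- The component at the arrow with source `i` of a path which starts at `i`. -/
def dOut : Alg →ₗ[ℂ] Alg := rightDer (isArrow_out i)

/-- The component at the loop of a path which starts at `i`. -/
def dT : Alg →ₗ[ℂ] Alg := rightDer (isArrow_t i)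

/-- The component at the arrow with target `i` of a path which ends at `i`. -/
def lInn : Alg →ₗ[ℂ] Alg := leftDer (isArrow_inn i)

/-- The component at the loop of a path which ends at `i`. -/
def lT : Alg →ₗ[ℂ] Alg := leftDer (isArrow_t i)

lemma t_ne_out : t i ≠ out i := by fin_cases i <;> simp [out]
lemma t_ne_inn : t i ≠ inn i := by fin_cases i <;> simp [inn]

lemma e_out : g (e i) * g (out i) = g (out i) := by
  have := g_src (out i); rwa [src_out] at this
lemma out_e : g (out i) * g (e (opp i)) = g (out i) := by
  have := g_tgt (out i); rwa [tgt_out] at this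
lemma e_inn : g (e (opp i)) * g (inn i) = g (inn i) := by
  have := g_src (inn i); rwa [src_inn] at this
lemma inn_e : g (inn i) * g (e i) = g (inn i) := by
  have := g_tgt (inn i); rwa [tgt_inn] at this
lemma e_t : g (e i) * g (t i) = g (t i) := g_src (t i)
lemma t_e : g (t i) * g (e i) = g (t i) := g_tgt (t i)

lemma opp_out : g (e (opp i)) * g (out i) = 0 := by rw [← e_out, ← mul_assoc, opp_e, zero_mul]
lemma opp_t : g (e (opp i)) * g (t i) = 0 := by rw [← e_t, ← mul_assoc, opp_e, zero_mul]
lemma inn_opp : g (inn i) * g (e (opp i)) = 0 := by rw [← inn_e, mul_assoc, e_opp, mul_zero]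
lemma t_opp : g (t i) * g (e (opp i)) = 0 := by rw [← t_e, mul_assoc, e_opp, mul_zero]

lemma char_out : char i (g (out i)) = 0 := char_eq_zero _ (isArrow_out i)
lemma char_inn : char i (g (inn i)) = 0 := char_eq_zero _ (isArrow_inn i)
lemma char_t : char i (g (t i)) = 0 := char_eq_zero _ (isArrow_t i)

lemma dOut_mul (x y : Alg) : dOut i (x * y) = dOut i x * y + char i x • dOut i y := by
  have := rightDer_mul (isArrow_out i) x y
  rwa [src_out] at this

lemma dT_mul (x y : Alg) : dT i (x * y) = dT i x * y + char i x • dT i y :=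
  rightDer_mul (isArrow_t i) x y

lemma lInn_mul (x y : Alg) : lInn i (x * y) = x * lInn i y + char i y • lInn i x := by
  have := leftDer_mul (isArrow_inn i) x y
  rwa [tgt_inn] at this

lemma lT_mul (x y : Alg) : lT i (x * y) = x * lT i y + char i y • lT i x :=
  leftDer_mul (isArrow_t i) x y

lemma dOut_out : dOut i (g (out i)) = g (e (opp i)) := by
  have := rightDer_self (isArrow_out i); rwa [tgt_out] at this
lemma dOut_e (k : Fin 2) : dOut i (g (e k)) = 0 := rightDer_ne _ (isArrow_out i k).symm
lemma dOut_t : dOut i (g (t i)) = 0 := rightDer_ne _ (t_ne_out i)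
lemma dT_out : dT i (g (out i)) = 0 := rightDer_ne _ (t_ne_out i).symm
lemma dT_e (k : Fin 2) : dT i (g (e k)) = 0 := rightDer_ne _ (isArrow_t i k).symm
lemma dT_t : dT i (g (t i)) = g (e i) := rightDer_self _
lemma dT_inn : dT i (g (inn i)) = 0 := rightDer_ne _ (t_ne_inn i).symm

lemma lInn_inn : lInn i (g (inn i)) = g (e (opp i)) := by
  have := leftDer_self (isArrow_inn i); rwa [src_inn] at this
lemma lInn_e (k : Fin 2) : lInn i (g (e k)) = 0 := leftDer_ne _ (isArrow_inn i k).symm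
lemma lInn_t : lInn i (g (t i)) = 0 := leftDer_ne _ (t_ne_inn i)
lemma lT_inn : lT i (g (inn i)) = 0 := leftDer_ne _ (t_ne_inn i).symm
lemma lT_e (k : Fin 2) : lT i (g (e k)) = 0 := leftDer_ne _ (isArrow_t i k).symm
lemma lT_t : lT i (g (t i)) = g (e i) := leftDer_self _
lemma lT_out : lT i (g (out i)) = 0 := leftDer_ne _ (t_ne_out i).symm

lemma e_dOut (x : Alg) : g (e (opp i)) * dOut i x = dOut i x := by
  have := e_rightDer (isArrow_out i) x; rwa [tgt_out] at this
lemma e_dT (x : Alg) : g (e i) * dT i x = dT i x := e_rightDer (isArrow_t i) x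
lemma lInn_mul_e (x : Alg) : lInn i x * g (e (opp i)) = lInn i x := by
  have := leftDer_e (isArrow_inn i) x; rwa [src_inn] at this
lemma lT_mul_e (x : Alg) : lT i x * g (e i) = lT i x := leftDer_e (isArrow_t i) x

lemma dOut_mem {n : ℤ} {x : Alg} (hx : x ∈ gr n) : dOut i x ∈ gr (n - (out i).deg) :=
  rightDer_mem _ hx
lemma dT_mem {n : ℤ} {x : Alg} (hx : x ∈ gr n) : dT i x ∈ gr (n + 2) := by
  have := rightDer_mem (isArrow_t i) hx; rwa [Gen.deg, sub_neg_eq_add] at this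
lemma lInn_mem {n : ℤ} {x : Alg} (hx : x ∈ gr n) : lInn i x ∈ gr (n - (inn i).deg) :=
  leftDer_mem _ hx
lemma lT_mem {n : ℤ} {x : Alg} (hx : x ∈ gr n) : lT i x ∈ gr (n + 2) := by
  have := leftDer_mem (isArrow_t i) hx; rwa [Gen.deg, sub_neg_eq_add] at this

lemma right_decomposition (x : Alg) : x = char i x • g (e i) + g (e (opp i)) * x +
    g (out i) * dOut i x + g (t i) * dT i x := by
  refine alg_induction (P := fun x => x = char i x • g (e i) + g (e (opp i)) * x +
    g (out i) * dOut i x + g (t i) * dT i x) (fun c => ?_) (fun x => ?_)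
    (fun x y hx hy => ?_) (fun x y hx hy => ?_) x
  · have h₁ : dOut i 1 = 0 := rightDer_one _
    have h₂ : dT i 1 = 0 := rightDer_one _
    simp only [Algebra.algebraMap_eq_smul_one, map_smul, h₁, h₂, map_one, smul_zero, mul_zero,
      add_zero, mul_smul_comm, mul_one, smul_assoc, one_smul]
    rw [← smul_add, e_add_opp]
  · have key : x = e i ∨ x = e (opp i) ∨ x = out i ∨ x = t i ∨ x = inn i ∨ x = t (opp i) := by
      fin_cases i <;> rcases x with (k | _ | _ | k) <;> simp [opp, out, inn] <;>
        fin_cases k <;> simp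
    have hio : inn i ≠ out i := by fin_cases i <;> simp [inn, out]
    have hto : t (opp i) ≠ out i := by fin_cases i <;> simp [out]
    have htt : t (opp i) ≠ t i := by fin_cases i <;> simp [opp]
    rcases key with rfl | rfl | rfl | rfl | rfl | rfl
    · simp [char_self, opp_e, dOut_e, dT_e]
    · simp [char_opp, e_e, dOut_e, dT_e]
    · simp [char_out, opp_out, dOut_out, dT_out, out_e]
    · simp [char_t, opp_t, dOut_t, dT_t, t_e]
    · have h₁ : dOut i (g (inn i)) = 0 := rightDer_ne _ hio
      simp [char_inn, e_inn, dT_inn, h₁]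
    · have h₁ : dOut i (g (t (opp i))) = 0 := rightDer_ne _ hto
      have h₂ : dT i (g (t (opp i))) = 0 := rightDer_ne _ htt
      have h₃ : char i (g (t (opp i))) = 0 := char_eq_zero _ (isArrow_t _)
      simp [h₁, h₂, h₃, e_t]
  · have h₁ : char i x • g (e i) * y = char i x • (y - g (e (opp i)) * y) := by
      rw [smul_mul_assoc, ← sub_eq_of_eq_add (e_add_opp i).symm, sub_mul, one_mul]
    rw [dOut_mul, dT_mul, map_mul, mul_add, mul_add, mul_smul_comm, mul_smul_comm]
    have h₂ : y - g (e (opp i)) * y = char i y • g (e i) + g (out i) * dOut i y +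
        g (t i) * dT i y := by
      rw [sub_eq_iff_eq_add]
      exact hy.trans (by abel)
    conv_lhs => rw [hx]
    simp only [add_mul, h₁, h₂]
    simp only [smul_add, smul_smul, mul_assoc]
    abel
  · conv_lhs => rw [hx, hy]
    simp only [map_add, add_smul, mul_add]
    abel

lemma left_decomposition (x : Alg) : x = char i x • g (e i) + x * g (e (opp i)) +
    lInn i x * g (inn i) + lT i x * g (t i) := by
  refine alg_induction (P := fun x => x = char i x • g (e i) + x * g (e (opp i)) +
    lInn i x * g (inn i) + lT i x * g (t i)) (fun c => ?_) (fun x => ?_)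
    (fun x y hx hy => ?_) (fun x y hx hy => ?_) x
  · have h₁ : lInn i 1 = 0 := leftDer_one _
    have h₂ : lT i 1 = 0 := leftDer_one _
    simp only [Algebra.algebraMap_eq_smul_one, map_smul, h₁, h₂, map_one, smul_zero, zero_mul,
      add_zero, smul_mul_assoc, one_mul, smul_assoc, one_smul]
    rw [← smul_add, e_add_opp]
  · have key : x = e i ∨ x = e (opp i) ∨ x = out i ∨ x = t i ∨ x = inn i ∨ x = t (opp i) := by
      fin_cases i <;> rcases x with (k | _ | _ | k) <;> simp [opp, out, inn] <;>
        fin_cases k <;> simp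
    have hio : out i ≠ inn i := by fin_cases i <;> simp [inn, out]
    have hto : t (opp i) ≠ inn i := by fin_cases i <;> simp [inn]
    have htt : t (opp i) ≠ t i := by fin_cases i <;> simp [opp]
    rcases key with rfl | rfl | rfl | rfl | rfl | rfl
    · simp [char_self, e_opp, lInn_e, lT_e]
    · simp [char_opp, e_e, lInn_e, lT_e]
    · have h₁ : lInn i (g (out i)) = 0 := leftDer_ne _ hio
      simp [char_out, out_e, lT_out, h₁]
    · simp [char_t, t_opp, lInn_t, lT_t, e_t]
    · simp [char_inn, inn_opp, lInn_inn, lT_inn, e_inn]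
    · have h₁ : lInn i (g (t (opp i))) = 0 := leftDer_ne _ hto
      have h₂ : lT i (g (t (opp i))) = 0 := leftDer_ne _ htt
      have h₃ : char i (g (t (opp i))) = 0 := char_eq_zero _ (isArrow_t _)
      simp [h₁, h₂, h₃, t_e]
  · have h₁ : x * char i y • g (e i) = char i y • (x - x * g (e (opp i))) := by
      rw [mul_smul_comm, ← sub_eq_of_eq_add (e_add_opp i).symm, mul_sub, mul_one]
    rw [lInn_mul, lT_mul, map_mul, add_mul, add_mul, smul_mul_assoc, smul_mul_assoc]
    have h₂ : x - x * g (e (opp i)) = char i x • g (e i) + lInn i x * g (inn i) +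
        lT i x * g (t i) := by
      rw [sub_eq_iff_eq_add]
      exact hx.trans (by abel)
    conv_lhs => rw [hy]
    simp only [mul_add, h₁, h₂]
    simp only [smul_add, smul_smul, mul_assoc, mul_comm (char i y)]
    abel
  · conv_lhs => rw [hx, hy]
    simp only [map_add, add_smul, add_mul]
    abel

end Ginzburg

end

noncomputable section

namespace Ginzburg

open Gen DGModule

variable (i : Fin 2)

/-- The idempotents at the targets of the generators of the right ideal `ker (char i)`, and at the
sources of the generators of the left ideal `ker (char i)`. -/
def idem : Fin 3 → Alg := ![g (e (opp i)), g (e (opp i)), g (e i)]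

lemma idem_mem (k : Fin 3) : idem i k ∈ gr 0 := by
  fin_cases k <;> exact g_mem (e _)

lemma d_idem (k : Fin 3) : d (idem i k) = 0 := by
  fin_cases k <;> exact d_e _

lemma idem_idem (k : Fin 3) : idem i k * idem i k = idem i k := by
  fin_cases k <;> exact e_e _

section Right

/-- The generators of the right ideal `ker (char i)`. -/
def rGen : Fin 3 → Alg := ![g (e (opp i)), g (out i), g (t i)]

/-- The degrees of the generators of the right ideal `ker (char i)`. -/
def rDeg : Fin 3 → ℤ := ![0, (out i).deg, -2]

/-- The coordinates of the elements of the right ideal `ker (char i)`. -/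
def rCoord : Fin 3 → Alg →ₗ[ℂ] Alg := ![LinearMap.mulLeft ℂ (g (e (opp i))), dOut i, dT i]

lemma rGen_mem (k : Fin 3) : rGen i k ∈ gr (rDeg i k) := by
  fin_cases k
  exacts [g_mem (e (opp i)), g_mem (out i), g_mem (t i)]

lemma char_rGen (k : Fin 3) : char i (rGen i k) = 0 := by
  fin_cases k
  exacts [char_opp i, char_out i, char_t i]

lemma rGen_idem (k : Fin 3) : rGen i k * idem i k = rGen i k := by
  fin_cases k
  exacts [e_e _, out_e i, t_e i]

lemma idem_rCoord (k : Fin 3) (x : Alg) : idem i k * rCoord i k x = rCoord i k x := by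
  fin_cases k
  · change g _ * (g _ * x) = g _ * x
    rw [← mul_assoc, e_e]
  exacts [e_dOut i x, e_dT i x]

lemma rCoord_mul {x : Alg} (hx : char i x = 0) (k : Fin 3) (y : Alg) :
    rCoord i k (x * y) = rCoord i k x * y := by
  fin_cases k
  · exact (mul_assoc _ _ _).symm
  · exact (dOut_mul i x y).trans (by rw [hx, zero_smul, add_zero]; rfl)
  · exact (dT_mul i x y).trans (by rw [hx, zero_smul, add_zero]; rfl)

lemma rCoord_mem {n : ℤ} {x : Alg} (hx : x ∈ gr n) (k : Fin 3) :
    rCoord i k x ∈ gr (n - rDeg i k) := by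
  fin_cases k
  · have := SetLike.mul_mem_graded (g_mem (e (opp i))) hx
    rwa [Gen.deg, zero_add, ← sub_zero n] at this
  · exact dOut_mem i hx
  · have := dT_mem i hx
    rwa [← sub_neg_eq_add] at this

lemma sum_rGen_rCoord {x : Alg} (hx : char i x = 0) : ∑ p, rGen i p * rCoord i p x = x := by
  have := right_decomposition i x
  rw [hx, zero_smul, zero_add] at this
  rw [Fin.sum_univ_three]
  refine Eq.trans ?_ this.symm
  change g _ * (g _ * x) + _ + _ = _
  rw [← mul_assoc, e_e]
  rfl

lemma rCoord_rGen (k l : Fin 3) : rCoord i k (rGen i l) = if k = l then idem i k else 0 := by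
  fin_cases k <;> fin_cases l
  exacts [e_e _, opp_out i, opp_t i, dOut_e i _, dOut_out i, dOut_t i, dT_e i _, dT_out i, dT_t i]

/-- The matrix of the differential of `rBimodule`. -/
def rC (k l : Fin 3) : Alg := if k = 1 ∧ l = 2 then -g (inn i) else 0

lemma rC_mem (k l : Fin 3) : rC i k l ∈ gr (1 + rDeg i l - rDeg i k) := by
  rw [rC]
  split_ifs with h
  · rw [h.1, h.2]
    refine neg_mem ?_
    have := g_mem (inn i)
    rwa [show (inn i).deg = 1 + rDeg i 2 - rDeg i 1 by
      change _ = 1 + (-2) - (out i).deg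
      linarith [deg_out_inn i]] at this
  · exact zero_mem _

lemma d_rC (k l : Fin 3) : d (rC i k l) = 0 := by
  rw [rC]
  split_ifs
  · rw [map_neg, d_inn, neg_zero]
  · exact map_zero _

lemma rC_mul_rC (k l p : Fin 3) : rC i k p * rC i p l = 0 := by
  fin_cases p <;> simp [rC]

lemma rC_right (k l : Fin 3) : rC i k l * idem i l = rC i k l := by
  rw [rC]
  split_ifs with h
  · rw [h.2, neg_mul]
    exact congrArg _ (inn_e i)
  · exact zero_mul _

lemma d_rGen (l : Fin 3) : d (rGen i l) = -∑ p, (-1 : ℂ) ^ rDeg i p • (rGen i p * rC i p l) := by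
  rw [Fin.sum_univ_three]
  fin_cases l
  · exact (d_e (opp i)).trans (by simp [rC])
  · exact (d_out i).trans (by simp [rC])
  · refine (d_t i).trans ?_
    have h : (-1 : ℂ) ^ rDeg i 1 = sg i := sign_out i
    simp [rC, h, rGen]

/-- The multiplication matrices of `rBimodule`. -/
def rMat : Alg →ₗ[ℂ] Fin 3 → Fin 3 → Alg :=
  LinearMap.pi fun k => LinearMap.pi fun l => rCoord i k ∘ₗ LinearMap.mulRight ℂ (rGen i l)

lemma rMat_apply (x : Alg) (k l : Fin 3) : rMat i x k l = rCoord i k (x * rGen i l) := rfl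

lemma char_mul_rGen (x : Alg) (k : Fin 3) : char i (x * rGen i k) = 0 := by
  rw [map_mul, char_rGen, mul_zero]

lemma rMat_mul (x y : Alg) (k l : Fin 3) : rMat i (x * y) k l = ∑ p, rMat i x k p * rMat i y p l := by
  rw [rMat_apply, mul_assoc, ← sum_rGen_rCoord i (char_mul_rGen i y l), Finset.mul_sum, map_sum]
  exact Finset.sum_congr rfl fun p _ => by
    rw [← mul_assoc, rCoord_mul i (char_mul_rGen i x p), rMat_apply, rMat_apply]

lemma rMat_right (x : Alg) (k l : Fin 3) : rMat i x k l * idem i l = rMat i x k l := by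
  rw [rMat_apply, ← rCoord_mul i (char_mul_rGen i x l), mul_assoc, rGen_idem]

lemma rCoord_d {x : Alg} (hx : char i x = 0) (k : Fin 3) : rCoord i k (d x) =
    (-1 : ℂ) ^ rDeg i k • (d (rCoord i k x) - ∑ p, rC i k p * rCoord i p x) := by
  have hC k p : rCoord i k (d (rGen i p)) = -((-1 : ℂ) ^ rDeg i k • rC i k p) := by
    have hC' q : rCoord i k ((-1 : ℂ) ^ rDeg i q • (rGen i q * rC i q p)) =
        if q = k then (-1 : ℂ) ^ rDeg i k • rC i k p else 0 := by
      rw [map_smul, rCoord_mul i (char_rGen i q), rCoord_rGen]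
      by_cases h : k = q
      · subst h
        rw [if_pos rfl, if_pos rfl]
        congr 1
        rw [rC]
        split_ifs with h
        · rw [h.1, mul_neg]
          exact congrArg _ (e_inn i)
        · exact mul_zero _
      · rw [if_neg h, if_neg (Ne.symm h), zero_mul, smul_zero]
    rw [d_rGen, map_neg, map_sum]
    simp only [hC']
    rw [Finset.sum_ite_eq' Finset.univ, if_pos (Finset.mem_univ _)]
  have key p : rCoord i k (d (rGen i p * rCoord i p x)) =
      -((-1 : ℂ) ^ rDeg i k • (rC i k p * rCoord i p x)) +
        if p = k then (-1 : ℂ) ^ rDeg i k • d (rCoord i k x) else 0 := by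
    rw [leibniz _ (rGen_mem i p), map_add, rCoord_mul i (char_d _), hC, map_smul,
      rCoord_mul i (char_rGen i p), rCoord_rGen, neg_mul, smul_mul_assoc]
    congr 1
    by_cases h : k = p
    · subst h
      rw [if_pos rfl, if_pos rfl]
      conv_rhs => rw [← idem_rCoord, leibniz _ (idem_mem i k), d_idem]
      simp
    · rw [if_neg h, if_neg (Ne.symm h), zero_mul, smul_zero]
  conv_lhs => rw [← sum_rGen_rCoord i hx, map_sum, map_sum]
  simp only [key]
  rw [Finset.sum_add_distrib, Finset.sum_ite_eq' Finset.univ, if_pos (Finset.mem_univ _),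
    Finset.sum_neg_distrib, ← Finset.smul_sum, smul_sub]
  abel

lemma d_rMat {n : ℤ} {x : Alg} (hx : x ∈ gr n) (k l : Fin 3) : d (rMat i x k l) +
    ∑ p, (-1 : ℂ) ^ (n + rDeg i p - rDeg i k) • (rMat i x k p * rC i p l) =
      ∑ p, rC i k p * rMat i x p l + (-1 : ℂ) ^ rDeg i k • rMat i (d x) k l := by
  have h₁ : rMat i (d x) k l = rCoord i k (d (x * rGen i l)) +
      (-1 : ℂ) ^ n • ∑ p, (-1 : ℂ) ^ rDeg i p • (rMat i x k p * rC i p l) := by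
    rw [leibniz _ hx, d_rGen, map_add, map_smul, mul_neg, map_neg, Finset.mul_sum, map_sum,
      smul_neg, add_assoc]
    refine (add_eq_left.2 ?_).symm
    rw [neg_add_eq_zero]
    congr 1
    exact Finset.sum_congr rfl fun p _ => by
      rw [mul_smul_comm, map_smul, ← mul_assoc, rCoord_mul i (char_mul_rGen i x p), rMat_apply]
  rw [h₁, rCoord_d i (char_mul_rGen i x l), smul_add, sign_smul_smul, smul_smul, Finset.smul_sum]
  simp only [smul_smul]
  have h₂ p : (-1 : ℂ) ^ (n + rDeg i p - rDeg i k) =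
      (-1 : ℂ) ^ rDeg i k * (-1 : ℂ) ^ n * (-1 : ℂ) ^ rDeg i p := by
    rw [sub_eq_add_neg, sign_add, sign_add, zpow_neg, ← inv_zpow, inv_neg_one]
    ring
  simp only [h₂, rMat_apply]
  abel

/-- The dg bimodule such that `M ⊗ rBimodule i` is the module of the morphisms from the right ideal
`ker (char i)` to `M`. -/
def rBimodule : MatrixBimodule ginzburgA₂ where
  K := Fin 3
  ε := idem i
  w := rDeg i
  R := rMat i
  c := rC i
  ε_mem := idem_mem i
  d_ε := d_idem i
  ε_ε := idem_idem i
  R_right := rMat_right i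
  R_one k l := by
    have key : rMat i 1 k l = if k = l then idem i k else 0 := by
      rw [rMat_apply, one_mul, rCoord_rGen]
    exact key
  R_mul := rMat_mul i
  R_mem {n x} hx k l := by
    have := rCoord_mem i (SetLike.mul_mem_graded hx (rGen_mem i l)) k
    exact this
  c_right := rC_right i
  c_mem := rC_mem i
  d_c k l := by
    have key : d (rC i k l) = ∑ p, (-1 : ℂ) ^ (rDeg i k + rDeg i p) • (rC i k p * rC i p l) := by
      simp only [rC_mul_rC, smul_zero, Finset.sum_const_zero, d_rC]
    exact key
  d_R := d_rMat i

end Right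

section Left

/-- The generators of the left ideal `ker (char i)`. -/
def lGen : Fin 3 → Alg := ![g (e (opp i)), g (inn i), g (t i)]

/-- The degrees of the generators of the left ideal `ker (char i)`, up to sign. -/
def lDeg : Fin 3 → ℤ := ![0, -(inn i).deg, 2]

/-- The coordinates of the elements of the left ideal `ker (char i)`. -/
def lCoord : Fin 3 → Alg →ₗ[ℂ] Alg := ![LinearMap.mulRight ℂ (g (e (opp i))), lInn i, lT i]

lemma lGen_mem (k : Fin 3) : lGen i k ∈ gr (-lDeg i k) := by
  fin_cases k
  · exact g_mem (e (opp i))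
  · have := g_mem (inn i)
    rwa [← neg_neg (inn i).deg] at this
  · exact g_mem (t i)

lemma char_lGen (k : Fin 3) : char i (lGen i k) = 0 := by
  fin_cases k
  exacts [char_opp i, char_inn i, char_t i]

lemma lCoord_idem (k : Fin 3) (x : Alg) : lCoord i k x * idem i k = lCoord i k x := by
  fin_cases k
  · change x * g _ * g _ = x * g _
    rw [mul_assoc, e_e]
  exacts [lInn_mul_e i x, lT_mul_e i x]

lemma lCoord_mul {y : Alg} (hy : char i y = 0) (k : Fin 3) (x : Alg) :
    lCoord i k (x * y) = x * lCoord i k y := by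
  fin_cases k
  · exact mul_assoc _ _ _
  · exact (lInn_mul i x y).trans (by rw [hy, zero_smul, add_zero]; rfl)
  · exact (lT_mul i x y).trans (by rw [hy, zero_smul, add_zero]; rfl)

lemma lCoord_mem {n : ℤ} {x : Alg} (hx : x ∈ gr n) (k : Fin 3) :
    lCoord i k x ∈ gr (n + lDeg i k) := by
  fin_cases k
  · exact SetLike.mul_mem_graded hx (g_mem (e (opp i)))
  · exact lInn_mem i hx
  · exact lT_mem i hx

lemma sum_lCoord_lGen {x : Alg} (hx : char i x = 0) : ∑ p, lCoord i p x * lGen i p = x := by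
  have := left_decomposition i x
  rw [hx, zero_smul, zero_add] at this
  rw [Fin.sum_univ_three]
  refine Eq.trans ?_ this.symm
  change x * g _ * g _ + _ + _ = _
  rw [mul_assoc, e_e]
  rfl

lemma lCoord_lGen (k l : Fin 3) : lCoord i l (lGen i k) = if k = l then idem i k else 0 := by
  fin_cases k <;> fin_cases l
  exacts [e_e _, lInn_e i _, lT_e i _, inn_opp i, lInn_inn i, lT_inn i, t_opp i, lInn_t i, lT_t i]

/-- The matrix of the differential of `lBimodule`. -/
def lC (k l : Fin 3) : Alg := if k = 2 ∧ l = 1 then sg i • g (out i) else 0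

lemma lC_mem (k l : Fin 3) : lC i k l ∈ gr (1 + lDeg i l - lDeg i k) := by
  rw [lC]
  split_ifs with h
  · rw [h.1, h.2]
    refine Submodule.smul_mem _ _ ?_
    have := g_mem (out i)
    rwa [show (out i).deg = 1 + lDeg i 1 - lDeg i 2 by
      change _ = 1 + (-(inn i).deg) - 2
      linarith [deg_out_inn i]] at this
  · exact zero_mem _

lemma d_lC (k l : Fin 3) : d (lC i k l) = 0 := by
  rw [lC]
  split_ifs
  · rw [map_smul, d_out, smul_zero]
  · exact map_zero _

lemma lC_mul_lC (k l p : Fin 3) : lC i k p * lC i p l = 0 := by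
  fin_cases p <;> simp [lC]

lemma lC_right (k l : Fin 3) : lC i k l * idem i l = lC i k l := by
  rw [lC]
  split_ifs with h
  · rw [h.2, smul_mul_assoc]
    exact congrArg _ (out_e i)
  · exact zero_mul _

lemma d_lGen (k : Fin 3) : d (lGen i k) = ∑ p, lC i k p * lGen i p := by
  rw [Fin.sum_univ_three]
  fin_cases k
  · exact (d_e (opp i)).trans (by simp [lC])
  · exact (d_inn i).trans (by simp [lC])
  · exact (d_t i).trans (by simp [lC, lGen])

/-- The multiplication matrices of `lBimodule`. -/
def lMat : Alg →ₗ[ℂ] Fin 3 → Fin 3 → Alg :=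
  LinearMap.pi fun k => LinearMap.pi fun l => lCoord i l ∘ₗ LinearMap.mulLeft ℂ (lGen i k)

lemma lMat_apply (x : Alg) (k l : Fin 3) : lMat i x k l = lCoord i l (lGen i k * x) := rfl

lemma char_lGen_mul (x : Alg) (k : Fin 3) : char i (lGen i k * x) = 0 := by
  rw [map_mul, char_lGen, zero_mul]

lemma lMat_mul (x y : Alg) (k l : Fin 3) : lMat i (x * y) k l = ∑ p, lMat i x k p * lMat i y p l := by
  rw [lMat_apply, ← mul_assoc, ← sum_lCoord_lGen i (char_lGen_mul i x k), Finset.sum_mul, map_sum]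
  exact Finset.sum_congr rfl fun p _ => by
    rw [mul_assoc, lCoord_mul i (char_lGen_mul i y p), lMat_apply, lMat_apply]

lemma lCoord_lC (k l : Fin 3) : lCoord i l (d (lGen i k)) = lC i k l := by
  rw [d_lGen, map_sum, Finset.sum_eq_single l]
  · rw [lCoord_mul i (char_lGen i l), lCoord_lGen, if_pos rfl, lC_right]
  · intro p _ hp
    rw [lCoord_mul i (char_lGen i p), lCoord_lGen, if_neg hp, mul_zero]
  · simp

lemma lCoord_d {n : ℤ} {x : Alg} (hx : x ∈ gr n) (h : char i x = 0) (l : Fin 3) :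
    lCoord i l (d x) = d (lCoord i l x) +
      ∑ p, (-1 : ℂ) ^ (n + lDeg i p) • (lCoord i p x * lC i p l) := by
  have key p : lCoord i l (d (lCoord i p x * lGen i p)) =
      (if p = l then d (lCoord i l x) else 0) +
        (-1 : ℂ) ^ (n + lDeg i p) • (lCoord i p x * lC i p l) := by
    rw [leibniz _ (lCoord_mem i hx p), map_add, lCoord_mul i (char_lGen i p), lCoord_lGen,
      map_smul, lCoord_mul i (char_d _), lCoord_lC]
    congr 1
    by_cases h : p = l
    · subst h
      rw [if_pos rfl, if_pos rfl]
      conv_rhs => rw [← lCoord_idem, leibniz _ (lCoord_mem i hx p), d_idem]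
      simp
    · rw [if_neg h, if_neg h, mul_zero]
  conv_lhs => rw [← sum_lCoord_lGen i h, map_sum, map_sum]
  simp only [key]
  rw [Finset.sum_add_distrib, Finset.sum_ite_eq' Finset.univ, if_pos (Finset.mem_univ _)]

lemma d_lMat {n : ℤ} {x : Alg} (hx : x ∈ gr n) (k l : Fin 3) : d (lMat i x k l) +
    ∑ p, (-1 : ℂ) ^ (n + lDeg i p - lDeg i k) • (lMat i x k p * lC i p l) =
      ∑ p, lC i k p * lMat i x p l + (-1 : ℂ) ^ lDeg i k • lMat i (d x) k l := by
  have h₁ := lCoord_d i (SetLike.mul_mem_graded (lGen_mem i k) hx) (char_lGen_mul i x k) l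
  have h₂ p : n + lDeg i p - lDeg i k = -lDeg i k + n + lDeg i p := by ring
  simp only [h₂, lMat_apply]
  rw [← h₁, leibniz _ (lGen_mem i k), d_lGen, map_add, Finset.sum_mul, map_sum, map_smul, zpow_neg,
    ← inv_zpow, inv_neg_one]
  congr 1
  exact Finset.sum_congr rfl fun p _ => by rw [mul_assoc, lCoord_mul i (char_lGen_mul i x p)]

/-- The left ideal `ker (char i)` as a dg bimodule. -/
def lBimodule : MatrixBimodule ginzburgA₂ where
  K := Fin 3
  ε := idem i
  w := lDeg i
  R := lMat i
  c := lC i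
  ε_mem := idem_mem i
  d_ε := d_idem i
  ε_ε := idem_idem i
  R_right x k l := lCoord_idem i l _
  R_one k l := by
    have key : lMat i 1 k l = if k = l then idem i k else 0 := by
      rw [lMat_apply, mul_one, lCoord_lGen]
    exact key
  R_mul := lMat_mul i
  R_mem {n x} hx k l := by
    have := lCoord_mem i (SetLike.mul_mem_graded (lGen_mem i k) hx) l
    rw [show -lDeg i k + n + lDeg i l = n + lDeg i l - lDeg i k by ring] at this
    exact this
  c_right := lC_right i
  c_mem := lC_mem i
  d_c k l := by
    have key : d (lC i k l) = ∑ p, (-1 : ℂ) ^ (lDeg i k + lDeg i p) • (lC i k p * lC i p l) := by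
      simp only [lC_mul_lC, smul_zero, Finset.sum_const_zero, d_lC]
    exact key
  d_R := d_lMat i

end Left

end Ginzburg

end

noncomputable section

open DGModule

namespace DGModule

variable {A : DGAlgebra}

/-- The subspace `F` meets all the cohomology classes of `M`. -/
def CohSpan (M : DGModule A) (F : Submodule ℂ M.carrier) : Prop :=
  ∀ x, M.d x = 0 → ∃ y, x - M.d y ∈ F

lemma acyclic_iff_cohSpan (M : DGModule A) : M.Acyclic ↔ M.CohSpan ⊥ :=
  forall₂_congr fun x _ => exists_congr fun y => by rw [Submodule.mem_bot, sub_eq_zero, eq_comm]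

lemma finite_coh_iff (M : DGModule A) :
    Module.Finite ℂ (Coh M) ↔ ∃ F : Submodule ℂ M.carrier, Module.Finite ℂ F ∧ M.CohSpan F := by
  constructor
  · intro h
    obtain ⟨k, s, hs⟩ := Module.Finite.exists_fin (R := ℂ) (M := Coh M)
    choose z hz using fun i => Submodule.Quotient.mk_surjective _ (s i)
    have hfin : Module.Finite ℂ (Submodule.span ℂ (Set.range z)) :=
      Module.Finite.span_of_finite ℂ (Set.finite_range z)
    refine ⟨(Submodule.span ℂ (Set.range z)).map (LinearMap.ker M.d).subtype,
      Module.Finite.map _ _, fun x hx => ?_⟩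
    have hw : (Submodule.Quotient.mk ⟨x, hx⟩ : Coh M) ∈
        (Submodule.span ℂ (Set.range z)).map (Submodule.mkQ _) := by
      rw [Submodule.map_span, ← Set.range_comp]
      have : (Submodule.mkQ _ ∘ z : Fin k → Coh M) = s := funext hz
      rw [this, hs]
      trivial
    obtain ⟨w, hw, hw'⟩ := hw
    obtain ⟨y, hy⟩ := (Submodule.Quotient.eq _).1 hw'.symm
    refine ⟨y, w, hw, ?_⟩
    rw [hy]
    change (w : M.carrier) = x - (x - w)
    rw [sub_sub_cancel]
  · rintro ⟨F, hF, h⟩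
    let φ : F.comap (LinearMap.ker M.d).subtype →ₗ[ℂ] Coh M :=
      (Submodule.mkQ _) ∘ₗ (F.comap (LinearMap.ker M.d).subtype).subtype
    have : Module.Finite ℂ (F.comap (LinearMap.ker M.d).subtype) := by
      let ψ : F.comap (LinearMap.ker M.d).subtype →ₗ[ℂ] F :=
        LinearMap.restrict (p := F.comap (LinearMap.ker M.d).subtype) (q := F)
          (LinearMap.ker M.d).subtype fun x hx => hx
      exact Module.Finite.of_injective ψ fun x y hxy =>
        Subtype.ext (Subtype.ext (congrArg (fun z : F => (z : M.carrier)) hxy))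
    refine Module.Finite.of_surjective φ fun w => ?_
    obtain ⟨⟨x, hx⟩, rfl⟩ := Submodule.Quotient.mk_surjective _ w
    obtain ⟨y, hy⟩ := h x hx
    have hx' : M.d (x - M.d y) = 0 := by rw [map_sub, M.d_d, LinearMap.mem_ker.1 hx, sub_zero]
    refine ⟨⟨⟨x - M.d y, hx'⟩, hy⟩, (Submodule.Quotient.eq _).2 ⟨-y, ?_⟩⟩
    change M.d (-y) = (x - M.d y) - x
    rw [map_neg]
    abel

end DGModule

namespace MatrixBimodule

variable {A : DGAlgebra} (B : MatrixBimodule A) (M : DGModule A)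

/-- The projection to the space underlying the tensor product. -/
def ofPi : (B.K → M.carrier) →ₗ[ℂ] B.space M where
  toFun m := ⟨fun k => MulOpposite.op (B.ε k) • m k, fun k => by rw [← op_mul_smul, B.ε_ε]⟩
  map_add' x y := space_ext fun k => smul_add _ _ _
  map_smul' r x := space_ext fun k => smul_comm _ _ _

lemma ofPi_apply (m : B.K → M.carrier) (k : B.K) :
    (B.ofPi M m).1 k = MulOpposite.op (B.ε k) • m k := rfl

lemma d_ε_smul (k : B.K) (x : M.carrier) :
    M.d (MulOpposite.op (B.ε k) • x) = MulOpposite.op (B.ε k) • M.d x := by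
  rw [leibniz_sig, B.d_ε, MulOpposite.op_zero, zero_smul, add_zero]

/-- The only nonzero coefficient of the differential is at `(k₀, l₀)`. -/
structure Triangular (k₀ l₀ : B.K) : Prop where
  ne : k₀ ≠ l₀
  c_eq_zero k l : ¬(k = k₀ ∧ l = l₀) → B.c k l = 0

variable {B M} {k₀ l₀ : B.K} (hB : B.Triangular k₀ l₀)
include hB

lemma Triangular.diff_ne (m : B.space M) {l : B.K} (hl : l ≠ l₀) :
    (B.diff M m).1 l = M.d (m.1 l) := by
  rw [diff_apply, Finset.sum_eq_zero, add_zero]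
  intro k _
  rw [hB.c_eq_zero k l fun h => hl h.2, MulOpposite.op_zero, zero_smul]

lemma Triangular.diff_eq (m : B.space M) : (B.diff M m).1 l₀ =
    M.d (m.1 l₀) + MulOpposite.op (B.c k₀ l₀) • M.sig (m.1 k₀) := by
  rw [diff_apply, Finset.sum_eq_single k₀]
  · intro k _ hk
    rw [hB.c_eq_zero k l₀ fun h => hk h.1, MulOpposite.op_zero, zero_smul]
  · simp

lemma Triangular.d_c : A.d (B.c k₀ l₀) = 0 := by
  rw [B.d_c]
  refine Finset.sum_eq_zero fun p _ => ?_
  by_cases hp : p = l₀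
  · rw [hp, hB.c_eq_zero l₀ l₀ fun h => hB.ne h.1.symm, mul_zero, smul_zero]
  · rw [hB.c_eq_zero k₀ p fun h => hp h.2, zero_mul, smul_zero]

lemma Triangular.exists_cohSpan {F : Submodule ℂ M.carrier} (hF : M.CohSpan F) :
    ∃ G : ((B.K → F) × F) →ₗ[ℂ] (B.obj M).carrier, (B.obj M).CohSpan (LinearMap.range G) := by
  obtain ⟨s, hs⟩ : ∃ s : M.carrier →ₗ[ℂ] M.carrier, ∀ x, M.d (s (M.d x)) = M.d x := by
    obtain ⟨s, hs⟩ := LinearMap.exists_rightInverse_of_surjective M.d.rangeRestrict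
      (LinearMap.range_rangeRestrict _)
    obtain ⟨s', hs'⟩ := LinearMap.exists_extend s
    refine ⟨s', fun x => ?_⟩
    have h₁ := congrArg Subtype.val (LinearMap.congr_fun hs ⟨M.d x, x, rfl⟩)
    have h₂ := LinearMap.congr_fun hs' ⟨M.d x, x, rfl⟩
    rw [LinearMap.comp_apply] at h₂
    change s' (M.d x) = _ at h₂
    rw [h₂]
    exact h₁
  let op (a : A.carrier) : M.carrier →ₗ[ℂ] M.carrier :=
    DistribSMul.toLinearMap ℂ M.carrier (MulOpposite.op a)
  let pr (k : B.K) : ((B.K → F) × F) →ₗ[ℂ] M.carrier :=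
    F.subtype ∘ₗ LinearMap.proj k ∘ₗ LinearMap.fst ℂ _ _
  let G : ((B.K → F) × F) →ₗ[ℂ] B.space M := B.ofPi M ∘ₗ LinearMap.pi fun k => if k = l₀ then
    F.subtype ∘ₗ LinearMap.snd ℂ _ _ - s ∘ₗ op (B.c k₀ l₀) ∘ₗ M.sig ∘ₗ op (B.ε k₀) ∘ₗ pr k₀
      else pr k
  suffices H : ∀ x : B.space M, B.diff M x = 0 → ∃ y : B.space M, ∃ w, G w = x - B.diff M y from
    ⟨G, fun x hx => let ⟨y, w, h⟩ := H x hx; ⟨y, w, h⟩⟩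
  intro x hx
  have hy (k : B.K) : ∃ y, k ≠ l₀ → x.1 k - M.d y ∈ F := by
    by_cases hk : k = l₀
    · exact ⟨0, fun h => (h hk).elim⟩
    · obtain ⟨y, hy⟩ := hF (x.1 k) (by rw [← hB.diff_ne x hk, hx]; rfl)
      exact ⟨y, fun _ => hy⟩
  choose y hy using hy
  let z := MulOpposite.op (B.c k₀ l₀) • M.sig (MulOpposite.op (B.ε k₀) • y k₀)
  let a := MulOpposite.op (B.c k₀ l₀) • M.sig (MulOpposite.op (B.ε k₀) • (x.1 k₀ - M.d (y k₀)))
  have ha : a = MulOpposite.op (B.c k₀ l₀) • M.sig (x.1 k₀) + M.d z := by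
    simp only [a, z]
    rw [smul_sub, ← d_ε_smul, x.2, map_sub, smul_sub, sig_d, smul_neg, sub_neg_eq_add, leibniz_sig,
      hB.d_c, MulOpposite.op_zero, zero_smul, add_zero]
  have hx₀ : M.d (x.1 l₀) = -MulOpposite.op (B.c k₀ l₀) • M.sig (x.1 k₀) := by
    have : (B.diff M x).1 l₀ = 0 := by rw [hx]; rfl
    rw [hB.diff_eq] at this
    rw [neg_smul]
    exact eq_neg_of_add_eq_zero_left this
  have hsa : M.d (s a) = a := by
    have : a = M.d (z - x.1 l₀) := by rw [map_sub, hx₀, ha, neg_smul, sub_neg_eq_add, add_comm]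
    rw [this, hs]
  obtain ⟨y', hy'⟩ := hF (x.1 l₀ - z + s a) (by
    rw [map_add, map_sub, hsa, hx₀, ha, neg_smul]
    abel)
  refine ⟨B.ofPi M fun k => if k = l₀ then y' else y k,
    (fun k => if hk : k = l₀ then 0 else ⟨_, hy k hk⟩, ⟨_, hy'⟩), ?_⟩
  refine space_ext fun k => ?_
  by_cases hk : k = l₀
  · subst hk
    have e₁ : (G (fun l => if hl : l = k then 0 else ⟨_, hy l hl⟩, ⟨_, hy'⟩)).1 k =
        MulOpposite.op (B.ε k) • (x.1 k - z + s a - M.d y' - s a) := by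
      simp only [G, LinearMap.comp_apply, ofPi_apply, LinearMap.pi_apply, if_true]
      simp [op, pr, hB.ne, a]
    rw [e₁]
    change _ = x.1 k - (B.diff M _).1 k
    rw [hB.diff_eq, ofPi_apply, ofPi_apply, if_pos rfl, if_neg hB.ne, d_ε_smul, add_sub_right_comm,
      add_sub_cancel_right, smul_sub, smul_sub, x.2]
    have : MulOpposite.op (B.ε k) • z = z := by rw [← op_mul_smul, B.c_right]
    rw [this]
    abel
  · have e₁ : (G (fun l => if hl : l = l₀ then 0 else ⟨_, hy l hl⟩, ⟨_, hy'⟩)).1 k =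
        MulOpposite.op (B.ε k) • (x.1 k - M.d (y k)) := by
      simp only [G, LinearMap.comp_apply, ofPi_apply, LinearMap.pi_apply, hk, if_false]
      simp [pr, hk]
    rw [e₁]
    change _ = x.1 k - (B.diff M _).1 k
    rw [hB.diff_ne _ hk, ofPi_apply, if_neg hk, d_ε_smul, smul_sub, x.2]

lemma Triangular.preservesAcyclic : B.tensor.PreservesAcyclic where
  acyclic M hM := by
    obtain ⟨G, hG⟩ := hB.exists_cohSpan ((acyclic_iff_cohSpan M).1 hM)
    refine (acyclic_iff_cohSpan _).2 fun x hx => ?_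
    obtain ⟨y, z, hz⟩ := hG x hx
    exact ⟨y, (Submodule.mem_bot ℂ).2 (hz.symm.trans (by
      rw [Subsingleton.elim z 0]
      exact map_zero G))⟩

lemma Triangular.fd_der [B.tensor.PreservesAcyclic] (X : DerCat A) (hX : DerCat.fd A X) :
    DerCat.fd A (B.tensor.der.obj X) := by
  obtain ⟨M, ⟨e⟩⟩ := DerCat.exists_iso_Q X
  obtain ⟨F, hF, h⟩ := (finite_coh_iff M).1
    ((DerCat.fd_Q_iff M).1 ((DerCat.fd A).prop_of_iso e.symm hX))
  obtain ⟨G, hG⟩ := hB.exists_cohSpan h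
  have : DerCat.fd A ((DerCat.Q A).obj (B.obj M)) := (DerCat.fd_Q_iff _).2
    ((finite_coh_iff _).2 ⟨_, inferInstance, hG⟩)
  exact (DerCat.fd A).prop_of_iso ((B.tensor.derIso.app M).symm ≪≫ B.tensor.der.mapIso e) this

end MatrixBimodule

end

noncomputable section

namespace DGModule

variable {A : DGAlgebra}

lemma quasiIso_of_homotopy {M N : DGModule A} (f : M ⟶ N) (s : N.carrier →ₗ[ℂ] M.carrier)
    (H : M.carrier →ₗ[ℂ] M.carrier) (K : N.carrier →ₗ[ℂ] N.carrier)
    (hs : ∀ y, s (N.d y) = M.d (s y)) (hH : ∀ x, s (lin f x) - x = M.d (H x) + H (M.d x))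
    (hK : ∀ y, lin f (s y) - y = N.d (K y) + K (N.d y)) : QuasiIso f where
  inj x y hx hy := ⟨s y - H x, by
    have := hH x
    rw [hx, map_zero, add_zero] at this
    rw [map_sub, ← hs, ← hy, ← this, sub_sub_cancel]⟩
  surj y hy := ⟨s y, -K y, by rw [← hs, hy, map_zero], by
    have := hK y
    rw [hy, map_zero, add_zero] at this
    rw [map_neg, ← this, neg_sub, add_sub_cancel]⟩

end DGModule

namespace Ginzburg

open Gen DGModule

section Rho

variable (M : DGModule ginzburgA₂)

/-- The right action of the path algebra. -/
def rho : Alg →ₗ[ℂ] M.carrier →ₗ[ℂ] M.carrier where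
  toFun x := DistribSMul.toLinearMap ℂ M.carrier (MulOpposite.op (show ginzburgA₂.carrier from x))
  map_add' x y := LinearMap.ext fun m => by
    change MulOpposite.op (show ginzburgA₂.carrier from x + y) • m = _
    exact add_smul (MulOpposite.op (show ginzburgA₂.carrier from x))
      (MulOpposite.op (show ginzburgA₂.carrier from y)) m
  map_smul' c x := LinearMap.ext fun m => d_op_smul c (show ginzburgA₂.carrier from x) m

variable {M}

lemma rho_mul (x y : Alg) (m : M.carrier) : rho M (x * y) m = rho M y (rho M x m) :=
  op_mul_smul (A := ginzburgA₂) x y m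

lemma rho_one (m : M.carrier) : rho M 1 m = m := one_smul _ m

lemma d_rho (x : Alg) (m : M.carrier) : M.d (rho M x m) = rho M x (M.d m) + rho M (d x) (M.sig m) :=
  leibniz_sig m x

lemma sig_rho {n : ℤ} {x : Alg} (hx : x ∈ gr n) (m : M.carrier) :
    M.sig (rho M x m) = (-1 : ℂ) ^ n • rho M x (M.sig m) :=
  sig_smul (A := ginzburgA₂) hx m

lemma rho_mem {k n : ℤ} {m : M.carrier} (hm : m ∈ M.gr k) {x : Alg} (hx : x ∈ gr n) :
    rho M x m ∈ M.gr (k + n) := M.smul_mem hm hx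

lemma map_rho {N : DGModule ginzburgA₂} (f : M.carrier →ₗ[ginzburgA₂.carrierᵐᵒᵖ] N.carrier) (x : Alg)
    (m : M.carrier) : f (rho M x m) = rho N x (f m) := map_smul f _ _

/-- A linear map which commutes with `rho`, as a morphism of right modules. -/
def ofRho {N : DGModule ginzburgA₂} (f : M.carrier →ₗ[ℂ] N.carrier)
    (h : ∀ x m, f (rho M x m) = rho N x (f m)) :
    M.carrier →ₗ[ginzburgA₂.carrierᵐᵒᵖ] N.carrier where
  toFun := f
  map_add' := map_add f
  map_smul' a m := h a.unop m

end Rho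

variable (i : Fin 2) (M : DGModule ginzburgA₂)

/-- The dg module of morphisms from the right ideal `ker (char i)` to `M`. -/
def rObj : DGModule ginzburgA₂ := (rBimodule i).obj M

/-- The tensor product of `M` and the left ideal `ker (char i)`. -/
def lObj : DGModule ginzburgA₂ := (lBimodule i).obj M

/-- The coordinates on `rObj`. -/
def rCo (k : Fin 3) : (rObj i M).carrier →ₗ[ℂ] M.carrier :=
  LinearMap.proj (φ := fun _ : Fin 3 => M.carrier) k ∘ₗ ((rBimodule i).space M).subtype

/-- The coordinates on `lObj`. -/
def lCo (k : Fin 3) : (lObj i M).carrier →ₗ[ℂ] M.carrier :=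
  LinearMap.proj (φ := fun _ : Fin 3 => M.carrier) k ∘ₗ ((lBimodule i).space M).subtype

variable {M}

/-- Constructor for the elements of `rObj`. -/
def rMk (m : Fin 3 → M.carrier) (h : ∀ k, rho M (idem i k) (m k) = m k) : (rObj i M).carrier :=
  ⟨m, h⟩

/-- Constructor for the elements of `lObj`. -/
def lMk (m : Fin 3 → M.carrier) (h : ∀ k, rho M (idem i k) (m k) = m k) : (lObj i M).carrier :=
  ⟨m, h⟩

@[simp] lemma rCo_rMk (m : Fin 3 → M.carrier) (h : ∀ k, rho M (idem i k) (m k) = m k) (k : Fin 3) :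
    rCo i M k (rMk i m h) = m k := rfl

@[simp] lemma lCo_lMk (m : Fin 3 → M.carrier) (h : ∀ k, rho M (idem i k) (m k) = m k) (k : Fin 3) :
    lCo i M k (lMk i m h) = m k := rfl

variable {i}

lemma rCo_ext {m n : (rObj i M).carrier} (h : ∀ k, rCo i M k m = rCo i M k n) : m = n :=
  Subtype.ext (funext h)

lemma lCo_ext {m n : (lObj i M).carrier} (h : ∀ k, lCo i M k m = lCo i M k n) : m = n :=
  Subtype.ext (funext h)

lemma idem_rCo (m : (rObj i M).carrier) (k : Fin 3) :
    rho M (idem i k) (rCo i M k m) = rCo i M k m := m.2 k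

lemma idem_lCo (m : (lObj i M).carrier) (k : Fin 3) :
    rho M (idem i k) (lCo i M k m) = lCo i M k m := m.2 k

lemma rCo_rho (x : Alg) (m : (rObj i M).carrier) (l : Fin 3) :
    rCo i M l (rho _ x m) = ∑ k, rho M (rMat i x k l) (rCo i M k m) := rfl

lemma lCo_rho (x : Alg) (m : (lObj i M).carrier) (l : Fin 3) :
    lCo i M l (rho _ x m) = ∑ k, rho M (lMat i x k l) (lCo i M k m) := rfl

lemma rCo_d (m : (rObj i M).carrier) (l : Fin 3) : rCo i M l ((rObj i M).d m) =
    M.d (rCo i M l m) + ∑ k, rho M (rC i k l) (M.sig (rCo i M k m)) := rfl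

lemma lCo_d (m : (lObj i M).carrier) (l : Fin 3) : lCo i M l ((lObj i M).d m) =
    M.d (lCo i M l m) + ∑ k, rho M (lC i k l) (M.sig (lCo i M k m)) := rfl

lemma rCo_mem {n : ℤ} {m : (rObj i M).carrier} (hm : m ∈ (rObj i M).gr n) (k : Fin 3) :
    rCo i M k m ∈ M.gr (n + rDeg i k) := hm k

lemma lCo_mem {n : ℤ} {m : (lObj i M).carrier} (hm : m ∈ (lObj i M).gr n) (k : Fin 3) :
    lCo i M k m ∈ M.gr (n + lDeg i k) := hm k

lemma mem_rObj {n : ℤ} {m : (rObj i M).carrier} (hm : ∀ k, rCo i M k m ∈ M.gr (n + rDeg i k)) :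
    m ∈ (rObj i M).gr n := hm

lemma mem_lObj {n : ℤ} {m : (lObj i M).carrier} (hm : ∀ k, lCo i M k m ∈ M.gr (n + lDeg i k)) :
    m ∈ (lObj i M).gr n := hm

lemma sig_rCo (m : (rObj i M).carrier) (k : Fin 3) :
    M.sig (rCo i M k m) = (-1 : ℂ) ^ rDeg i k • rCo i M k ((rObj i M).sig m) :=
  parity_map (rObj i M).isInternal M.isInternal (rCo i M k) _ (fun _ _ hm => rCo_mem hm k) m

lemma sig_lCo (m : (lObj i M).carrier) (k : Fin 3) :
    M.sig (lCo i M k m) = (-1 : ℂ) ^ lDeg i k • lCo i M k ((lObj i M).sig m) :=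
  parity_map (lObj i M).isInternal M.isInternal (lCo i M k) _ (fun _ _ hm => lCo_mem hm k) m

lemma rho_sum (x : Fin 3 → Alg) (m : M.carrier) : rho M (∑ k, x k) m = ∑ k, rho M (x k) m := by
  rw [map_sum, LinearMap.sum_apply]

variable (i M)

/-- The value at an element of the right ideal `ker (char i)`. -/
def pair : (rObj i M).carrier →ₗ[ℂ] Alg →ₗ[ℂ] M.carrier :=
  ∑ k, (((rho M).flip ∘ₗ rCo i M k).flip ∘ₗ rCoord i k).flip

/-- The tensor product of an element of `M` and an element of the left ideal `ker (char i)`. -/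
def tens (x : Alg) : M.carrier →ₗ[ℂ] (lObj i M).carrier where
  toFun m := lMk i (fun k => rho M (lCoord i k x) m) fun k => by rw [← rho_mul, lCoord_idem]
  map_add' m n := lCo_ext fun k => by simp
  map_smul' c m := lCo_ext fun k => by simp

variable {i M}

lemma pair_apply (m : (rObj i M).carrier) (x : Alg) :
    pair i M m x = ∑ k, rho M (rCoord i k x) (rCo i M k m) := by
  simp [pair, LinearMap.sum_apply]

lemma pair_mul (m : (rObj i M).carrier) {x : Alg} (hx : char i x = 0) (y : Alg) :
    pair i M m (x * y) = rho M y (pair i M m x) := by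
  simp only [pair_apply, rCoord_mul i hx, rho_mul, map_sum]

lemma pair_rho (m : (rObj i M).carrier) (y : Alg) {x : Alg} (hx : char i x = 0) :
    pair i M (rho _ y m) x = pair i M m (y * x) := by
  simp only [pair_apply, rCo_rho, map_sum]
  rw [Finset.sum_comm]
  refine Finset.sum_congr rfl fun k _ => ?_
  simp only [← rho_mul]
  rw [← rho_sum]
  congr 2
  conv_rhs => rw [← sum_rGen_rCoord i hx, Finset.mul_sum, map_sum]
  exact Finset.sum_congr rfl fun p _ => by
    rw [← mul_assoc, rCoord_mul i (char_mul_rGen i y p), rMat_apply]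

lemma pair_rGen (m : (rObj i M).carrier) (k : Fin 3) : pair i M m (rGen i k) = rCo i M k m := by
  rw [pair_apply, Finset.sum_eq_single k]
  · rw [rCoord_rGen, if_pos rfl, idem_rCo]
  · intro l _ hl
    rw [rCoord_rGen, if_neg hl, map_zero, LinearMap.zero_apply]
  · simp

lemma pair_d (m : (rObj i M).carrier) {x : Alg} (hx : char i x = 0) :
    pair i M ((rObj i M).d m) x = M.d (pair i M m x) - pair i M ((rObj i M).sig m) (d x) := by
  have h k : rho M (rCoord i k (d x)) (rCo i M k ((rObj i M).sig m)) =
      rho M (d (rCoord i k x)) (M.sig (rCo i M k m)) -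
        ∑ p, rho M (rC i k p * rCoord i p x) (M.sig (rCo i M k m)) := by
    rw [rCoord_d i hx, map_smul, LinearMap.smul_apply, ← map_smul, ← sig_rCo, map_sub,
      LinearMap.sub_apply, rho_sum]
  simp only [pair_apply, h, rCo_d, map_add, map_sum, d_rho, rho_mul, Finset.sum_add_distrib,
    Finset.sum_sub_distrib]
  rw [Finset.sum_comm (f := fun k p => rho M (rCoord i k x) (rho M (rC i p k) _))]
  abel

lemma lCo_tens (x : Alg) (m : M.carrier) (k : Fin 3) :
    lCo i M k (tens i M x m) = rho M (lCoord i k x) m := rfl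

lemma tens_smul (c : ℂ) (x : Alg) (m : M.carrier) : tens i M (c • x) m = c • tens i M x m :=
  lCo_ext fun k => by simp [lCo_tens]

lemma tens_sum (x : Fin 3 → Alg) (m : M.carrier) :
    tens i M (∑ p, x p) m = ∑ p, tens i M (x p) m :=
  lCo_ext fun k => by simp [lCo_tens]

lemma tens_mul {x : Alg} (hx : char i x = 0) (y : Alg) (m : M.carrier) :
    tens i M (x * y) m = rho _ y (tens i M x m) := lCo_ext fun l => by
  simp only [lCo_rho, lCo_tens, ← rho_mul]
  rw [← rho_sum]
  congr 2
  conv_lhs => rw [← sum_lCoord_lGen i hx, Finset.sum_mul, map_sum]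
  exact Finset.sum_congr rfl fun p _ => by
    rw [mul_assoc, lCoord_mul i (char_lGen_mul i y p), lMat_apply]

lemma tens_rho {x : Alg} (hx : char i x = 0) (y : Alg) (m : M.carrier) :
    tens i M x (rho M y m) = tens i M (y * x) m := lCo_ext fun l => by
  rw [lCo_tens, lCo_tens, lCoord_mul i hx, rho_mul]

lemma d_tens {n : ℤ} {x : Alg} (hx : x ∈ gr n) (h : char i x = 0) (m : M.carrier) :
    (lObj i M).d (tens i M x m) = tens i M x (M.d m) + tens i M (d x) (M.sig m) :=
  lCo_ext fun l => by
    simp only [map_add, lCo_d, lCo_tens, d_rho]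
    rw [lCoord_d i hx h, map_add, LinearMap.add_apply, rho_sum, add_assoc]
    congr 2
    exact Finset.sum_congr rfl fun p _ => by
      rw [sig_rho (lCoord_mem i hx p), map_smul, map_smul, LinearMap.smul_apply, rho_mul]

lemma sig_tens {n : ℤ} {x : Alg} (hx : x ∈ gr n) (m : M.carrier) :
    (lObj i M).sig (tens i M x m) = (-1 : ℂ) ^ n • tens i M x (M.sig m) :=
  lCo_ext fun l => by
    have h := sig_lCo (tens i M x m) l
    rw [lCo_tens, sig_rho (lCoord_mem i hx l), sign_add, mul_comm, mul_smul] at h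
    have h' := congrArg ((-1 : ℂ) ^ lDeg i l • ·) h
    simp only [sign_smul_smul] at h'
    rw [← h', map_smul, lCo_tens]

lemma tens_mem {n k : ℤ} {x : Alg} (hx : x ∈ gr n) {m : M.carrier} (hm : m ∈ M.gr k) :
    tens i M x m ∈ (lObj i M).gr (k + n) := mem_lObj fun l => by
  have := rho_mem hm (lCoord_mem i hx l)
  rwa [← add_assoc] at this

lemma pair_mem {n k : ℤ} {m : (rObj i M).carrier} (hm : m ∈ (rObj i M).gr k) {x : Alg}
    (hx : x ∈ gr n) : pair i M m x ∈ M.gr (k + n) := by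
  rw [pair_apply]
  refine Submodule.sum_mem _ fun l _ => ?_
  have := rho_mem (rCo_mem hm l) (rCoord_mem i hx l)
  rwa [show k + rDeg i l + (n - rDeg i l) = k + n by ring] at this

variable (i M)

/-- The map `M ⟶ Hom(ker (char i), M)`. -/
def toR : M ⟶ rObj i M :=
  mkHom (ofRho
    { toFun m := rMk i (fun k => rho M (rGen i k) m) fun k => by rw [← rho_mul, rGen_idem]
      map_add' m n := rCo_ext fun k => by simp
      map_smul' c m := rCo_ext fun k => by simp }
    fun x m => rCo_ext fun l => by
      have e : rho M (rGen i l) (rho M x m) = ∑ k, rho M (rMat i x k l) (rho M (rGen i k) m) := by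
        simp only [← rho_mul]
        rw [← rho_sum]
        congr 2
        exact (sum_rGen_rCoord i (char_mul_rGen i x l)).symm
      exact e)
    (fun n m hm => mem_rObj fun k => rho_mem hm (rGen_mem i k))
    (fun m => rCo_ext fun l => by
      have e : rho M (rGen i l) (M.d m) = M.d (rho M (rGen i l) m) +
          ∑ k, rho M (rC i k l) (M.sig (rho M (rGen i k) m)) := by
        rw [d_rho, d_rGen, map_neg, LinearMap.neg_apply, add_assoc]
        refine (add_eq_left.2 ?_).symm
        rw [neg_add_eq_zero, rho_sum]
        exact Finset.sum_congr rfl fun p _ => by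
          rw [sig_rho (rGen_mem i p), map_smul, map_smul, LinearMap.smul_apply, rho_mul]
      exact e)

lemma rCo_toR (m : M.carrier) (k : Fin 3) : rCo i M k (lin (toR i M) m) = rho M (rGen i k) m := rfl

/-- The counit of the adjunction between `lObj` and `rObj`. -/
def counit : lObj i (rObj i M) ⟶ M :=
  mkHom (ofRho (∑ k, (pair i M).flip (lGen i k) ∘ₗ lCo i (rObj i M) k) fun x m => by
      simp only [LinearMap.sum_apply, LinearMap.comp_apply, LinearMap.flip_apply, lCo_rho, map_sum]
      rw [Finset.sum_comm]
      refine Finset.sum_congr rfl fun k _ => ?_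
      simp only [pair_rho _ _ (char_lGen i _)]
      rw [← map_sum, ← pair_mul _ (char_lGen i k)]
      congr 1
      exact sum_lCoord_lGen i (char_lGen_mul i x k))
    (fun n m hm => by
      change (∑ k, (pair i M).flip (lGen i k) ∘ₗ lCo i (rObj i M) k) m ∈ _
      simp only [LinearMap.sum_apply, LinearMap.comp_apply, LinearMap.flip_apply]
      refine Submodule.sum_mem _ fun k _ => ?_
      have := pair_mem (lCo_mem hm k) (lGen_mem i k)
      rwa [add_assoc, add_neg_cancel, add_zero] at this)
    (fun m => by
      change (∑ k, (pair i M).flip (lGen i k) ∘ₗ lCo i (rObj i M) k) ((lObj i (rObj i M)).d m) =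
        M.d ((∑ k, (pair i M).flip (lGen i k) ∘ₗ lCo i (rObj i M) k) m)
      simp only [LinearMap.sum_apply, LinearMap.comp_apply, LinearMap.flip_apply, lCo_d, map_add,
        map_sum, pair_d _ (char_lGen i _), pair_rho _ _ (char_lGen i _),
        Finset.sum_add_distrib, Finset.sum_sub_distrib, d_lGen]
      rw [Finset.sum_comm (f := fun k p => pair i M _ (lC i p k * _))]
      abel)

lemma counit_apply (m : (lObj i (rObj i M)).carrier) :
    lin (counit i M) m = ∑ k, pair i M (lCo i (rObj i M) k m) (lGen i k) := by
  change (∑ k, (pair i M).flip (lGen i k) ∘ₗ lCo i (rObj i M) k) m = _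
  simp only [LinearMap.sum_apply, LinearMap.comp_apply, LinearMap.flip_apply]

/-- The unit of the adjunction between `lObj` and `rObj`. -/
def unit : M ⟶ rObj i (lObj i M) :=
  mkHom (ofRho
    { toFun m := rMk i (fun k => tens i M (rGen i k) m) fun k => by
        rw [← tens_mul (char_rGen i k), rGen_idem]
      map_add' m n := rCo_ext fun k => by simp
      map_smul' c m := rCo_ext fun k => by simp }
    fun x m => rCo_ext fun l => by
      have e : tens i M (rGen i l) (rho M x m) =
          ∑ k, rho _ (rMat i x k l) (tens i M (rGen i k) m) := by
        rw [tens_rho (char_rGen i l), ← sum_rGen_rCoord i (char_mul_rGen i x l), tens_sum]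
        exact Finset.sum_congr rfl fun p _ => by rw [tens_mul (char_rGen i p), rMat_apply]
      exact e)
    (fun n m hm => mem_rObj fun k => tens_mem (rGen_mem i k) hm)
    (fun m => rCo_ext fun l => by
      have e : tens i M (rGen i l) (M.d m) = (lObj i M).d (tens i M (rGen i l) m) +
          ∑ k, rho _ (rC i k l) ((lObj i M).sig (tens i M (rGen i k) m)) := by
        rw [d_tens (rGen_mem i l) (char_rGen i l), add_assoc]
        refine (add_eq_left.2 ?_).symm
        rw [d_rGen, ← neg_one_smul ℂ, tens_smul, neg_one_smul, neg_add_eq_zero, tens_sum]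
        exact Finset.sum_congr rfl fun p _ => by
          rw [sig_tens (rGen_mem i p), map_smul, tens_smul, tens_mul (char_rGen i p)]
      exact e)

lemma rCo_unit (m : M.carrier) (k : Fin 3) :
    rCo i (lObj i M) k (lin (unit i M) m) = tens i M (rGen i k) m := rfl

end Ginzburg

end

noncomputable section

namespace Ginzburg

open Gen DGModule

section Coordinates

variable {i : Fin 2} {M : DGModule ginzburgA₂}

lemma rCo_rho_eq_pair (x : Alg) (m : (rObj i M).carrier) (l : Fin 3) :
    rCo i M l (rho _ x m) = pair i M m (x * rGen i l) := by
  rw [rCo_rho, pair_apply]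
  rfl

lemma rCo_rho_opp (m : (rObj i M).carrier) (l : Fin 3) :
    rCo i M l (rho _ (g (e (opp i))) m) = if l = 0 then rCo i M 0 m else 0 := by
  have h : g (e (opp i)) * rGen i l = if l = 0 then rGen i 0 else 0 := by
    fin_cases l
    exacts [e_e _, opp_out i, opp_t i]
  rw [rCo_rho_eq_pair, h]
  split_ifs
  exacts [pair_rGen _ _, map_zero _]

lemma rCo_rho_e (m : (rObj i M).carrier) (l : Fin 3) :
    rCo i M l (rho _ (g (e i)) m) = if l = 0 then 0 else rCo i M l m := by
  have h : g (e i) * rGen i l = if l = 0 then 0 else rGen i l := by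
    fin_cases l
    exacts [e_opp i, e_out i, e_t i]
  rw [rCo_rho_eq_pair, h]
  split_ifs
  exacts [map_zero _, pair_rGen _ _]

lemma rCo_rho_out (m : (rObj i M).carrier) (l : Fin 3) :
    rCo i M l (rho _ (g (out i)) m) = if l = 0 then rCo i M 1 m else 0 := by
  have h : g (out i) * rGen i l = if l = 0 then rGen i 1 else 0 := by
    fin_cases l
    · exact out_e i
    · change g (out i) * g (out i) = 0
      rw [show g (out i) * g (out i) = g (out i) * g (e (opp i)) * g (out i) by rw [out_e],
        mul_assoc, opp_out, mul_zero]
    · change g (out i) * g (t i) = 0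
      rw [← out_e, mul_assoc, opp_t, mul_zero]
  rw [rCo_rho_eq_pair, h]
  split_ifs
  exacts [pair_rGen _ _, map_zero _]

lemma lCo_rho_of {x : Alg} {f : Fin 3 → Fin 3} {p : Fin 3 → Prop} [DecidablePred p]
    (h : ∀ k, lGen i k * x = if p k then lGen i (f k) else 0) (m : (lObj i M).carrier) (l : Fin 3) :
    lCo i M l (rho _ x m) = ∑ k, if p k ∧ f k = l then rho M (idem i l) (lCo i M k m) else 0 := by
  rw [lCo_rho]
  refine Finset.sum_congr rfl fun k _ => ?_
  rw [lMat_apply, h]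
  by_cases hp : p k
  · rw [if_pos hp, lCoord_lGen]
    by_cases hf : f k = l
    · rw [if_pos hf, if_pos ⟨hp, hf⟩, hf]
    · rw [if_neg hf, if_neg fun h => hf h.2, map_zero, LinearMap.zero_apply]
  · rw [if_neg hp, if_neg fun h => hp h.1, map_zero, map_zero, LinearMap.zero_apply]

lemma lCo_rho_opp (m : (lObj i M).carrier) (l : Fin 3) :
    lCo i M l (rho _ (g (e (opp i))) m) = if l = 0 then lCo i M 0 m else 0 := by
  have h k : lGen i k * g (e (opp i)) = if k = 0 then lGen i 0 else 0 := by
    fin_cases k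
    exacts [e_e _, inn_opp i, t_opp i]
  rw [lCo_rho_of h (p := fun k => k = 0) (f := fun _ => 0), Fin.sum_univ_three]
  have := idem_lCo m 0
  fin_cases l <;> simp [this]

lemma lCo_rho_e (m : (lObj i M).carrier) (l : Fin 3) :
    lCo i M l (rho _ (g (e i)) m) = if l = 0 then 0 else lCo i M l m := by
  have h k : lGen i k * g (e i) = if k ≠ 0 then lGen i k else 0 := by
    fin_cases k
    exacts [opp_e i, inn_e i, t_e i]
  rw [lCo_rho_of h (p := fun k => k ≠ 0) (f := id), Fin.sum_univ_three]
  have := idem_lCo m l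
  fin_cases l <;> simp_all

lemma lCo_rho_inn (m : (lObj i M).carrier) (l : Fin 3) :
    lCo i M l (rho _ (g (inn i)) m) = if l = 1 then lCo i M 0 m else 0 := by
  have h k : lGen i k * g (inn i) = if k = 0 then lGen i 1 else 0 := by
    fin_cases k
    · exact e_inn i
    · change g (inn i) * g (inn i) = 0
      rw [show g (inn i) * g (inn i) = g (inn i) * (g (e (opp i)) * g (inn i)) by rw [e_inn],
        ← mul_assoc, inn_opp, zero_mul]
    · change g (t i) * g (inn i) = 0
      rw [← e_inn, ← mul_assoc, t_opp, zero_mul]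
  rw [lCo_rho_of h (p := fun k => k = 0) (f := fun _ => 1), Fin.sum_univ_three]
  have : rho M (idem i 1) (lCo i M 0 m) = lCo i M 0 m := idem_lCo m 0
  fin_cases l <;> simp [this]

lemma rCo_d_zero (m : (rObj i M).carrier) :
    rCo i M 0 ((rObj i M).d m) = M.d (rCo i M 0 m) := by
  simp [rCo_d, rC]

lemma rCo_d_one (m : (rObj i M).carrier) :
    rCo i M 1 ((rObj i M).d m) = M.d (rCo i M 1 m) := by
  simp [rCo_d, rC]

lemma rCo_d_two (m : (rObj i M).carrier) : rCo i M 2 ((rObj i M).d m) =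
    M.d (rCo i M 2 m) - rho M (g (inn i)) (M.sig (rCo i M 1 m)) := by
  simp [rCo_d, rC, Fin.sum_univ_three, sub_eq_add_neg]

lemma lCo_d_zero (m : (lObj i M).carrier) :
    lCo i M 0 ((lObj i M).d m) = M.d (lCo i M 0 m) := by
  simp [lCo_d, lC]

lemma lCo_d_one (m : (lObj i M).carrier) : lCo i M 1 ((lObj i M).d m) =
    M.d (lCo i M 1 m) + sg i • rho M (g (out i)) (M.sig (lCo i M 2 m)) := by
  simp [lCo_d, lC, Fin.sum_univ_three]

lemma lCo_d_two (m : (lObj i M).carrier) :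
    lCo i M 2 ((lObj i M).d m) = M.d (lCo i M 2 m) := by
  simp [lCo_d, lC]

lemma rCo_sig (m : (rObj i M).carrier) (k : Fin 3) :
    rCo i M k ((rObj i M).sig m) = (-1 : ℂ) ^ rDeg i k • M.sig (rCo i M k m) := by
  rw [sig_rCo, sign_smul_smul]

lemma lCo_sig (m : (lObj i M).carrier) (k : Fin 3) :
    lCo i M k ((lObj i M).sig m) = (-1 : ℂ) ^ lDeg i k • M.sig (lCo i M k m) := by
  rw [sig_lCo, sign_smul_smul]

lemma d_rho_idem (k : Fin 3) (m : M.carrier) :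
    M.d (rho M (idem i k) m) = rho M (idem i k) (M.d m) := by
  rw [d_rho, d_idem, map_zero, LinearMap.zero_apply, add_zero]

lemma sig_rho_idem (k : Fin 3) (m : M.carrier) :
    M.sig (rho M (idem i k) m) = rho M (idem i k) (M.sig m) := by
  rw [sig_rho (idem_mem i k), zpow_zero, one_smul]

variable (i M)

/-- The inclusions of the coordinates of `rObj`. -/
def rIn (k : Fin 3) : M.carrier →ₗ[ℂ] (rObj i M).carrier where
  toFun m := rMk i (fun l => if l = k then rho M (idem i k) m else 0) fun l => by
    split_ifs with h
    · rw [h, ← rho_mul, idem_idem]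
    · rw [map_zero]
  map_add' m n := rCo_ext fun l => by
    simp only [map_add, rCo_rMk]
    split_ifs <;> simp
  map_smul' c m := rCo_ext fun l => by
    simp only [map_smul, rCo_rMk]
    split_ifs <;> simp

/-- The inclusions of the coordinates of `lObj`. -/
def lIn (k : Fin 3) : M.carrier →ₗ[ℂ] (lObj i M).carrier where
  toFun m := lMk i (fun l => if l = k then rho M (idem i k) m else 0) fun l => by
    split_ifs with h
    · rw [h, ← rho_mul, idem_idem]
    · rw [map_zero]
  map_add' m n := lCo_ext fun l => by
    simp only [map_add, lCo_lMk]
    split_ifs <;> simp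
  map_smul' c m := lCo_ext fun l => by
    simp only [map_smul, lCo_lMk]
    split_ifs <;> simp

variable {i M}

lemma rCo_rIn (k l : Fin 3) (m : M.carrier) :
    rCo i M l (rIn i M k m) = if l = k then rho M (idem i k) m else 0 := rfl

lemma lCo_lIn (k l : Fin 3) (m : M.carrier) :
    lCo i M l (lIn i M k m) = if l = k then rho M (idem i k) m else 0 := rfl

lemma rCo_idem_zero (m : (rObj i M).carrier) (l : Fin 3) :
    rCo i M l (rho _ (idem i 0) m) = if l = 0 then rCo i M 0 m else 0 := rCo_rho_opp m l

lemma rCo_idem_two (m : (rObj i M).carrier) (l : Fin 3) :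
    rCo i M l (rho _ (idem i 2) m) = if l = 0 then 0 else rCo i M l m := rCo_rho_e m l

lemma lCo_idem_zero (m : (lObj i M).carrier) (l : Fin 3) :
    lCo i M l (rho _ (idem i 0) m) = if l = 0 then lCo i M 0 m else 0 := lCo_rho_opp m l

lemma idem_one : idem i 1 = idem i 0 := rfl

lemma idem_zero_inn (m : M.carrier) : rho M (idem i 0) (rho M (g (inn i)) m) = 0 := by
  rw [← rho_mul, show g (inn i) * idem i 0 = 0 from inn_opp i, map_zero, LinearMap.zero_apply]

lemma idem_two_inn (m : M.carrier) :
    rho M (idem i 2) (rho M (g (inn i)) m) = rho M (g (inn i)) m := by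
  rw [← rho_mul, show g (inn i) * idem i 2 = g (inn i) from inn_e i]

lemma idem_zero_out (m : M.carrier) :
    rho M (idem i 0) (rho M (g (out i)) m) = rho M (g (out i)) m := by
  rw [← rho_mul, show g (out i) * idem i 0 = g (out i) from out_e i]

lemma out_idem_zero (m : M.carrier) : rho M (g (out i)) (rho M (idem i 0) m) = 0 := by
  rw [← rho_mul, show idem i 0 * g (out i) = 0 from opp_out i, map_zero, LinearMap.zero_apply]

lemma idem_zero_two (m : M.carrier) : rho M (idem i 0) (rho M (idem i 2) m) = 0 := by
  rw [← rho_mul, show idem i 2 * idem i 0 = 0 from e_opp i, map_zero, LinearMap.zero_apply]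

lemma idem_two_zero (m : M.carrier) : rho M (idem i 2) (rho M (idem i 0) m) = 0 := by
  rw [← rho_mul, show idem i 0 * idem i 2 = 0 from opp_e i, map_zero, LinearMap.zero_apply]

lemma idem_zero_rCo (m : (rObj i M).carrier) : rho M (idem i 0) (rCo i M 2 m) = 0 := by
  rw [← idem_rCo, idem_zero_two]

lemma idem_two_rCo (m : (rObj i M).carrier) : rho M (idem i 2) (rCo i M 0 m) = 0 := by
  rw [← idem_rCo, idem_two_zero]

lemma idem_zero_lCo (m : (lObj i M).carrier) : rho M (idem i 0) (lCo i M 2 m) = 0 := by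
  rw [← idem_lCo, idem_zero_two]

lemma idem_two_lCo (m : (lObj i M).carrier) : rho M (idem i 2) (lCo i M 0 m) = 0 := by
  rw [← idem_lCo, idem_two_zero]

lemma out_lCo (m : (lObj i M).carrier) : rho M (g (out i)) (lCo i M 0 m) = 0 := by
  rw [← idem_lCo, out_idem_zero]

lemma idem_zero_rCo_one (m : (rObj i M).carrier) :
    rho M (idem i 0) (rCo i M 1 m) = rCo i M 1 m := idem_rCo m 1

lemma idem_zero_lCo_one (m : (lObj i M).carrier) :
    rho M (idem i 0) (lCo i M 1 m) = lCo i M 1 m := idem_lCo m 1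

lemma rCo_sig_one (m : (rObj i M).carrier) :
    rCo i M 1 ((rObj i M).sig m) = sg i • M.sig (rCo i M 1 m) := by
  rw [rCo_sig, show rDeg i 1 = (out i).deg from rfl, sign_out]

lemma lCo_sig_zero (m : (lObj i M).carrier) :
    lCo i M 0 ((lObj i M).sig m) = M.sig (lCo i M 0 m) := by
  rw [lCo_sig, show lDeg i 0 = 0 from rfl, zpow_zero, one_smul]

lemma lCoord_rGen_zero : lCoord i 0 (rGen i 0) = idem i 0 := e_e _
lemma lCoord_rGen_one : lCoord i 0 (rGen i 1) = g (out i) := out_e _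
lemma lCoord_rGen_two : lCoord i 2 (rGen i 2) = idem i 2 := lT_t i
lemma lCoord_rGen_one_two : lCoord i 1 (rGen i 2) = 0 := lInn_t i

lemma sig_out (m : M.carrier) :
    M.sig (rho M (g (out i)) m) = sg i • rho M (g (out i)) (M.sig m) := by
  rw [sig_rho (g_mem (out i)), sign_out]

lemma idem_add (m : M.carrier) : rho M (idem i 0) m + rho M (idem i 2) m = m := by
  have : idem i 0 + idem i 2 = 1 := (add_comm _ _).trans (e_add_opp i)
  rw [← LinearMap.add_apply, ← map_add, this, rho_one]

lemma rCo_lCo_zero (m : (lObj i (rObj i M)).carrier) (l : Fin 3) (hl : l ≠ 0) :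
    rCo i M l (lCo i (rObj i M) 0 m) = 0 := by
  have h := rCo_rho_opp (lCo i (rObj i M) 0 m) l
  rwa [if_neg hl, show g (e (opp i)) = idem i 0 from rfl, idem_lCo] at h

lemma rCo_lCo_one (m : (lObj i (rObj i M)).carrier) (l : Fin 3) (hl : l ≠ 0) :
    rCo i M l (lCo i (rObj i M) 1 m) = 0 := by
  have h := rCo_rho_opp (lCo i (rObj i M) 1 m) l
  rwa [if_neg hl, show g (e (opp i)) = idem i 1 from rfl, idem_lCo] at h

lemma rCo_lCo_two (m : (lObj i (rObj i M)).carrier) : rCo i M 0 (lCo i (rObj i M) 2 m) = 0 := by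
  have h := rCo_rho_e (lCo i (rObj i M) 2 m) 0
  rwa [if_pos rfl, show g (e i) = idem i 2 from rfl, idem_lCo] at h

lemma lCo_rCo_zero (m : (rObj i (lObj i M)).carrier) (l : Fin 3) (hl : l ≠ 0) :
    lCo i M l (rCo i (lObj i M) 0 m) = 0 := by
  have h := lCo_rho_opp (rCo i (lObj i M) 0 m) l
  rwa [if_neg hl, show g (e (opp i)) = idem i 0 from rfl, idem_rCo] at h

lemma lCo_rCo_one (m : (rObj i (lObj i M)).carrier) (l : Fin 3) (hl : l ≠ 0) :
    lCo i M l (rCo i (lObj i M) 1 m) = 0 := by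
  have h := lCo_rho_opp (rCo i (lObj i M) 1 m) l
  rwa [if_neg hl, show g (e (opp i)) = idem i 1 from rfl, idem_rCo] at h

lemma lCo_rCo_two (m : (rObj i (lObj i M)).carrier) : lCo i M 0 (rCo i (lObj i M) 2 m) = 0 := by
  have h := lCo_rho_e (rCo i (lObj i M) 2 m) 0
  rwa [if_pos rfl, show g (e i) = idem i 2 from rfl, idem_rCo] at h

lemma ext_lObj_rObj {m n : (lObj i (rObj i M)).carrier}
    (h₀ : rCo i M 0 (lCo i _ 0 m) = rCo i M 0 (lCo i _ 0 n))
    (h₁ : rCo i M 0 (lCo i _ 1 m) = rCo i M 0 (lCo i _ 1 n))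
    (h₂ : rCo i M 1 (lCo i _ 2 m) = rCo i M 1 (lCo i _ 2 n))
    (h₃ : rCo i M 2 (lCo i _ 2 m) = rCo i M 2 (lCo i _ 2 n)) : m = n :=
  lCo_ext fun k => rCo_ext fun l => by
    fin_cases k <;> fin_cases l <;>
      simp only [Fin.zero_eta, Fin.mk_one, Fin.reduceFinMk, rCo_lCo_two, rCo_lCo_zero _ _ one_ne_zero,
        rCo_lCo_zero _ 2 (by decide), rCo_lCo_one _ _ one_ne_zero, rCo_lCo_one _ 2 (by decide), *]

lemma ext_rObj_lObj {m n : (rObj i (lObj i M)).carrier}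
    (h₀ : lCo i M 0 (rCo i _ 0 m) = lCo i M 0 (rCo i _ 0 n))
    (h₁ : lCo i M 0 (rCo i _ 1 m) = lCo i M 0 (rCo i _ 1 n))
    (h₂ : lCo i M 1 (rCo i _ 2 m) = lCo i M 1 (rCo i _ 2 n))
    (h₃ : lCo i M 2 (rCo i _ 2 m) = lCo i M 2 (rCo i _ 2 n)) : m = n :=
  rCo_ext fun k => lCo_ext fun l => by
    fin_cases k <;> fin_cases l <;>
      simp only [Fin.zero_eta, Fin.mk_one, Fin.reduceFinMk, lCo_rCo_two, lCo_rCo_zero _ _ one_ne_zero,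
        lCo_rCo_zero _ 2 (by decide), lCo_rCo_one _ _ one_ne_zero, lCo_rCo_one _ 2 (by decide), *]

end Coordinates

variable (i : Fin 2) (M : DGModule ginzburgA₂)

lemma counit_eq (m : (lObj i (rObj i M)).carrier) : lin (counit i M) m =
    rCo i M 0 (lCo i _ 0 m) + rho M (g (inn i)) (rCo i M 0 (lCo i _ 1 m)) +
      rCo i M 2 (lCo i _ 2 m) := by
  have h₀ : lGen i 0 = rGen i 0 := rfl
  have h₂ : lGen i 2 = rGen i 2 := rfl
  have h₁ : lGen i 1 = rGen i 0 * g (inn i) := (e_inn i).symm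
  rw [counit_apply, Fin.sum_univ_three, h₀, h₁, h₂, pair_rGen, pair_rGen,
    pair_mul _ (char_rGen i 0), pair_rGen]

lemma quasiIso_counit : QuasiIso (counit i M) := by
  refine quasiIso_of_homotopy _ (lIn i _ 0 ∘ₗ rIn i M 0 + lIn i _ 2 ∘ₗ rIn i M 2)
    (-(lIn i _ 2 ∘ₗ rIn i M 1 ∘ₗ M.sig ∘ₗ rCo i M 0 ∘ₗ lCo i _ 1)) 0 (fun m => ?_) (fun m => ?_)
    (fun m => ?_)
  · apply ext_lObj_rObj <;>
    simp [lCo_d_zero, lCo_d_one, lCo_d_two, rCo_d_zero, rCo_d_one, rCo_d_two, lCo_lIn, rCo_rIn,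
      rCo_rho_out, d_rho_idem, rCo_idem_zero, rCo_idem_two, rCo_sig_one]
  · rw [counit_eq]
    apply ext_lObj_rObj <;>
    simp [lCo_d_zero, lCo_d_one, lCo_d_two, rCo_d_zero, rCo_d_one, rCo_d_two, lCo_lIn, rCo_rIn,
      rCo_rho_out, ← d_rho_idem, ← sig_rho_idem, rCo_idem_zero, rCo_idem_two, rCo_sig_one, idem_one,
      idem_zero_inn, idem_two_inn, idem_zero_rCo, idem_two_rCo, idem_rCo, idem_zero_rCo_one, sg_sg,
      sig_sig, sig_d]
  · rw [counit_eq]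
    simp [lCo_lIn, rCo_rIn, rCo_idem_zero, rCo_idem_two, idem_add]

lemma quasiIso_unit : QuasiIso (unit i M) := by
  refine quasiIso_of_homotopy _ (lCo i M 0 ∘ₗ rCo i _ 0 + lCo i M 2 ∘ₗ rCo i _ 2) 0
    (rIn i _ 1 ∘ₗ lIn i M 0 ∘ₗ M.sig ∘ₗ lCo i M 1 ∘ₗ rCo i _ 2) (fun m => ?_) (fun m => ?_)
    (fun m => ?_)
  · simp [lCo_d_zero, lCo_d_two, rCo_d_zero, rCo_d_two, lCo_rho_inn]
  · simp [rCo_unit, lCo_tens, lCoord_rGen_zero, lCoord_rGen_two, idem_add]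
  · apply ext_rObj_lObj <;>
    simp [lCo_d_zero, lCo_d_one, rCo_d_zero, rCo_d_one, rCo_d_two, lCo_lIn, rCo_rIn,
      lCo_rho_inn, ← d_rho_idem, ← sig_rho_idem, lCo_idem_zero, rCo_unit, lCo_tens,
      lCoord_rGen_zero, lCoord_rGen_one, lCoord_rGen_two, lCoord_rGen_one_two, idem_zero_lCo,
      idem_two_lCo, idem_lCo, idem_zero_lCo_one, idem_one, out_lCo, lCo_sig_zero, sig_out, sg_sg,
      sig_sig, sig_d, idem_zero_out]
    abel

/-- Tensoring with the dual of the right ideal `ker (char i)`. -/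
def rFun : DGFunctor ginzburgA₂ := (rBimodule i).tensor

/-- Tensoring with the left ideal `ker (char i)`. -/
def lFun : DGFunctor ginzburgA₂ := (lBimodule i).tensor

lemma triangular_rBimodule : (rBimodule i).Triangular (1 : Fin 3) (2 : Fin 3) where
  ne := (by decide : (1 : Fin 3) ≠ 2)
  c_eq_zero _ _ h := if_neg h

lemma triangular_lBimodule : (lBimodule i).Triangular (2 : Fin 3) (1 : Fin 3) where
  ne := (by decide : (2 : Fin 3) ≠ 1)
  c_eq_zero _ _ h := if_neg h

instance : (rFun i).PreservesAcyclic := (triangular_rBimodule i).preservesAcyclic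

instance : (lFun i).PreservesAcyclic := (triangular_lBimodule i).preservesAcyclic

lemma fd_rFun (X : DerCat ginzburgA₂) (hX : DerCat.fd _ X) : DerCat.fd _ ((rFun i).der.obj X) :=
  have : (rBimodule i).tensor.PreservesAcyclic := (triangular_rBimodule i).preservesAcyclic
  (triangular_rBimodule i).fd_der X hX

lemma fd_lFun (X : DerCat ginzburgA₂) (hX : DerCat.fd _ X) : DerCat.fd _ ((lFun i).der.obj X) :=
  have : (lBimodule i).tensor.PreservesAcyclic := (triangular_lBimodule i).preservesAcyclic
  (triangular_lBimodule i).fd_der X hX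

/-- The natural transformation `M ⟶ Hom(ker (char i), M)`. -/
def toRNat : 𝟭 (DGModule ginzburgA₂) ⟶ (rFun i).functor where
  app M := toR i M
  naturality _ _ f := hom_ext fun m => rCo_ext fun _ => (map_rho (lin f) _ m).symm

/-- The unit of the adjunction, as a natural transformation. -/
def unitNat : 𝟭 (DGModule ginzburgA₂) ⟶ (lFun i).functor ⋙ (rFun i).functor where
  app M := unit i M
  naturality _ _ f := hom_ext fun m => rCo_ext fun _ => lCo_ext fun _ =>
    (map_rho (lin f) _ m).symm

/-- The counit of the adjunction, as a natural transformation. -/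
def counitNat : (rFun i).functor ⋙ (lFun i).functor ⟶ 𝟭 (DGModule ginzburgA₂) where
  app M := counit i M
  naturality M N f := hom_ext fun m => by
    refine (counit_eq i N _).trans (Eq.trans ?_ (congrArg (lin f) (counit_eq i M m)).symm)
    rw [map_add, map_add, map_rho]
    rfl

lemma exists_equivalence : ∃ Φ : D ≌ D, Φ.functor = (rFun i).fd (fd_rFun i) := by
  obtain ⟨Φ, hΦ⟩ := DGFunctor.exists_equivalence (fd_lFun i) (fd_rFun i) (unitNat i)
    (quasiIso_unit i) (counitNat i) (quasiIso_counit i)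
  exact ⟨Φ.symm, hΦ.2⟩

end Ginzburg

end

noncomputable section

namespace DGModule

variable {A : DGAlgebra}

/-- The cocycles of degree `n`. -/
def cocycles (M : DGModule A) (n : ℤ) : Submodule ℂ M.carrier := M.gr n ⊓ LinearMap.ker M.d

lemma mem_of_cocycles {M : DGModule A} {n : ℤ} {x : M.carrier} (hx : x ∈ M.cocycles n) :
    x ∈ M.gr n := hx.1

lemma d_of_cocycles {M : DGModule A} {n : ℤ} {x : M.carrier} (hx : x ∈ M.cocycles n) :
    M.d x = 0 := hx.2

lemma acyclic_cone {M N : DGModule A} (f : M ⟶ N) (hM : M.Acyclic) (hN : N.Acyclic) :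
    (cone f).Acyclic :=
  QuasiIso.acyclic_cone ⟨fun x _ hx _ => hM x hx, fun y hy => by
    obtain ⟨z, hz⟩ := hN y hy
    exact ⟨0, z, map_zero _, by rw [map_zero, zero_add, hz]⟩⟩

lemma Acyclic.shift {M : DGModule A} (hM : M.Acyclic) (k : ℤ) : (M.shift k).Acyclic := by
  intro x hx
  have h (x : M.carrier) (hx : (-1 : ℂ) ^ k • M.d x = 0) :
      ∃ y : M.carrier, (-1 : ℂ) ^ k • M.d y = x := by
    have h₁ := congrArg (fun y => (-1 : ℂ) ^ k • y) hx
    simp only [sign_smul_smul, smul_zero] at h₁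
    obtain ⟨y, hy⟩ := hM x h₁
    exact ⟨(-1 : ℂ) ^ k • y, by rw [map_smul, sign_smul_smul, hy]⟩
  exact h x hx

end DGModule

namespace Ginzburg

open Gen DGModule

variable (i : Fin 2)

lemma char_zero_add {x y : Alg} (hx : char i x = 0) (hy : char i y = 0) : char i (x + y) = 0 := by
  rw [map_add, hx, hy, add_zero]

lemma char_zero_mul {x : Alg} (hx : char i x = 0) (y : Alg) : char i (x * y) = 0 := by
  rw [map_mul, hx, zero_mul]

/-- The right ideal `ker (char i)`. -/
def idealSubmodule : Submodule ginzburgA₂.carrierᵐᵒᵖ (free ginzburgA₂).carrier where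
  carrier := {x | char i x = 0}
  add_mem' {_ _} hx hy := char_zero_add i hx hy
  zero_mem' := map_zero (char i)
  smul_mem' a _ hx := char_zero_mul i hx a.unop

lemma char_proj_zero (x : (free ginzburgA₂).carrier) :
    char i (proj (free ginzburgA₂).isInternal 0 x) = char i x := by
  refine LinearMap.congr_fun (f := (char i).toLinearMap ∘ₗ proj (free ginzburgA₂).isInternal 0)
    (g := (char i).toLinearMap) (linearMap_ext_gr (free ginzburgA₂).isInternal fun n y hy => ?_) x
  by_cases hn : n = 0
  · subst hn
    exact congrArg (char i) (proj_of_mem (free ginzburgA₂).isInternal hy)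
  · refine (congrArg (char i) (proj_of_mem_ne (free ginzburgA₂).isInternal hn hy)).trans
      ((map_zero (char i)).trans (char_gr hn hy).symm)

/-- The right ideal `ker (char i)`, as a dg module. -/
def ideal : DGModule ginzburgA₂ := (free ginzburgA₂).sub (idealSubmodule i) (fun x _ => char_d x)
  (fun n x hx => by
    by_cases hn : n = 0
    · subst hn
      exact (char_proj_zero i x).trans hx
    · exact char_gr hn (proj_mem (free ginzburgA₂).isInternal n x))

/-- The inclusion of the ideal. -/
def idealι : ideal i ⟶ free ginzburgA₂ := subι _ _ _ _

/-- The two term resolution of the simple module by the ideal and the free module. -/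
def res : DGModule ginzburgA₂ := cone (idealι i)

/-- The coordinate in the ideal. -/
def resI : (res i).carrier →ₗ[ℂ] Alg :=
  ((lin (idealι i)).restrictScalars ℂ) ∘ₗ LinearMap.fst ℂ (ideal i).carrier (free ginzburgA₂).carrier

/-- The coordinate in the free module. -/
def resA : (res i).carrier →ₗ[ℂ] Alg :=
  LinearMap.snd ℂ (ideal i).carrier (free ginzburgA₂).carrier

variable {i}

/-- Constructor for elements of `res`. -/
def resMk {x : Alg} (hx : char i x = 0) (z : Alg) : (res i).carrier := (⟨x, hx⟩, z)

@[simp] lemma resI_resMk {x : Alg} (hx : char i x = 0) (z : Alg) : resI i (resMk hx z) = x := rfl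

@[simp] lemma resA_resMk {x : Alg} (hx : char i x = 0) (z : Alg) : resA i (resMk hx z) = z := rfl

lemma char_resI (c : (res i).carrier) : char i (resI i c) = 0 := c.1.2

lemma res_ext {c c' : (res i).carrier} (h : resI i c = resI i c') (h' : resA i c = resA i c') :
    c = c' := Prod.ext (Subtype.ext h) h'

lemma resI_d (c : (res i).carrier) : resI i ((res i).d c) = -d (resI i c) := rfl

lemma resA_d (c : (res i).carrier) : resA i ((res i).d c) = resI i c + d (resA i c) := rfl

lemma resI_rho (x : Alg) (c : (res i).carrier) : resI i (rho _ x c) = resI i c * x := rfl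

lemma resA_rho (x : Alg) (c : (res i).carrier) : resA i (rho _ x c) = resA i c * x := rfl

lemma resI_mem {n : ℤ} {c : (res i).carrier} (hc : c ∈ (res i).gr n) : resI i c ∈ gr (n + 1) :=
  hc.1

lemma resA_mem {n : ℤ} {c : (res i).carrier} (hc : c ∈ (res i).gr n) : resA i c ∈ gr n :=
  hc.2

lemma mem_res {n : ℤ} {c : (res i).carrier} (h : resI i c ∈ gr (n + 1)) (h' : resA i c ∈ gr n) :
    c ∈ (res i).gr n := ⟨h, h'⟩

variable (i) in
/-- The generators of `res` in the ideal. -/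
def resGen (k : Fin 3) : (res i).carrier := resMk (char_rGen i k) 0

variable (i) in
/-- The generator of `res` in the free module. -/
def resOne : (res i).carrier := resMk (i := i) (map_zero _) 1

lemma resGen_mem (k : Fin 3) : resGen i k ∈ (res i).gr (rDeg i k - 1) :=
  mem_res (by rw [sub_add_cancel]; exact rGen_mem i k) (zero_mem _)

lemma resOne_mem : resOne i ∈ (res i).gr 0 := mem_res (zero_mem _) (SetLike.one_mem_graded gr)

lemma d_resOne : (res i).d (resOne i) = 0 := res_ext
  (by rw [resI_d, resOne, resI_resMk, map_zero, neg_zero, map_zero])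
  (by rw [resA_d, resOne, resI_resMk, resA_resMk, d_one, zero_add, map_zero])

lemma resGen_idem (k : Fin 3) : rho _ (idem i k) (resGen i k) = resGen i k := res_ext
  (by rw [resI_rho, resGen, resI_resMk, rGen_idem]) (by rw [resA_rho, resGen, resA_resMk, zero_mul])

variable {M : DGModule ginzburgA₂}

/-- The restriction of a linear map to the ideal, as an element of `rObj`. -/
def resCo (h : (res i).carrier →ₗ[ginzburgA₂.carrierᵐᵒᵖ] M.carrier) : (rObj i M).carrier :=
  rMk i (fun k => h (resGen i k)) fun k => by rw [← map_rho, resGen_idem]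

lemma resMk_eq {x : Alg} (hx : char i x = 0) :
    resMk hx 0 = ∑ k, rho _ (rCoord i k x) (resGen i k) := res_ext
  (by
    rw [map_sum, resI_resMk]
    simp only [resI_rho, resGen, resI_resMk]
    exact (sum_rGen_rCoord i hx).symm)
  (by
    rw [map_sum, resA_resMk]
    simp only [resA_rho, resGen, resA_resMk, zero_mul, Finset.sum_const_zero])

lemma map_resMk (h : (res i).carrier →ₗ[ginzburgA₂.carrierᵐᵒᵖ] M.carrier) {x : Alg}
    (hx : char i x = 0) : h (resMk hx 0) = pair i M (resCo h) x := by
  rw [resMk_eq, map_sum, pair_apply]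
  exact Finset.sum_congr rfl fun k _ => map_rho h _ _

lemma res_eq (c : (res i).carrier) :
    c = resMk (char_resI c) 0 + rho _ (resA i c) (resOne i) := res_ext
  (by rw [map_add, resI_rho, resI_resMk, resOne, resI_resMk, zero_mul, add_zero])
  (by rw [map_add, resA_rho, resA_resMk, resOne, resA_resMk, one_mul, zero_add])

lemma map_res (h : (res i).carrier →ₗ[ginzburgA₂.carrierᵐᵒᵖ] M.carrier) (c : (res i).carrier) :
    h c = pair i M (resCo h) (resI i c) + rho M (resA i c) (h (resOne i)) := by
  conv_lhs => rw [res_eq c, map_add, map_resMk, map_rho]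

variable (i M)

/-- The fibre of the map from `M` to the morphisms from the ideal to `M`. -/
def fib : DGModule ginzburgA₂ := (cone (toR i M)).shift (-1)

/-- The first coordinate. -/
def fibM : (fib i M).carrier →ₗ[ℂ] M.carrier := LinearMap.fst ℂ M.carrier (rObj i M).carrier

/-- The second coordinate. -/
def fibR : (fib i M).carrier →ₗ[ℂ] (rObj i M).carrier :=
  LinearMap.snd ℂ M.carrier (rObj i M).carrier

variable {i M}

/-- Constructor for elements of `fib`. -/
def fibMk (m : M.carrier) (f : (rObj i M).carrier) : (fib i M).carrier := (m, f)

@[simp] lemma fibM_fibMk (m : M.carrier) (f : (rObj i M).carrier) : fibM i M (fibMk m f) = m := rfl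

@[simp] lemma fibR_fibMk (m : M.carrier) (f : (rObj i M).carrier) : fibR i M (fibMk m f) = f := rfl

lemma fib_ext {w w' : (fib i M).carrier} (h : fibM i M w = fibM i M w')
    (h' : fibR i M w = fibR i M w') : w = w' := Prod.ext h h'

lemma fib_d (w : (fib i M).carrier) : (fib i M).d w = fibMk (M.d (fibM i M w))
    (-(lin (toR i M) (fibM i M w) + (rObj i M).d (fibR i M w))) := by
  have key (m : M.carrier) (f : (rObj i M).carrier) : ((-1 : ℂ) ^ (-1 : ℤ)) • (((-M.d m,
      lin (toR i M) m + (rObj i M).d f)) : M.carrier × (rObj i M).carrier) =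
      (M.d m, -(lin (toR i M) m + (rObj i M).d f)) := by
    rw [zpow_neg, zpow_one, inv_neg, inv_one, neg_one_smul]
    ext
    · simp
    · simp
  exact key _ _

lemma fibM_d (w : (fib i M).carrier) : fibM i M ((fib i M).d w) = M.d (fibM i M w) := by
  rw [fib_d, fibM_fibMk]

lemma fibR_d (w : (fib i M).carrier) : fibR i M ((fib i M).d w) =
    -(lin (toR i M) (fibM i M w) + (rObj i M).d (fibR i M w)) := by
  rw [fib_d, fibR_fibMk]

lemma fibM_rho (x : Alg) (w : (fib i M).carrier) :
    fibM i M (rho _ x w) = rho M x (fibM i M w) := rfl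

lemma fibR_rho (x : Alg) (w : (fib i M).carrier) :
    fibR i M (rho _ x w) = rho _ x (fibR i M w) := rfl

lemma fibM_mem {n : ℤ} {w : (fib i M).carrier} (hw : w ∈ (fib i M).gr n) :
    fibM i M w ∈ M.gr n := by
  have : fibM i M w ∈ M.gr (n + -1 + 1) := hw.1
  rwa [neg_add_cancel_right] at this

lemma fibR_mem {n : ℤ} {w : (fib i M).carrier} (hw : w ∈ (fib i M).gr n) :
    fibR i M w ∈ (rObj i M).gr (n - 1) := hw.2

lemma mem_fib {n : ℤ} {w : (fib i M).carrier} (h : fibM i M w ∈ M.gr n)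
    (h' : fibR i M w ∈ (rObj i M).gr (n - 1)) : w ∈ (fib i M).gr n := by
  have h₁ : fibM i M w ∈ M.gr (n + -1 + 1) := by rwa [neg_add_cancel_right]
  exact ⟨h₁, h'⟩

lemma toR_pair {f : (rObj i M).carrier} {x : Alg} (hx : char i x = 0) :
    lin (toR i M) (pair i M f x) = rho _ x f := rCo_ext fun k => by
  rw [rCo_toR, ← pair_mul _ hx, rCo_rho_eq_pair]

lemma pair_toR (m : M.carrier) {x : Alg} (hx : char i x = 0) :
    pair i M (lin (toR i M) m) x = rho M x m := by
  rw [pair_apply]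
  simp only [rCo_toR, ← rho_mul]
  rw [← rho_sum, sum_rGen_rCoord i hx]

variable (i M) in
/-- The projection of the fibre. -/
def fibEv : fib i M ⟶ M :=
  mkHom (ofRho (fibM i M) fibM_rho) (fun _ _ hx => fibM_mem hx) fibM_d

lemma cocycle_fib {l : ℤ} {w : (fib i M).carrier} (hw : w ∈ (fib i M).cocycles l) :
    M.d (fibM i M w) = 0 ∧ (rObj i M).d (fibR i M w) = -lin (toR i M) (fibM i M w) := by
  have h : (fib i M).d w = 0 := hw.2
  refine ⟨by rw [← fibM_d, h, map_zero], ?_⟩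
  have h' := fibR_d w
  rw [h, map_zero, eq_comm, neg_eq_zero] at h'
  exact eq_neg_of_add_eq_zero_right h'

lemma pair_d_of_mem {n : ℤ} {f : (rObj i M).carrier} (hf : f ∈ (rObj i M).gr n) {x : Alg}
    (hx : char i x = 0) : M.d (pair i M f x) =
      pair i M ((rObj i M).d f) x + (-1 : ℂ) ^ n • pair i M f (d x) := by
  rw [pair_d f hx, sig_of_mem hf, map_smul, LinearMap.smul_apply, sub_add_cancel]

/-- The map underlying `toFib`. -/
def toFibLin (l : ℤ) (w : (fib i M).carrier) : (res i).carrier →ₗ[ℂ] (fib i M).carrier where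
  toFun c := fibMk (-((-1 : ℂ) ^ l • pair i M (fibR i M w) (resI i c)) +
    rho M (resA i c) (fibM i M w)) (rho _ (resA i c) (fibR i M w))
  map_add' c c' := fib_ext (by
      simp only [map_add, fibM_fibMk, LinearMap.add_apply, smul_add, neg_add_rev]
      abel) (by simp only [map_add, fibR_fibMk, LinearMap.add_apply])
  map_smul' r c := fib_ext (by
      simp only [map_smul, fibM_fibMk, LinearMap.smul_apply, smul_add, smul_neg, smul_comm r,
        RingHom.id_apply]) (by simp only [map_smul, fibR_fibMk, LinearMap.smul_apply,
        RingHom.id_apply])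

lemma fibM_toFibLin (l : ℤ) (w : (fib i M).carrier) (c : (res i).carrier) :
    fibM i M (toFibLin l w c) = -((-1 : ℂ) ^ l • pair i M (fibR i M w) (resI i c)) +
    rho M (resA i c) (fibM i M w) := rfl

lemma fibR_toFibLin (l : ℤ) (w : (fib i M).carrier) (c : (res i).carrier) :
    fibR i M (toFibLin l w c) = rho _ (resA i c) (fibR i M w) := rfl

lemma toFibLin_rho (l : ℤ) (w : (fib i M).carrier) (x : Alg) (c : (res i).carrier) :
    toFibLin l w (rho _ x c) = rho _ x (toFibLin l w c) := fib_ext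
  (by simp only [fibM_toFibLin, fibM_rho, resI_rho, resA_rho, map_add, map_neg, map_smul,
      pair_mul _ (char_resI c), rho_mul])
  (by simp only [fibR_toFibLin, fibR_rho, resA_rho, rho_mul])

lemma toFibLin_mem {k l : ℤ} (h : k + l = 0) {w : (fib i M).carrier} (hw : w ∈ (fib i M).gr l)
    {n : ℤ} {c : (res i).carrier} (hc : c ∈ (res i).gr (n + k)) :
    toFibLin l w c ∈ (fib i M).gr n := by
  have h₁ := pair_mem (fibR_mem hw) (resI_mem hc)
  have h₂ := rho_mem (fibM_mem hw) (resA_mem hc)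
  have h₃ := rho_mem (fibR_mem hw) (resA_mem hc)
  rw [show l - 1 + (n + k + 1) = n by lia] at h₁
  rw [show l + (n + k) = n by lia] at h₂
  rw [show l - 1 + (n + k) = n - 1 by lia] at h₃
  exact mem_fib (add_mem (neg_mem (Submodule.smul_mem _ _ h₁)) h₂) h₃

lemma sign_pred (l : ℤ) : (-1 : ℂ) ^ (l - 1) = -(-1 : ℂ) ^ l := by
  rw [← neg_eq_iff_eq_neg, ← sign_succ, sub_add_cancel]

lemma toFibLin_d {l : ℤ} {w : (fib i M).carrier} (hw : w ∈ (fib i M).cocycles l)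
    (c : (res i).carrier) :
    (-1 : ℂ) ^ l • toFibLin l w ((res i).d c) = (fib i M).d (toFibLin l w c) := by
  obtain ⟨h₁, h₂⟩ := cocycle_fib hw
  have h₃ := fibM_mem hw.1
  have h₄ := fibR_mem hw.1
  have e₂ := pair_d_of_mem h₄ (char_resI c)
  rw [h₂, sign_pred, map_neg, LinearMap.neg_apply, pair_toR _ (char_resI c)] at e₂
  have e₃ : rho M (d (resA i c)) (M.sig (fibM i M w)) =
    (-1 : ℂ) ^ l • rho M (d (resA i c)) (fibM i M w) := by rw [sig_of_mem h₃, map_smul]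
  have e₄ : rho _ (d (resA i c)) ((rObj i M).sig (fibR i M w)) =
    -((-1 : ℂ) ^ l • rho _ (d (resA i c)) (fibR i M w)) := by
      rw [sig_of_mem h₄, map_smul, sign_pred, neg_smul]
  refine fib_ext ?_ ?_
  · rw [fibM_d]
    simp only [fibM_toFibLin, map_smul, map_add, map_neg, d_rho, h₁, map_zero, zero_add, e₂, e₃, resI_d,
      resA_d, smul_add, smul_neg, neg_neg, LinearMap.add_apply, sign_smul_smul, neg_smul]
    abel
  · rw [fibR_d]
    simp only [fibM_toFibLin, fibR_toFibLin, map_add, map_neg, LinearMap.map_smul_of_tower, d_rho,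
      h₂, e₄, resA_d, smul_add, LinearMap.add_apply, toR_pair (char_resI c), neg_add_rev, neg_neg,
      map_rho]
    abel

lemma sign_of_add_eq_zero {k l : ℤ} (h : k + l = 0) : (-1 : ℂ) ^ k = (-1 : ℂ) ^ l := by
  have := DGModule.sign_mul_self l
  rw [← mul_left_inj' (zpow_ne_zero l (by norm_num : (-1 : ℂ) ≠ 0)), ← sign_add, h, zpow_zero, this]

lemma toFibLin_shift_d {k l : ℤ} (h : k + l = 0) {w : (fib i M).carrier}
    (hw : w ∈ (fib i M).cocycles l) (c : (res i).carrier) :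
    toFibLin l w ((-1 : ℂ) ^ k • (res i).d c) = (fib i M).d (toFibLin l w c) := by
  rw [map_smul, sign_of_add_eq_zero h, toFibLin_d hw]

/-- The morphism from the resolution of the simple module associated to a cocycle of the fibre. -/
def toFib {k l : ℤ} (h : k + l = 0) (w : (fib i M).carrier) (hw : w ∈ (fib i M).cocycles l) :
    (res i).shift k ⟶ fib i M :=
  mkHom (M := (res i).shift k) (ofRho (toFibLin l w) (toFibLin_rho l w))
    (fun _ _ hc => toFibLin_mem h hw.1 hc)
    (toFibLin_shift_d h hw)

/-- The linear map underlying a morphism from a shift of `res`. -/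
def resLin {k : ℤ} (φ : (res i).shift k ⟶ M) :
    (res i).carrier →ₗ[ginzburgA₂.carrierᵐᵒᵖ] M.carrier := (lin (M := (res i).shift k) (N := M) φ :)

lemma resLin_mem {k l : ℤ} (h : k + l = 0) (φ : (res i).shift k ⟶ M) {n : ℤ} {c : (res i).carrier}
    (hc : c ∈ (res i).gr n) : resLin φ c ∈ M.gr (n + l) := by
  refine lin_mem φ (show c ∈ (res i).gr (n + l + k) from ?_)
  rwa [add_assoc, add_comm l, h, add_zero]

lemma d_resLin {k l : ℤ} (h : k + l = 0) (φ : (res i).shift k ⟶ M) (c : (res i).carrier) :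
    M.d (resLin φ c) = (-1 : ℂ) ^ l • resLin φ ((res i).d c) := by
  have e : resLin φ ((-1 : ℂ) ^ k • (res i).d c) = M.d (resLin φ c) := lin_d φ c
  rw [← e, LinearMap.map_smul_of_tower, sign_of_add_eq_zero h]

lemma d_resGen (k : Fin 3) : (res i).d (resGen i k) =
    -resMk (char_d (rGen i k)) 0 + rho _ (rGen i k) (resOne i) := res_ext
  (by rw [resI_d, map_add, map_neg, resI_rho, resGen, resOne, resI_resMk, resI_resMk, resI_resMk,
        zero_mul, add_zero])
  (by rw [resA_d, map_add, map_neg, resA_rho, resGen, resOne, resI_resMk, resA_resMk, resA_resMk,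
        resA_resMk, one_mul, map_zero, neg_zero, zero_add, add_zero])

lemma rCo_resCo (h : (res i).carrier →ₗ[ginzburgA₂.carrierᵐᵒᵖ] M.carrier) (k : Fin 3) :
    rCo i M k (resCo h) = h (resGen i k) := by rw [resCo, rCo_rMk]

lemma resCo_mem {l : ℤ} {h : (res i).carrier →ₗ[ginzburgA₂.carrierᵐᵒᵖ] M.carrier}
    (hh : ∀ n, ∀ c ∈ (res i).gr n, h c ∈ M.gr (n + l)) : resCo h ∈ (rObj i M).gr (l - 1) :=
  mem_rObj fun k => by
    rw [rCo_resCo, show l - 1 + rDeg i k = rDeg i k - 1 + l by lia]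
    exact hh _ _ (resGen_mem k)

lemma d_map_resGen {l : ℤ} {h : (res i).carrier →ₗ[ginzburgA₂.carrierᵐᵒᵖ] M.carrier}
    (hh : ∀ n, ∀ c ∈ (res i).gr n, h c ∈ M.gr (n + l)) (k : Fin 3) :
    M.d (h (resGen i k)) + (-1 : ℂ) ^ l • pair i M (resCo h) (d (rGen i k)) =
      rCo i M k ((rObj i M).d (resCo h)) := by
  have := pair_d_of_mem (resCo_mem hh) (char_rGen i k)
  rw [pair_rGen, pair_rGen, rCo_resCo, sign_pred, neg_smul] at this
  rw [this, neg_add_cancel_right]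

/-- The cocycle of the fibre associated to a morphism from a shift of `res`. -/
def resCocycle (l : ℤ) (h : (res i).carrier →ₗ[ginzburgA₂.carrierᵐᵒᵖ] M.carrier) :
    (fib i M).carrier := fibMk (h (resOne i)) (-((-1 : ℂ) ^ l • resCo h))

lemma resCocycle_mem {k l : ℤ} (h : k + l = 0) (φ : (res i).shift k ⟶ M) :
    resCocycle l (resLin φ) ∈ (fib i M).cocycles l := by
  have hφ : ∀ n, ∀ c ∈ (res i).gr n, resLin φ c ∈ M.gr (n + l) := fun n c hc => resLin_mem h φ hc
  refine ⟨mem_fib ?_ (neg_mem (Submodule.smul_mem _ _ (resCo_mem hφ))), ?_⟩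
  · have := hφ 0 _ resOne_mem
    rwa [zero_add] at this
  · have h₁ : M.d (resLin φ (resOne i)) = 0 := by
      rw [d_resLin h, d_resOne, map_zero, smul_zero]
    have h₂ : (rObj i M).d (resCo (resLin φ)) =
        (-1 : ℂ) ^ l • lin (toR i M) (resLin φ (resOne i)) := rCo_ext fun k => by
      rw [← d_map_resGen hφ, d_resLin h, d_resGen, map_add, map_neg, map_resMk, map_rho, smul_add,
        smul_neg, map_smul, rCo_toR]
      abel
    have key : (fib i M).d (resCocycle l (resLin φ)) = 0 := fib_ext
      (by rw [fibM_d, resCocycle, fibM_fibMk, h₁, map_zero])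
      (by rw [fibR_d, resCocycle, fibM_fibMk, fibR_fibMk, map_neg, map_smul, h₂, sign_smul_smul,
            add_neg_cancel, neg_zero, map_zero])
    exact key

lemma toFib_resCocycle {k l : ℤ} (h : k + l = 0) (φ : (res i).shift k ⟶ M) :
    toFib h _ (resCocycle_mem h φ) ≫ fibEv i M = φ := by
  have key (c : (res i).carrier) : -((-1 : ℂ) ^ l • pair i M (fibR i M (resCocycle l (resLin φ)))
      (resI i c)) + rho M (resA i c) (fibM i M (resCocycle l (resLin φ))) = resLin φ c := by
    rw [map_res, resCocycle, fibR_fibMk, fibM_fibMk, map_neg, map_smul, LinearMap.neg_apply,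
      LinearMap.smul_apply, smul_neg, neg_neg, sign_smul_smul]
  exact hom_ext fun c => key c

/-- The homotopy associated to an element of the fibre. -/
def fibHtpy (l : ℤ) (v : (fib i M).carrier) : (res i).carrier →ₗ[ℂ] M.carrier where
  toFun c := (-1 : ℂ) ^ l • pair i M (fibR i M v) (resI i c) + rho M (resA i c) (fibM i M v)
  map_add' c c' := by
    simp only [map_add, LinearMap.add_apply, smul_add]
    abel
  map_smul' r c := by
    simp only [map_smul, LinearMap.smul_apply, smul_add, smul_comm r, RingHom.id_apply]

lemma fibHtpy_apply (l : ℤ) (v : (fib i M).carrier) (c : (res i).carrier) : fibHtpy l v c =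
    (-1 : ℂ) ^ l • pair i M (fibR i M v) (resI i c) + rho M (resA i c) (fibM i M v) := rfl

lemma fibHtpy_rho (l : ℤ) (v : (fib i M).carrier) (x : Alg) (c : (res i).carrier) :
    fibHtpy l v (rho _ x c) = rho _ x (fibHtpy l v c) := by
  simp only [fibHtpy_apply, resI_rho, resA_rho, map_add, map_smul, pair_mul _ (char_resI c),
    rho_mul]

lemma fibHtpy_mem {k l : ℤ} (h : k + l = 0) {v : (fib i M).carrier} (hv : v ∈ (fib i M).gr (l - 1))
    {n : ℤ} {c : (res i).carrier} (hc : c ∈ (res i).gr (n + 1 + k)) : fibHtpy l v c ∈ M.gr n := by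
  have h₁ := pair_mem (fibR_mem hv) (resI_mem hc)
  have h₂ := rho_mem (fibM_mem hv) (resA_mem hc)
  rw [show l - 1 - 1 + (n + 1 + k + 1) = n by lia] at h₁
  rw [show l - 1 + (n + 1 + k) = n by lia] at h₂
  exact add_mem (Submodule.smul_mem _ _ h₁) h₂

lemma fibHtpy_d {l : ℤ} {v : (fib i M).carrier} (hv : v ∈ (fib i M).gr (l - 1))
    (c : (res i).carrier) :
    -((-1 : ℂ) ^ l • pair i M (fibR i M ((fib i M).d v)) (resI i c)) +
      rho M (resA i c) (fibM i M ((fib i M).d v)) =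
      M.d (fibHtpy l v c) + (-1 : ℂ) ^ l • fibHtpy l v ((res i).d c) := by
  have e₂ := pair_d_of_mem (fibR_mem hv) (char_resI c)
  rw [sign_pred, sign_pred, neg_neg] at e₂
  have e₃ : rho M (d (resA i c)) (M.sig (fibM i M v)) =
    -((-1 : ℂ) ^ l • rho M (d (resA i c)) (fibM i M v)) := by
      rw [sig_of_mem (fibM_mem hv), map_smul, sign_pred, neg_smul]
  rw [fibM_d, fibR_d]
  simp only [fibHtpy_apply, map_add, map_neg, map_smul, LinearMap.add_apply, LinearMap.neg_apply,
    resI_d, resA_d, e₂, e₃, d_rho, smul_add, smul_neg, neg_neg, sign_smul_smul,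
    pair_toR _ (char_resI c)]
  abel

lemma htpy_toFib_of_coboundary {k l : ℤ} (h : k + l = 0) {w : (fib i M).carrier}
    (hw : w ∈ (fib i M).cocycles l) {v : (fib i M).carrier} (hv : v ∈ (fib i M).gr (l - 1))
    (hvw : (fib i M).d v = w) : htpy _ (toFib h w hw ≫ fibEv i M) 0 := by
  subst hvw
  refine ⟨ofRho (M := (res i).shift k) (fibHtpy l v) (fibHtpy_rho l v),
    fun n c hc => fibHtpy_mem h hv hc, fun c => ?_⟩
  have key (c : (res i).carrier) : -((-1 : ℂ) ^ l • pair i M (fibR i M ((fib i M).d v))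
      (resI i c)) + rho M (resA i c) (fibM i M ((fib i M).d v)) - 0 =
      M.d (fibHtpy l v c) + fibHtpy l v ((-1 : ℂ) ^ k • (res i).d c) := by
    rw [sub_zero, fibHtpy_d hv, sign_of_add_eq_zero h, map_smul]
  exact key c

lemma exists_of_htpy_toFib {k l : ℤ} (h : k + l = 0) {w : (fib i M).carrier}
    (hw : w ∈ (fib i M).cocycles l) (H : htpy _ (toFib h w hw ≫ fibEv i M) 0) :
    ∃ v ∈ (fib i M).gr (l - 1), (fib i M).d v = w := by
  obtain ⟨H, hH, hd⟩ := H
  obtain ⟨F, rfl⟩ : ∃ F : (res i).carrier →ₗ[ginzburgA₂.carrierᵐᵒᵖ] M.carrier, F = H := ⟨H, rfl⟩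
  have hF : ∀ n, ∀ c ∈ (res i).gr n, F c ∈ M.gr (n + (l - 1)) := fun n c hc => hH _ _
    (show c ∈ (res i).gr (n + (l - 1) + 1 + k) by rwa [show n + (l - 1) + 1 + k = n by lia])
  have key (c : (res i).carrier) : -((-1 : ℂ) ^ l • pair i M (fibR i M w) (resI i c)) +
      rho M (resA i c) (fibM i M w) = M.d (F c) + (-1 : ℂ) ^ l • F ((res i).d c) := by
    have e : -((-1 : ℂ) ^ l • pair i M (fibR i M w) (resI i c)) +
      rho M (resA i c) (fibM i M w) - 0 = M.d (F c) + F ((-1 : ℂ) ^ k • (res i).d c) := hd c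
    rwa [sub_zero, LinearMap.map_smul_of_tower, sign_of_add_eq_zero h] at e
  refine ⟨fibMk (F (resOne i)) ((-1 : ℂ) ^ l • resCo F), mem_fib ?_
    (Submodule.smul_mem _ _ (resCo_mem hF)), fib_ext ?_ (rCo_ext fun k => ?_)⟩
  · have := hF 0 _ resOne_mem
    rwa [zero_add] at this
  · have := key (resOne i)
    rw [d_resOne, map_zero, smul_zero, resOne, resI_resMk, resA_resMk, map_zero, smul_zero,
      neg_zero, zero_add, rho_one, add_zero] at this
    rw [fibM_d, fibM_fibMk]
    exact this.symm
  · have e₁ := key (resGen i k)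
    have e₂ := d_map_resGen hF k
    rw [sign_pred, neg_smul] at e₂
    rw [d_resGen, map_add, map_neg, map_resMk, map_rho, resGen, resI_resMk, resA_resMk, map_zero,
      LinearMap.zero_apply, add_zero, pair_rGen] at e₁
    rw [fibR_d, fibM_fibMk, fibR_fibMk, map_neg, map_add, map_smul, map_smul, rCo_toR, ← e₂]
    have e₃ := congrArg (fun m => -((-1 : ℂ) ^ l • m)) e₁
    simp only [smul_neg, neg_neg, sign_smul_smul, smul_add, neg_add_rev] at e₃ ⊢
    rw [e₃, resGen]
    abel

lemma acyclic_fib (hM : M.Acyclic) : (fib i M).Acyclic :=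
  (acyclic_cone (toR i M) hM (DGFunctor.PreservesAcyclic.acyclic (F := rFun i) M hM)).shift (-1)

lemma kProjective_res (k : ℤ) : ((res i).shift k).KProjective := fun M hM φ => by
  have h : k + -k = 0 := add_neg_cancel k
  obtain ⟨v, hv, hv'⟩ := exists_homogeneous
    (show resCocycle (-k) (resLin φ) ∈ (fib i M).gr (-k - 1 + 1) by
      rw [sub_add_cancel]; exact (resCocycle_mem h φ).1)
    (acyclic_fib hM _ (resCocycle_mem h φ).2)
  rw [← toFib_resCocycle h φ]
  exact htpy_toFib_of_coboundary h _ hv hv'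

variable (i) in
/-- The linear map underlying `resπ`. -/
def resChar : (res i).carrier →ₗ[ℂ] (simpleModule i).carrier := (char i).toLinearMap ∘ₗ resA i

lemma resChar_apply (c : (res i).carrier) : resChar i c = char i (resA i c) := rfl

lemma resChar_mem {n : ℤ} {c : (res i).carrier} (hc : c ∈ (res i).gr n) :
    resChar i c ∈ (simpleModule i).gr n := by
  change resChar i c ∈ degZero n
  by_cases hn : n = 0
  · rw [degZero, if_pos hn]
    trivial
  · rw [resChar_apply, char_gr hn (resA_mem hc)]
    exact zero_mem _

lemma resChar_d (c : (res i).carrier) : resChar i ((res i).d c) = 0 := by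
  rw [resChar_apply, resA_d, map_add, char_resI, char_d, add_zero]
  rfl

variable (i) in
/-- The quasi-isomorphism from `res` to the simple module. -/
def resπ : res i ⟶ simpleModule i :=
  mkHom (ofRho (resChar i) fun x c => (congrArg (char i) (resA_rho x c)).trans
    ((map_mul _ _ _).trans (mul_comm _ _))) (fun _ _ => resChar_mem) resChar_d

lemma d_algebraMap (y : ℂ) : d (algebraMap ℂ Alg y) = 0 := by
  rw [Algebra.algebraMap_eq_smul_one, map_smul, d_one, smul_zero]

lemma quasiIso_resπ : QuasiIso (resπ i) := by
  refine ⟨fun c y hc hy => ?_, fun y _ => ⟨resMk (map_zero _) (algebraMap ℂ Alg y), 0, ?_, ?_⟩⟩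
  · have h : char i (resA i c) = 0 := hy
    refine ⟨resMk h 0, res_ext ?_ ?_⟩
    · have := congrArg (resA i) hc
      rw [resA_d, map_zero] at this
      rw [resI_d, resI_resMk, eq_neg_of_add_eq_zero_left this]
    · rw [resA_d, resI_resMk, resA_resMk, map_zero, add_zero]
  · refine res_ext (by rw [resI_d, resI_resMk, map_zero, neg_zero, map_zero]) ?_
    rw [resA_d, resI_resMk, resA_resMk, zero_add, map_zero]
    exact d_algebraMap y
  · rw [map_zero, add_zero]
    exact ((char i).commutes y).symm

/-- The morphism from a shift of the free module to a shift of the resolution. -/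
def resInr (k : ℤ) : (free ginzburgA₂).shift k ⟶ (res i).shift k := shiftMap (inr (idealι i)) k

lemma resInr_toFib {k l : ℤ} (h : k + l = 0) (w : (fib i M).carrier)
    (hw : w ∈ (fib i M).cocycles l) :
    resInr k ≫ toFib h w hw = ofCocycle h w (mem_of_cocycles hw) (d_of_cocycles hw) := by
  refine hom_free_ext ?_
  rw [val_ofCocycle]
  have key : toFibLin l w (resOne i) = w := fib_ext
    (by rw [fibM_toFibLin, resOne, resI_resMk, resA_resMk, map_zero, smul_zero, neg_zero, zero_add,
          rho_one])
    (by rw [fibR_toFibLin, resOne, resA_resMk, rho_one])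
  exact key

end Ginzburg

end

noncomputable section

section Evaluation

universe v u v' u'

variable {C : Type u} [Category.{v} C] [HasZeroObject C] [HasShift C ℤ] [Preadditive C]
  [∀ n : ℤ, (shiftFunctor C n).Additive] [Pretriangulated C] [Linear ℂ C]
  {E : Type u'} [Category.{v'} E] [Preadditive E] [Linear ℂ E] (F : C ⥤ E) [F.Additive]
  [F.Linear ℂ]

/-- A criterion for a morphism to be an evaluation map. The objects `P k` detect isomorphisms. -/
lemma isEvaluation_of_detect {P : ℤ → E}
    (hP : ∀ {X Y : C} (θ : X ⟶ Y),
      (∀ k, Function.Bijective fun f : P k ⟶ F.obj X => f ≫ F.map θ) → IsIso θ)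
    {U Y W : C} (ev : W ⟶ Y) (p : ∀ k : ℤ, P k ⟶ F.obj (U⟦k⟧))
    (hp : ∀ k (f : P k ⟶ F.obj (U⟦k⟧)), ∃ c : ℂ, f = c • p k)
    (hp₀ : ∀ k l, k ≠ l → HomZero (P k) (F.obj (U⟦l⟧)))
    {V : ℤ → Type} [∀ k, AddCommGroup (V k)] [∀ k, Module ℂ (V k)]
    (a : ∀ k, V k →ₗ[ℂ] (U⟦k⟧ ⟶ W))
    (h₁ : ∀ k (f : U⟦k⟧ ⟶ Y), ∃ v, a k v ≫ ev = f)
    (h₂ : ∀ k (f : P k ⟶ F.obj W), ∃ v, p k ≫ F.map (a k v) = f)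
    (h₃ : ∀ k v, p k ≫ F.map (a k v) = 0 ↔ a k v ≫ ev = 0)
    (hfin : ∀ k : ℤ, Module.Finite ℂ (U⟦k⟧ ⟶ Y)) {N : ℤ}
    (hN : ∀ k : ℤ, N < |k| → HomZero (U⟦k⟧) Y) : IsEvaluation U Y W ev := by
  let J (k : ℤ) : Type := Fin (Module.finrank ℂ (U⟦k⟧ ⟶ Y))
  let β (k : ℤ) : Module.Basis (J k) ℂ (U⟦k⟧ ⟶ Y) := Module.finBasis ℂ _
  choose w hw using fun p : Σ k, J k => h₁ p.1 (β p.1 p.2)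
  have hJ : Finite (Σ k, J k) := by
    have hi : ∀ q : Σ k, J k, q.1 ∈ Set.Icc (-N) N := fun q => by
      by_contra h
      refine (β q.1).ne_zero q.2 (hN q.1 ?_ _)
      rw [Set.mem_Icc, ← abs_le, not_le] at h
      exact h
    refine Finite.of_injective (β := Σ k : Set.Icc (-N) N, J k)
      (fun q => ⟨⟨q.1, hi q⟩, q.2⟩) ?_
    rintro ⟨k, x⟩ ⟨l, y⟩ h
    simp only [Sigma.mk.injEq, Subtype.mk.injEq] at h
    obtain ⟨rfl, h⟩ := h
    rw [eq_of_heq h]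
  have := Fintype.ofFinite (Σ k, J k)
  let X (q : Σ k, J k) : C := U⟦q.1⟧
  let θ : ⨁ X ⟶ W := biproduct.desc fun q => a q.1 (w q)
  have hθ : IsIso θ := by
    have hc k (f : P k ⟶ F.obj (⨁ X)) : ∃ c : J k → ℂ,
        f = ∑ j, c j • (p k ≫ F.map (biproduct.ι X ⟨k, j⟩)) := by
      choose c hc using fun j : J k => hp k (f ≫ F.map (biproduct.π X ⟨k, j⟩))
      refine ⟨c, ?_⟩
      have e : f = ∑ q, f ≫ F.map (biproduct.π X q ≫ biproduct.ι X q) := by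
        rw [← Preadditive.comp_sum, ← F.map_sum, biproduct.total, F.map_id, Category.comp_id]
      rw [e]
      refine (Fintype.sum_of_injective (fun j : J k => (⟨k, j⟩ : Σ k, J k))
        sigma_mk_injective _ _ ?_ fun j => ?_).symm
      · rintro ⟨l, j⟩ hl
        have hl' : k ≠ l := by
          rintro rfl
          exact hl ⟨j, rfl⟩
        rw [F.map_comp, ← Category.assoc, hp₀ k l hl' (f ≫ F.map (biproduct.π X ⟨l, j⟩)),
          zero_comp]
      · rw [F.map_comp, ← Category.assoc, hc, Linear.smul_comp]
    have hs k (c : J k → ℂ) :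
        (∑ j, c j • (p k ≫ F.map (biproduct.ι X ⟨k, j⟩))) ≫ F.map θ =
          p k ≫ F.map (a k (∑ j, c j • w ⟨k, j⟩)) := by
      simp only [map_sum, map_smul, F.map_sum, F.map_smul, Preadditive.sum_comp,
        Preadditive.comp_sum, Linear.smul_comp, Linear.comp_smul, Category.assoc, ← F.map_comp, θ,
        biproduct.ι_desc]
    have hb k (c : J k → ℂ) :
        a k (∑ j, c j • w ⟨k, j⟩) ≫ ev = ∑ j, c j • β k j := by
      simp only [map_sum, map_smul, Preadditive.sum_comp, Linear.smul_comp]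
      exact Finset.sum_congr rfl fun j _ => congrArg _ (hw ⟨k, j⟩)
    refine hP θ fun k => ⟨?_, ?_⟩
    · intro f f' hff
      rw [← sub_eq_zero]
      obtain ⟨c, hc'⟩ := hc k (f - f')
      have h : (f - f') ≫ F.map θ = 0 := by
        rw [Preadditive.sub_comp, sub_eq_zero]
        exact hff
      rw [hc', hs, h₃, hb] at h
      have hc₀ := Fintype.linearIndependent_iff.1 (β k).linearIndependent c h
      rw [hc']
      exact Finset.sum_eq_zero fun j _ => by rw [hc₀, zero_smul]
    · intro g
      obtain ⟨u, rfl⟩ := h₂ k g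
      refine ⟨∑ j, (β k).repr (a k u ≫ ev) j • (p k ≫ F.map (biproduct.ι X ⟨k, j⟩)), ?_⟩
      refine (hs k _).trans ?_
      rw [← sub_eq_zero, ← Preadditive.comp_sub, ← F.map_sub, ← map_sub, h₃, map_sub,
        Preadditive.sub_comp, hb, (β k).sum_repr, sub_self]
  refine ⟨J, β, fun q => a q.1 (w q), ⟨IsColimit.ofIsoColimit (biproduct.isColimit X)
    (Cofan.ext (@asIso _ _ _ _ θ hθ) fun q => ?_)⟩, hw⟩
  exact biproduct.ι_desc _ _

end Evaluation

section

variable {C : Type*} [Category* C] [HasZeroObject C] [HasShift C ℤ] [Preadditive C]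
  [∀ n : ℤ, (shiftFunctor C n).Additive] [Pretriangulated C]

lemma dist_of_map {D : Type*} [Category* D] [HasZeroObject D] [HasShift D ℤ] [Preadditive D]
    [∀ n : ℤ, (shiftFunctor D n).Additive] [Pretriangulated D] (F : C ⥤ D) [F.CommShift ℤ]
    [F.IsTriangulated] [F.Full] [F.Faithful] {X Y Z : C} {f : X ⟶ Y} {g : Y ⟶ Z}
    {δ : F.obj Z ⟶ (F.obj X)⟦(1 : ℤ)⟧}
    (H : Triangle.mk (F.map f) (F.map g) δ ∈ distTriang D) :
    Triangle.mk f g (F.preimage (δ ≫ (F.commShiftIso (1 : ℤ)).inv.app X)) ∈ distTriang C := by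
  rw [← F.map_distinguished_iff]
  refine isomorphic_distinguished _ H _ (Triangle.isoMk _ _ (Iso.refl _) (Iso.refl _) (Iso.refl _)
    (by change F.map f ≫ 𝟙 _ = 𝟙 _ ≫ F.map f; simp)
    (by change F.map g ≫ 𝟙 _ = 𝟙 _ ≫ F.map g; simp)
    (by
      change (F.map (F.preimage _) ≫ (F.commShiftIso (1 : ℤ)).hom.app X) ≫ (𝟙 _)⟦(1 : ℤ)⟧' = 𝟙 _ ≫ δ
      simp))

lemma neg_neg_dist {X Y Z : C} {f : X ⟶ Y} {g : Y ⟶ Z} {h : Z ⟶ X⟦(1 : ℤ)⟧}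
    (H : Triangle.mk f g h ∈ distTriang C) : Triangle.mk (-f) g (-h) ∈ distTriang C :=
  isomorphic_distinguished _ H _ (Triangle.isoMk _ _ (-Iso.refl _) (Iso.refl _) (Iso.refl _)
    (by change (-f) ≫ 𝟙 _ = (-𝟙 _) ≫ f; simp) (by change g ≫ 𝟙 _ = 𝟙 _ ≫ g; simp)
    (by change (-h) ≫ (-𝟙 _)⟦(1 : ℤ)⟧' = 𝟙 _ ≫ h; simp))

end

section Detect

variable {A : DGAlgebra}

open DerCat

lemma isIso_of_bijective {X Y : Dfd A} (θ : X ⟶ Y)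
    (h : ∀ k : ℤ, Function.Bijective fun f : ((Q A).obj (DGModule.free A))⟦k⟧ ⟶ (fd A).ι.obj X =>
      f ≫ (fd A).ι.map θ) : IsIso θ := by
  obtain ⟨Z, g, δ, hT⟩ := Pretriangulated.distinguished_cocone_triangle ((fd A).ι.map θ)
  have hZ : IsZero Z := isZero_of_cohZero fun n => by
    intro f
    have hT' := rot_of_distTriang _ hT
    have hn : ∀ f' : ((Q A).obj (DGModule.free A))⟦-n⟧ ⟶ ((fd A).ι.obj X)⟦(1 : ℤ)⟧,
        f' ≫ ((fd A).ι.map θ)⟦(1 : ℤ)⟧' = 0 → f' = 0 := by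
      intro f' hf'
      let e := (shiftFunctorAdd' (DerCat A) (-n - 1) 1 (-n) (by lia)).app
        ((Q A).obj (DGModule.free A))
      obtain ⟨f'', hf''⟩ := (shiftFunctor (DerCat A) (1 : ℤ)).map_surjective (e.inv ≫ f')
      have h₀ : f'' ≫ (fd A).ι.map θ = 0 := by
        apply (shiftFunctor (DerCat A) (1 : ℤ)).map_injective
        rw [Functor.map_comp, hf'', Category.assoc, hf', comp_zero, Functor.map_zero]
      have h₁ : f'' = 0 := (h (-n - 1)).1 (h₀.trans zero_comp.symm)
      rw [← cancel_epi e.inv, ← hf'', h₁, Functor.map_zero, comp_zero]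
    have h₁ : f ≫ δ = 0 := hn _ (by
      have := comp_distTriang_mor_zero₃₁ _ hT
      rw [Category.assoc]
      exact (congrArg (f ≫ ·) this).trans comp_zero)
    obtain ⟨f', hf'⟩ := Triangle.coyoneda_exact₃ _ hT f h₁
    obtain ⟨f'', hf''⟩ := (h (-n)).2 f'
    have h₂ : (fd A).ι.map θ ≫ g = 0 := comp_distTriang_mor_zero₁₂ _ hT
    refine hf'.trans ?_
    change f' ≫ g = 0
    rw [← hf'']
    exact (Category.assoc _ _ _).trans ((congrArg (f'' ≫ ·) h₂).trans comp_zero)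
  have : IsIso ((fd A).ι.map θ) := (Triangle.isZero₃_iff_isIso₁ _ hT).1 hZ
  exact isIso_of_reflects_iso θ (fd A).ι

end Detect

namespace DGModule

variable {A : DGAlgebra} (k : ℤ)

/-- The compatibility of the shifts of dg modules and in the derived category. -/
def Qshift (M : DGModule A) : ((DerCat.Q A).obj M)⟦k⟧ ≅ (DerCat.Q A).obj (M.shift k) :=
  ((DerCat.Q A).commShiftIso k).symm.app M

lemma Qshift_naturality {M N : DGModule A} (f : M ⟶ N) : ((DerCat.Q A).map f)⟦k⟧' ≫
    (Qshift k N).hom = (Qshift k M).hom ≫ (DerCat.Q A).map (shiftMap f k) :=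
  ((DerCat.Q A).commShiftIso k).inv.naturality f

end DGModule

namespace Ginzburg

open Gen DGModule DerCat

variable (i : Fin 2)

/-- The simple module at the vertex `i`. -/
def simple : D := ⟨(Q ginzburgA₂).obj (simpleModule i),
  fd_of_finite _ (inferInstanceAs (Module.Finite ℂ ℂ))⟩

/-- The free module, in the derived category. -/
abbrev Qfree : DerCat ginzburgA₂ := (Q ginzburgA₂).obj (free ginzburgA₂)

/-- The projection from the free module to the simple module. -/
def freeπ : Qfree ⟶ (simple i).obj := (Q ginzburgA₂).map (inr (idealι i) ≫ resπ i)

/-- The isomorphism from the resolution to the simple module. -/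
def simpleIso : (Q ginzburgA₂).obj (res i) ≅ (simple i).obj :=
  @asIso _ _ _ _ ((Q ginzburgA₂).map (resπ i)) quasiIso_resπ.isIso

/-- The isomorphism from the shifts of the resolution to the shifts of the simple module. -/
def simpleShiftIso (k : ℤ) : (fd ginzburgA₂).ι.obj ((simple i)⟦k⟧) ≅
    (Q ginzburgA₂).obj ((res i).shift k) :=
  ((fd ginzburgA₂).ι.commShiftIso k).app (simple i) ≪≫
    (shiftFunctor _ k).mapIso (simpleIso i).symm ≪≫
    Qshift k (res i)

/-- The projection from the shifts of the free module to the shifts of the simple module. -/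
def freeShiftπ (k : ℤ) : Qfree⟦k⟧ ⟶ (fd ginzburgA₂).ι.obj ((simple i)⟦k⟧) :=
  (freeπ i)⟦k⟧' ≫ ((fd ginzburgA₂).ι.commShiftIso k).inv.app (simple i)

lemma freeπ_simpleIso_inv : freeπ i ≫ (simpleIso i).inv =
    (show Qfree ⟶ (Q ginzburgA₂).obj (res i) from (Q ginzburgA₂).map (inr (idealι i))) :=
  (Iso.comp_inv_eq _).2 (Functor.map_comp _ _ _)

lemma freeShiftπ_comp (k : ℤ) : freeShiftπ i k ≫ (simpleShiftIso i k).hom =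
    (Qshift k (free ginzburgA₂)).hom ≫ (Q ginzburgA₂).map (resInr k) := by
  refine Eq.trans ?_ (Qshift_naturality k (N := res i) (inr (idealι i)))
  simp only [freeShiftπ, simpleShiftIso, Iso.trans_hom, Iso.app_hom, Functor.mapIso_hom,
    Iso.symm_hom, Category.assoc, Iso.inv_hom_id_app_assoc]
  refine (Category.assoc _ _ _).symm.trans (congrArg (· ≫ (Qshift k (res i)).hom) ?_)
  exact (Functor.map_comp _ _ _).symm.trans
    (congrArg (shiftFunctor (DerCat ginzburgA₂) k).map (freeπ_simpleIso_inv i))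

variable {i} {M : DGModule ginzburgA₂}

/-- `toFib`, as a linear map. -/
def toFibₗ {k l : ℤ} (h : k + l = 0) :
    (fib i M).cocycles l →ₗ[ℂ] ((res i).shift k ⟶ fib i M) where
  toFun w := toFib h w.1 w.2
  map_add' v w := hom_ext fun c => by
    have key (c : (res i).carrier) (v w : (fib i M).carrier) :
        toFibLin l (v + w) c = toFibLin l v c + toFibLin l w c := fib_ext
      (by
        simp only [fibM_toFibLin, map_add, LinearMap.add_apply, smul_add, neg_add_rev]
        abel)
      (by simp only [fibR_toFibLin, map_add])
    exact key c v.1 w.1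
  map_smul' r w := hom_ext fun c => by
    have key (c : (res i).carrier) (w : (fib i M).carrier) :
        toFibLin l (r • w) c = r • toFibLin l w c := fib_ext
      (by simp only [fibM_toFibLin, map_smul, LinearMap.smul_apply, smul_add, smul_neg, smul_comm r])
      (by simp only [fibR_toFibLin, map_smul])
    exact key c w.1

/-- The morphism from a shift of the simple module given by a cocycle of the fibre. -/
def simpleHom {k l : ℤ} (h : k + l = 0) : (fib i M).cocycles l →ₗ[ℂ]
    ((fd ginzburgA₂).ι.obj ((simple i)⟦k⟧) ⟶ (Q ginzburgA₂).obj (fib i M)) :=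
  Linear.leftComp ℂ _ (simpleShiftIso i k).hom ∘ₗ (Q ginzburgA₂).mapLinearMap ℂ ∘ₗ toFibₗ h

lemma simpleHom_apply {k l : ℤ} (h : k + l = 0) (w : (fib i M).cocycles l) :
    simpleHom h w = (simpleShiftIso i k).hom ≫ (Q ginzburgA₂).map (toFib h w.1 w.2) := rfl

lemma exists_simpleHom {k l : ℤ} (h : k + l = 0)
    (f : (fd ginzburgA₂).ι.obj ((simple i)⟦k⟧) ⟶ (Q ginzburgA₂).obj M) :
    ∃ w, simpleHom h w ≫ (Q ginzburgA₂).map (fibEv i M) = f := by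
  obtain ⟨φ, hφ⟩ := (kProjective_res k).exists_map ((simpleShiftIso i k).inv ≫ f)
  refine ⟨⟨_, resCocycle_mem h φ⟩, ?_⟩
  rw [simpleHom_apply, Category.assoc, ← Functor.map_comp, toFib_resCocycle, hφ,
    Iso.hom_inv_id_assoc]

lemma simpleHom_fibEv_eq_zero {k l : ℤ} (h : k + l = 0) (w : (fib i M).cocycles l) :
    simpleHom h w ≫ (Q ginzburgA₂).map (fibEv i M) = 0 ↔ ∃ v, (fib i M).d v = w.1 := by
  rw [simpleHom_apply, Category.assoc, ← Functor.map_comp, Preadditive.IsIso.comp_left_eq_zero]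
  constructor
  · intro H
    obtain ⟨v, -, hv⟩ := exists_of_htpy_toFib h w.2 ((kProjective_res k).htpy_of_eq
      (H.trans (Functor.map_zero _ _ _).symm))
    exact ⟨v, hv⟩
  · intro H
    obtain ⟨v, hv, hv'⟩ := exists_homogeneous (show w.1 ∈ (fib i M).gr (l - 1 + 1) by
      rw [sub_add_cancel]
      exact mem_of_cocycles w.2) H
    exact (Q_map_eq_of_htpy (htpy_toFib_of_coboundary h w.2 hv hv')).trans (Functor.map_zero _ _ _)

lemma freeShiftπ_simpleHom {k l : ℤ} (h : k + l = 0) (w : (fib i M).cocycles l) :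
    freeShiftπ i k ≫ simpleHom h w = (Qshift k (free ginzburgA₂)).hom ≫
      (Q ginzburgA₂).map (ofCocycle h w.1 (mem_of_cocycles w.2) (d_of_cocycles w.2)) := by
  rw [simpleHom_apply, ← Category.assoc, freeShiftπ_comp, Category.assoc, ← resInr_toFib h w.1 w.2,
    Functor.map_comp]

lemma exists_freeShiftπ_simpleHom {k l : ℤ} (h : k + l = 0)
    (f : Qfree⟦k⟧ ⟶ (Q ginzburgA₂).obj (fib i M)) :
    ∃ w : (fib i M).cocycles l, freeShiftπ i k ≫ simpleHom h w = f := by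
  obtain ⟨φ, hφ⟩ := (kProjective_free k).exists_map
    ((Qshift k (free ginzburgA₂)).inv ≫ f)
  refine ⟨⟨val φ, val_mem h φ, d_val φ⟩, ?_⟩
  rw [freeShiftπ_simpleHom]
  have e : ofCocycle h (val φ) (val_mem h φ) (d_val φ) = φ := hom_free_ext (val_ofCocycle ..)
  rw [e, hφ, Iso.hom_inv_id_assoc]

lemma freeShiftπ_simpleHom_eq_zero {k l : ℤ} (h : k + l = 0) (w : (fib i M).cocycles l) :
    freeShiftπ i k ≫ simpleHom h w = 0 ↔ ∃ v, (fib i M).d v = w.1 := by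
  rw [freeShiftπ_simpleHom, Preadditive.IsIso.comp_left_eq_zero]
  have e := htpy_free_iff (ofCocycle h w.1 (mem_of_cocycles w.2) (d_of_cocycles w.2))
  rw [val_ofCocycle] at e
  rw [← e]
  constructor
  · intro H
    exact (kProjective_free k).htpy_of_eq (H.trans (Functor.map_zero _ _ _).symm)
  · intro H
    exact (Q_map_eq_of_htpy H).trans (Functor.map_zero _ _ _)

/-- The standard triangle in the derived category. -/
lemma _root_.DGModule.mapTriangle_triangle_dist {A : DGAlgebra} {M N : DGModule A} (f : M ⟶ N) :
    (Q A).mapTriangle.obj (triangle f) ∈ distTriang (DerCat A) :=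
  isomorphic_distinguished _ ((HoCat.qis A).Q.map_distinguished _ (HoCat.triangleh_dist f)) _
    ((Functor.mapTriangleCompIso (HoCat.q A) (HoCat.qis A).Q).app (triangle f))

lemma _root_.DGModule.isId_shiftFunctorCompIsoId {A : DGAlgebra} (M : DGModule A) :
    IsId ((shiftFunctorCompIsoId (DGModule A) (1 : ℤ) (-1) (by lia)).hom.app M) rfl := fun x =>
  (congrArg (lin ((shiftFunctorZero (DGModule A) ℤ).hom.app M)) (isId_add_inv M 1 (-1) 0 rfl x)).trans rfl

lemma invRotate_mor₁ : (triangle (toR i M)).invRotate.mor₁ =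
    (show (cone (toR i M))⟦(-1 : ℤ)⟧ ⟶ M from -fibEv i M) := by
  refine hom_ext fun x => ?_
  refine (isId_shiftFunctorCompIsoId M _).trans ?_
  rfl

/-- The triangle of the fibre. -/
lemma exists_fib_triangle : ∃ δ, Triangle.mk ((Q ginzburgA₂).map (fibEv i M))
    ((Q ginzburgA₂).map (toR i M)) δ ∈ distTriang (DerCat ginzburgA₂) := by
  have h₂ := inv_rot_of_distTriang _ (mapTriangle_triangle_dist (toR i M))
  let T := (Q ginzburgA₂).mapTriangle.obj (triangle (toR i M)).invRotate
  have h₃ : T ∈ distTriang (DerCat ginzburgA₂) :=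
    isomorphic_distinguished _ h₂ _
      ((Functor.mapTriangleInvRotateIso (Q ginzburgA₂)).symm.app (triangle (toR i M)))
  have e₁ : T.mor₁ = -(Q ginzburgA₂).map (fibEv i M) :=
    (congrArg (Q ginzburgA₂).map invRotate_mor₁).trans (Functor.map_neg _)
  have h₄ : ∀ f, T.mor₁ = -f → Triangle.mk f T.mor₂ (-T.mor₃) ∈ distTriang _ := fun f hf => by
    have := neg_neg_dist (f := T.mor₁) (g := T.mor₂) (h := T.mor₃) h₃
    rwa [hf, neg_neg] at this
  exact ⟨_, h₄ _ e₁⟩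

lemma fd_fib (hM : fd _ ((Q ginzburgA₂).obj M)) : fd _ ((Q ginzburgA₂).obj (fib i M)) := by
  obtain ⟨δ, hT⟩ := exists_fib_triangle (i := i) (M := M)
  have h : fd _ ((Q ginzburgA₂).obj (rObj i M)) :=
    (fd _).prop_of_iso ((rFun i).derIso.app M) (fd_rFun i _ hM)
  exact (fd ginzburgA₂).ext_of_isTriangulatedClosed₁ _ hT hM h

lemma cohZero_simple {n : ℤ} (hn : n ≠ 0) : CohZero (simple i).obj n :=
  (cohZero_Q_iff _ n).2 fun _ hx _ =>
    ⟨0, (map_zero (simpleModule i).d).trans (eq_zero_of_mem_degZero hn hx).symm⟩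

lemma homZero_free_simple {k l : ℤ} (h : k ≠ l) :
    HomZero (Qfree⟦k⟧) ((fd ginzburgA₂).ι.obj ((simple i)⟦l⟧)) := by
  refine (homZero_iff_of_iso (Iso.refl _)
    (((fd ginzburgA₂).ι.commShiftIso l).app (simple i))).2 ?_
  have := (cohZero_shift_iff (simple i).obj l (l - k) (-k) (by lia)).2 (cohZero_simple (by lia))
  rw [DerCat.CohZero, neg_neg] at this
  exact this

lemma exists_smul_freeShiftπ (k : ℤ) (f : Qfree⟦k⟧ ⟶ (fd ginzburgA₂).ι.obj ((simple i)⟦k⟧)) :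
    ∃ c : ℂ, f = c • freeShiftπ i k := by
  obtain ⟨φ, hφ⟩ := (kProjective_free k).exists_map ((Qshift k (free ginzburgA₂)).inv ≫ f ≫
    ((fd ginzburgA₂).ι.commShiftIso k).hom.app (simple i) ≫ (Qshift k (simpleModule i)).hom)
  let ψ : (free ginzburgA₂).shift k ⟶ (simpleModule i).shift k :=
    shiftMap (inr (idealι i) ≫ resπ i) k
  let c : ℂ := val φ
  have e : φ = c • ψ := hom_free_ext (by
    have h₁ : val (c • ψ) = c • val ψ := rfl
    have h₂ : c • char i 1 = c := by rw [map_one, smul_eq_mul, mul_one]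
    exact h₂.symm.trans h₁.symm)
  refine ⟨c, ?_⟩
  have h₁ : f ≫ ((fd ginzburgA₂).ι.commShiftIso k).hom.app (simple i) ≫
      (Qshift k (simpleModule i)).hom = (Qshift k (free ginzburgA₂)).hom ≫
        (Q ginzburgA₂).map (c • ψ) := by
    rw [← e, hφ, Iso.hom_inv_id_assoc]
  rw [Functor.map_smul, Linear.comp_smul, ← Qshift_naturality, ← Linear.smul_comp] at h₁
  have h₂ : f ≫ ((fd ginzburgA₂).ι.commShiftIso k).hom.app (simple i) = c • (freeπ i)⟦k⟧' :=
    (cancel_mono (Qshift k (simpleModule i)).hom).1 ((Category.assoc _ _ _).trans h₁)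
  rw [freeShiftπ, ← Linear.smul_comp, ← h₂, Category.assoc, Iso.hom_inv_id_app]
  exact (Category.comp_id f).symm

/-- The class of a cocycle. -/
def _root_.DGModule.cocycleClass {A : DGAlgebra} (N : DGModule A) (l : ℤ) :
    N.cocycles l →ₗ[ℂ] Coh N :=
  Submodule.mkQ _ ∘ₗ Submodule.inclusion (inf_le_right : N.cocycles l ≤ LinearMap.ker N.d)

lemma _root_.DGModule.cocycleClass_eq_zero {A : DGAlgebra} (N : DGModule A) (l : ℤ)
    (w : N.cocycles l) : cocycleClass N l w = 0 ↔ ∃ v, N.d v = w.1 :=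
  Submodule.Quotient.mk_eq_zero _

variable (M) in
/-- The fibre, as an object of `D`. -/
def fibD (hM : fd _ ((Q ginzburgA₂).obj M)) : D := ⟨(Q ginzburgA₂).obj (fib i M), fd_fib hM⟩

/-- `simpleHom`, as a linear map to morphisms in `D`. -/
def simpleHomD (hM : fd _ ((Q ginzburgA₂).obj M)) {k l : ℤ} (h : k + l = 0) :
    (fib i M).cocycles l →ₗ[ℂ] ((simple i)⟦k⟧ ⟶ fibD (i := i) M hM) where
  toFun w := (fd ginzburgA₂).homMk (simpleHom h w)
  map_add' v w := (fd ginzburgA₂).ι.map_injective (map_add (simpleHom h) v w)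
  map_smul' r w := (fd ginzburgA₂).ι.map_injective (map_smul (simpleHom h) r w)

/-- The projection of the fibre, in `D`. -/
def evD {Y : D} (e : (Q ginzburgA₂).obj M ≅ Y.obj) (hM : fd _ ((Q ginzburgA₂).obj M)) :
    fibD (i := i) M hM ⟶ Y := (fd ginzburgA₂).homMk ((Q ginzburgA₂).map (fibEv i M) ≫ e.hom)

section

variable {Y : D} (ε : (Q ginzburgA₂).obj M ≅ Y.obj) (hM : fd _ ((Q ginzburgA₂).obj M))

lemma exists_simpleHomD {k l : ℤ} (h : k + l = 0) (f : (simple i)⟦k⟧ ⟶ Y) :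
    ∃ w, simpleHomD hM h w ≫ evD ε hM = f := by
  obtain ⟨w, hw⟩ := exists_simpleHom h ((fd ginzburgA₂).ι.map f ≫ ε.inv)
  refine ⟨w, (fd ginzburgA₂).ι.map_injective ?_⟩
  refine (Category.assoc _ _ _).symm.trans ((congrArg (· ≫ ε.hom) hw).trans ?_)
  rw [Category.assoc, Iso.inv_hom_id, Category.comp_id]

lemma simpleHomD_evD_eq_zero {k l : ℤ} (h : k + l = 0) (w : (fib i M).cocycles l) :
    simpleHomD hM h w ≫ evD ε hM = 0 ↔ ∃ v, (fib i M).d v = w.1 := by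
  rw [← simpleHom_fibEv_eq_zero h w]
  constructor
  · intro H
    have H' : (simpleHom h w ≫ (Q ginzburgA₂).map (fibEv i M)) ≫ ε.hom = 0 :=
      (Category.assoc _ _ _).trans (congrArg (fd ginzburgA₂).ι.map H)
    rwa [Preadditive.IsIso.comp_right_eq_zero] at H'
  · intro H
    refine (fd ginzburgA₂).ι.map_injective ?_
    exact (Category.assoc _ _ _).symm.trans ((congrArg (· ≫ ε.hom) H).trans zero_comp)

lemma homZero_simple_iff {Y : D} (ε : (Q ginzburgA₂).obj M ≅ Y.obj) {k l : ℤ} (h : k + l = 0) :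
    HomZero ((simple i)⟦k⟧) Y ↔ (fib i M).CohZero l := by
  constructor
  · intro H w hw hw'
    exact (simpleHomD_evD_eq_zero ε ((fd _).prop_of_iso ε.symm Y.property) h ⟨w, hw, hw'⟩).1 (H _)
  · intro H f
    obtain ⟨w, rfl⟩ := exists_simpleHomD ε ((fd _).prop_of_iso ε.symm Y.property) h f
    exact (simpleHomD_evD_eq_zero ε _ h w).2 (H _ (mem_of_cocycles w.2) (d_of_cocycles w.2))

lemma finite_simpleHom {Y : D} (ε : (Q ginzburgA₂).obj M ≅ Y.obj)
    (hM : fd _ ((Q ginzburgA₂).obj M)) (k : ℤ) : Module.Finite ℂ ((simple i)⟦k⟧ ⟶ Y) := by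
  have h : k + -k = 0 := add_neg_cancel k
  let s := Linear.rightComp ℂ ((simple i)⟦k⟧) (evD ε hM) ∘ₗ simpleHomD hM h
  have hs : Function.Surjective s := exists_simpleHomD ε hM h
  have hk : LinearMap.ker (cocycleClass (fib i M) (-k)) = LinearMap.ker s := by
    ext w
    exact (cocycleClass_eq_zero _ _ w).trans (simpleHomD_evD_eq_zero ε hM h w).symm
  have : Module.Finite ℂ (Coh (fib i M)) := (fd_Q_iff _).1 (fd_fib hM)
  have h₁ : Module.Finite ℂ ((fib i M).cocycles (-k) ⧸ LinearMap.ker s) := by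
    rw [← hk]
    exact Module.Finite.equiv (cocycleClass (fib i M) (-k)).quotKerEquivRange.symm
  exact Module.Finite.equiv (s.quotKerEquivOfSurjective hs)

lemma isEvaluation_evD : IsEvaluation (simple i) Y (fibD (i := i) M hM) (evD ε hM) := by
  obtain ⟨N, hN⟩ := exists_cohZero_bound (fd_fib (i := i) hM)
  refine isEvaluation_of_detect (fd ginzburgA₂).ι (P := fun k => Qfree⟦k⟧) isIso_of_bijective
    (evD ε hM) (freeShiftπ i) exists_smul_freeShiftπ (fun k l h => homZero_free_simple h)
    (fun k => simpleHomD hM (add_neg_cancel k)) (fun k => exists_simpleHomD ε hM _)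
    (fun k f => exists_freeShiftπ_simpleHom (add_neg_cancel k) f)
    (fun k v => (freeShiftπ_simpleHom_eq_zero _ v).trans (simpleHomD_evD_eq_zero ε hM _ v).symm)
    (fun k => finite_simpleHom ε hM k) (N := N) (fun k hk => ?_)
  exact (homZero_simple_iff ε (add_neg_cancel k)).2 ((cohZero_Q_iff _ _).1 (hN _ (by rwa [abs_neg])))

end

variable (i) in
/-- The spherical twist exists. -/
theorem exists_isTwist : ∃ Φ : D ≌ D, IsTwist (simple i) Φ := by
  obtain ⟨Φ, hΦ⟩ := exists_equivalence i
  refine ⟨Φ, ?_, ?_, ?_⟩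
  · rw [hΦ]
    infer_instance
  · rw [hΦ]
    exact ⟨inferInstance, inferInstance⟩
  · rw [hΦ]
    obtain ⟨η, hη⟩ := (rFun i).exists_natTrans_id (toRNat i)
    refine ⟨{ app Y := (fd ginzburgA₂).homMk (η.app Y.obj)
              naturality _ _ f := (fd ginzburgA₂).ι.map_injective (η.naturality f.hom) }, fun Y => ?_⟩
    obtain ⟨M, ⟨ε⟩⟩ := exists_iso_Q Y.obj
    have hM := (fd _).prop_of_iso ε.symm Y.property
    obtain ⟨δ, hT⟩ := exists_fib_triangle (i := i) (M := M)
    let c : (Q ginzburgA₂).obj (rObj i M) ≅ (rFun i).der.obj Y.obj :=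
      ((rFun i).derIso.app M).symm ≪≫ (rFun i).der.mapIso ε
    have hc : (Q ginzburgA₂).map (toR i M) ≫ c.hom = ε.hom ≫ η.app Y.obj := by
      refine Eq.trans ?_ (η.naturality ε.hom).symm
      rw [hη]
      exact (Category.assoc _ _ _).symm
    refine ⟨fibD M hM, evD ε hM, _, isEvaluation_evD ε hM,
      dist_of_map (fd ginzburgA₂).ι (δ := c.inv ≫ δ) ?_⟩
    refine isomorphic_distinguished _ hT _ (Triangle.isoMk _ _ (Iso.refl _) ε.symm c.symm ?_ ?_ ?_)
    · change ((Q ginzburgA₂).map (fibEv i M) ≫ ε.hom) ≫ ε.inv =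
        𝟙 _ ≫ (Q ginzburgA₂).map (fibEv i M)
      rw [Category.assoc, Iso.hom_inv_id, Category.comp_id, Category.id_comp]
    · change η.app Y.obj ≫ c.inv = ε.inv ≫ (Q ginzburgA₂).map (toR i M)
      rw [Iso.comp_inv_eq, Category.assoc, hc, Iso.inv_hom_id_assoc]
    · change (c.inv ≫ δ) ≫ (𝟙 _)⟦(1 : ℤ)⟧' = c.inv ≫ δ
      rw [CategoryTheory.Functor.map_id, Category.comp_id]

end Ginzburg

end

noncomputable section

namespace Ginzburg

open Gen DGModule DerCat

variable {i : Fin 2} {M : DGModule ginzburgA₂}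

lemma finrank_simpleHom {Y : D} (ε : (Q ginzburgA₂).obj M ≅ Y.obj) {k l : ℤ} (h : k + l = 0)
    (w : (fib i M).carrier) (hw : w ∈ (fib i M).gr l) (lam : (fib i M).carrier →ₗ[ℂ] ℂ)
    (h₀ : (fib i M).d w = 0) (h₁ : lam w = 1) (h₂ : ∀ v, lam ((fib i M).d v) = 0)
    (h₃ : ∀ v ∈ (fib i M).gr l, (fib i M).d v = 0 → lam v = 0 → ∃ u, (fib i M).d u = v) :
    Module.finrank ℂ ((simple i)⟦k⟧ ⟶ Y) = 1 := by
  have hM := (fd _).prop_of_iso ε.symm Y.property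
  let w' : (fib i M).cocycles l := ⟨w, hw, h₀⟩
  refine finrank_eq_one (simpleHomD hM h w' ≫ evD ε hM) (fun h' => ?_) fun f => ?_
  · obtain ⟨v, hv⟩ := (simpleHomD_evD_eq_zero ε hM h w').1 h'
    have := h₂ v
    rw [hv, h₁] at this
    exact one_ne_zero this
  · obtain ⟨v, rfl⟩ := exists_simpleHomD ε hM h f
    refine ⟨lam v, ?_⟩
    rw [← Linear.smul_comp, ← map_smul, ← sub_eq_zero, ← Preadditive.sub_comp, ← map_sub,
      simpleHomD_evD_eq_zero]
    refine h₃ _ (mem_of_cocycles (lam v • w' - v).2) (d_of_cocycles (lam v • w' - v).2) ?_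
    change lam (lam v • w - v) = 0
    rw [map_sub, map_smul, h₁, smul_eq_mul, mul_one, sub_self]

section

variable {j : Fin 2}

lemma d_simpleModule (m : (simpleModule j).carrier) : (simpleModule j).d m = 0 := rfl

lemma rho_simpleModule_eq_zero {x : Alg} (hx : char j x = 0) (m : (simpleModule j).carrier) :
    rho (simpleModule j) x m = 0 := by
  have key (m : ℂ) : char j x * m = 0 := by rw [hx, zero_mul]
  exact key m

lemma eq_zero_of_mem_simpleModule {n : ℤ} (hn : n ≠ 0) {m : (simpleModule j).carrier}
    (hm : m ∈ (simpleModule j).gr n) : m = 0 := eq_zero_of_mem_degZero hn hm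

lemma mem_simpleModule_zero (m : (simpleModule j).carrier) : m ∈ (simpleModule j).gr 0 := by
  have : degZero 0 = ⊤ := if_pos rfl
  have h : (m : ℂ) ∈ degZero 0 := by
    rw [this]
    trivial
  exact h

lemma rC_char (k l : Fin 3) : char j (rC i k l) = 0 := by
  have h : char j (g (inn i)) = 0 := char_eq_zero _ (isArrow_inn i)
  fin_cases k <;> fin_cases l <;> simp [rC, h]

lemma d_rObj_simpleModule (f : (rObj i (simpleModule j)).carrier) :
    (rObj i (simpleModule j)).d f = 0 := rCo_ext fun l => by
  rw [rCo_d, d_simpleModule, zero_add, map_zero]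
  exact Finset.sum_eq_zero fun k _ => rho_simpleModule_eq_zero (rC_char k l) _

lemma d_fib_simpleModule (w : (fib i (simpleModule j)).carrier) :
    (fib i (simpleModule j)).d w =
      fibMk 0 (-lin (toR i (simpleModule j)) (fibM i (simpleModule j) w)) := fib_ext
  (by rw [fibM_d, d_simpleModule, fibM_fibMk])
  (by rw [fibR_d, d_rObj_simpleModule, add_zero, fibR_fibMk])

lemma rCo_eq_zero_of_char {k : Fin 3} (h : char j (idem i k) = 0)
    (f : (rObj i (simpleModule j)).carrier) : rCo i (simpleModule j) k f = 0 := by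
  rw [← idem_rCo]
  exact rho_simpleModule_eq_zero h _

lemma rho_simpleModule_eq_self {x : Alg} (hx : char j x = 1) (m : (simpleModule j).carrier) :
    rho (simpleModule j) x m = m := by
  have key (m : ℂ) : char j x * m = m := by rw [hx, one_mul]
  exact key m

lemma rIn_simpleModule_mem (k : Fin 3) (m : (simpleModule j).carrier) {n : ℤ}
    (hn : n + rDeg i k = 0) :
    rIn i (simpleModule j) k m ∈ (rObj i (simpleModule j)).gr n := mem_rObj fun l => by
  rw [rCo_rIn]
  split_ifs with h
  · rw [h, hn]
    exact mem_simpleModule_zero _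
  · exact zero_mem _

/-- A coordinate of an element of the fibre of a simple module. -/
def fibCo (i j : Fin 2) (k : Fin 3) : (fib i (simpleModule j)).carrier →ₗ[ℂ] ℂ :=
  rCo i (simpleModule j) k ∘ₗ fibR i (simpleModule j)

variable (i j) in
/-- A generator of a coordinate of the fibre of a simple module. -/
def fibGen (k : Fin 3) : (fib i (simpleModule j)).carrier :=
  fibMk 0 (rIn i _ k (show (simpleModule j).carrier from (1 : ℂ)))

lemma fibGen_mem (k : Fin 3) {l : ℤ} (hl : l - 1 + rDeg i k = 0) :
    fibGen i j k ∈ (fib i (simpleModule j)).gr l :=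
  mem_fib (zero_mem _) (rIn_simpleModule_mem k _ hl)

lemma d_fibGen (k : Fin 3) : (fib i (simpleModule j)).d (fibGen i j k) = 0 := by
  rw [d_fib_simpleModule, fibGen, fibM_fibMk, map_zero, neg_zero]
  rfl

lemma fibCo_fibGen {k : Fin 3} (hk : char j (idem i k) = 1) : fibCo i j k (fibGen i j k) = 1 :=
  (rCo_rIn k k _).trans ((if_pos rfl).trans (rho_simpleModule_eq_self hk _))

lemma fibCo_d (k : Fin 3) (w : (fib i (simpleModule j)).carrier) :
    fibCo i j k ((fib i (simpleModule j)).d w) =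
      -(show ℂ from rho (simpleModule j) (rGen i k) (fibM i (simpleModule j) w)) := by
  rw [d_fib_simpleModule]
  exact (map_neg _ _).trans (congrArg (fun x : ℂ => -x) (rCo_toR i (simpleModule j) _ k))

lemma rCo_mem_fib {l : ℤ} {w : (fib i M).carrier} (hw : w ∈ (fib i M).gr l) (k : Fin 3) :
    rCo i M k (fibR i M w) ∈ M.gr (l - 1 + rDeg i k) := rCo_mem (fibR_mem hw) k

end

lemma toR_simpleModule_self (m : (simpleModule i).carrier) :
    lin (toR i (simpleModule i)) m = 0 := rCo_ext fun k => by
  rw [rCo_toR, map_zero]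
  exact rho_simpleModule_eq_zero (char_rGen i k) m

lemma rCo_self_zero (f : (rObj i (simpleModule i)).carrier) :
    rCo i (simpleModule i) 0 f = 0 := rCo_eq_zero_of_char (char_opp i) f

lemma rCo_self_one (f : (rObj i (simpleModule i)).carrier) :
    rCo i (simpleModule i) 1 f = 0 := rCo_eq_zero_of_char (char_opp i) f

lemma fib_self_eq {w : (fib i (simpleModule i)).carrier} (h : fibM i (simpleModule i) w = 0)
    (h' : rCo i (simpleModule i) 2 (fibR i (simpleModule i) w) = 0) : w = 0 := fib_ext
  (by rw [h, map_zero]) (rCo_ext fun k => by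
    rw [map_zero, map_zero]
    fin_cases k
    exacts [rCo_self_zero _, rCo_self_one _, h'])

lemma d_fib_self (w : (fib i (simpleModule i)).carrier) :
    (fib i (simpleModule i)).d w = 0 := by
  rw [d_fib_simpleModule, toR_simpleModule_self, neg_zero]
  rfl

lemma homZero_self {k : ℤ} (h₀ : k ≠ 0) (h₁ : k ≠ -3) :
    HomZero ((simple i)⟦k⟧) (simple i) :=
  (homZero_simple_iff (Iso.refl _) (add_neg_cancel k)).2 fun w hw _ =>
    ⟨0, (map_zero _).trans (fib_self_eq (eq_zero_of_mem_simpleModule (by lia) (fibM_mem hw))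
      (eq_zero_of_mem_simpleModule (by change -k - 1 + -2 ≠ 0; lia) (rCo_mem_fib hw 2))).symm⟩

lemma finrank_self : Module.finrank ℂ ((simple i)⟦(0 : ℤ)⟧ ⟶ simple i) = 1 := by
  refine finrank_simpleHom (M := simpleModule i) (Iso.refl _) (add_zero 0)
    (fibMk (show (simpleModule i).carrier from (1 : ℂ)) 0)
    (mem_fib (mem_simpleModule_zero _) (zero_mem _)) (fibM i (simpleModule i)) (d_fib_self _) rfl
    (fun v => by rw [d_fib_self]; exact map_zero (fibM i (simpleModule i))) fun v hv _ h => ⟨0, ?_⟩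
  rw [map_zero]
  exact (fib_self_eq h (eq_zero_of_mem_simpleModule (by change (0 : ℤ) - 1 + -2 ≠ 0; lia)
    (rCo_mem_fib hv 2))).symm

lemma finrank_self_three : Module.finrank ℂ ((simple i)⟦(-3 : ℤ)⟧ ⟶ simple i) = 1 := by
  refine finrank_simpleHom (M := simpleModule i) (Iso.refl _) (by norm_num : (-3 : ℤ) + 3 = 0)
    (fibGen i i 2) (fibGen_mem 2 (by change (3 : ℤ) - 1 + -2 = 0; lia)) (fibCo i i 2) (d_fib_self _)
    (fibCo_fibGen (char_self i)) (fun v => by rw [d_fib_self, map_zero]) fun v hv _ h => ⟨0, ?_⟩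
  rw [map_zero]
  exact (fib_self_eq (eq_zero_of_mem_simpleModule (by lia) (fibM_mem hv)) h).symm

section

variable {w : (fib i (simpleModule (opp i))).carrier}

lemma rCo_opp_two (f : (rObj i (simpleModule (opp i))).carrier) :
    rCo i (simpleModule (opp i)) 2 f = 0 := rCo_eq_zero_of_char
  ((char_e _ _).trans (if_neg (opp_ne i).symm)) f

/-- A cocycle of the fibre whose second coordinate vanishes is a coboundary. -/
lemma exists_d_eq_of_fibCo (hw : (fib i (simpleModule (opp i))).d w = 0)
    (h : fibCo i (opp i) 1 w = 0) : ∃ v, (fib i (simpleModule (opp i))).d v = w := by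
  have hm (m : (simpleModule (opp i)).carrier) : rho (simpleModule (opp i)) (rGen i 0) m = m :=
    rho_simpleModule_eq_self (char_self (opp i)) m
  have h₀ : fibM i (simpleModule (opp i)) w = 0 := by
    have := fibCo_d 0 w
    rw [hw, map_zero, hm] at this
    have key (x : ℂ) (hx : 0 = -x) : x = 0 := neg_eq_zero.1 hx.symm
    exact key _ this
  refine ⟨fibMk (-rCo i _ 0 (fibR i _ w)) 0, ?_⟩
  rw [d_fib_simpleModule, fibM_fibMk, map_neg, neg_neg]
  refine fib_ext (by rw [fibM_fibMk, h₀]) (rCo_ext fun k => ?_)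
  rw [fibR_fibMk, rCo_toR]
  fin_cases k
  · exact hm _
  · exact (rho_simpleModule_eq_zero (char_eq_zero _ (isArrow_out i)) _).trans h.symm
  · exact (rho_simpleModule_eq_zero (char_eq_zero _ (isArrow_t i)) _).trans (rCo_opp_two _).symm

lemma homZero_opp {k : ℤ} (h₀ : k ≠ (out i).deg - 1) :
    HomZero ((simple i)⟦k⟧) (simple (opp i)) :=
  (homZero_simple_iff (Iso.refl _) (add_neg_cancel k)).2 fun w hw hw' =>
    exists_d_eq_of_fibCo hw' (eq_zero_of_mem_simpleModule
      (by change -k - 1 + (out i).deg ≠ 0; lia) (rCo_mem_fib hw 1))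

lemma finrank_opp {k : ℤ} (h : k = (out i).deg - 1) :
    Module.finrank ℂ ((simple i)⟦k⟧ ⟶ simple (opp i)) = 1 := by
  refine finrank_simpleHom (M := simpleModule (opp i)) (Iso.refl _) (add_neg_cancel k)
    (fibGen i (opp i) 1) (fibGen_mem 1 (by change -k - 1 + (out i).deg = 0; lia))
    (fibCo i (opp i) 1) (d_fibGen _) (fibCo_fibGen (char_self (opp i))) (fun v => ?_)
    fun v _ h₁ h₂ => exists_d_eq_of_fibCo h₁ h₂
  rw [fibCo_d]
  have : rho (simpleModule (opp i)) (rGen i 1) (fibM i (simpleModule (opp i)) v) = 0 :=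
    rho_simpleModule_eq_zero (char_eq_zero _ (isArrow_out i)) _
  rw [this]
  exact neg_zero

end

lemma homZero_S_S {k : ℤ} (h₀ : k ≠ 0) (h₁ : k ≠ -3) : HomZero (S⟦k⟧) S := homZero_self h₀ h₁

lemma homZero_T_T {k : ℤ} (h₀ : k ≠ 0) (h₁ : k ≠ -3) : HomZero (T⟦k⟧) T := homZero_self h₀ h₁

lemma homZero_S_T {k : ℤ} (h : k ≠ -1) : HomZero (S⟦k⟧) T := homZero_opp (i := 0) h

lemma homZero_T_S {k : ℤ} (h : k ≠ -2) : HomZero (T⟦k⟧) S := homZero_opp (i := 1) h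

lemma finrank_S_S : Module.finrank ℂ (S⟦(0 : ℤ)⟧ ⟶ S) = 1 := finrank_self

lemma finrank_T_T : Module.finrank ℂ (T⟦(0 : ℤ)⟧ ⟶ T) = 1 := finrank_self

lemma finrank_S_S_three : Module.finrank ℂ (S⟦(-3 : ℤ)⟧ ⟶ S) = 1 := finrank_self_three

lemma finrank_T_T_three : Module.finrank ℂ (T⟦(-3 : ℤ)⟧ ⟶ T) = 1 := finrank_self_three

lemma finrank_S_T : Module.finrank ℂ (S⟦(-1 : ℤ)⟧ ⟶ T) = 1 := finrank_opp (i := 0) rfl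

lemma finrank_T_S : Module.finrank ℂ (T⟦(-2 : ℤ)⟧ ⟶ S) = 1 := finrank_opp (i := 1) rfl

end Ginzburg

end

noncomputable section

namespace DGModule

variable {A : DGAlgebra}

/-- The morphism from the free module of rank one given by a cocycle of degree zero. -/
def freeHom {M : DGModule A} (z : M.carrier) (hz : z ∈ M.gr 0) (hz' : M.d z = 0) :
    (DerCat.Q A).obj (free A) ⟶ (DerCat.Q A).obj M :=
  (DerCat.Q A).map ((shiftZeroIso (free A)).inv ≫ ofCocycle (add_zero 0) z hz hz')

lemma exists_freeHom {M : DGModule A} (f : (DerCat.Q A).obj (free A) ⟶ (DerCat.Q A).obj M) :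
    ∃ z hz hz', f = freeHom (M := M) z hz hz' := by
  obtain ⟨φ, hφ⟩ := (kProjective_free 0).exists_map
    ((DerCat.Q A).map (shiftZeroIso (free A)).hom ≫ f)
  refine ⟨val φ, val_mem (add_zero 0) φ, d_val φ, ?_⟩
  have e : ofCocycle (add_zero 0) (val φ) (val_mem (add_zero 0) φ) (d_val φ) = φ :=
    hom_free_ext (val_ofCocycle ..)
  rw [freeHom, e, Functor.map_comp, hφ, ← Functor.map_comp_assoc, Iso.inv_hom_id,
    CategoryTheory.Functor.map_id, Category.id_comp]

lemma freeHom_eq_zero_iff {M : DGModule A} (z : M.carrier) (hz : z ∈ M.gr 0) (hz' : M.d z = 0) :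
    freeHom z hz hz' = 0 ↔ ∃ y, M.d y = z := by
  have e := htpy_free_iff (ofCocycle (add_zero 0) z hz hz')
  rw [val_ofCocycle] at e
  rw [← e, freeHom, Functor.map_comp, Preadditive.IsIso.comp_left_eq_zero]
  constructor
  · intro H
    exact (kProjective_free 0).htpy_of_eq (H.trans (Functor.map_zero _ _ _).symm)
  · intro H
    exact (Q_map_eq_of_htpy H).trans (Functor.map_zero _ _ _)

lemma freeHom_comp {M N : DGModule A} (z : M.carrier) (hz : z ∈ M.gr 0) (hz' : M.d z = 0)
    (f : M ⟶ N) : freeHom z hz hz' ≫ (DerCat.Q A).map f =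
      freeHom (lin f z) (lin_mem f hz) (by rw [← lin_d, hz', map_zero]) := by
  rw [freeHom, freeHom, ← Functor.map_comp, Category.assoc]
  congr 2
  refine hom_free_ext ?_
  rw [val_ofCocycle]
  exact congrArg (lin f) (val_ofCocycle (add_zero 0) z hz hz')

/-- Left multiplication by a cocycle of degree zero. -/
def leftMul (z : A.carrier) (hz : z ∈ A.gr 0) (hz' : A.d z = 0) :
    (DerCat.Q A).obj (free A) ⟶ (DerCat.Q A).obj (free A) :=
  (DerCat.Q A).map (mkHom (M := free A) (N := free A) (mulLeft (M := free A) z)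
    (fun n x hx => by
      have := A.mul_mem hz (show (show A.carrier from x) ∈ A.gr n from hx)
      rwa [zero_add] at this)
    (fun x => by
      have := A.leibniz (show A.carrier from x) hz
      rw [hz', zero_mul, zero_add, zpow_zero, one_smul] at this
      exact this.symm))

lemma leftMul_freeHom {M : DGModule A} {a : A.carrier} (ha : a ∈ A.gr 0) (ha' : A.d a = 0)
    (z : M.carrier) (hz : z ∈ M.gr 0) (hz' : M.d z = 0)
    (h : MulOpposite.op a • z ∈ M.gr 0) (h' : M.d (MulOpposite.op a • z) = 0) :
    leftMul a ha ha' ≫ freeHom z hz hz' = freeHom (MulOpposite.op a • z) h h' := by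
  rw [freeHom, freeHom, leftMul, ← Functor.map_comp]
  congr 1
  refine hom_ext fun x => ?_
  change MulOpposite.op (a * (show A.carrier from x)) • z =
    MulOpposite.op (show A.carrier from x) • MulOpposite.op a • z
  rw [MulOpposite.op_mul, mul_smul]

end DGModule

namespace Ginzburg

open Gen DGModule DerCat

variable {N : DGModule ginzburgA₂} {i : Fin 2}

variable (i) in
/-- The multiplication by an idempotent on the free module. -/
def mulE : Qfree ⟶ Qfree := leftMul (A := ginzburgA₂) (g (e i)) (g_mem (e i)) (d_e i)

lemma d_rho_e (k : Fin 2) (m : N.carrier) : N.d (rho N (g (e k)) m) = rho N (g (e k)) (N.d m) := by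
  rw [d_rho, d_e, map_zero, LinearMap.zero_apply, add_zero]

lemma rho_e_mem (k : Fin 2) {n : ℤ} {m : N.carrier} (hm : m ∈ N.gr n) :
    rho N (g (e k)) m ∈ N.gr n := by
  have := rho_mem hm (g_mem (e k))
  rwa [show (e k).deg = 0 from rfl, add_zero] at this

lemma mulE_freeHom (z : N.carrier) (hz : z ∈ N.gr 0) (hz' : N.d z = 0) :
    mulE i ≫ freeHom z hz hz' = freeHom (rho N (g (e i)) z) (rho_e_mem i hz)
      (by rw [d_rho_e, hz', map_zero]) := leftMul_freeHom _ _ z hz hz' _ _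

section Functional

/-- The zeroth component. -/
abbrev pr (N : DGModule ginzburgA₂) : N.carrier →ₗ[ℂ] N.carrier := proj N.isInternal 0

lemma d_pr (hN : ∀ n > 0, ∀ x ∈ N.gr n, x = 0) (x : N.carrier) : N.d (pr N x) = 0 := hN 1 one_pos _ (by
  have := N.d_mem (proj_mem N.isInternal 0 x)
  rwa [zero_add] at this)

variable (hN : ∀ n > 0, ∀ x ∈ N.gr n, x = 0)

/-- The class in cohomology of the zeroth component, multiplied by an idempotent. -/
def classE (i : Fin 2) : N.carrier →ₗ[ℂ] Coh N :=
  Submodule.mkQ _ ∘ₗ (rho N (g (e i)) ∘ₗ pr N).codRestrict (LinearMap.ker N.d) fun x => by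
    rw [LinearMap.mem_ker, LinearMap.comp_apply, d_rho_e, d_pr hN, map_zero]

lemma classE_eq_zero_iff (x : N.carrier) :
    classE hN i x = 0 ↔ ∃ y, N.d y = rho N (g (e i)) (pr N x) := Submodule.Quotient.mk_eq_zero _

lemma classE_eq_iff (x x' : N.carrier) : classE hN i x = classE hN i x' ↔
    ∃ y, N.d y = rho N (g (e i)) (pr N (x - x')) := by
  rw [← sub_eq_zero, ← map_sub, classE_eq_zero_iff]

lemma classE_d (x : N.carrier) : classE hN i (N.d x) = 0 := by
  rw [classE_eq_zero_iff]
  have := proj_d N (-1) x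
  rw [neg_add_cancel] at this
  exact ⟨rho N (g (e i)) (proj N.isInternal (-1) x), by rw [d_rho_e, this]⟩

lemma classE_rho_gen (hi : i = 0 ∨ ∀ z ∈ N.gr 0, ∃ y, N.d y = rho N (g (e 0)) z) (y : Gen)
    (x : N.carrier) : classE hN i (rho N (g y) x) = char i (g y) • classE hN i x := by
  have hp : pr N (rho N (g y) x) = rho N (g y) (proj N.isInternal (0 - y.deg) x) :=
    proj_smul' N (g_mem y) 0 x
  by_cases hy : y.deg = 0
  · rw [hy, sub_zero] at hp
    rw [← map_smul, classE_eq_iff, map_sub, map_sub, hp, map_smul, map_smul, ← rho_mul]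
    cases y with
    | e k =>
      by_cases hk : k = i
      · subst hk
        exact ⟨0, by rw [char_self, one_smul, e_e, sub_self, map_zero]⟩
      · have hk' : i = opp k := by
          fin_cases k <;> fin_cases i <;> first | rfl | exact absurd rfl hk
        exact ⟨0, by rw [char_e, if_neg hk, zero_smul, sub_zero, hk', e_opp, map_zero, map_zero,
          LinearMap.zero_apply]⟩
    | a =>
      have hc : char i (g a) = 0 := char_eq_zero _ (by simp)
      rw [hc, zero_smul, sub_zero]
      obtain rfl | h := hi
      · have : g a * g (e 0) = 0 := by
          rw [← show g a * g (e 1) = g a from out_e 0, mul_assoc, show g (e 1) * g (e 0) = 0 from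
            opp_e 0, mul_zero]
        exact ⟨0, by rw [this, map_zero, map_zero, LinearMap.zero_apply]⟩
      · obtain ⟨y, hy⟩ := h _ (proj_mem N.isInternal 0 x)
        refine ⟨rho N (g (e i)) (rho N (g a) y), ?_⟩
        have ha : d (g a) = 0 := d_g a
        rw [d_rho_e, d_rho, ha, map_zero, LinearMap.zero_apply, add_zero, hy, ← rho_mul, ← rho_mul,
          ← mul_assoc, show g (e 0) * g a = g a from g_src a]
    | b => exact absurd hy (by simp [Gen.deg])
    | t k => exact absurd hy (by simp [Gen.deg])
  · have hy' : y.deg < 0 := by cases y <;> simp_all [Gen.deg]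
    have hc : char i (g y) = 0 := char_g hy'.ne
    rw [hc, zero_smul, classE_eq_zero_iff, hp,
      hN _ (by lia) _ (proj_mem N.isInternal (0 - y.deg) x), map_zero, map_zero]
    exact ⟨0, map_zero _⟩

lemma classE_rho (hi : i = 0 ∨ ∀ z ∈ N.gr 0, ∃ y, N.d y = rho N (g (e 0)) z) (y : Alg)
    (x : N.carrier) : classE hN i (rho N y x) = char i y • classE hN i x := by
  refine alg_induction (P := fun y => ∀ x : N.carrier,
    classE hN i (rho N y x) = char i y • classE hN i x) (fun c x => ?_) (fun y x => classE_rho_gen hN hi y x)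
    (fun y y' h h' x => ?_) (fun y y' h h' x => ?_) y x
  · rw [Algebra.algebraMap_eq_smul_one, map_smul, map_smul, map_one (char i), LinearMap.smul_apply,
      rho_one, map_smul, smul_eq_mul, mul_one]
  · rw [rho_mul, h', h, map_mul, smul_smul, mul_comm]
  · rw [map_add, map_add, LinearMap.add_apply, map_add, h, h', add_smul]

/-- A dg morphism to a simple module given by a functional on cohomology. -/
def functionalHom (hi : i = 0 ∨ ∀ z ∈ N.gr 0, ∃ y, N.d y = rho N (g (e 0)) z)
    (l : LinearMap.range (classE hN i) →ₗ[ℂ] (simpleModule i).carrier) : N ⟶ simpleModule i :=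
  mkHom (ofRho (l ∘ₗ (classE hN i).rangeRestrict) fun y x => by
      have e : (classE hN i).rangeRestrict (rho N y x) =
        char i y • (classE hN i).rangeRestrict x := Subtype.ext (classE_rho hN hi y x)
      rw [LinearMap.comp_apply, e, map_smul]
      rfl)
    (fun n x hx => by
      by_cases hn : n = 0
      · subst hn
        exact mem_simpleModule_zero _
      · have e : (classE hN i).rangeRestrict x = 0 := Subtype.ext (by
          change classE hN i x = 0
          rw [classE_eq_zero_iff, pr, proj_of_mem_ne N.isInternal hn hx, map_zero]
          exact ⟨0, map_zero _⟩)
        change l ((classE hN i).rangeRestrict x) ∈ _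
        rw [e, map_zero]
        exact zero_mem _)
    (fun x => by
      have e : (classE hN i).rangeRestrict (N.d x) = 0 := Subtype.ext (classE_d hN x)
      change l ((classE hN i).rangeRestrict (N.d x)) = 0
      rw [e, map_zero])

/-- A family of morphisms to a simple module which computes a vertex of the cohomology. -/
lemma exists_functionals (hN : ∀ n > 0, ∀ x ∈ N.gr n, x = 0)
    (hi : i = 0 ∨ ∀ z ∈ N.gr 0, ∃ y, N.d y = rho N (g (e 0)) z)
    (hfin : Module.Finite ℂ (Coh N)) : ∃ (n : ℕ) (φ : Fin n → (N ⟶ simpleModule i)),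
      (∀ z ∈ N.gr 0, (∀ k, lin (φ k) z = 0) → ∃ y, N.d y = rho N (g (e i)) z) ∧
      ∀ c : Fin n → (simpleModule i).carrier, ∃ z ∈ N.gr 0, N.d z = 0 ∧ ∀ k, lin (φ k) z = c k := by
  let b := Module.finBasis ℂ (LinearMap.range (classE hN i))
  refine ⟨_, fun k => functionalHom hN hi (b.coord k), fun z hz h => ?_, fun c => ?_⟩
  · have h₀ : (classE hN i).rangeRestrict z = 0 := b.ext_elem fun k =>
      (h k).trans (map_zero (b.coord k)).symm
    have h₁ := (classE_eq_zero_iff hN z).1 (congrArg Subtype.val h₀)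
    rwa [pr, proj_of_mem N.isInternal hz] at h₁
  · obtain ⟨z, hz⟩ := (classE hN i).surjective_rangeRestrict 
      (∑ k, (show Fin _ → ℂ from c) k • b k)
    have e : (classE hN i).rangeRestrict (pr N z) = (classE hN i).rangeRestrict z :=
      Subtype.ext ((classE_eq_iff hN _ _).2 ⟨0, by
        rw [map_zero, map_sub, pr, proj_of_mem N.isInternal (proj_mem N.isInternal 0 z), sub_self,
          map_zero]⟩)
    refine ⟨pr N z, proj_mem N.isInternal 0 z, d_pr hN z, fun k => ?_⟩
    change b.coord k ((classE hN i).rangeRestrict (pr N z)) = c k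
    rw [e, hz, Module.Basis.coord_apply, b.repr_sum_self]

end Functional

/-- A family of morphisms to a simple module which computes a vertex of the cohomology. -/
lemma exists_homs_simple {X : D} (hX : ∀ n ≠ 0, DerCat.CohZero X.obj n)
    (hi : i = 0 ∨ ∀ f : Qfree ⟶ X.obj, mulE 0 ≫ f = 0) : ∃ (n : ℕ) (φ : Fin n → (X ⟶ simple i)),
      (∀ f : Qfree ⟶ X.obj, (∀ k, f ≫ (φ k).hom = 0) → mulE i ≫ f = 0) ∧
      ∀ h : Fin n → (Qfree ⟶ (simple i).obj), ∃ f : Qfree ⟶ X.obj, ∀ k, f ≫ (φ k).hom = h k := by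
  obtain ⟨M, ⟨ε⟩⟩ := exists_strict (n := 0) fun m hm => hX m hm.ne'
  have hN : ∀ n > 0, ∀ x ∈ (M.trunc 0).gr n, x = 0 := fun n hn x hx =>
    trunc_gr_eq_zero M 0 hn hx
  have hfin := (fd_Q_iff _).1 ((fd _).prop_of_iso ε.symm X.property)
  obtain ⟨n, φ, h₁, h₂⟩ := exists_functionals (i := i) hN (hi.imp id fun h z (hz : z ∈ (M.trunc 0).gr 0) => by
    have hz' : (M.trunc 0).d z = 0 := hN 1 one_pos _ (by
      have := (M.trunc 0).d_mem hz
      rwa [zero_add] at this)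
    have h' := h (freeHom z hz hz' ≫ ε.hom)
    rwa [← Category.assoc, mulE_freeHom, Preadditive.IsIso.comp_right_eq_zero,
      freeHom_eq_zero_iff] at h') hfin
  have hφ (k : Fin n) (z : (M.trunc 0).carrier) (hz : z ∈ (M.trunc 0).gr 0)
      (hz' : (M.trunc 0).d z = 0) : freeHom z hz hz' ≫ (Q ginzburgA₂).map (φ k) =
        freeHom (M := simpleModule i) (lin (φ k) z) (mem_simpleModule_zero _) (d_simpleModule _) :=
    freeHom_comp z hz hz' (φ k)
  refine ⟨n, fun k => (fd _).homMk (ε.inv ≫ (Q ginzburgA₂).map (φ k)), fun f hf => ?_, fun h => ?_⟩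
  · obtain ⟨z, hz, hz', e⟩ := exists_freeHom (f ≫ ε.inv)
    have e' : f = freeHom z hz hz' ≫ ε.hom := by rw [← e, Category.assoc, Iso.inv_hom_id,
      Category.comp_id]
    rw [e', ← Category.assoc, mulE_freeHom, Preadditive.IsIso.comp_right_eq_zero,
      freeHom_eq_zero_iff]
    refine h₁ z hz fun k => ?_
    have h₃ : (f ≫ ε.inv) ≫ (Q ginzburgA₂).map (φ k) = 0 := (Category.assoc _ _ _).trans (hf k)
    rw [e, hφ] at h₃
    obtain ⟨y, hy⟩ := (freeHom_eq_zero_iff _ _ _).1 h₃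
    exact hy.symm
  · choose c hc hc' e using fun k => exists_freeHom (M := simpleModule i) (h k)
    obtain ⟨z, hz, hz', hz''⟩ := h₂ c
    refine ⟨freeHom z hz hz' ≫ ε.hom, fun k => ?_⟩
    refine (Category.assoc _ _ _).trans ?_
    refine (congrArg (freeHom z hz hz' ≫ ·) (Iso.hom_inv_id_assoc ε _)).trans ?_
    refine (hφ k z hz hz').trans ((e k).symm ▸ ?_)
    congr 1
    exact hz'' k

lemma eq_zero_of_mulE {X : DerCat ginzburgA₂} {f : Qfree ⟶ X} (h₀ : mulE 0 ≫ f = 0)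
    (h₁ : mulE 1 ≫ f = 0) : f = 0 := by
  obtain ⟨M, ⟨ε⟩⟩ := exists_iso_Q X
  obtain ⟨z, hz, hz', e⟩ := exists_freeHom (f ≫ ε.inv)
  have h (k : Fin 2) (hk : mulE k ≫ f = 0) : ∃ y, M.d y = rho M (g (Gen.e k)) z := by
    have := (Category.assoc (mulE k) f ε.inv).symm.trans ((congrArg (· ≫ ε.inv) hk).trans zero_comp)
    rwa [e, mulE_freeHom, freeHom_eq_zero_iff] at this
  obtain ⟨y₀, hy₀⟩ := h 0 h₀
  obtain ⟨y₁, hy₁⟩ := h 1 h₁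
  have hf : f ≫ ε.inv = 0 := by
    rw [e, freeHom_eq_zero_iff]
    refine ⟨y₀ + y₁, ?_⟩
    rw [map_add, hy₀, hy₁, ← LinearMap.add_apply, ← map_add,
      show g (Gen.e 0) + g (Gen.e 1) = 1 from e_add_opp 0, rho_one]
  rwa [Preadditive.IsIso.comp_right_eq_zero] at hf

section Cone

variable {X Y Z : DerCat ginzburgA₂} {f : X ⟶ Y} {g : Y ⟶ Z} {δ : Z ⟶ X⟦(1 : ℤ)⟧}

lemma homZero_free_shift {n : ℤ} (hZ : DerCat.CohZero Z n) : HomZero Qfree (Z⟦n⟧) :=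
  (homZero_shift_right_iff Qfree Z (neg_add_cancel n)).1 hZ

lemma comp_eq_zero_of_fib (hT : Triangle.mk f g δ ∈ distTriang (DerCat ginzburgA₂))
    (hZ : DerCat.CohZero Z (-1)) {h : Qfree ⟶ X} (hh : h ≫ f = 0) : h = 0 := by
  obtain ⟨u, hu⟩ := Triangle.coyoneda_exact₂ _ (inv_rot_of_distTriang _ hT) h hh
  have hu₀ : u = 0 := homZero_free_shift hZ u
  rw [hu, hu₀]
  exact zero_comp

lemma cohZero_fib (hT : Triangle.mk f g δ ∈ distTriang (DerCat ginzburgA₂))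
    (hY : ∀ n ≠ 0, DerCat.CohZero Y n) (hZ : ∀ n ≠ 0, DerCat.CohZero Z n)
    (hg : ∀ u : Qfree ⟶ Z, ∃ v, v ≫ g = u) : ∀ n ≠ 0, DerCat.CohZero X n := by
  intro n hn
  by_cases hn' : n = 1
  · subst hn'
    refine (homZero_shift_right_iff Qfree X (neg_add_cancel 1)).2 fun u => ?_
    obtain ⟨v, hv⟩ := Triangle.coyoneda_exact₁ _ hT u
      (homZero_free_shift (hY 1 one_ne_zero) (u ≫ f⟦(1 : ℤ)⟧'))
    obtain ⟨w, rfl⟩ := hg v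
    rw [hv]
    refine (Category.assoc w g δ).trans ?_
    have : g ≫ δ = 0 := comp_distTriang_mor_zero₂₃ _ hT
    rw [this, comp_zero]
  · refine HomZero.middle_right (inv_rot_of_distTriang _ hT) ?_ (hY n hn)
    exact (DerCat.cohZero_shift_iff Z (-1) (n - 1) n (by lia)).2 (hZ _ (by lia))

end Cone

section Sums

variable {n : ℕ}

lemma biproduct_comp_eq_zero {P : DerCat ginzburgA₂} {X : Fin n → D}
    {h : P ⟶ (⨁ X).obj} (hh : ∀ k, h ≫ (biproduct.π X k).hom = 0) : h = 0 := by
  have e := (congrArg (fd ginzburgA₂).ι.map (biproduct.total (f := X))).symm.trans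
    ((fd ginzburgA₂).ι.map_sum _ _)
  have e' := congrArg (h ≫ ·) e
  rw [CategoryTheory.Functor.map_id, Preadditive.comp_sum] at e'
  refine (Category.comp_id h).symm.trans (e'.trans (Finset.sum_eq_zero fun k _ => ?_))
  exact (Category.assoc h (biproduct.π X k).hom (biproduct.ι X k).hom).symm.trans
    ((congrArg (· ≫ (biproduct.ι X k).hom) (hh k)).trans zero_comp)

lemma cohZero_biproduct {k : ℤ} (hk : k ≠ 0) :
    DerCat.CohZero (⨁ fun _ : Fin n => simple i).obj k := fun _ =>
  biproduct_comp_eq_zero fun _ => cohZero_simple hk _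

/-- The conclusions of `exists_homs_simple` for the morphism to the direct sum. -/
lemma exists_lift_simple {X : D} (hX : ∀ n ≠ 0, DerCat.CohZero X.obj n)
    (hi : i = 0 ∨ ∀ f : Qfree ⟶ X.obj, mulE 0 ≫ f = 0) :
    ∃ (n : ℕ) (φ : X ⟶ ⨁ fun _ : Fin n => simple i),
      (∀ f : Qfree ⟶ X.obj, f ≫ φ.hom = 0 → mulE i ≫ f = 0) ∧
      ∀ h : Qfree ⟶ (⨁ fun _ : Fin n => simple i).obj, ∃ f : Qfree ⟶ X.obj, f ≫ φ.hom = h := by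
  obtain ⟨n, φ, h₁, h₂⟩ := exists_homs_simple hX hi
  have hφ (k : Fin n) : (biproduct.lift φ).hom ≫ (biproduct.π (fun _ : Fin n => simple i) k).hom =
    (φ k).hom := congrArg (fd ginzburgA₂).ι.map (biproduct.lift_π φ k)
  refine ⟨n, biproduct.lift φ, fun f hf => h₁ f fun k => ?_, fun h => ?_⟩
  · rw [← hφ, ← Category.assoc, hf, zero_comp]
  · obtain ⟨f, hf⟩ := h₂ fun k => h ≫ (biproduct.π (fun _ : Fin n => simple i) k).hom
    refine ⟨f, sub_eq_zero.1 (biproduct_comp_eq_zero fun k => ?_)⟩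
    rw [Preadditive.sub_comp, Category.assoc, hφ, hf, sub_self]

end Sums

lemma isIso_of_heart {X Y : D} (hX : ∀ n ≠ 0, DerCat.CohZero X.obj n)
    (hY : ∀ n ≠ 0, DerCat.CohZero Y.obj n) (φ : X ⟶ Y)
    (h : Function.Bijective fun f : Qfree ⟶ X.obj => f ≫ φ.hom) : IsIso φ := by
  refine isIso_of_bijective φ fun k => ?_
  by_cases hk : k = 0
  · subst hk
    let e := (shiftFunctorZero (DerCat ginzburgA₂) ℤ).app Qfree
    refine ⟨fun f f' hf => ?_, fun f => ?_⟩
    · have h₁ : (e.inv ≫ f) ≫ φ.hom = (e.inv ≫ f') ≫ φ.hom := by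
        refine (Category.assoc _ _ _).trans (Eq.trans ?_ (Category.assoc _ _ _).symm)
        exact congrArg (e.inv ≫ ·) hf
      exact (cancel_epi e.inv).1 (h.1 h₁)
    · obtain ⟨u, hu⟩ := h.2 (e.inv ≫ f)
      refine ⟨e.hom ≫ u, (Category.assoc _ _ _).trans ((congrArg (e.hom ≫ ·) hu).trans ?_)⟩
      exact e.hom_inv_id_assoc f
  · have h₁ := hX (-k) (neg_ne_zero.2 hk)
    have h₂ := hY (-k) (neg_ne_zero.2 hk)
    rw [DerCat.CohZero, neg_neg] at h₁ h₂
    exact ⟨fun f f' _ => (h₁ f).trans (h₁ f').symm, fun f => ⟨0, zero_comp.trans (h₂ f).symm⟩⟩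

/-- An object of the standard heart is an extension of copies of the simple modules. -/
theorem exists_simple_triangle {X : D} (hX : ∀ n ≠ 0, DerCat.CohZero X.obj n) :
    ∃ (m n : ℕ) (f : (⨁ fun _ : Fin m => T) ⟶ X) (g : X ⟶ ⨁ fun _ : Fin n => S)
      (δ : (⨁ fun _ : Fin n => S) ⟶ (⨁ fun _ : Fin m => T)⟦(1 : ℤ)⟧),
      Triangle.mk f g δ ∈ distTriang D := by
  obtain ⟨n, φ, h₁, h₂⟩ := exists_lift_simple (i := 0) hX (Or.inl rfl)
  obtain ⟨K, ι, δ, hT⟩ := Pretriangulated.distinguished_cocone_triangle₁ φ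
  have hT' := (fd ginzburgA₂).ι.map_distinguished _ hT
  have hK : ∀ n ≠ 0, DerCat.CohZero K.obj n :=
    cohZero_fib hT' hX (fun n hn => cohZero_biproduct hn) h₂
  have hιφ : ι.hom ≫ φ.hom = 0 := congrArg (fd ginzburgA₂).ι.map (comp_distTriang_mor_zero₁₂ _ hT)
  have hK₀ (f : Qfree ⟶ K.obj) : mulE 0 ≫ f = 0 := by
    refine comp_eq_zero_of_fib hT' (cohZero_biproduct (by norm_num)) ?_
    refine (Category.assoc _ _ _).trans (h₁ (f ≫ ι.hom) ?_)
    rw [Category.assoc, hιφ, comp_zero]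
  obtain ⟨m, ψ, h₃, h₄⟩ := exists_lift_simple (i := 1) hK (Or.inr hK₀)
  have hψ : IsIso ψ := isIso_of_heart hK (fun n hn => cohZero_biproduct hn) ψ
    ⟨fun f f' hf => sub_eq_zero.1 (eq_zero_of_mulE (hK₀ _) (h₃ _ (by
      rw [Preadditive.sub_comp, sub_eq_zero]
      exact hf))), h₄⟩
  let ε : K ≅ ⨁ fun _ : Fin m => T := @asIso _ _ _ _ ψ hψ
  refine ⟨m, n, ε.inv ≫ ι, φ, δ ≫ ε.hom⟦(1 : ℤ)⟧', isomorphic_distinguished _ hT _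
    (Triangle.isoMk _ _ ε.symm (Iso.refl _) (Iso.refl _) ?_ ?_ ?_)⟩
  · exact Category.comp_id _
  · exact (Category.comp_id _).trans (Category.id_comp _).symm
  · change (δ ≫ ε.hom⟦(1 : ℤ)⟧') ≫ ε.inv⟦(1 : ℤ)⟧' = 𝟙 _ ≫ δ
    rw [Category.assoc, ← Functor.map_comp, Iso.hom_inv_id, CategoryTheory.Functor.map_id,
      Category.comp_id, Category.id_comp]

lemma standardHeart_iff (X : D) : standardHeart X ↔ ∀ n ≠ 0, DerCat.CohZero X.obj n := by
  constructor
  · rintro ⟨M, hM, ⟨ε⟩⟩ n hn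
    exact ((cohZero_Q_iff M n).2 (hM n hn)).of_iso ε.symm
  · intro h
    obtain ⟨M, ⟨ε⟩⟩ := exists_iso_Q X.obj
    exact ⟨M, fun n hn => (cohZero_Q_iff M n).1 ((h n hn).of_iso ε.symm), ⟨ε.symm⟩⟩

lemma heart_tFd : (tFd ginzburgA₂).heart = standardHeart := by
  ext X
  rw [tFd_heart_iff, standardHeart_iff]

end Ginzburg

end

noncomputable section

section DirectSums

variable {C : Type*} [Category* C] [Preadditive C] [HasZeroObject C] [HasShift C ℤ]
  [∀ n : ℤ, (shiftFunctor C n).Additive] [Pretriangulated C]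

lemma dist_of_isos {X Y Z X' Y' Z' : C} {f : X ⟶ Y} {g : Y ⟶ Z} {h : Z ⟶ X⟦(1 : ℤ)⟧}
    (H : Triangle.mk f g h ∈ distTriang C) (e₁ : X ≅ X') (e₂ : Y ≅ Y') (e₃ : Z ≅ Z') :
    Triangle.mk (e₁.inv ≫ f ≫ e₂.hom) (e₂.inv ≫ g ≫ e₃.hom) (e₃.inv ≫ h ≫ e₁.hom⟦(1 : ℤ)⟧') ∈
      distTriang C :=
  isomorphic_distinguished _ H _ (Triangle.isoMk _ _ e₁.symm e₂.symm e₃.symm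
    (by change (e₁.inv ≫ f ≫ e₂.hom) ≫ e₂.inv = e₁.inv ≫ f; simp)
    (by change (e₂.inv ≫ g ≫ e₃.hom) ≫ e₃.inv = e₂.inv ≫ g; simp)
    (by
      change (e₃.inv ≫ h ≫ e₁.hom⟦(1 : ℤ)⟧') ≫ e₁.inv⟦(1 : ℤ)⟧' = e₃.inv ≫ h
      simp [← CategoryTheory.Functor.map_comp]))

section Exact

variable {X Y Z W : C} {f : X ⟶ Y} {g : Y ⟶ Z} {h : Z ⟶ X⟦(1 : ℤ)⟧}

lemma exists_lift_of_dist (H : Triangle.mk f g h ∈ distTriang C) (u : W ⟶ Y) (hu : u ≫ g = 0) :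
    ∃ w : W ⟶ X, w ≫ f = u := by
  obtain ⟨w, hw⟩ := Triangle.coyoneda_exact₂ _ H u hu
  exact ⟨w, hw.symm⟩

lemma exists_desc_of_dist (H : Triangle.mk f g h ∈ distTriang C) (u : Y ⟶ W) (hu : f ≫ u = 0) :
    ∃ w : Z ⟶ W, g ≫ w = u := by
  obtain ⟨w, hw⟩ := Triangle.yoneda_exact₂ _ H u hu
  exact ⟨w, hw.symm⟩

lemma eq_zero_of_comp_dist (H : Triangle.mk f g h ∈ distTriang C)
    (hW : HomZero W (Z⟦(-1 : ℤ)⟧)) (u : W ⟶ X) (hu : u ≫ f = 0) : u = 0 := by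
  obtain ⟨w, hw⟩ := Triangle.coyoneda_exact₂ _ (inv_rot_of_distTriang _ H) u hu
  exact hw.trans ((congrArg (· ≫ _) (hW w)).trans zero_comp)

lemma eq_zero_of_dist_comp (H : Triangle.mk f g h ∈ distTriang C)
    (hW : HomZero (X⟦(1 : ℤ)⟧) W) (u : Z ⟶ W) (hu : g ≫ u = 0) : u = 0 := by
  obtain ⟨w, hw⟩ := Triangle.yoneda_exact₃ _ H u hu
  exact hw.trans ((congrArg (_ ≫ ·) (hW w)).trans comp_zero)

end Exact

lemma directSums_iff {A P : C} : directSums A P ↔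
    ∃ (n : ℕ) (i : Fin n → (A ⟶ P)) (p : Fin n → (P ⟶ A)),
      (∀ j k, i j ≫ p k = if j = k then 𝟙 A else 0) ∧ ∑ j, p j ≫ i j = 𝟙 P := by
  constructor
  · rintro ⟨n, i, ⟨hc⟩⟩
    have fac (k j) : i j ≫ Cofan.IsColimit.desc hc (fun j => if j = k then 𝟙 A else 0) =
        if j = k then 𝟙 A else 0 := Cofan.IsColimit.fac hc _ j
    refine ⟨n, i, fun k => Cofan.IsColimit.desc hc fun j => if j = k then 𝟙 A else 0,
      fun j k => fac k j, Cofan.IsColimit.hom_ext hc _ _ fun j => ?_⟩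
    change i j ≫ _ = i j ≫ _
    rw [Preadditive.comp_sum, Category.comp_id]
    refine (Finset.sum_congr rfl fun k _ => ?_).trans (Finset.sum_ite_eq Finset.univ j i |>.trans
      (if_pos (Finset.mem_univ j)))
    rw [← Category.assoc, fac]
    split_ifs <;> simp_all
  · rintro ⟨n, i, p, h, h'⟩
    refine ⟨n, i, ⟨Cofan.IsColimit.mk _ (fun s => ∑ j, p j ≫ s.inj j) (fun s j => ?_)
      (fun s m hm => ?_)⟩⟩
    · change i j ≫ _ = _
      rw [Preadditive.comp_sum]
      refine (Finset.sum_congr rfl fun k _ => ?_).trans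
        (Finset.sum_ite_eq Finset.univ j (fun k => s.inj k) |>.trans (if_pos (Finset.mem_univ j)))
      rw [← Category.assoc, h]
      split_ifs with hjk
      · subst hjk
        simp
      · simp
    · have key (m : P ⟶ s.pt) (hm : ∀ j, i j ≫ m = s.inj j) : m = ∑ j, p j ≫ s.inj j := by
        rw [← Category.id_comp m, ← h', Preadditive.sum_comp]
        exact Finset.sum_congr rfl fun j _ => by rw [Category.assoc, hm j]
      exact key m hm

lemma directSums.of_iso {A P P' : C} (h : directSums A P) (e : P ≅ P') : directSums A P' := by
  rw [directSums_iff] at h ⊢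
  obtain ⟨n, i, p, h, h'⟩ := h
  refine ⟨n, fun j => i j ≫ e.hom, fun j => e.inv ≫ p j, fun j k => by simp [h], ?_⟩
  have : ∀ j, (e.inv ≫ p j) ≫ i j ≫ e.hom = e.inv ≫ (p j ≫ i j) ≫ e.hom := fun j => by simp
  rw [Finset.sum_congr rfl fun j _ => this j, ← Preadditive.comp_sum, ← Preadditive.sum_comp, h']
  simp

lemma directSums.of_iso_left {A A' P : C} (h : directSums A P) (e : A ≅ A') :
    directSums A' P := by
  rw [directSums_iff] at h ⊢
  obtain ⟨n, i, p, h, h'⟩ := h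
  refine ⟨n, fun j => e.inv ≫ i j, fun j => p j ≫ e.hom, fun j k => ?_, by simpa using h'⟩
  have : (e.inv ≫ i j) ≫ p k ≫ e.hom = e.inv ≫ (i j ≫ p k) ≫ e.hom := by simp
  rw [this, h]
  split_ifs <;> simp

lemma directSums.map {D : Type*} [Category* D] [Preadditive D] [HasZeroObject D] [HasShift D ℤ]
    [∀ n : ℤ, (shiftFunctor D n).Additive] [Pretriangulated D] (F : C ⥤ D) [F.Additive] {A P : C}
    (h : directSums A P) : directSums (F.obj A) (F.obj P) := by
  rw [directSums_iff] at h ⊢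
  obtain ⟨n, i, p, h, h'⟩ := h
  refine ⟨n, fun j => F.map (i j), fun j => F.map (p j), fun j k => ?_, ?_⟩
  · rw [← F.map_comp, h]
    split_ifs <;> simp
  · simp_rw [← F.map_comp]
    rw [← Functor.map_sum, h', F.map_id]

lemma directSums.homZero_left {A P X : C} (h : directSums A P) (hA : HomZero A X) :
    HomZero P X := fun f => by
  obtain ⟨n, i, p, h, h'⟩ := directSums_iff.1 h
  rw [← Category.id_comp f, ← h', Preadditive.sum_comp]
  exact Finset.sum_eq_zero fun j _ => by rw [Category.assoc, hA (i j ≫ f), comp_zero]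

lemma directSums.homZero_right {A P X : C} (h : directSums A P) (hA : HomZero X A) :
    HomZero X P := fun f => by
  obtain ⟨n, i, p, h, h'⟩ := directSums_iff.1 h
  rw [← Category.comp_id f, ← h', Preadditive.comp_sum]
  exact Finset.sum_eq_zero fun j _ => by rw [← Category.assoc, hA (f ≫ p j), zero_comp]

lemma directSums.exists_ne_zero {A P X : C} (h : directSums A P) {f : P ⟶ X} (hf : f ≠ 0) :
    ∃ i : A ⟶ P, i ≫ f ≠ 0 := by
  obtain ⟨n, i, p, h, h'⟩ := directSums_iff.1 h
  by_contra! H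
  refine hf ?_
  rw [← Category.id_comp f, ← h', Preadditive.sum_comp]
  exact Finset.sum_eq_zero fun j _ => by rw [Category.assoc, H, comp_zero]

lemma directSums.exists_splitMono {A P : C} (h : directSums A P) (hP : ¬IsZero P) :
    ∃ (i : A ⟶ P) (p : P ⟶ A), i ≫ p = 𝟙 A := by
  obtain ⟨n, i, p, h, h'⟩ := directSums_iff.1 h
  cases n with
  | zero => exact absurd ((IsZero.iff_id_eq_zero _).2 (by simpa using h'.symm)) hP
  | succ n => exact ⟨i 0, p 0, by simp [h]⟩

lemma directSums_biproduct (A : C) (n : ℕ) : directSums A (⨁ fun _ : Fin n => A) :=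
  directSums_iff.2 ⟨n, fun j => biproduct.ι (fun _ : Fin n => A) j, fun j => biproduct.π _ j,
    fun j k => by
      rw [biproduct.ι_π]
      split_ifs <;> simp, biproduct.total⟩

lemma extensionClosure_of_iso {A B X Y : C} (h : ExtensionClosure A B X) (e : X ≅ Y) :
    ExtensionClosure A B Y :=
  open ZeroObject in
  .ext X Y (0 : C) e.hom 0 0 ((Triangle.distinguished_iff_of_isZero₃ _ (isZero_zero C)).2
    (inferInstanceAs (IsIso e.hom))) h (.zero _ (isZero_zero C))

lemma extensionClosure_biprod {A B X Y : C} (hX : ExtensionClosure A B X)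
    (hY : ExtensionClosure A B Y) : ExtensionClosure A B (X ⊞ Y) :=
  .ext X _ Y _ _ _ (binaryBiproductTriangle_distinguished X Y) hX hY

lemma extensionClosure_directSums {A B U P : C} (hU : ExtensionClosure A B U)
    (h : directSums U P) : ExtensionClosure A B P := by
  rw [directSums_iff] at h
  obtain ⟨n, i, p, h, h'⟩ := h
  induction n generalizing P with
  | zero => exact .zero _ ((IsZero.iff_id_eq_zero _).2 (by simpa using h'.symm))
  | succ n ih =>
    have hP' := ih (P := ⨁ fun _ : Fin n => U) (fun j => biproduct.ι (fun _ : Fin n => U) j)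
      (fun j => biproduct.π _ j) (fun j k => by rw [biproduct.ι_π]; split_ifs <;> simp)
      biproduct.total
    refine extensionClosure_of_iso (extensionClosure_biprod hU hP')
      ⟨biprod.desc (i 0) (biproduct.desc fun j => i j.succ),
        biprod.lift (p 0) (biproduct.lift fun j => p j.succ), ?_, ?_⟩
    · refine biprod.hom_ext' _ _ ?_ (biproduct.hom_ext' _ _ fun j => ?_)
      · refine biprod.hom_ext _ _ ?_ (biproduct.hom_ext _ _ fun k => ?_) <;> simp [h]
        exact fun hk => absurd hk.symm (Fin.succ_ne_zero k)
      · refine biprod.hom_ext _ _ ?_ (biproduct.hom_ext _ _ fun k => ?_)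
        · simp [h]
        · simp [h, biproduct.ι_π]
    · rw [biprod.lift_desc, biproduct.lift_desc, ← h', Fin.sum_univ_succ]

end DirectSums

end

noncomputable section

section Hearts

variable {C : Type*} [Category* C] [Preadditive C] [HasZeroObject C] [HasShift C ℤ]
  [∀ n : ℤ, (shiftFunctor C n).Additive] [Pretriangulated C]

open Triangulated

namespace CategoryTheory.Triangulated.TStructure

variable (t : TStructure C)

lemma heart_homZero {X Y : C} (hX : t.heart X) (hY : t.heart Y) {a b : ℤ} (h : b < a) :
    HomZero (X⟦a⟧) (Y⟦b⟧) := fun f => by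
  rw [t.mem_heart_iff] at hX hY
  obtain ⟨_, _⟩ := hX
  obtain ⟨_, _⟩ := hY
  have := t.isLE_shift X 0 a (-a)
  have := t.isGE_shift Y 0 b (-b)
  exact t.zero f (-a) (-b)

lemma heart_homZero_right {X Y : C} (hX : t.heart X) (hY : t.heart Y) {b : ℤ} (h : b < 0) :
    HomZero X (Y⟦b⟧) :=
  (t.heart_homZero hX hY h).of_iso ((shiftFunctorZero C ℤ).app X) (Iso.refl _)

lemma heart_homZero_left {X Y : C} (hX : t.heart X) (hY : t.heart Y) {a : ℤ} (h : 0 < a) :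
    HomZero (X⟦a⟧) Y :=
  (t.heart_homZero hX hY h).of_iso (Iso.refl _) ((shiftFunctorZero C ℤ).app Y)

lemma heart_of_iso {X Y : C} (hX : t.heart X) (e : X ≅ Y) : t.heart Y := by
  rw [t.mem_heart_iff] at hX ⊢
  obtain ⟨_, _⟩ := hX
  exact ⟨t.isLE_of_iso e 0, t.isGE_of_iso e 0⟩

lemma heart_of_dist {X Y Z : C} {f : X ⟶ Y} {g : Y ⟶ Z} {h : Z ⟶ X⟦(1 : ℤ)⟧}
    (H : Triangle.mk f g h ∈ distTriang C) (hX : t.heart X) (hZ : t.heart Z) : t.heart Y := by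
  rw [t.mem_heart_iff] at hX hZ ⊢
  exact ⟨t.isLE₂ _ H 0 hX.1 hZ.1, t.isGE₂ _ H 0 hX.2 hZ.2⟩

lemma heart_of_directSums {A P : C} (hA : t.heart A) (h : directSums A P) : t.heart P := by
  rw [t.mem_heart_iff] at hA ⊢
  obtain ⟨_, _⟩ := hA
  exact ⟨(t.isLE_iff_orthogonal 0 1 rfl P).2 fun Y f _ =>
      h.homZero_left (fun g => t.zero g 0 1) f,
    (t.isGE_iff_orthogonal (-1) 0 rfl P).2 fun Y f _ =>
      h.homZero_right (fun g => t.zero g (-1) 0) f⟩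

lemma heart_of_isZero {X : C} (h : IsZero X) : t.heart X := by
  rw [t.mem_heart_iff]
  exact ⟨(t.isLE_iff_orthogonal 0 1 rfl X).2 fun Y f _ => h.eq_of_src _ _,
    (t.isGE_iff_orthogonal (-1) 0 rfl X).2 fun Y f _ => h.eq_of_tgt _ _⟩

lemma isLE_of_homZero_heart {X : C} (hX : t.bounded X)
    (h : ∀ Y, t.heart Y → ∀ k : ℤ, 1 ≤ k → HomZero X (Y⟦-k⟧)) : t.IsLE X 0 := by
  obtain ⟨n, hn⟩ := hX.2
  have key (m : ℕ) : ∀ _ : t.IsLE X m, t.IsLE X 0 := by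
    induction m with
    | zero => exact fun h => h
    | succ m ih =>
      intro hm
      refine ih ((t.isLE_iff_orthogonal m (m + 1) rfl X).2 fun Y f hY => ?_)
      obtain ⟨U, V, hU, hV, a, b, c, H⟩ := t.exists_triangle Y (m + 1) (m + 1 + 1) rfl
      have _ : t.IsGE V (m + 1 + 1) := ⟨hV⟩
      have _ : t.IsLE U (m + 1) := ⟨hU⟩
      have _ : t.IsLE X (m + 1) := by simpa using hm
      have hfb : f ≫ b = 0 := t.zero (f ≫ b) (m + 1) (m + 1 + 1)
      obtain ⟨g, rfl⟩ := exists_lift_of_dist H f hfb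
      have hU' : t.IsGE U (m + 1) := by
        rw [t.isGE_iff_orthogonal m (m + 1) rfl]
        intro W u hW
        have e₁ : u ≫ a = 0 := t.zero (u ≫ a) m (m + 1)
        have _ := t.isGE_shift V (m + 1 + 1) (-1) (m + 1 + 1 + 1)
        exact eq_zero_of_comp_dist H (fun w => t.zero w m (m + 1 + 1 + 1)) u e₁
      have hU'' : t.heart (U⟦(m + 1 : ℤ)⟧) := by
        rw [t.mem_heart_iff]
        exact ⟨t.isLE_shift U (m + 1) (m + 1) 0, t.isGE_shift U (m + 1) (m + 1) 0⟩
      have := (h _ hU'' (m + 1) (by lia)).of_iso (Iso.refl X)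
        ((shiftFunctorCompIsoId C (m + 1 : ℤ) (-(m + 1)) (by lia)).app U) g
      rw [this, zero_comp]
  have := t.isLE_of_le X n n.toNat (Int.self_le_toNat n)
  exact key _ this

lemma isGE_of_homZero_heart {X : C} (hX : t.bounded X)
    (h : ∀ Y, t.heart Y → ∀ k : ℤ, 1 ≤ k → HomZero (Y⟦k⟧) X) : t.IsGE X 0 := by
  obtain ⟨n, hn⟩ := hX.1
  have key (m : ℕ) : ∀ _ : t.IsGE X (-m), t.IsGE X 0 := by
    induction m with
    | zero => exact fun h => by simpa using h
    | succ m ih =>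
      intro hm
      refine ih ((t.isGE_iff_orthogonal (-m - 1) (-m) (by lia) X).2 fun Y f hY => ?_)
      obtain ⟨U, V, hU, hV, a, b, c, H⟩ := t.exists_triangle Y (-m - 1 - 1) (-m - 1) (by lia)
      have _ : t.IsGE V (-m - 1) := ⟨hV⟩
      have _ : t.IsLE U (-m - 1 - 1) := ⟨hU⟩
      have _ : t.IsGE X (-m - 1) := by
        have e : (-m - 1 : ℤ) = -((m + 1 : ℕ) : ℤ) := by push_cast; ring
        rwa [e]
      have haf : a ≫ f = 0 := t.zero (a ≫ f) (-m - 1 - 1) (-m - 1)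
      obtain ⟨g, rfl⟩ := exists_desc_of_dist H f haf
      have hV' : t.IsLE V (-m - 1) := by
        rw [t.isLE_iff_orthogonal (-m - 1) (-m) (by lia)]
        intro W u hW
        have e₁ : b ≫ u = 0 := t.zero (b ≫ u) (-m - 1) (-m)
        have _ := t.isLE_shift U (-m - 1 - 1) 1 (-m - 1 - 1 - 1)
        exact eq_zero_of_dist_comp H (fun w => t.zero w (-m - 1 - 1 - 1) (-m)) u e₁
      have hV'' : t.heart (V⟦(-m - 1 : ℤ)⟧) := by
        rw [t.mem_heart_iff]
        exact ⟨t.isLE_shift V (-m - 1) (-m - 1) 0, t.isGE_shift V (-m - 1) (-m - 1) 0⟩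
      have := (h _ hV'' (m + 1) (by lia)).of_iso
        ((shiftFunctorCompIsoId C (-m - 1 : ℤ) (m + 1) (by lia)).app V) (Iso.refl X) g
      rw [this, comp_zero]
  have := t.isGE_of_ge X (-(-n).toNat : ℤ) n (by have := Int.self_le_toNat (-n); lia)
  exact key _ this

end CategoryTheory.Triangulated.TStructure

/-- All nonzero endomorphisms of the nonzero object `A` are invertible. -/
structure IsBrick (A : C) : Prop where
  not_isZero : ¬IsZero A
  isIso (f : A ⟶ A) (hf : f ≠ 0) : IsIso f

/-- `ℋ` is the heart of a bounded t-structure, all of whose objects are extensions of direct sums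
of the brick `B` by direct sums of the brick `A`. -/
structure SimplePair (ℋ : ObjectProperty C) (A B : C) : Prop where
  isHeart : ∃ t : Triangulated.TStructure C, t.heart = ℋ ∧ ∀ X, t.bounded X
  left_mem : ℋ A
  right_mem : ℋ B
  brick_left : IsBrick A
  brick_right : IsBrick B
  homZero_left_right : HomZero A B
  homZero_right_left : HomZero B A
  exists_triangle (X : C) (hX : ℋ X) : ∃ (P Q : C) (f : P ⟶ X) (g : X ⟶ Q) (h : Q ⟶ P⟦(1 : ℤ)⟧),
    directSums A P ∧ directSums B Q ∧ Triangle.mk f g h ∈ distTriang C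
  extension_unique (E E' : C) (hE : IsNontrivialExtension A B E)
    (hE' : IsNontrivialExtension A B E') : Nonempty (E ≅ E')

lemma simple_of_split {ℋ : ObjectProperty C} {X : ℋ.FullSubcategory} (hX : ¬IsZero X.obj)
    (h : ∀ (Y : ℋ.FullSubcategory) (φ : Y.obj ⟶ X.obj),
      (∀ W, ℋ W → ∀ u : W ⟶ Y.obj, u ≫ φ = 0 → u = 0) → φ ≠ 0 → ∃ s, s ≫ φ = 𝟙 X.obj) :
    Simple X where
  mono_isIso_iff_nonzero {Y} φ hφ := by
    constructor
    · intro hi h0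
      have h1 : inv φ ≫ φ = 0 := (congrArg (inv φ ≫ ·) h0).trans comp_zero
      rw [IsIso.inv_hom_id] at h1
      exact hX ((IsZero.iff_id_eq_zero _).2 (congrArg (·.hom) h1))
    · intro h0
      obtain ⟨s, hs⟩ := h Y φ.hom (fun W hW u hu => by
        have := (cancel_mono φ).1 (show ObjectProperty.homMk (P := ℋ) (X := ⟨W, hW⟩) u ≫ φ =
          0 ≫ φ from ObjectProperty.hom_ext _ (hu.trans zero_comp.symm))
        exact congrArg (·.hom) this) fun h1 => h0 (ObjectProperty.hom_ext _ h1)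
      have : IsSplitEpi φ := ⟨⟨⟨ObjectProperty.homMk s, ObjectProperty.hom_ext _ hs⟩⟩⟩
      exact isIso_of_mono_of_isSplitEpi φ

namespace SimplePair

variable {ℋ : ObjectProperty C} {A B : C}

lemma homZero_from (H : SimplePair ℋ A B) {X Y : C} (hX : ℋ X) (hA : HomZero A Y) (hB : HomZero B Y) : HomZero X Y := by
  obtain ⟨P, Q, f, g, h, hP, hQ, hT⟩ := H.exists_triangle X hX
  exact HomZero.middle_left hT (hP.homZero_left hA) (hQ.homZero_left hB)

lemma homZero_to (H : SimplePair ℋ A B) {X Y : C} (hX : ℋ X) (hA : HomZero Y A) (hB : HomZero Y B) : HomZero Y X := by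
  obtain ⟨P, Q, f, g, h, hP, hQ, hT⟩ := H.exists_triangle X hX
  exact HomZero.middle_right hT (hP.homZero_right hA) (hQ.homZero_right hB)

lemma mem_iff (H : SimplePair ℋ A B) (X : C) : ℋ X ↔ ∀ k : ℤ, 1 ≤ k →
    (HomZero X (A⟦-k⟧) ∧ HomZero (A⟦k⟧) X) ∧ (HomZero X (B⟦-k⟧) ∧ HomZero (B⟦k⟧) X) := by
  have H' := H
  obtain ⟨⟨t, rfl, ht⟩, hA, hB, -⟩ := H'
  constructor
  · exact fun hX k hk => ⟨⟨t.heart_homZero_right hX hA (by lia),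
      t.heart_homZero_left hA hX (by lia)⟩, t.heart_homZero_right hX hB (by lia),
      t.heart_homZero_left hB hX (by lia)⟩
  · intro h
    rw [t.mem_heart_iff]
    refine ⟨t.isLE_of_homZero_heart (ht X) fun Y hY k hk => ?_,
      t.isGE_of_homZero_heart (ht X) fun Y hY k hk => ?_⟩
    · rw [← homZero_shift_right_iff _ _ (add_neg_cancel k)]
      exact H.homZero_to hY ((homZero_shift_right_iff _ _ (add_neg_cancel k)).2 (h k hk).1.1)
        ((homZero_shift_right_iff _ _ (add_neg_cancel k)).2 (h k hk).2.1)
    · rw [homZero_shift_right_iff _ _ (add_neg_cancel k)]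
      exact H.homZero_from hY ((homZero_shift_right_iff _ _ (add_neg_cancel k)).1 (h k hk).1.2)
        ((homZero_shift_right_iff _ _ (add_neg_cancel k)).1 (h k hk).2.2)

lemma mem_of_iso (H : SimplePair ℋ A B) {X Y : C} (hX : ℋ X) (e : X ≅ Y) : ℋ Y := by
  obtain ⟨⟨t, rfl, ht⟩, -⟩ := H
  exact t.heart_of_iso hX e

lemma cancel_left (H : SimplePair ℋ A B) {X P Q : C} {f : P ⟶ X} {g : X ⟶ Q} {h : Q ⟶ P⟦(1 : ℤ)⟧}
    (hQ : directSums B Q) (hT : Triangle.mk f g h ∈ distTriang C) {W : C} (hW : ℋ W) (u : W ⟶ P)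
    (hu : u ≫ f = 0) : u = 0 := by
  obtain ⟨⟨t, rfl, ht⟩, -, hB, -⟩ := H
  exact eq_zero_of_comp_dist hT
    (t.heart_homZero_right hW (t.heart_of_directSums hB hQ) (by lia)) u hu

lemma directSums_right (H : SimplePair ℋ A B) {X : C} (hX : ℋ X) (h : HomZero A X) : directSums B X := by
  obtain ⟨P, Q, f, g, δ, hP, hQ, hT⟩ := H.exists_triangle X hX
  have hf : f = 0 := hP.homZero_left h f
  have hPm : ℋ P := by
    obtain ⟨⟨t, rfl, ht⟩, hA, -⟩ := H
    exact t.heart_of_directSums hA hP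
  have hP0 : IsZero P := (IsZero.iff_id_eq_zero _).2
    (H.cancel_left hQ hT hPm _ (by rw [hf, comp_zero]))
  have : IsIso g := (Triangle.isZero₁_iff_isIso₂ _ hT).1 hP0
  exact hQ.of_iso (asIso g).symm

lemma directSums_left (H : SimplePair ℋ A B) {X : C} (hX : ℋ X) (h : HomZero X B) : directSums A X := by
  obtain ⟨P, Q, f, g, δ, hP, hQ, hT⟩ := H.exists_triangle X hX
  have hg : g = 0 := hQ.homZero_right h g
  have hQm : HomZero (P⟦(1 : ℤ)⟧) Q := by
    obtain ⟨⟨t, rfl, ht⟩, hA, hB, -⟩ := H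
    exact t.heart_homZero_left (t.heart_of_directSums hA hP) (t.heart_of_directSums hB hQ)
      (by lia)
  have hQ0 : IsZero Q := by
    rw [IsZero.iff_id_eq_zero]
    exact eq_zero_of_dist_comp hT hQm _ (by rw [hg, zero_comp])
  have : IsIso f := (Triangle.isZero₃_iff_isIso₁ _ hT).1 hQ0
  exact hP.of_iso (asIso f)

lemma simple_left (H : SimplePair ℋ A B) : Simple (⟨A, H.left_mem⟩ : ℋ.FullSubcategory) :=
  simple_of_split H.brick_left.not_isZero fun Y φ _ h0 => by
    obtain ⟨P, Q, f, g, δ, hP, hQ, hT⟩ := H.exists_triangle Y.obj Y.property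
    have hf : f ≫ φ ≠ 0 := fun hf => by
      obtain ⟨w, rfl⟩ := exists_desc_of_dist hT φ hf
      exact h0 (by rw [hQ.homZero_left H.homZero_right_left w, comp_zero])
    obtain ⟨i, hi⟩ := hP.exists_ne_zero hf
    have := H.brick_left.isIso _ hi
    exact ⟨inv (i ≫ f ≫ φ) ≫ i ≫ f, by simp⟩

lemma simple_right (H : SimplePair ℋ A B) : Simple (⟨B, H.right_mem⟩ : ℋ.FullSubcategory) :=
  simple_of_split H.brick_right.not_isZero fun Y φ hφ h0 => by
    have hAY : HomZero A Y.obj := fun u => hφ A H.left_mem u (H.homZero_left_right _)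
    obtain ⟨i, hi⟩ := (H.directSums_right Y.property hAY).exists_ne_zero h0
    have := H.brick_right.isIso _ hi
    exact ⟨inv (i ≫ φ) ≫ i, by simp⟩

lemma iso_of_simple (H : SimplePair ℋ A B) (X : ℋ.FullSubcategory) (hX : Simple X) :
    Nonempty (X.obj ≅ A) ∨ Nonempty (X.obj ≅ B) := by
  have key {Y : C} (hY : ℋ Y) (hY0 : ¬IsZero Y) (φ : Y ⟶ X.obj)
      (hφ : ∀ W, ℋ W → ∀ u : W ⟶ Y, u ≫ φ = 0 → u = 0) : Nonempty (X.obj ≅ Y) := by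
    let ψ : (⟨Y, hY⟩ : ℋ.FullSubcategory) ⟶ X := ObjectProperty.homMk φ
    have hψ : Mono ψ := Preadditive.mono_of_cancel_zero _ fun {W} u hu =>
      ObjectProperty.hom_ext _ (hφ W.obj W.property u.hom (congrArg (·.hom) hu))
    have hψ0 : ψ ≠ 0 := fun h0 => hY0 ((IsZero.iff_id_eq_zero _).2
      (hφ Y hY _ ((Category.id_comp _).trans (congrArg (·.hom) h0))))
    have := (Simple.mono_isIso_iff_nonzero ψ).2 hψ0
    exact ⟨(ℋ.ι.mapIso (asIso ψ)).symm⟩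
  obtain ⟨P, Q, f, g, δ, hP, hQ, hT⟩ := H.exists_triangle X.obj X.property
  by_cases hP0 : IsZero P
  · refine Or.inr ?_
    have : IsIso g := (Triangle.isZero₁_iff_isIso₂ _ hT).1 hP0
    have hQ0 : ¬IsZero Q := fun hQ0 => by
      have h0 : 𝟙 X = 0 := ObjectProperty.hom_ext _ ((hQ0.of_iso (asIso g)).eq_of_src _ _)
      exact (Simple.mono_isIso_iff_nonzero (𝟙 X)).1 inferInstance h0
    obtain ⟨i, p, hip⟩ := hQ.exists_splitMono hQ0
    refine key H.right_mem H.brick_right.not_isZero (i ≫ inv g) fun W _ u hu => ?_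
    have e : u = (u ≫ i ≫ inv g) ≫ g ≫ p := by simp [hip]
    rw [e, hu, zero_comp]
  · obtain ⟨i, p, hip⟩ := hP.exists_splitMono hP0
    refine Or.inl (key H.left_mem H.brick_left.not_isZero (i ≫ f) fun W hW u hu => ?_)
    have e := H.cancel_left hQ hT hW (u ≫ i) (by rw [Category.assoc, hu])
    rw [← Category.comp_id u, ← hip, ← Category.assoc, e, zero_comp]

lemma mem_iff_extensionClosure (H : SimplePair ℋ A B) (X : C) :
    ℋ X ↔ ExtensionClosure A B X := by
  constructor
  · intro hX
    obtain ⟨P, Q, f, g, δ, hP, hQ, hT⟩ := H.exists_triangle X hX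
    exact .ext _ _ _ _ _ _ hT (extensionClosure_directSums .left hP)
      (extensionClosure_directSums .right hQ)
  · intro hX
    induction hX with
    | left => exact H.left_mem
    | right => exact H.right_mem
    | zero X h =>
      obtain ⟨⟨t, rfl, -⟩, -⟩ := H
      exact t.heart_of_isZero h
    | ext X Y Z f g h hT _ _ hX hZ =>
      obtain ⟨⟨t, rfl, -⟩, -⟩ := H
      exact t.heart_of_dist hT hX hZ

lemma isGeneratedBySimples (H : SimplePair ℋ A B) {E : C} (hE : IsNontrivialExtension A B E) :
    IsGeneratedBySimples ℋ A B E where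
  isHeart := H.isHeart
  left_mem := H.left_mem
  right_mem := H.right_mem
  simple_left := H.simple_left
  simple_right := H.simple_right
  not_iso := ⟨fun e => H.brick_left.not_isZero ((IsZero.iff_id_eq_zero _).2 (by
    rw [← e.hom_inv_id, H.homZero_left_right e.hom, zero_comp]))⟩
  iso_of_simple := H.iso_of_simple
  generated := H.mem_iff_extensionClosure
  extension := ⟨hE, fun E' hE' => H.extension_unique E' E hE' hE⟩

end SimplePair

end Hearts

end

noncomputable section

section Transport

variable {C : Type*} [Category* C] [Preadditive C] [HasZeroObject C] [HasShift C ℤ]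
  [∀ n : ℤ, (shiftFunctor C n).Additive] [Pretriangulated C]

open Triangulated

/-- The additive functor `F` is faithful, and it commutes with shifts and preserves distinguished
triangles up to the choice of the connecting morphisms. -/
structure PreservesTriangles (F : C ⥤ C) : Prop where
  additive : F.Additive
  faithful : F.Faithful
  shift (X : C) (n : ℤ) : Nonempty (F.obj (X⟦n⟧) ≅ (F.obj X)⟦n⟧)
  dist {X Y Z : C} {f : X ⟶ Y} {g : Y ⟶ Z} {h : Z ⟶ X⟦(1 : ℤ)⟧}
    (H : Triangle.mk f g h ∈ distTriang C) :
    ∃ h' : F.obj Z ⟶ (F.obj X)⟦(1 : ℤ)⟧,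
      Triangle.mk (F.map f) (F.map g) h' ∈ distTriang C ∧ (h' = 0 → F.map h = 0)

lemma preservesTriangles_of_isTriangulated (F : C ⥤ C) [F.Faithful] [F.CommShift ℤ]
    [F.IsTriangulated] : PreservesTriangles F where
  additive := inferInstance
  faithful := inferInstance
  shift X n := ⟨(F.commShiftIso n).app X⟩
  dist {X _ _ _ _ h} H := ⟨F.map h ≫ (F.commShiftIso (1 : ℤ)).hom.app X,
    F.map_distinguished _ H, fun h0 => by
      rw [← cancel_mono ((F.commShiftIso (1 : ℤ)).hom.app X), h0, zero_comp]⟩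

lemma preservesTriangles_shift (n : ℤ) : PreservesTriangles (shiftFunctor C n) where
  additive := inferInstance
  faithful := inferInstance
  shift X m := ⟨(shiftFunctorComm C m n).app X⟩
  dist {X Y Z f g h} H := by
    have H' := Triangle.shift_distinguished _ H n
    let h' : Z⟦n⟧ ⟶ X⟦n⟧⟦(1 : ℤ)⟧ := h⟦n⟧' ≫ (shiftFunctorComm C 1 n).hom.app X
    have hh (ε : ℤˣ) : ε • h' = 0 → (shiftFunctor C n).map h = 0 := fun h0 => by
      have : h' = 0 := by
        rcases Int.units_eq_one_or ε with rfl | rfl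
        · simpa using h0
        · simpa using h0
      rw [← cancel_mono ((shiftFunctorComm C 1 n).hom.app X), zero_comp]
      exact this
    have H'' : Triangle.mk (n.negOnePow • f⟦n⟧') (n.negOnePow • g⟦n⟧') (n.negOnePow • h') ∈
      distTriang C := H'
    refine ⟨n.negOnePow • h', isomorphic_distinguished _ H'' _
      (Triangle.isoMk _ _ (Iso.refl _) (n.negOnePow • Iso.refl _) (Iso.refl _) ?_ ?_ ?_), hh _⟩
    · change f⟦n⟧' ≫ (n.negOnePow • 𝟙 _) = 𝟙 _ ≫ (n.negOnePow • f⟦n⟧')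
      simp
    · change g⟦n⟧' ≫ 𝟙 _ = (n.negOnePow • 𝟙 _) ≫ (n.negOnePow • g⟦n⟧')
      simp [smul_smul, Int.units_mul_self]
    · change (n.negOnePow • h') ≫ (𝟙 _)⟦(1 : ℤ)⟧' = 𝟙 _ ≫ (n.negOnePow • h')
      simp

lemma PreservesTriangles.comp {F G : C ⥤ C} (hF : PreservesTriangles F)
    (hG : PreservesTriangles G) : PreservesTriangles (F ⋙ G) where
  additive := by
    have := hF.additive
    have := hG.additive
    infer_instance
  faithful := by
    have := hF.faithful
    have := hG.faithful
    infer_instance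
  shift X n := by
    obtain ⟨e⟩ := hF.shift X n
    obtain ⟨e'⟩ := hG.shift (F.obj X) n
    exact ⟨G.mapIso e ≪≫ e'⟩
  dist H := by
    obtain ⟨h', H', h0⟩ := hF.dist H
    obtain ⟨h'', H'', h0'⟩ := hG.dist H'
    refine ⟨h'', H'', fun e => ?_⟩
    have := hG.additive
    have := hG.faithful
    have e' := h0 (G.map_injective ((h0' e).trans (G.map_zero _ _).symm))
    exact (congrArg G.map e').trans (G.map_zero _ _)

/-- The autoequivalence `Φ` and its inverse preserve distinguished triangles. -/
structure IsExactEquiv (Φ : C ≌ C) : Prop where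
  functor : PreservesTriangles Φ.functor
  inverse : PreservesTriangles Φ.inverse

lemma IsExactEquiv.symm {Φ : C ≌ C} (h : IsExactEquiv Φ) : IsExactEquiv Φ.symm := ⟨h.2, h.1⟩

lemma IsExactEquiv.trans {Φ Ψ : C ≌ C} (h : IsExactEquiv Φ) (h' : IsExactEquiv Ψ) :
    IsExactEquiv (Φ.trans Ψ) := ⟨h.1.comp h'.1, h'.2.comp h.2⟩

lemma isExactEquiv_shift (n : ℤ) : IsExactEquiv (shiftEquiv C n) :=
  ⟨preservesTriangles_shift n, preservesTriangles_shift (-n)⟩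

lemma isExactEquiv_of_isTriangulated (Φ : C ≌ C) [Φ.functor.CommShift ℤ]
    [Φ.functor.IsTriangulated] : IsExactEquiv Φ := by
  let _ : Φ.inverse.CommShift ℤ := Φ.commShiftInverse ℤ
  have _ : Φ.CommShift ℤ := Φ.commShift_of_functor ℤ
  have _ : Φ.IsTriangulated := CategoryTheory.Equivalence.IsTriangulated.mk' Φ inferInstance
  exact ⟨preservesTriangles_of_isTriangulated _, preservesTriangles_of_isTriangulated _⟩

lemma IsNontrivialExtension.of_iso {A B E A' B' E' : C} (h : IsNontrivialExtension A B E)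
    (e₁ : A ≅ A') (e₂ : B ≅ B') (e₃ : E ≅ E') : IsNontrivialExtension A' B' E' := by
  obtain ⟨f, g, δ, H, h0⟩ := h
  refine ⟨_, _, _, dist_of_isos H e₁ e₃ e₂, fun h => h0 ?_⟩
  rwa [Preadditive.IsIso.comp_left_eq_zero, Preadditive.IsIso.comp_right_eq_zero] at h

lemma IsNontrivialExtension.map {A B E : C} (h : IsNontrivialExtension A B E) {F : C ⥤ C}
    (hF : PreservesTriangles F) : IsNontrivialExtension (F.obj A) (F.obj B) (F.obj E) := by
  obtain ⟨f, g, δ, H, h0⟩ := h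
  obtain ⟨h', H', hh⟩ := hF.dist H
  have := hF.additive
  have := hF.faithful
  exact ⟨_, _, h', H', fun e => h0 (F.map_injective ((hh e).trans (F.map_zero _ _).symm))⟩

lemma IsBrick.of_iso {A A' : C} (h : IsBrick A) (e : A ≅ A') : IsBrick A' where
  not_isZero h0 := h.not_isZero (h0.of_iso e)
  isIso f hf := by
    have := h.isIso (e.hom ≫ f ≫ e.inv) fun h0 => hf (by
      rwa [Preadditive.IsIso.comp_left_eq_zero, Preadditive.IsIso.comp_right_eq_zero] at h0)
    have e' : f = e.inv ≫ (e.hom ≫ f ≫ e.inv) ≫ e.hom := by simp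
    rw [e']
    infer_instance

lemma homZero_map_iff (F : C ⥤ C) [F.Full] [F.Faithful] [F.Additive] {X Y : C} :
    HomZero (F.obj X) (F.obj Y) ↔ HomZero X Y :=
  ⟨fun h f => F.map_injective ((h _).trans (F.map_zero _ _).symm), fun h f => by
    obtain ⟨f, rfl⟩ := F.map_surjective f
    rw [h f, F.map_zero]⟩

lemma IsBrick.map {A : C} (h : IsBrick A) (F : C ⥤ C) [F.Full] [F.Faithful] [F.Additive] :
    IsBrick (F.obj A) where
  not_isZero h0 := h.not_isZero ((IsZero.iff_id_eq_zero _).2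
    (F.map_injective (h0.eq_of_src _ _)))
  isIso f hf := by
    obtain ⟨f, rfl⟩ := F.map_surjective f
    have := h.isIso f fun h0 => hf (by rw [h0, F.map_zero])
    infer_instance

/-- The image of a t-structure under an autoequivalence. -/
def tMap (t : TStructure C) (Φ : C ≌ C) (h : IsExactEquiv Φ) : TStructure C where
  le n := (t.le n).map Φ.functor
  ge n := (t.ge n).map Φ.functor
  le_shift n a n' e X hX := by
    obtain ⟨Y, hY, ⟨i⟩⟩ := (ObjectProperty.prop_map_iff _ _ _).1 hX
    obtain ⟨j⟩ := h.functor.shift Y a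
    exact (ObjectProperty.prop_map_iff _ _ _).2 ⟨_, t.le_shift n a n' e Y hY,
      ⟨j ≪≫ (shiftFunctor C a).mapIso i⟩⟩
  ge_shift n a n' e X hX := by
    obtain ⟨Y, hY, ⟨i⟩⟩ := (ObjectProperty.prop_map_iff _ _ _).1 hX
    obtain ⟨j⟩ := h.functor.shift Y a
    exact (ObjectProperty.prop_map_iff _ _ _).2 ⟨_, t.ge_shift n a n' e Y hY,
      ⟨j ≪≫ (shiftFunctor C a).mapIso i⟩⟩
  zero' X Y f hX hY := by
    obtain ⟨X', hX', ⟨i⟩⟩ := (ObjectProperty.prop_map_iff _ _ _).1 hX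
    obtain ⟨Y', hY', ⟨j⟩⟩ := (ObjectProperty.prop_map_iff _ _ _).1 hY
    have := h.functor.additive
    exact ((homZero_map_iff Φ.functor).2 (fun g => t.zero' g hX' hY')).of_iso i j f
  le_zero_le := ObjectProperty.map_monotone t.le_zero_le _
  ge_one_le := ObjectProperty.map_monotone t.ge_one_le _
  exists_triangle_zero_one X := by
    obtain ⟨Y, Z, hY, hZ, f, g, δ, H⟩ := t.exists_triangle_zero_one (Φ.inverse.obj X)
    obtain ⟨h', H', -⟩ := h.functor.dist H
    exact ⟨_, _, (t.le 0).prop_map_obj Φ.functor hY, (t.ge 1).prop_map_obj Φ.functor hZ, _, _, _,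
      dist_of_iso₂ H' (Φ.counitIso.app X)⟩

lemma tMap_le_iff (t : TStructure C) (Φ : C ≌ C) (h : IsExactEquiv Φ) (n : ℤ) (X : C) :
    (tMap t Φ h).le n X ↔ t.le n (Φ.inverse.obj X) := by
  refine ⟨fun hX => ?_, fun hX => (ObjectProperty.prop_map_iff _ _ _).2
    ⟨_, hX, ⟨Φ.counitIso.app X⟩⟩⟩
  obtain ⟨Y, hY, ⟨i⟩⟩ := (ObjectProperty.prop_map_iff _ _ _).1 hX
  exact (t.le n).prop_of_iso (Φ.unitIso.app Y ≪≫ Φ.inverse.mapIso i) hY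

lemma tMap_ge_iff (t : TStructure C) (Φ : C ≌ C) (h : IsExactEquiv Φ) (n : ℤ) (X : C) :
    (tMap t Φ h).ge n X ↔ t.ge n (Φ.inverse.obj X) := by
  refine ⟨fun hX => ?_, fun hX => (ObjectProperty.prop_map_iff _ _ _).2
    ⟨_, hX, ⟨Φ.counitIso.app X⟩⟩⟩
  obtain ⟨Y, hY, ⟨i⟩⟩ := (ObjectProperty.prop_map_iff _ _ _).1 hX
  exact (t.ge n).prop_of_iso (Φ.unitIso.app Y ≪≫ Φ.inverse.mapIso i) hY

lemma map_iff_inverse {ℋ : ObjectProperty C} [ℋ.IsClosedUnderIsomorphisms] (Φ : C ≌ C) (X : C) :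
    ℋ.map Φ.functor X ↔ ℋ (Φ.inverse.obj X) := by
  refine ⟨fun hX => ?_, fun hX => (ObjectProperty.prop_map_iff _ _ _).2
    ⟨_, hX, ⟨Φ.counitIso.app X⟩⟩⟩
  obtain ⟨Y, hY, ⟨i⟩⟩ := (ObjectProperty.prop_map_iff _ _ _).1 hX
  exact ℋ.prop_of_iso (Φ.unitIso.app Y ≪≫ Φ.inverse.mapIso i) hY

namespace SimplePair

variable {ℋ : ObjectProperty C} {A B : C}

lemma of_iso (H : SimplePair ℋ A B) {A' B' : C} (e : A ≅ A') (e' : B ≅ B') :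
    SimplePair ℋ A' B' where
  isHeart := H.isHeart
  left_mem := H.mem_of_iso H.left_mem e
  right_mem := H.mem_of_iso H.right_mem e'
  brick_left := H.brick_left.of_iso e
  brick_right := H.brick_right.of_iso e'
  homZero_left_right := H.homZero_left_right.of_iso e e'
  homZero_right_left := H.homZero_right_left.of_iso e' e
  exists_triangle X hX := by
    obtain ⟨P, Q, f, g, δ, hP, hQ, hT⟩ := H.exists_triangle X hX
    exact ⟨P, Q, f, g, δ, hP.of_iso_left e, hQ.of_iso_left e', hT⟩
  extension_unique E E' hE hE' := H.extension_unique E E'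
    (hE.of_iso e.symm e'.symm (Iso.refl _)) (hE'.of_iso e.symm e'.symm (Iso.refl _))

lemma map (H : SimplePair ℋ A B) {Φ : C ≌ C} (h : IsExactEquiv Φ) :
    SimplePair (ℋ.map Φ.functor) (Φ.functor.obj A) (Φ.functor.obj B) := by
  have := h.functor.additive
  refine ⟨?_, ℋ.prop_map_obj _ H.left_mem, ℋ.prop_map_obj _ H.right_mem, H.brick_left.map _,
    H.brick_right.map _, (homZero_map_iff _).2 H.homZero_left_right,
    (homZero_map_iff _).2 H.homZero_right_left, fun X hX => ?_, fun E E' hE hE' => ?_⟩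
  · obtain ⟨t, rfl, ht⟩ := H.isHeart
    refine ⟨tMap t Φ h, ?_, fun X => ?_⟩
    · ext X
      rw [TStructure.mem_heart_iff, ← TStructure.le_iff_isLE, ← TStructure.ge_iff_isGE,
        tMap_le_iff, tMap_ge_iff, map_iff_inverse, TStructure.mem_heart_iff,
        TStructure.le_iff_isLE, TStructure.ge_iff_isGE]
    · obtain ⟨⟨a, ha⟩, ⟨b, hb⟩⟩ := ht (Φ.inverse.obj X)
      exact ⟨⟨a, ⟨(tMap_ge_iff _ _ _ _ _).2 ha.ge⟩⟩, ⟨b, ⟨(tMap_le_iff _ _ _ _ _).2 hb.le⟩⟩⟩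
  · obtain ⟨Y, hY, ⟨i⟩⟩ := (ObjectProperty.prop_map_iff _ _ _).1 hX
    obtain ⟨P, Q, f, g, δ, hP, hQ, hT⟩ := H.exists_triangle Y hY
    obtain ⟨δ', hT', -⟩ := h.functor.dist hT
    exact ⟨_, _, _, _, _, hP.map Φ.functor, hQ.map Φ.functor, dist_of_iso₂ hT' i⟩
  · have key {E} (hE : IsNontrivialExtension (Φ.functor.obj A) (Φ.functor.obj B) E) :
        IsNontrivialExtension A B (Φ.inverse.obj E) :=
      (hE.map h.inverse).of_iso (Φ.unitIso.symm.app A) (Φ.unitIso.symm.app B) (Iso.refl _)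
    obtain ⟨e⟩ := H.extension_unique _ _ (key hE) (key hE')
    exact ⟨(Φ.counitIso.app E).symm ≪≫ Φ.functor.mapIso e ≪≫ Φ.counitIso.app E'⟩

end SimplePair

end Transport

end

noncomputable section

section Tilts

variable {C : Type*} [Category* C] [Preadditive C] [HasZeroObject C] [HasShift C ℤ]
  [∀ n : ℤ, (shiftFunctor C n).Additive] [Pretriangulated C]

open Triangulated

/-- The objects of `ℬ` are characterized by the morphisms to and from the shifts of `P` and `Q`, and
they are extensions of these two objects. -/
structure HeartPair (ℬ : ObjectProperty C) (P Q : C) : Prop where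
  left_mem : ℬ P
  mem_iff (X : C) : ℬ X ↔ ∀ k : ℤ, 1 ≤ k →
    (HomZero X (P⟦-k⟧) ∧ HomZero (P⟦k⟧) X) ∧ (HomZero X (Q⟦-k⟧) ∧ HomZero (Q⟦k⟧) X)
  homZero_from {X Y : C} (hX : ℬ X) (hP : HomZero P Y) (hQ : HomZero Q Y) : HomZero X Y
  homZero_to {X Y : C} (hX : ℬ X) (hP : HomZero Y P) (hQ : HomZero Y Q) : HomZero Y X

lemma SimplePair.heartPair {ℬ : ObjectProperty C} {P Q : C} (H : SimplePair ℬ P Q) :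
    HeartPair ℬ P Q :=
  ⟨H.left_mem, H.mem_iff, H.homZero_from, H.homZero_to⟩

lemma SimplePair.heartPair_symm {ℬ : ObjectProperty C} {P Q : C} (H : SimplePair ℬ P Q) :
    HeartPair ℬ Q P :=
  ⟨H.right_mem, fun X => (H.mem_iff X).trans (forall₂_congr fun _ _ => and_comm),
    fun hX h h' => H.homZero_from hX h' h, fun hX h h' => H.homZero_to hX h' h⟩

lemma HeartPair.mem_of_dist {ℬ : ObjectProperty C} {P Q : C} (H : HeartPair ℬ P Q) {X Y Z : C}
    {f : X ⟶ Y} {g : Y ⟶ Z} {h : Z ⟶ X⟦(1 : ℤ)⟧} (hT : Triangle.mk f g h ∈ distTriang C)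
    (hX : ℬ X) (hZ : ℬ Z) : ℬ Y := by
  rw [H.mem_iff] at hX hZ ⊢
  exact fun k hk => ⟨⟨HomZero.middle_left hT (hX k hk).1.1 (hZ k hk).1.1,
    HomZero.middle_right hT (hX k hk).1.2 (hZ k hk).1.2⟩,
    HomZero.middle_left hT (hX k hk).2.1 (hZ k hk).2.1,
    HomZero.middle_right hT (hX k hk).2.2 (hZ k hk).2.2⟩

lemma HeartPair.mem_of_directSums {ℬ : ObjectProperty C} {P Q : C} (H : HeartPair ℬ P Q) {X Y : C}
    (hY : directSums X Y) (hX : ℬ X) : ℬ Y := by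
  rw [H.mem_iff] at hX ⊢
  exact fun k hk => ⟨⟨hY.homZero_left (hX k hk).1.1, hY.homZero_right (hX k hk).1.2⟩,
    hY.homZero_left (hX k hk).2.1, hY.homZero_right (hX k hk).2.2⟩

namespace CategoryTheory.Triangulated.TStructure

variable (t : TStructure C)

lemma exists_triangle_of_isLE_of_isGE {Y : C} (n : ℤ) (hl : t.IsLE Y (n + 1)) (hg : t.IsGE Y n) :
    ∃ (A B : C) (f : A ⟶ Y) (g : Y ⟶ B) (h : B ⟶ A⟦(1 : ℤ)⟧), t.IsLE A n ∧ t.IsGE A n ∧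
      t.IsLE B (n + 1) ∧ t.IsGE B (n + 1) ∧ Triangle.mk f g h ∈ distTriang C := by
  obtain ⟨A, B, hA, hB, f, g, h, H⟩ := t.exists_triangle Y n (n + 1) rfl
  have _ : t.IsLE A n := ⟨hA⟩
  have _ : t.IsGE B (n + 1) := ⟨hB⟩
  refine ⟨A, B, f, g, h, ⟨hA⟩, ?_, ?_, ⟨hB⟩, H⟩
  · refine (t.isGE_iff_orthogonal (n - 1) n (by lia) A).2 fun W u hW => ?_
    have _ := t.isGE_shift B (n + 1) (-1) (n + 2)
    exact eq_zero_of_comp_dist H (fun w => t.zero w (n - 1) (n + 2)) u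
      (t.zero (u ≫ f) (n - 1) n)
  · refine (t.isLE_iff_orthogonal (n + 1) (n + 2) (by lia) B).2 fun W u hW => ?_
    have _ := t.isLE_shift A n 1 (n - 1)
    exact eq_zero_of_dist_comp H (fun w => t.zero w (n - 1) (n + 2)) u
      (t.zero (g ≫ u) (n + 1) (n + 2))

variable {t} {ℬ : ObjectProperty C} {U Q : C}

theorem rightSimpleTilt_eq (H : HeartPair ℬ (U⟦(1 : ℤ)⟧) Q) (hU : t.heart U) (hQ : t.heart Q)
    (hQU : HomZero Q U) (hV : ∀ V, t.heart V → HomZero Q V → directSums U V) :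
    rightSimpleTilt t.heart U = ℬ := by
  have hU' := hU
  have hQ' := hQ
  rw [t.mem_heart_iff] at hU' hQ'
  obtain ⟨_, _⟩ := hU'
  obtain ⟨_, _⟩ := hQ'
  have _ := t.isLE_shift U 0 1 (-1)
  have _ := t.isGE_shift U 0 1 (-1)
  have _ := t.isLE_shift Q 0 1 (-1)
  ext Y
  constructor
  · rintro ⟨F, T, f, g, h, hF, ⟨hT, hTU⟩, hD⟩
    refine H.mem_of_dist hD (H.mem_of_directSums (hF.map (shiftFunctor C (1 : ℤ))) H.left_mem)
      ((H.mem_iff T).2 fun k hk => ⟨⟨?_, ?_⟩, t.heart_homZero_right hT hQ (by lia),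
        t.heart_homZero_left hQ hT (by lia)⟩)
    · refine HomZero.of_iso ?_ (Iso.refl T) ((shiftFunctorAdd' C 1 (-k) (1 - k) (by lia)).app U)
      obtain rfl | hk' := eq_or_lt_of_le hk
      · exact HomZero.of_iso (X := T) hTU (Iso.refl T) ((shiftFunctorZero C ℤ).symm.app U)
      · exact t.heart_homZero_right hT hU (by lia)
    · exact (t.heart_homZero_left hU hT (by lia : 0 < 1 + k)).of_iso
        ((shiftFunctorAdd' C 1 k (1 + k) (by lia)).app U) (Iso.refl T)
  · intro hY
    have hl : t.IsLE Y (-1 + 1) := (t.isLE_iff_orthogonal 0 1 rfl Y).2 fun W u hW =>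
      H.homZero_from hY (fun v => t.zero v (-1) 1) (fun v => t.zero v 0 1) u
    have hg : t.IsGE Y (-1) := (t.isGE_iff_orthogonal (-2) (-1) rfl Y).2 fun W u hW =>
      H.homZero_to hY (fun v => t.zero v (-2) (-1)) (fun v => t.zero v (-2) 0) u
    obtain ⟨A, B, f, g, h, _, _, hB, hB', hD⟩ := t.exists_triangle_of_isLE_of_isGE (-1) hl hg
    have _ : t.IsLE B 0 := hB
    have _ : t.IsGE B 0 := hB'
    have _ := t.isGE_shift B 0 (-1) 1
    have _ := t.isLE_shift A (-1) 1 (-2)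
    have hQA : HomZero (Q⟦(1 : ℤ)⟧) A := fun u =>
      eq_zero_of_comp_dist hD (fun v => t.zero v (-1) 1) u (((H.mem_iff Y).1 hY 1 le_rfl).2.2 _)
    have hBU : HomZero B U := fun u =>
      eq_zero_of_dist_comp hD (fun v => t.zero v (-2) 0) u
        (H.homZero_from hY (fun v => t.zero v (-1) 0) hQU _)
    have hA : t.heart (A⟦(-1 : ℤ)⟧) := (t.mem_heart_iff _).2
      ⟨t.isLE_shift A (-1) (-1) 0, t.isGE_shift A (-1) (-1) 0⟩
    have := dist_of_isos hD ((shiftFunctorCompIsoId C (-1 : ℤ) 1 (by lia)).symm.app A)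
      (Iso.refl Y) (Iso.refl B)
    exact ⟨A⟦(-1 : ℤ)⟧, B, _, _, _,
      hV _ hA ((homZero_shift_right_iff Q A (by lia : (1 : ℤ) + -1 = 0)).1 hQA),
      ⟨(t.mem_heart_iff B).2 ⟨hB, hB'⟩, hBU⟩, this⟩

theorem leftSimpleTilt_eq (H : HeartPair ℬ (U⟦(-1 : ℤ)⟧) Q) (hU : t.heart U) (hQ : t.heart Q)
    (hUQ : HomZero U Q) (hV : ∀ V, t.heart V → HomZero V Q → directSums U V) :
    leftSimpleTilt t.heart U = ℬ := by
  have hU' := hU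
  have hQ' := hQ
  rw [t.mem_heart_iff] at hU' hQ'
  obtain ⟨_, _⟩ := hU'
  obtain ⟨_, _⟩ := hQ'
  have _ := t.isLE_shift U 0 (-1) 1
  have _ := t.isGE_shift U 0 (-1) 1
  have _ := t.isGE_shift Q 0 (-1) 1
  ext Y
  constructor
  · rintro ⟨F, T, f, g, h, ⟨hF, hUF⟩, hT, hD⟩
    refine H.mem_of_dist hD ((H.mem_iff F).2 fun k hk => ⟨⟨?_, ?_⟩,
      t.heart_homZero_right hF hQ (by lia), t.heart_homZero_left hQ hF (by lia)⟩)
      (H.mem_of_directSums (hT.map (shiftFunctor C (-1 : ℤ))) H.left_mem)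
    · exact (t.heart_homZero_right hF hU (by lia : -1 - k < 0)).of_iso (Iso.refl F)
        ((shiftFunctorAdd' C (-1) (-k) (-1 - k) (by lia)).app U)
    · refine HomZero.of_iso ?_ ((shiftFunctorAdd' C (-1) k (-1 + k) (by lia)).app U) (Iso.refl F)
      obtain rfl | hk' := eq_or_lt_of_le hk
      · exact HomZero.of_iso (Y := F) hUF ((shiftFunctorZero C ℤ).symm.app U) (Iso.refl F)
      · exact t.heart_homZero_left hU hF (by lia)
  · intro hY
    have hl : t.IsLE Y (0 + 1) := (t.isLE_iff_orthogonal 1 2 rfl Y).2 fun W u hW =>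
      H.homZero_from hY (fun v => t.zero v 1 2) (fun v => t.zero v 0 2) u
    have hg : t.IsGE Y 0 := (t.isGE_iff_orthogonal (-1) 0 rfl Y).2 fun W u hW =>
      H.homZero_to hY (fun v => t.zero v (-1) 1) (fun v => t.zero v (-1) 0) u
    obtain ⟨A, B, f, g, h, hA, hA', hB, hB', hD⟩ := t.exists_triangle_of_isLE_of_isGE 0 hl hg
    have _ : t.IsLE B 1 := hB
    have _ : t.IsGE B 1 := hB'
    have _ := t.isGE_shift B 1 (-1) 2
    have _ := t.isLE_shift A 0 1 (-1)
    have hBQ : HomZero B (Q⟦(-1 : ℤ)⟧) := fun u =>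
      eq_zero_of_dist_comp hD (fun v => t.zero v (-1) 1) u (((H.mem_iff Y).1 hY 1 le_rfl).2.1 _)
    have hUA : HomZero U A := fun u =>
      eq_zero_of_comp_dist hD (fun v => t.zero v 0 2) u
        (H.homZero_to hY (fun v => t.zero v 0 1) hUQ _)
    have hB1 : t.heart (B⟦(1 : ℤ)⟧) := (t.mem_heart_iff _).2
      ⟨t.isLE_shift B 1 1 0, t.isGE_shift B 1 1 0⟩
    have := dist_of_isos hD (Iso.refl A) (Iso.refl Y)
      ((shiftFunctorCompIsoId C (1 : ℤ) (-1) (by lia)).symm.app B)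
    exact ⟨A, B⟦(1 : ℤ)⟧, _, _, _, ⟨(t.mem_heart_iff A).2 ⟨hA, hA'⟩, hUA⟩,
      hV _ hB1 ((homZero_shift_right_iff B Q (by lia : (1 : ℤ) + -1 = 0)).2 hBQ), this⟩

end CategoryTheory.Triangulated.TStructure

end Tilts

end

noncomputable section

section Twists

variable {C : Type*} [Category* C] [Preadditive C] [HasZeroObject C] [HasShift C ℤ]
  [∀ n : ℤ, (shiftFunctor C n).Additive] [Pretriangulated C] [Linear ℂ C]

open Module

lemma finrank_hom_of_iso {X Y X' Y' : C} (e : X ≅ X') (e' : Y ≅ Y') :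
    finrank ℂ (X ⟶ Y) = finrank ℂ (X' ⟶ Y') :=
  (Linear.homCongr ℂ e e').finrank_eq

lemma finrank_hom_map (F : C ⥤ C) [F.Additive] [F.Linear ℂ] [F.Full] [F.Faithful] (X Y : C) :
    finrank ℂ (X ⟶ Y) = finrank ℂ (F.obj X ⟶ F.obj Y) :=
  (LinearEquiv.ofBijective (F.mapLinearMap ℂ (X := X) (Y := Y))
    ⟨F.map_injective, F.map_surjective⟩).finrank_eq

lemma exists_smul_eq_of_finrank {X Y : C} (h : finrank ℂ (X ⟶ Y) = 1) {f : X ⟶ Y} (hf : f ≠ 0)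
    (g : X ⟶ Y) : ∃ c : ℂ, c • f = g :=
  (finrank_eq_one_iff_of_nonzero' f hf).1 h g

lemma exists_ne_zero_of_finrank {X Y : C} (h : finrank ℂ (X ⟶ Y) = 1) : ∃ f : X ⟶ Y, f ≠ 0 := by
  have := Module.nontrivial_of_finrank_pos (R := ℂ) (M := X ⟶ Y) (by lia)
  exact exists_ne 0

lemma isBrick_of_finrank {A : C} (h : finrank ℂ (A ⟶ A) = 1) : IsBrick A where
  not_isZero h0 := by
    obtain ⟨f, hf⟩ := exists_ne_zero_of_finrank h
    exact hf (h0.eq_of_src _ _)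
  isIso f hf := by
    obtain ⟨c, hc⟩ := exists_smul_eq_of_finrank h hf (𝟙 A)
    exact ⟨c • 𝟙 A, by rw [Linear.comp_smul, Category.comp_id, hc],
      by rw [Linear.smul_comp, Category.id_comp, hc]⟩

lemma extension_unique_of_finrank {A B : C} (h : finrank ℂ (B ⟶ A⟦(1 : ℤ)⟧) = 1) {E E' : C}
    (hE : IsNontrivialExtension A B E) (hE' : IsNontrivialExtension A B E') :
    Nonempty (E ≅ E') := by
  obtain ⟨f, g, δ, H, hδ⟩ := hE
  obtain ⟨f', g', δ', H', hδ'⟩ := hE'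
  obtain ⟨c, hc⟩ := exists_smul_eq_of_finrank h hδ δ'
  have hc0 : c ≠ 0 := by
    rintro rfl
    exact hδ' (by rw [← hc, zero_smul])
  let e : B ≅ B := ⟨c • 𝟙 B, c⁻¹ • 𝟙 B, by simp [smul_smul, hc0], by simp [smul_smul, hc0]⟩
  have comm : (Triangle.mk f' g' δ').mor₃ ≫ (𝟙 A)⟦(1 : ℤ)⟧' =
      e.hom ≫ (Triangle.mk f g δ).mor₃ := by
    change δ' ≫ (𝟙 A)⟦(1 : ℤ)⟧' = (c • 𝟙 B) ≫ δ
    simp [hc]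
  obtain ⟨b, hb₁, hb₂⟩ := complete_distinguished_triangle_morphism₂ _ _ H' H (𝟙 A) e.hom comm
  let φ : Triangle.mk f' g' δ' ⟶ Triangle.mk f g δ := ⟨𝟙 A, b, e.hom, hb₁, hb₂, comm⟩
  have := isIso₂_of_isIso₁₃ φ H' H (inferInstanceAs (IsIso (𝟙 A))) e.isIso_hom
  exact ⟨(asIso φ.hom₂).symm⟩

/-- The graded vector space `Hom^•(U, Y)` is one-dimensional, and it lies in the degree of the
morphisms `U⟦n⟧ ⟶ Y`. -/
structure Concentrated (U Y : C) (n : ℤ) : Prop where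
  homZero {k : ℤ} (hk : k ≠ n) : HomZero (U⟦k⟧) Y
  finrank : finrank ℂ (U⟦n⟧ ⟶ Y) = 1

/-- `U` is a spherical object of dimension three. -/
structure IsSpherical (U : C) : Prop where
  homZero {k : ℤ} (hk : k ≠ 0) (hk' : k ≠ -3) : HomZero (U⟦k⟧) U
  finrank_zero : finrank ℂ (U⟦(0 : ℤ)⟧ ⟶ U) = 1
  finrank_three : finrank ℂ (U⟦(-3 : ℤ)⟧ ⟶ U) = 1

lemma exists_unique_basis {V ι : Type*} [AddCommGroup V] [Module ℂ V] (b : Basis ι ℂ V)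
    (h : Module.finrank ℂ V = 1) : ∃ j : ι, ∀ k, k = j := by
  rw [Module.finrank_eq_nat_card_basis b, Nat.card_eq_one_iff_unique] at h
  obtain ⟨h, ⟨j⟩⟩ := h
  exact ⟨j, fun k => Subsingleton.elim _ _⟩

namespace IsTwist

variable {U : C} {Φ : C ≌ C}

lemma isExactEquiv (h : IsTwist U Φ) : IsExactEquiv Φ := by
  obtain ⟨_, _⟩ := h.exact
  exact isExactEquiv_of_isTriangulated Φ

lemma exists_dist (h : IsTwist U Φ) {Y : C} {n : ℤ} (hY : Concentrated U Y n) :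
    ∃ (f : U⟦n⟧ ⟶ Y) (g : Y ⟶ Φ.functor.obj Y) (δ : Φ.functor.obj Y ⟶ U⟦n⟧⟦(1 : ℤ)⟧),
      f ≠ 0 ∧ Triangle.mk f g δ ∈ distTriang C := by
  obtain ⟨η, hη⟩ := h.cone
  obtain ⟨W, ev, δ, ⟨J, β, inj, ⟨hc⟩, hev⟩, H⟩ := hη Y
  obtain ⟨j, hj⟩ := exists_unique_basis (β n) hY.finrank
  have hq (q : Σ i, J i) : q = ⟨n, j⟩ := by
    obtain ⟨i, k⟩ := q
    obtain rfl : i = n := by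
      by_contra hi
      exact (β i).ne_zero k (hY.homZero hi _)
    rw [hj k]
  let r : W ⟶ U⟦n⟧ := Cofan.IsColimit.desc hc fun q => eqToHom (by rw [hq q])
  have h₁ : inj ⟨n, j⟩ ≫ r = 𝟙 _ :=
    (Cofan.IsColimit.fac hc (fun q => eqToHom (by rw [hq q])) ⟨n, j⟩).trans (eqToHom_refl _ _)
  have h₂ : r ≫ inj ⟨n, j⟩ = 𝟙 W := Cofan.IsColimit.hom_ext hc _ _ fun q => by
    rw [hq q]
    have : inj ⟨n, j⟩ ≫ r ≫ inj ⟨n, j⟩ = inj ⟨n, j⟩ ≫ 𝟙 W := by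
      rw [← Category.assoc, h₁, Category.id_comp, Category.comp_id]
    exact this
  let e : W ≅ U⟦n⟧ := ⟨r, inj ⟨n, j⟩, h₂, h₁⟩
  refine ⟨_, _, _, ?_, dist_of_isos H e (Iso.refl Y) (Iso.refl _)⟩
  change inj ⟨n, j⟩ ≫ ev ≫ 𝟙 Y ≠ 0
  rw [Category.comp_id, hev]
  exact (β n).ne_zero j

lemma isNontrivialExtension (h : IsTwist U Φ) {Y : C} {n : ℤ} (hY : Concentrated U Y n) :
    IsNontrivialExtension Y (U⟦n + 1⟧) (Φ.functor.obj Y) := by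
  obtain ⟨f, g, δ, hf, H⟩ := h.exists_dist hY
  have H' : IsNontrivialExtension Y (U⟦n⟧⟦(1 : ℤ)⟧) (Φ.functor.obj Y) :=
    ⟨g, δ, -f⟦(1 : ℤ)⟧', rot_of_distTriang _ H, fun h0 => hf ((shiftFunctor C (1 : ℤ)).map_injective
      ((neg_eq_zero.1 h0).trans (Functor.map_zero _ _ _).symm))⟩
  exact H'.of_iso (Iso.refl _) ((shiftFunctorAdd C n 1).symm.app U) (Iso.refl _)

lemma self_iso (h : IsTwist U Φ) (hU : IsSpherical U) :
    Nonempty (Φ.functor.obj U ≅ U⟦(-2 : ℤ)⟧) := by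
  classical
  obtain ⟨η, hη⟩ := h.cone
  obtain ⟨W, ev, δ, ⟨J, β, inj, ⟨hc⟩, hev⟩, H⟩ := hη U
  obtain ⟨j₀, hj₀⟩ := exists_unique_basis (β 0) hU.finrank_zero
  obtain ⟨j₃, hj₃⟩ := exists_unique_basis (β (-3)) hU.finrank_three
  have hq (q : Σ i, J i) : q = ⟨0, j₀⟩ ∨ q = ⟨-3, j₃⟩ := by
    obtain ⟨i, k⟩ := q
    by_cases hi : i = 0
    · subst hi
      exact Or.inl (by rw [hj₀ k])
    · by_cases hi' : i = -3
      · subst hi'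
        exact Or.inr (by rw [hj₃ k])
      · exact absurd (hU.homZero hi hi' _) ((β i).ne_zero k)
  obtain ⟨i₀, hi₀⟩ : ∃ i₀ : U⟦(0 : ℤ)⟧ ⟶ W, inj ⟨0, j₀⟩ = i₀ := ⟨_, rfl⟩
  obtain ⟨i₃, hi₃⟩ : ∃ i₃ : U⟦(-3 : ℤ)⟧ ⟶ W, inj ⟨-3, j₃⟩ = i₃ := ⟨_, rfl⟩
  have ext {Z : C} {a b : W ⟶ Z} (h₀ : i₀ ≫ a = i₀ ≫ b) (h₃ : i₃ ≫ a = i₃ ≫ b) : a = b :=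
    Cofan.IsColimit.hom_ext hc _ _ fun q => by
      rcases hq q with rfl | rfl
      · exact (congrArg (· ≫ a) hi₀).trans (h₀.trans (congrArg (· ≫ b) hi₀.symm))
      · exact (congrArg (· ≫ a) hi₃).trans (h₃.trans (congrArg (· ≫ b) hi₃.symm))
  let p : W ⟶ U⟦(-3 : ℤ)⟧ := Cofan.IsColimit.desc hc fun q =>
    if h : q = ⟨-3, j₃⟩ then eqToHom (by rw [h]) else 0
  have hp₃ : i₃ ≫ p = 𝟙 _ := hi₃ ▸
    (Cofan.IsColimit.fac hc (fun q => if h : q = ⟨-3, j₃⟩ then eqToHom (by rw [h]) else 0)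
      ⟨-3, j₃⟩).trans ((dif_pos rfl).trans (eqToHom_refl _ _))
  have hp₀ : i₀ ≫ p = 0 := hi₀ ▸
    (Cofan.IsColimit.fac hc (fun q => if h : q = ⟨-3, j₃⟩ then eqToHom (by rw [h]) else 0)
      ⟨0, j₀⟩).trans (dif_neg fun e => by simpa using congrArg Sigma.fst e)
  obtain ⟨c, hc'⟩ := exists_smul_eq_of_finrank hU.finrank_zero ((β 0).ne_zero j₀)
    ((shiftFunctorZero C ℤ).hom.app U)
  let z : U⟦(0 : ℤ)⟧ ≅ U := (shiftFunctorZero C ℤ).app U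
  have hz : c • i₀ ≫ ev = z.hom := by
    refine Eq.trans ?_ hc'
    rw [← hi₀]
    exact congrArg (c • ·) (hev _)
  let σ : U ⟶ W := z.inv ≫ (c • i₀)
  have hσ : σ ≫ ev = 𝟙 U := by rw [Category.assoc, Linear.smul_comp, hz, z.inv_hom_id]
  have hσ' : i₀ ≫ ev ≫ σ = i₀ := by
    have : i₀ ≫ ev ≫ σ = (c • i₀ ≫ ev) ≫ z.inv ≫ i₀ := by simp [σ]
    rw [this, hz]
    simp
  let κ : U⟦(-3 : ℤ)⟧ ⟶ W := i₃ - i₃ ≫ ev ≫ σ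
  have hκ : κ ≫ ev = 0 := by simp [κ, hσ]
  have hκp : κ ≫ p = 𝟙 _ := by simp [κ, hp₃, σ, hp₀]
  have hid : p ≫ κ + ev ≫ σ = 𝟙 W := ext
    (by rw [Preadditive.comp_add, ← Category.assoc, hp₀, zero_comp, zero_add, hσ',
      Category.comp_id])
    (by
      rw [Preadditive.comp_add, ← Category.assoc, hp₃, Category.id_comp, Category.comp_id]
      exact sub_add_cancel _ _)
  have hη0 : η.app U = 0 := by
    rw [← Category.id_comp (η.app U)]
    erw [← hσ]
    rw [Category.assoc]
    exact (congrArg (σ ≫ ·) (comp_distTriang_mor_zero₁₂ _ H)).trans comp_zero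
  have hδ : Mono δ := Triangle.mono₃ _ H hη0
  have hδev : δ ≫ ev⟦(1 : ℤ)⟧' = 0 := comp_distTriang_mor_zero₃₁ _ H
  obtain ⟨k, hk'⟩ : ∃ k : U⟦(-3 : ℤ)⟧⟦(1 : ℤ)⟧ ⟶ Φ.functor.obj U, k ≫ δ = κ⟦(1 : ℤ)⟧' := by
    obtain ⟨k, hk⟩ := Triangle.coyoneda_exact₁ _ H (κ⟦(1 : ℤ)⟧') (by
      change κ⟦(1 : ℤ)⟧' ≫ ev⟦(1 : ℤ)⟧' = 0
      rw [← CategoryTheory.Functor.map_comp, hκ, Functor.map_zero])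
    exact ⟨k, hk.symm⟩
  refine ⟨(⟨δ ≫ p⟦(1 : ℤ)⟧', k, ?_, ?_⟩ : Φ.functor.obj U ≅ U⟦(-3 : ℤ)⟧⟦(1 : ℤ)⟧) ≪≫
    (shiftFunctorAdd' C (-3) 1 (-2) (by lia)).symm.app U⟩
  · rw [← cancel_mono δ, Category.assoc, hk', Category.assoc, ← CategoryTheory.Functor.map_comp,
      eq_sub_of_add_eq hid, Functor.map_sub, CategoryTheory.Functor.map_id,
      CategoryTheory.Functor.map_comp, Preadditive.comp_sub, ← Category.assoc δ, hδev]
    simp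
  · rw [← Category.assoc, hk', ← CategoryTheory.Functor.map_comp, hκp,
      CategoryTheory.Functor.map_id]

lemma map_shift_iso (h : IsTwist U Φ) (hU : IsSpherical U) {k l : ℤ} (hkl : l + 2 = k) :
    Nonempty (Φ.functor.obj (U⟦k⟧) ≅ U⟦l⟧) := by
  obtain ⟨e⟩ := h.self_iso hU
  obtain ⟨e'⟩ := h.isExactEquiv.functor.shift U k
  exact ⟨e' ≪≫ (shiftFunctor C k).mapIso e ≪≫
    (shiftFunctorAdd' C (-2) k l (by lia)).symm.app U⟩

lemma homZero_functor_iff (h : IsTwist U Φ) (hU : IsSpherical U) {k l : ℤ} (hkl : l + 2 = k)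
    (Y : C) : HomZero (U⟦l⟧) (Φ.functor.obj Y) ↔ HomZero (U⟦k⟧) Y := by
  have := h.isExactEquiv.functor.additive
  obtain ⟨e⟩ := h.map_shift_iso hU hkl
  exact (homZero_iff_of_iso e.symm (Iso.refl _)).trans (homZero_map_iff Φ.functor)

lemma concentrated_inverse (h : IsTwist U Φ) (hU : IsSpherical U) {Y : C}
    (hY : Concentrated U Y (-2)) : Concentrated U (Φ.inverse.obj Y) 0 where
  homZero {k} hk := by
    rw [← h.homZero_functor_iff hU (by lia : (k - 2) + 2 = k)]
    exact (hY.homZero (by lia)).of_iso (Iso.refl _) (Φ.counitIso.symm.app Y)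
  finrank := by
    have := h.isExactEquiv.functor.additive
    have := h.linear
    obtain ⟨e⟩ := h.map_shift_iso hU (by lia : (-2 : ℤ) + 2 = 0)
    exact (finrank_hom_map Φ.functor _ _).trans
      ((finrank_hom_of_iso e (Φ.counitIso.app Y)).trans hY.finrank)

lemma isNontrivialExtension_inverse (h : IsTwist U Φ) (hU : IsSpherical U) {Y : C}
    (hY : Concentrated U Y (-2)) : IsNontrivialExtension U Y (Φ.inverse.obj Y) := by
  have hZ := h.concentrated_inverse hU hY
  obtain ⟨f, g, δ, -, H⟩ := h.exists_dist hZ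
  have H' : IsNontrivialExtension (U⟦(0 : ℤ)⟧) (Φ.functor.obj (Φ.inverse.obj Y))
      (Φ.inverse.obj Y) := by
    refine ⟨f, g, δ, H, fun h0 => ?_⟩
    obtain ⟨u, hu⟩ := exists_ne_zero_of_finrank hU.finrank_three
    have : Mono f := Triangle.mono₁ _ H h0
    have h1 : (u ≫ (shiftFunctorZero C ℤ).inv.app U) ≫ f = 0 := hZ.homZero (by lia) _
    exact hu ((Preadditive.IsIso.comp_right_eq_zero _ _).1 (zero_of_comp_mono f h1))
  exact H'.of_iso ((shiftFunctorZero C ℤ).app U) (Φ.counitIso.app Y) (Iso.refl _)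

end IsTwist

end Twists

end

noncomputable section

namespace Ginzburg

open Module Triangulated

lemma isSpherical_S : IsSpherical S := ⟨homZero_S_S, finrank_S_S, finrank_S_S_three⟩

lemma isSpherical_T : IsSpherical T := ⟨homZero_T_T, finrank_T_T, finrank_T_T_three⟩

lemma concentrated_S_T : Concentrated S T (-1) := ⟨homZero_S_T, finrank_S_T⟩

lemma concentrated_T_S : Concentrated T S (-2) := ⟨homZero_T_S, finrank_T_S⟩

lemma finrank_shift {X Y : D} (a b c : ℤ) (h : a + b = c) :
    finrank ℂ (X⟦a⟧ ⟶ Y) = finrank ℂ (X⟦c⟧ ⟶ Y⟦b⟧) :=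
  (finrank_hom_map (shiftFunctor D b) _ _).trans
    (finrank_hom_of_iso ((shiftFunctorAdd' D a b c h).symm.app X) (Iso.refl _))

lemma homZero_S_T_shift {a b : ℤ} (h : a - b ≠ -1) : HomZero (S⟦a⟧) (T⟦b⟧) :=
  (homZero_shift_iff' S T (by lia : a + 0 = (a - b) + b)).2
    ((homZero_S_T h).of_iso (Iso.refl _) ((shiftFunctorZero D ℤ).symm.app T))

lemma concentrated_S_T_shift : Concentrated S (T⟦(-1 : ℤ)⟧) (-2) :=
  ⟨fun hk => homZero_S_T_shift (by lia),
    (finrank_shift (-1) (-1) (-2) (by lia)).symm.trans finrank_S_T⟩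

lemma extension_unique_T_S {E E' : D} (h : IsNontrivialExtension T S E)
    (h' : IsNontrivialExtension T S E') : Nonempty (E ≅ E') := by
  refine extension_unique_of_finrank ?_ h h'
  rw [← finrank_S_T, finrank_shift (-1) 1 0 (by lia)]
  exact finrank_hom_of_iso ((shiftFunctorZero D ℤ).symm.app S) (Iso.refl _)

lemma extension_unique_S_T {X X' : D} (h : IsNontrivialExtension S (T⟦(-1 : ℤ)⟧) X)
    (h' : IsNontrivialExtension S (T⟦(-1 : ℤ)⟧) X') : Nonempty (X ≅ X') := by
  refine extension_unique_of_finrank ?_ h h'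
  rw [← finrank_T_S, finrank_shift (-2) 1 (-1) (by lia)]

lemma simple_mem (i : Fin 2) : standardHeart (simple i) :=
  ⟨simpleModule i, fun _ hn _ hx _ =>
    ⟨0, (map_zero _).trans (DGModule.eq_zero_of_mem_degZero hn hx).symm⟩, ⟨Iso.refl _⟩⟩

theorem simplePair_standardHeart : SimplePair standardHeart T S where
  isHeart := ⟨DerCat.tFd ginzburgA₂, heart_tFd, DerCat.tFd_bounded⟩
  left_mem := simple_mem 1
  right_mem := simple_mem 0
  brick_left := isBrick_of_finrank
    ((finrank_hom_of_iso ((shiftFunctorZero D ℤ).symm.app T) (Iso.refl _)).trans finrank_T_T)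
  brick_right := isBrick_of_finrank
    ((finrank_hom_of_iso ((shiftFunctorZero D ℤ).symm.app S) (Iso.refl _)).trans finrank_S_S)
  homZero_left_right := (homZero_T_S (k := 0) (by lia)).of_iso
    ((shiftFunctorZero D ℤ).app T) (Iso.refl _)
  homZero_right_left := (homZero_S_T (k := 0) (by lia)).of_iso
    ((shiftFunctorZero D ℤ).app S) (Iso.refl _)
  exists_triangle X hX := by
    obtain ⟨m, n, f, g, δ, H⟩ := exists_simple_triangle ((standardHeart_iff X).1 hX)
    exact ⟨_, _, f, g, δ, directSums_biproduct T m, directSums_biproduct S n, H⟩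
  extension_unique _ _ := extension_unique_T_S

section

variable {Φ : D ≌ D}

lemma map_shift_iso (h : IsExactEquiv Φ) {X Y : D} (e : Nonempty (Φ.functor.obj X ≅ Y)) (n : ℤ) :
    Nonempty (Φ.functor.obj (X⟦n⟧) ≅ Y⟦n⟧) := by
  obtain ⟨e⟩ := e
  obtain ⟨e'⟩ := h.functor.shift X n
  exact ⟨e' ≪≫ (shiftFunctor D n).mapIso e⟩

lemma inverse_iso {X Y : D} (e : Nonempty (Φ.functor.obj X ≅ Y)) :
    Nonempty (Φ.inverse.obj Y ≅ X) :=
  e.map fun e => Φ.inverse.mapIso e.symm ≪≫ Φ.unitIso.symm.app X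

lemma inverse_iso_shift (h : IsExactEquiv Φ) {X Y : D} {m n : ℤ}
    (e : Nonempty (Φ.functor.obj X ≅ Y⟦m⟧)) (hmn : m + n = 0) :
    Nonempty (Φ.inverse.obj Y ≅ X⟦n⟧) := by
  obtain ⟨e⟩ := map_shift_iso (Φ := Φ.symm) h.symm (inverse_iso e) n
  exact ⟨Φ.inverse.mapIso ((shiftFunctorCompIsoId D m n hmn).symm.app Y) ≪≫ e⟩

lemma comp_iso {Ψ : D ≌ D} {X Y Z : D} (e : Nonempty (Φ.functor.obj X ≅ Y))
    (e' : Nonempty (Ψ.functor.obj Y ≅ Z)) : Nonempty ((Φ.trans Ψ).functor.obj X ≅ Z) := by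
  obtain ⟨e⟩ := e
  obtain ⟨e'⟩ := e'
  exact ⟨Ψ.functor.mapIso e ≪≫ e'⟩

lemma comp_shift_iso {X Y : D} {a n b : ℤ} (e : Nonempty (Φ.functor.obj X ≅ Y⟦a⟧))
    (h : a + n = b) : Nonempty ((Φ.trans (shiftEquiv D n)).functor.obj X ≅ Y⟦b⟧) :=
  comp_iso e ⟨(shiftFunctorAdd' D a n b h).symm.app Y⟩

end

section

variable {E X : D} {ΦS ΦT : D ≌ D}

lemma extension_twist_S_T (hS : IsTwist S ΦS) :
    IsNontrivialExtension T S (ΦS.functor.obj T) :=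
  (hS.isNontrivialExtension concentrated_S_T).of_iso (Iso.refl _)
    ((shiftFunctorZero' D (-1 + 1 : ℤ) (by lia)).app S) (Iso.refl _)

lemma extension_twist_T_S (hT : IsTwist T ΦT) :
    IsNontrivialExtension S (T⟦(-1 : ℤ)⟧) (ΦT.functor.obj S) :=
  (hT.isNontrivialExtension concentrated_T_S).of_iso (Iso.refl _)
    (eqToIso (by norm_num)) (Iso.refl _)

lemma twist_S_T (hE : IsNontrivialExtension T S E) (hS : IsTwist S ΦS) :
    Nonempty (ΦS.functor.obj T ≅ E) :=
  extension_unique_T_S (extension_twist_S_T hS) hE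

lemma twist_T_S (hX : IsNontrivialExtension S (T⟦(-1 : ℤ)⟧) X) (hT : IsTwist T ΦT) :
    Nonempty (ΦT.functor.obj S ≅ X) :=
  extension_unique_S_T (extension_twist_T_S hT) hX

lemma twist_T_E (hE : IsNontrivialExtension T S E) (hT : IsTwist T ΦT) :
    Nonempty (ΦT.functor.obj E ≅ S) :=
  inverse_iso (Φ := ΦT.symm) (extension_unique_T_S
    (hT.isNontrivialExtension_inverse isSpherical_T concentrated_T_S) hE)

lemma twist_S_X (hX : IsNontrivialExtension S (T⟦(-1 : ℤ)⟧) X) (hS : IsTwist S ΦS) :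
    Nonempty (ΦS.functor.obj X ≅ T⟦(-1 : ℤ)⟧) :=
  inverse_iso (Φ := ΦS.symm) (extension_unique_S_T
    (hS.isNontrivialExtension_inverse isSpherical_S concentrated_S_T_shift) hX)

lemma homZero_S_E (hE : IsNontrivialExtension T S E) (hS : IsTwist S ΦS) {k : ℤ} (hk : k ≠ -3) :
    HomZero (S⟦k⟧) E := by
  obtain ⟨e⟩ := twist_S_T hE hS
  exact ((hS.homZero_functor_iff isSpherical_S rfl T).2
    (homZero_S_T (by lia : k + 2 ≠ -1))).of_iso (Iso.refl _) e

lemma homZero_E_T (hE : IsNontrivialExtension T S E) (hT : IsTwist T ΦT) {k : ℤ} (hk : k ≠ 3) :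
    HomZero E (T⟦k⟧) := by
  have := hT.isExactEquiv.functor.additive
  obtain ⟨e⟩ := twist_T_E hE hT
  obtain ⟨e'⟩ := hT.map_shift_iso isSpherical_T (by lia : k - 2 + 2 = k)
  exact (homZero_map_iff ΦT.functor).1 ((homZero_S_T_shift (by lia : 0 - (k - 2) ≠ -1)).of_iso
    ((shiftFunctorZero D ℤ).app S ≪≫ e.symm) e'.symm)

lemma directSums_T_of_homZero (hE : IsNontrivialExtension T S E) (hE0 : ¬IsZero E)
    (h₀ : HomZero E T) (h₁ : HomZero E (T⟦(1 : ℤ)⟧)) {V : D} (hV : standardHeart V)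
    (h : HomZero E V) : directSums T V := by
  obtain ⟨P, Q, f, g, δ, hP, hQ, H⟩ := simplePair_standardHeart.exists_triangle V hV
  obtain ⟨j, e, ε, HE, -⟩ := hE
  have hQ0 : IsZero Q := by
    by_contra hQ0
    obtain ⟨i, p, hip⟩ := hQ.exists_splitMono hQ0
    obtain ⟨w, hw⟩ := Triangle.coyoneda_exact₃ _ H (e ≫ i)
      ((hP.map (shiftFunctor D (1 : ℤ))).homZero_right h₁ _)
    have hei : e ≫ i = 0 := hw.trans ((congrArg (· ≫ g) (h w)).trans zero_comp)
    have he : e = 0 := by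
      rw [← Category.comp_id e, ← hip, ← Category.assoc, hei, zero_comp]
    obtain ⟨u, hu⟩ := exists_lift_of_dist HE (𝟙 E) (by rw [he, comp_zero])
    exact hE0 ((IsZero.iff_id_eq_zero _).2 (by rw [← hu, h₀ u, zero_comp]))
  have : IsIso f := (Triangle.isZero₃_iff_isIso₁ _ H).1 hQ0
  exact hP.of_iso (asIso f)

lemma directSums_S_of_homZero (hE : IsNontrivialExtension T S E) (hE0 : ¬IsZero E)
    (h₀ : HomZero S E) (h₁ : HomZero (S⟦(-1 : ℤ)⟧) E) {V : D} (hV : standardHeart V)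
    (h : HomZero V E) : directSums S V := by
  obtain ⟨P, Q, f, g, δ, hP, hQ, H⟩ := simplePair_standardHeart.exists_triangle V hV
  obtain ⟨j, e, ε, HE, -⟩ := hE
  have hP0 : IsZero P := by
    by_contra hP0
    obtain ⟨i, p, hip⟩ := hP.exists_splitMono hP0
    obtain ⟨w, hw⟩ := exists_desc_of_dist (inv_rot_of_distTriang _ H) (p ≫ j)
      ((hQ.map (shiftFunctor D (-1 : ℤ))).homZero_left h₁ _)
    have hpj : p ≫ j = 0 := hw.symm.trans ((congrArg (f ≫ ·) (h w)).trans comp_zero)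
    have hj : j = 0 := by
      rw [← Category.id_comp j, ← hip, Category.assoc, hpj, comp_zero]
    obtain ⟨u, hu⟩ := exists_desc_of_dist HE (𝟙 E) (by rw [hj, zero_comp])
    exact hE0 ((IsZero.iff_id_eq_zero _).2 (by rw [← hu, h₀ u, comp_zero]))
  have : IsIso g := (Triangle.isZero₁_iff_isIso₂ _ H).1 hP0
  exact hQ.of_iso (asIso g).symm

end

/-- The autoequivalence `(Φ_T Φ_S Φ_T)[3]`. -/
abbrev twistTST (ΦS ΦT : D ≌ D) : D ≌ D :=
  ((ΦT.trans ΦS).trans ΦT).trans (shiftEquiv D (3 : ℤ))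

/-- The autoequivalence `(Φ_S Φ_T)[2]`. -/
abbrev twistST (ΦS ΦT : D ≌ D) : D ≌ D := (ΦT.trans ΦS).trans (shiftEquiv D (2 : ℤ))

section

variable {E X : D} {ΦS ΦT : D ≌ D}

lemma isExactEquiv_twistTST (hS : IsTwist S ΦS) (hT : IsTwist T ΦT) :
    IsExactEquiv (twistTST ΦS ΦT) :=
  ((hT.isExactEquiv.trans hS.isExactEquiv).trans hT.isExactEquiv).trans (isExactEquiv_shift 3)

lemma isExactEquiv_twistST (hS : IsTwist S ΦS) (hT : IsTwist T ΦT) :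
    IsExactEquiv (twistST ΦS ΦT) :=
  (hT.isExactEquiv.trans hS.isExactEquiv).trans (isExactEquiv_shift 2)

lemma iso_shift_zero {Y Z : D} (e : Nonempty (Y ≅ Z⟦(0 : ℤ)⟧)) : Nonempty (Y ≅ Z) :=
  e.map fun e => e ≪≫ (shiftFunctorZero D ℤ).app Z

lemma twistTST_T (hE : IsNontrivialExtension T S E) (hS : IsTwist S ΦS) (hT : IsTwist T ΦT) :
    Nonempty ((twistTST ΦS ΦT).functor.obj T ≅ S⟦(1 : ℤ)⟧) :=
  comp_shift_iso (comp_iso (comp_iso (hT.self_iso isSpherical_T)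
    (map_shift_iso hS.isExactEquiv (twist_S_T hE hS) (-2)))
    (map_shift_iso hT.isExactEquiv (twist_T_E hE hT) (-2))) (by lia)

lemma twistTST_S (hX : IsNontrivialExtension S (T⟦(-1 : ℤ)⟧) X) (hS : IsTwist S ΦS)
    (hT : IsTwist T ΦT) : Nonempty ((twistTST ΦS ΦT).functor.obj S ≅ T) :=
  iso_shift_zero (comp_shift_iso (comp_iso (comp_iso (twist_T_S hX hT) (twist_S_X hX hS))
    (hT.map_shift_iso isSpherical_T (by lia : (-3 : ℤ) + 2 = -1))) (by lia))

lemma twistTST_E (hE : IsNontrivialExtension T S E)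
    (hX : IsNontrivialExtension S (T⟦(-1 : ℤ)⟧) X) (hS : IsTwist S ΦS) (hT : IsTwist T ΦT) :
    Nonempty ((twistTST ΦS ΦT).functor.obj E ≅ X⟦(1 : ℤ)⟧) :=
  comp_shift_iso (comp_iso (comp_iso (twist_T_E hE hT) (hS.self_iso isSpherical_S))
    (map_shift_iso hT.isExactEquiv (twist_T_S hX hT) (-2))) (by lia)

lemma twistST_T (hE : IsNontrivialExtension T S E) (hS : IsTwist S ΦS) (hT : IsTwist T ΦT) :
    Nonempty ((twistST ΦS ΦT).functor.obj T ≅ E) :=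
  iso_shift_zero (comp_shift_iso (comp_iso (hT.self_iso isSpherical_T)
    (map_shift_iso hS.isExactEquiv (twist_S_T hE hS) (-2))) (by lia))

lemma twistST_S (hX : IsNontrivialExtension S (T⟦(-1 : ℤ)⟧) X) (hS : IsTwist S ΦS)
    (hT : IsTwist T ΦT) : Nonempty ((twistST ΦS ΦT).functor.obj S ≅ T⟦(1 : ℤ)⟧) :=
  comp_shift_iso (comp_iso (twist_T_S hX hT) (twist_S_X hX hS)) (by lia)

lemma twistST_E (hE : IsNontrivialExtension T S E) (hS : IsTwist S ΦS) (hT : IsTwist T ΦT) :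
    Nonempty ((twistST ΦS ΦT).functor.obj E ≅ S) :=
  iso_shift_zero (comp_shift_iso (comp_iso (twist_T_E hE hT) (hS.self_iso isSpherical_S))
    (by lia))

lemma simplePair_twistTST (hE : IsNontrivialExtension T S E)
    (hX : IsNontrivialExtension S (T⟦(-1 : ℤ)⟧) X) (hS : IsTwist S ΦS) (hT : IsTwist T ΦT) :
    SimplePair (standardHeart.map (twistTST ΦS ΦT).functor) (S⟦(1 : ℤ)⟧) T :=
  (simplePair_standardHeart.map (isExactEquiv_twistTST hS hT)).of_iso
    (twistTST_T hE hS hT).some (twistTST_S hX hS hT).some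

lemma simplePair_twistTST_inverse (hE : IsNontrivialExtension T S E)
    (hX : IsNontrivialExtension S (T⟦(-1 : ℤ)⟧) X) (hS : IsTwist S ΦS) (hT : IsTwist T ΦT) :
    SimplePair (standardHeart.map (twistTST ΦS ΦT).inverse) S (T⟦(-1 : ℤ)⟧) :=
  (simplePair_standardHeart.map (isExactEquiv_twistTST hS hT).symm).of_iso
    (inverse_iso (twistTST_S hX hS hT)).some
    (inverse_iso_shift (isExactEquiv_twistTST hS hT) (twistTST_T hE hS hT) (by lia)).some

lemma simplePair_twistST (hE : IsNontrivialExtension T S E)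
    (hX : IsNontrivialExtension S (T⟦(-1 : ℤ)⟧) X) (hS : IsTwist S ΦS) (hT : IsTwist T ΦT) :
    SimplePair (standardHeart.map (twistST ΦS ΦT).functor) E (T⟦(1 : ℤ)⟧) :=
  (simplePair_standardHeart.map (isExactEquiv_twistST hS hT)).of_iso
    (twistST_T hE hS hT).some (twistST_S hX hS hT).some

lemma simplePair_twistST_inverse (hE : IsNontrivialExtension T S E)
    (hX : IsNontrivialExtension S (T⟦(-1 : ℤ)⟧) X) (hS : IsTwist S ΦS) (hT : IsTwist T ΦT) :
    SimplePair (standardHeart.map (twistST ΦS ΦT).inverse) (S⟦(-1 : ℤ)⟧) E :=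
  (simplePair_standardHeart.map (isExactEquiv_twistST hS hT).symm).of_iso
    (inverse_iso_shift (isExactEquiv_twistST hS hT) (twistST_S hX hS hT) (by lia)).some
    (inverse_iso (twistST_E hE hS hT)).some

lemma mem_of_extension (hE : IsNontrivialExtension T S E) : standardHeart E := by
  obtain ⟨_, _, _, H, -⟩ := hE
  rw [simplePair_standardHeart.mem_iff_extensionClosure]
  exact .ext _ _ _ _ _ _ H .left .right

lemma heart_of_mem {Y : D} (h : standardHeart Y) : (DerCat.tFd ginzburgA₂).heart Y := heart_tFd ▸ h

theorem rightSimpleTilt_S (hE : IsNontrivialExtension T S E)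
    (hX : IsNontrivialExtension S (T⟦(-1 : ℤ)⟧) X) (hS : IsTwist S ΦS) (hT : IsTwist T ΦT) :
    rightSimpleTilt standardHeart S = standardHeart.map (twistTST ΦS ΦT).functor := by
  have := TStructure.rightSimpleTilt_eq (t := DerCat.tFd ginzburgA₂)
    (simplePair_twistTST hE hX hS hT).heartPair (heart_of_mem (simple_mem 0))
    (heart_of_mem (simple_mem 1)) simplePair_standardHeart.homZero_left_right
    fun V hV h => simplePair_standardHeart.directSums_right (heart_tFd ▸ hV) h
  rwa [heart_tFd] at this

theorem leftSimpleTilt_T (hE : IsNontrivialExtension T S E)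
    (hX : IsNontrivialExtension S (T⟦(-1 : ℤ)⟧) X) (hS : IsTwist S ΦS) (hT : IsTwist T ΦT) :
    leftSimpleTilt standardHeart T = standardHeart.map (twistTST ΦS ΦT).inverse := by
  have := TStructure.leftSimpleTilt_eq (t := DerCat.tFd ginzburgA₂)
    (simplePair_twistTST_inverse hE hX hS hT).heartPair_symm (heart_of_mem (simple_mem 1))
    (heart_of_mem (simple_mem 0)) simplePair_standardHeart.homZero_left_right
    fun V hV h => simplePair_standardHeart.directSums_left (heart_tFd ▸ hV) h
  rwa [heart_tFd] at this

theorem rightSimpleTilt_T (hE : IsNontrivialExtension T S E)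
    (hX : IsNontrivialExtension S (T⟦(-1 : ℤ)⟧) X) (hS : IsTwist S ΦS) (hT : IsTwist T ΦT) :
    rightSimpleTilt standardHeart T = standardHeart.map (twistST ΦS ΦT).functor := by
  have H := simplePair_twistST hE hX hS hT
  have hET : HomZero E T := (homZero_E_T hE hT (by lia : (0 : ℤ) ≠ 3)).of_iso (Iso.refl _)
    ((shiftFunctorZero D ℤ).app T)
  have := TStructure.rightSimpleTilt_eq (t := DerCat.tFd ginzburgA₂) H.heartPair_symm
    (heart_of_mem (simple_mem 1)) (heart_of_mem (mem_of_extension hE)) hET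
    fun V hV h => directSums_T_of_homZero hE H.brick_left.not_isZero hET
      (homZero_E_T hE hT (by lia)) (heart_tFd ▸ hV) h
  rwa [heart_tFd] at this

theorem leftSimpleTilt_S (hE : IsNontrivialExtension T S E)
    (hX : IsNontrivialExtension S (T⟦(-1 : ℤ)⟧) X) (hS : IsTwist S ΦS) (hT : IsTwist T ΦT) :
    leftSimpleTilt standardHeart S = standardHeart.map (twistST ΦS ΦT).inverse := by
  have H := simplePair_twistST_inverse hE hX hS hT
  have hSE : HomZero S E := (homZero_S_E hE hS (by lia : (0 : ℤ) ≠ -3)).of_iso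
    ((shiftFunctorZero D ℤ).app S) (Iso.refl _)
  have := TStructure.leftSimpleTilt_eq (t := DerCat.tFd ginzburgA₂) H.heartPair
    (heart_of_mem (simple_mem 0)) (heart_of_mem (mem_of_extension hE)) hSE
    fun V hV h => directSums_S_of_homZero hE H.brick_right.not_isZero hSE
      (homZero_S_E hE hS (by lia)) (heart_tFd ▸ hV) h
  rwa [heart_tFd] at this

end

end Ginzburg

end

theorem mainTheorem6 :
    (∃ E, IsUniqueNontrivialExtension Ginzburg.T Ginzburg.S E) ∧
    (∃ X, IsUniqueNontrivialExtension Ginzburg.S (Ginzburg.T⟦(-1 : ℤ)⟧) X) ∧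
    (∃ Φ, IsTwist Ginzburg.S Φ) ∧ (∃ Φ, IsTwist Ginzburg.T Φ) ∧
    ∀ E X : Ginzburg.D, IsNontrivialExtension Ginzburg.T Ginzburg.S E →
      IsNontrivialExtension Ginzburg.S (Ginzburg.T⟦(-1 : ℤ)⟧) X →
      IsGeneratedBySimples Ginzburg.standardHeart Ginzburg.T Ginzburg.S E ∧
      IsGeneratedBySimples (rightSimpleTilt Ginzburg.standardHeart Ginzburg.S)
        (Ginzburg.S⟦(1 : ℤ)⟧) Ginzburg.T (X⟦(1 : ℤ)⟧) ∧
      IsGeneratedBySimples (leftSimpleTilt Ginzburg.standardHeart Ginzburg.T)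
        Ginzburg.S (Ginzburg.T⟦(-1 : ℤ)⟧) X ∧
      IsGeneratedBySimples (rightSimpleTilt Ginzburg.standardHeart Ginzburg.T)
        E (Ginzburg.T⟦(1 : ℤ)⟧) Ginzburg.S ∧
      IsGeneratedBySimples (leftSimpleTilt Ginzburg.standardHeart Ginzburg.S)
        (Ginzburg.S⟦(-1 : ℤ)⟧) E Ginzburg.T ∧
      ∀ ΦS ΦT : Ginzburg.D ≌ Ginzburg.D, IsTwist Ginzburg.S ΦS → IsTwist Ginzburg.T ΦT →
        rightSimpleTilt Ginzburg.standardHeart Ginzburg.S = Ginzburg.standardHeart.map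
          (((ΦT.trans ΦS).trans ΦT).trans (shiftEquiv Ginzburg.D (3 : ℤ))).functor ∧
        leftSimpleTilt Ginzburg.standardHeart Ginzburg.T = Ginzburg.standardHeart.map
          (((ΦT.trans ΦS).trans ΦT).trans (shiftEquiv Ginzburg.D (3 : ℤ))).inverse ∧
        rightSimpleTilt Ginzburg.standardHeart Ginzburg.T = Ginzburg.standardHeart.map
          ((ΦT.trans ΦS).trans (shiftEquiv Ginzburg.D (2 : ℤ))).functor ∧
        leftSimpleTilt Ginzburg.standardHeart Ginzburg.S = Ginzburg.standardHeart.map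
          ((ΦT.trans ΦS).trans (shiftEquiv Ginzburg.D (2 : ℤ))).inverse := by
  obtain ⟨ΦS, hS⟩ : ∃ Φ, IsTwist Ginzburg.S Φ := Ginzburg.exists_isTwist 0
  obtain ⟨ΦT, hT⟩ : ∃ Φ, IsTwist Ginzburg.T Φ := Ginzburg.exists_isTwist 1
  refine ⟨⟨_, Ginzburg.extension_twist_S_T hS, fun _ h =>
      Ginzburg.extension_unique_T_S h (Ginzburg.extension_twist_S_T hS)⟩,
    ⟨_, Ginzburg.extension_twist_T_S hT, fun _ h =>
      Ginzburg.extension_unique_S_T h (Ginzburg.extension_twist_T_S hT)⟩, ⟨ΦS, hS⟩, ⟨ΦT, hT⟩,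
    fun E X hE hX => ?_⟩
  refine ⟨Ginzburg.simplePair_standardHeart.isGeneratedBySimples hE, ?_, ?_, ?_, ?_,
    fun ΦS ΦT hS hT => ⟨Ginzburg.rightSimpleTilt_S hE hX hS hT,
      Ginzburg.leftSimpleTilt_T hE hX hS hT, Ginzburg.rightSimpleTilt_T hE hX hS hT,
      Ginzburg.leftSimpleTilt_S hE hX hS hT⟩⟩
  · rw [Ginzburg.rightSimpleTilt_S hE hX hS hT]
    exact (Ginzburg.simplePair_twistTST hE hX hS hT).isGeneratedBySimples
      ((hE.map (Ginzburg.isExactEquiv_twistTST hS hT).functor).of_iso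
        (Ginzburg.twistTST_T hE hS hT).some (Ginzburg.twistTST_S hX hS hT).some
        (Ginzburg.twistTST_E hE hX hS hT).some)
  · rw [Ginzburg.leftSimpleTilt_T hE hX hS hT]
    exact (Ginzburg.simplePair_twistTST_inverse hE hX hS hT).isGeneratedBySimples hX
  · rw [Ginzburg.rightSimpleTilt_T hE hX hS hT]
    exact (Ginzburg.simplePair_twistST hE hX hS hT).isGeneratedBySimples
      ((hE.map (Ginzburg.isExactEquiv_twistST hS hT).functor).of_iso
        (Ginzburg.twistST_T hE hS hT).some (Ginzburg.twistST_S hX hS hT).some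
        (Ginzburg.twistST_E hE hS hT).some)
  · rw [Ginzburg.leftSimpleTilt_S hE hX hS hT]
    exact (Ginzburg.simplePair_twistST_inverse hE hX hS hT).isGeneratedBySimples
      ((hE.map (Ginzburg.isExactEquiv_twistST hS hT).inverse).of_iso
        (Ginzburg.inverse_iso_shift (Ginzburg.isExactEquiv_twistST hS hT)
          (Ginzburg.twistST_S hX hS hT) (by lia)).some
        (Ginzburg.inverse_iso (Ginzburg.twistST_E hE hS hT)).some
        (Ginzburg.inverse_iso (Ginzburg.twistST_T hE hS hT)).some)
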